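/- Let $\mathbb K$ be $\mathbb R$ or $\mathbb C$, $n\ge 0$ an integer and $d=n+1$. **Graphs.** Let $\mathsf{Gra}_d(N)$ be the graded $\mathbb K$-vector space spanned by directed graphs (loops and multiple edges allowed) with vertices $1,\dots,N$ and totally ordered edges, a graph with $k$ edges having degree $k(1-d)$, modulo the relations that permuting the edges by $\sigma$ multiplies a graph by $\operatorname{sgn}(\sigma)^{d+1}$ and reversing an edge multiplies it by $(-1)^d$. The composition $\gamma\circ_1\gamma'$ inserts $\gamma'$ at vertex $1$ of $\gamma$, summing over all ways of reconnecting the half-edges at that vertex (edges of $\gamma$ before those of $\gamma'$). The full graph complex is $\mathsf{fGC}_d=\prod_{N\ge1}\big(\mathsf{Gra}_d(N)\otimes \mathrm{sgn}_N^{\otimes d}[d(1-N)]\big)^{S_N}$, so that a graph with $N$ vertices and $k$ edges has degree $d(N-1)+k(1-d)$. With $\gamma\circ\gamma'=\sum_\sigma \operatorname{sgn}(\sigma)^{d}\,(\gamma\circ_1\gamma')\cdot\sigma$, summed over unshuffles, and with $\Gamma_{\mathrm{br}}$ the graph with two vertices and the single edge $1\to2$, the differential is $\delta\gamma=[\Gamma_{\mathrm{br}},\gamma]=\Gamma_{\mathrm{br}}\circ\gamma-(-1)^{|\gamma|}\gamma\circ\Gamma_{\mathrm{br}}$.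 **Graded symplectic domains.** A (Darboux) graded symplectic domain $\mathcal V$ of degree $n$ has finitely many coordinates $z^A$ of degrees $|A|\ge0$, those of degree $0$ ranging over an open set $U$ of Euclidean space, and a constant invertible matrix $\omega^{AB}\in\mathbb K$ with $\omega^{AB}=0$ unless $|A|+|B|=n$ and $\omega^{BA}=-(-1)^{n+|A||B|}\omega^{AB}$. Its functions $C^\infty(\mathcal V)$ are the polynomials in the graded-commuting coordinates of positive degree with coefficients in $C^\infty(U,\mathbb K)$, and $\{f,g\}=\sum_{A,B}\omega^{AB}(-1)^{|f||B|}\,\partial_Af\,\partial_Bg$. A graph $\gamma$ with $N$ vertices and edges $(i_1,j_1),\dots,(i_k,j_k)$ acts by $$\mathsf{Rep}_{\mathcal V}(\gamma)(f_1,\dots,f_N)=\mu_N\big(\Delta_{i_1j_1}\cdots\Delta_{i_kj_k}(f_1\otimes\cdots\otimes f_N)\big),\qquad \Delta_{ij}=\sum_{A,B}\omega^{AB}\,\partial_A^{(i)}\partial_B^{(j)},$$ where $\partial^{(i)}_A$ is $\partial_A$ on the $i$-th factor with Koszul signs and $\mu_N$ is multiplication of the factors. Thus $\mathsf{Rep}_{\mathcal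 V}(\Gamma_{\mathrm{br}})=\{\cdot,\cdot\}$. **Hamiltonian deformations.** $\mathsf{Ham}(\mathcal V)$ is the set of $H\in C^\infty(\mathcal V)$ of degree $d$ with $\{H,H\}=0$. For $H\in\mathsf{Ham}(\mathcal V)$, $\mathsf{FHam}_H(\mathcal V)$ is the set of formal series $H_*\in\epsilon\,C^\infty(\mathcal V)_d[[\epsilon]]$ with $\{H_*,H_*\}=0$ and with coefficient $H$ at $\epsilon^1$. A Hamiltonian deformation map assigns to every $\mathcal V$ of degree $n$ and every $H\in\mathsf{Ham}(\mathcal V)$ an element of $\mathsf{FHam}_H(\mathcal V)$. It is *universal* if there is an element $(\Gamma_N)_{N\ge1}$ of $\mathsf{fGC}_d$ of degree $0$, independent of $\mathcal V$ and $H$, such that $H_*=\sum_{N\ge1}\frac{\epsilon^N}{N!}\mathsf{Rep}_{\mathcal V}(\Gamma_N)(H,\dots,H)$ for all $\mathcal V$ and $H$. Two series $F,G\in\epsilon\,C^\infty(\mathcal V)_d[[\epsilon]]$ are *gauge equivalent* if $G=\exp(\{\lambda,\cdot\})F$ for some $\lambda\in\epsilon\, C^\infty(\mathcal V)_n[[\epsilon]]$.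 Let $s:C^\infty(\mathcal V)[n]\to C^\infty(\mathcal V)$ be the suspension, under which $\{\cdot,\cdot\}$ becomes a graded Lie bracket on $C^\infty(\mathcal V)[n]$. For a cocycle $\gamma\in\mathsf{fGC}_d$ of degree $0$ let $\mathcal U^\Gamma=\exp(s^*\mathsf{Rep}_{\mathcal V}(\gamma))$ be the exponential of the coderivation with components $s^*\mathsf{Rep}_{\mathcal V}(\gamma)$, with components $\mathcal U^\Gamma_k$, and put $\hat{\mathcal U}^\Gamma(m)=\sum_{k\ge1}\frac1{k!}\,\mathcal U^\Gamma_k(m,\dots,m)$. **Proposition.** For every degree $0$ cocycle $\gamma$ of $\mathsf{fGC}_d$, the assignment $$H\longmapsto H_*:=s\big(\hat{\mathcal U}^\Gamma(\epsilon\, s^{-1}H)\big)$$ is a Hamiltonian deformation map: for all $\mathcal V$ and $H\in\mathsf{Ham}(\mathcal V)$ the series $H_*$ lies in $\epsilon\,C^\infty(\mathcal V)_d[[\epsilon]]$, satisfies $\{H_*,H_*\}=0$ and has first-order term $H$. This map is universal. If $\gamma,\gamma'$ represent the same class in $H^0(\mathsf{fGC}_d)$, then the two deformations of any $H\in\mathsf{Ham}(\mathcal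 V)$ are gauge equivalent. In this sense there is a canonical map from $H^0(\mathsf{fGC}_d)$ to universal Hamiltonian deformation maps $\mathsf{Ham}\to\mathsf{FHam}$. -/

import Mathlib

open scoped TensorProduct ContDiff

noncomputable section

namespace GraphHam

/-! ### Labelled multidigraphs and the graph operad -/

/-- Multidigraphs (loops and multiple edges allowed) with `N` labelled vertices and `k` labelled
edges: the edge `e` goes from `(g e).1` to `(g e).2`. -/
abbrev MDigraph (N k : ℕ) : Type := Fin k → Fin N × Fin N

/-- Reverse the direction of the edge `e`. -/
def flipEdge {N k : ℕ} (e : Fin k) (g : MDigraph N k) : MDigraph N k :=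
  Function.update g e (g e).swap

/-- The relations imposed on multidigraphs: permuting the edge labels by `σ` costs
`sgn(σ)^(d+1)`, reversing an edge costs `(-1)^d`. -/
def graRel (𝕂 : Type*) [Field 𝕂] (d N k : ℕ) : Submodule 𝕂 (MDigraph N k →₀ 𝕂) :=
  Submodule.span 𝕂
    ({x | ∃ (g : MDigraph N k) (σ : Equiv.Perm (Fin k)),
        x = Finsupp.single (g ∘ σ) 1 -
          (((Equiv.Perm.sign σ : ℤˣ) : ℤ) : 𝕂) ^ (d + 1) • Finsupp.single g 1} ∪
     {x | ∃ (g : MDigraph N k) (e : Fin k),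
        x = Finsupp.single (flipEdge e g) 1 - (-1 : 𝕂) ^ d • Finsupp.single g 1})

/-- The part of `Gra_d(N)` spanned by graphs with `k` edges, sitting in degree `k (1 - d)`. -/
def Gra (𝕂 : Type*) [Field 𝕂] (d N k : ℕ) : Type _ := (MDigraph N k →₀ 𝕂) ⧸ graRel 𝕂 d N k

instance (𝕂 : Type*) [Field 𝕂] (d N k : ℕ) : AddCommGroup (Gra 𝕂 d N k) :=
  inferInstanceAs (AddCommGroup ((MDigraph N k →₀ 𝕂) ⧸ graRel 𝕂 d N k))

instance (𝕂 : Type*) [Field 𝕂] (d N k : ℕ) : Module 𝕂 (Gra 𝕂 d N k) :=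
  inferInstanceAs (Module 𝕂 ((MDigraph N k →₀ 𝕂) ⧸ graRel 𝕂 d N k))

section Gra

variable {𝕂 : Type*} [Field 𝕂]

/-- The quotient map onto `Gra_d(N)`. -/
def Gra.proj (d N k : ℕ) : (MDigraph N k →₀ 𝕂) →ₗ[𝕂] Gra 𝕂 d N k := (graRel 𝕂 d N k).mkQ

theorem Gra.proj_eq_zero {d N k : ℕ} {x : MDigraph N k →₀ 𝕂} (hx : x ∈ graRel 𝕂 d N k) :
    Gra.proj d N k x = 0 :=
  (Submodule.Quotient.mk_eq_zero _).mpr hx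

/-- The class of a multidigraph in `Gra_d(N)`. -/
def Gra.mk (d : ℕ) {N k : ℕ} (g : MDigraph N k) : Gra 𝕂 d N k :=
  Gra.proj d N k (Finsupp.single g 1)

theorem Gra.mk_perm (d : ℕ) {N k : ℕ} (g : MDigraph N k) (σ : Equiv.Perm (Fin k)) :
    (Gra.mk d (g ∘ σ) : Gra 𝕂 d N k) =
      (((Equiv.Perm.sign σ : ℤˣ) : ℤ) : 𝕂) ^ (d + 1) • Gra.mk d g := by
  unfold Gra.mk
  rw [← map_smul, ← sub_eq_zero, ← map_sub]
  exact Gra.proj_eq_zero (Submodule.subset_span (Or.inl ⟨g, σ, rfl⟩))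

theorem Gra.mk_flip (d : ℕ) {N k : ℕ} (g : MDigraph N k) (e : Fin k) :
    (Gra.mk d (flipEdge e g) : Gra 𝕂 d N k) = (-1 : 𝕂) ^ d • Gra.mk d g := by
  unfold Gra.mk
  rw [← map_smul, ← sub_eq_zero, ← map_sub]
  exact Gra.proj_eq_zero (Submodule.subset_span (Or.inr ⟨g, e, rfl⟩))

/-- A function on multidigraphs with the right symmetries descends to `Gra_d(N)`. -/
def Gra.lift {M : Type*} [AddCommGroup M] [Module 𝕂 M] (d : ℕ) {N k : ℕ}
    (F : MDigraph N k → M)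
    (hperm : ∀ g (σ : Equiv.Perm (Fin k)),
      F (g ∘ σ) = (((Equiv.Perm.sign σ : ℤˣ) : ℤ) : 𝕂) ^ (d + 1) • F g)
    (hflip : ∀ g e, F (flipEdge e g) = (-1 : 𝕂) ^ d • F g) :
    Gra 𝕂 d N k →ₗ[𝕂] M :=
  (graRel 𝕂 d N k).liftQ (Finsupp.linearCombination 𝕂 F) <| by
    refine Submodule.span_le.mpr ?_
    rintro x (⟨g, σ, rfl⟩ | ⟨g, e, rfl⟩)
    · simp [Finsupp.linearCombination_single, hperm g σ]
    · simp [Finsupp.linearCombination_single, hflip g e]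

@[simp]
theorem Gra.lift_mk {M : Type*} [AddCommGroup M] [Module 𝕂 M] (d : ℕ) {N k : ℕ}
    (F : MDigraph N k → M) (hperm) (hflip) (g : MDigraph N k) :
    Gra.lift (𝕂 := 𝕂) d F hperm hflip (Gra.mk d g) = F g := by
  refine (Submodule.liftQ_apply _ _ _).trans ?_
  simp [Finsupp.linearCombination_single]

theorem Gra.hom_ext {M : Type*} [AddCommGroup M] [Module 𝕂 M] {d N k : ℕ}
    {L L' : Gra 𝕂 d N k →ₗ[𝕂] M} (h : ∀ g, L (Gra.mk d g) = L' (Gra.mk d g)) : L = L' := by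
  refine Submodule.linearMap_qext _ (Finsupp.lhom_ext' fun g => LinearMap.ext_ring ?_)
  exact h g

theorem flipEdge_flipEdge {N k : ℕ} (e : Fin k) (g : MDigraph N k) :
    flipEdge e (flipEdge e g) = g := by
  simp [flipEdge]

theorem map_flipEdge {N N' k : ℕ} (f : Fin N → Fin N') (e : Fin k) (g : MDigraph N k) :
    Prod.map f f ∘ flipEdge e g = flipEdge e (Prod.map f f ∘ g) := by
  funext i
  by_cases h : i = e
  · subst h
    simp only [flipEdge, Function.comp_apply, Function.update_self]
    rfl
  · simp [flipEdge, h]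

/-- Rename the vertex `v` to `τ v`. With `τ = σ⁻¹` this is the right action of `σ`. -/
def Gra.relabel (d : ℕ) {N k : ℕ} (τ : Equiv.Perm (Fin N)) : Gra 𝕂 d N k →ₗ[𝕂] Gra 𝕂 d N k :=
  Gra.lift d (fun g => Gra.mk d (Prod.map τ τ ∘ g))
    (fun g σ => Gra.mk_perm d (Prod.map τ τ ∘ g) σ)
    (fun g e => by rw [← Gra.mk_flip, map_flipEdge])

/-- When a graph on vertices `0, …, q` is inserted in place of the vertex `0` of a graph on
vertices `0, …, p`, the new vertices `0, …, q` lie over the old vertex `0` and the new vertex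
`v > q` is the old vertex `v - q` (the subtraction is truncated). -/
def collapse {p q M : ℕ} (hM : p + q = M) (v : Fin (M + 1)) : Fin (p + 1) :=
  ⟨v - q, by omega⟩

/-- Graphs obtained from `g` by reconnecting all half-edges at the vertex `0` to the vertices
`0, …, q` in an arbitrary way. -/
def reconnections {p j q M : ℕ} (hM : p + q = M) (g : MDigraph (p + 1) j) :
    Finset (MDigraph (M + 1) j) :=
  Finset.univ.filter fun h => Prod.map (collapse hM) (collapse hM) ∘ h = g

/-- The edges of `h` followed by the edges of `g'`, the latter placed on the vertices
`0, …, q`. -/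
def joinEdges {j q k M K : ℕ} (hq : q ≤ M) (hK : j + k = K)
    (h : MDigraph (M + 1) j) (g' : MDigraph (q + 1) k) : MDigraph (M + 1) K :=
  Fin.append h (Prod.map (Fin.castLE (by omega)) (Fin.castLE (by omega)) ∘ g') ∘ Fin.cast hK.symm

theorem joinEdges_left {j q k M K : ℕ} (hq : q ≤ M) (hK : j + k = K)
    (h : MDigraph (M + 1) j) (g' : MDigraph (q + 1) k) (e : Fin j) :
    joinEdges hq hK h g' (Fin.cast hK (Fin.castAdd k e)) = h e := by
  simp [joinEdges]

theorem joinEdges_right {j q k M K : ℕ} (hq : q ≤ M) (hK : j + k = K)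
    (h : MDigraph (M + 1) j) (g' : MDigraph (q + 1) k) (e : Fin k) :
    joinEdges hq hK h g' (Fin.cast hK (Fin.natAdd j e)) =
      Prod.map (Fin.castLE (by omega)) (Fin.castLE (by omega)) (g' e) := by
  simp [joinEdges]

theorem funext_edges {α : Type*} {j k K : ℕ} (hK : j + k = K) {f g : Fin K → α}
    (hl : ∀ e : Fin j, f (Fin.cast hK (Fin.castAdd k e)) = g (Fin.cast hK (Fin.castAdd k e)))
    (hr : ∀ e : Fin k, f (Fin.cast hK (Fin.natAdd j e)) = g (Fin.cast hK (Fin.natAdd j e))) :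
    f = g := by
  subst hK
  funext i
  exact Fin.addCases hl hr i

/-- A permutation of the first `j` and one of the last `k` edges, put together. -/
def sumPerm {j k K : ℕ} (hK : j + k = K) (σ : Equiv.Perm (Fin j)) (τ : Equiv.Perm (Fin k)) :
    Equiv.Perm (Fin K) :=
  (finSumFinEquiv.trans (finCongr hK)).permCongr (Equiv.sumCongr σ τ)

theorem sign_sumPerm {j k K : ℕ} (hK : j + k = K) (σ : Equiv.Perm (Fin j))
    (τ : Equiv.Perm (Fin k)) :
    Equiv.Perm.sign (sumPerm hK σ τ) = Equiv.Perm.sign σ * Equiv.Perm.sign τ := by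
  rw [sumPerm, Equiv.Perm.sign_permCongr]
  exact Equiv.Perm.sign_sumCongr σ τ

theorem sumPerm_left {j k K : ℕ} (hK : j + k = K) (σ : Equiv.Perm (Fin j))
    (τ : Equiv.Perm (Fin k)) (e : Fin j) :
    sumPerm hK σ τ (Fin.cast hK (Fin.castAdd k e)) = Fin.cast hK (Fin.castAdd k (σ e)) := by
  subst hK
  simp [sumPerm, Equiv.permCongr_apply]

theorem sumPerm_right {j k K : ℕ} (hK : j + k = K) (σ : Equiv.Perm (Fin j))
    (τ : Equiv.Perm (Fin k)) (e : Fin k) :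
    sumPerm hK σ τ (Fin.cast hK (Fin.natAdd j e)) = Fin.cast hK (Fin.natAdd j (τ e)) := by
  subst hK
  simp [sumPerm, Equiv.permCongr_apply]

theorem joinEdges_perm {j q k M K : ℕ} (hq : q ≤ M) (hK : j + k = K)
    (h : MDigraph (M + 1) j) (g' : MDigraph (q + 1) k)
    (σ : Equiv.Perm (Fin j)) (τ : Equiv.Perm (Fin k)) :
    joinEdges hq hK (h ∘ σ) (g' ∘ τ) = joinEdges hq hK h g' ∘ sumPerm hK σ τ := by
  refine funext_edges hK (fun e => ?_) (fun e => ?_)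
  · simp only [joinEdges_left, Function.comp_apply, sumPerm_left]
  · simp only [joinEdges_right, Function.comp_apply, sumPerm_right]

theorem joinEdges_flip_left {j q k M K : ℕ} (hq : q ≤ M) (hK : j + k = K)
    (h : MDigraph (M + 1) j) (g' : MDigraph (q + 1) k) (e : Fin j) :
    joinEdges hq hK (flipEdge e h) g' =
      flipEdge (Fin.cast hK (Fin.castAdd k e)) (joinEdges hq hK h g') := by
  refine funext_edges hK (fun e' => ?_) (fun e' => ?_)
  · by_cases he : e' = e
    · subst he; simp [joinEdges_left, flipEdge]
    · rw [joinEdges_left]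
      simp only [flipEdge]
      rw [Function.update_of_ne he, Function.update_of_ne, joinEdges_left]
      intro h'
      apply he
      simpa [Fin.ext_iff] using h'
  · rw [joinEdges_right]
    simp only [flipEdge]
    rw [Function.update_of_ne, joinEdges_right]
    intro h'
    have := congrArg Fin.val h'
    simp at this
    omega

theorem joinEdges_flip_right {j q k M K : ℕ} (hq : q ≤ M) (hK : j + k = K)
    (h : MDigraph (M + 1) j) (g' : MDigraph (q + 1) k) (e : Fin k) :
    joinEdges hq hK h (flipEdge e g') =
      flipEdge (Fin.cast hK (Fin.natAdd j e)) (joinEdges hq hK h g') := by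
  refine funext_edges hK (fun e' => ?_) (fun e' => ?_)
  · rw [joinEdges_left]
    simp only [flipEdge]
    rw [Function.update_of_ne, joinEdges_left]
    intro h'
    have := congrArg Fin.val h'
    simp at this
    omega
  · by_cases he : e' = e
    · subst he
      simp only [joinEdges_right, flipEdge, Function.update_self]
      rfl
    · rw [joinEdges_right]
      simp only [flipEdge]
      rw [Function.update_of_ne he, Function.update_of_ne, joinEdges_right]
      intro h'
      apply he
      simpa [Fin.ext_iff] using h'

theorem sum_reconnections_perm {A : Type*} [AddCommMonoid A] {p j q M : ℕ} (hM : p + q = M)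
    (g : MDigraph (p + 1) j) (σ : Equiv.Perm (Fin j)) (F : MDigraph (M + 1) j → A) :
    ∑ h ∈ reconnections hM (g ∘ σ), F h = ∑ h ∈ reconnections hM g, F (h ∘ σ) := by
  symm
  refine Finset.sum_bij (fun h _ => h ∘ σ) ?_ ?_ ?_ (fun _ _ => rfl)
  · intro h hh
    simp only [reconnections, Finset.mem_filter, Finset.mem_univ, true_and] at hh ⊢
    rw [← Function.comp_assoc, hh]
  · intro a _ b _ hab
    funext i
    have := congrFun hab (σ.symm i)
    simpa using this
  · intro b hb
    refine ⟨b ∘ σ.symm, ?_, ?_⟩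
    · simp only [reconnections, Finset.mem_filter, Finset.mem_univ, true_and] at hb ⊢
      rw [← Function.comp_assoc, hb]
      funext i
      simp
    · funext i
      simp

theorem sum_reconnections_flip {A : Type*} [AddCommMonoid A] {p j q M : ℕ} (hM : p + q = M)
    (g : MDigraph (p + 1) j) (e : Fin j) (F : MDigraph (M + 1) j → A) :
    ∑ h ∈ reconnections hM (flipEdge e g), F h = ∑ h ∈ reconnections hM g, F (flipEdge e h) := by
  symm
  refine Finset.sum_bij (fun h _ => flipEdge e h) ?_ ?_ ?_ (fun _ _ => rfl)
  · intro h hh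
    simp only [reconnections, Finset.mem_filter, Finset.mem_univ, true_and] at hh ⊢
    rw [map_flipEdge, hh]
  · intro a _ b _ hab
    have := congrArg (flipEdge e) hab
    simpa [flipEdge_flipEdge] using this
  · intro b hb
    refine ⟨flipEdge e b, ?_, flipEdge_flipEdge e b⟩
    simp only [reconnections, Finset.mem_filter, Finset.mem_univ, true_and] at hb ⊢
    rw [map_flipEdge, hb, flipEdge_flipEdge]

/-- The partial composition `∘₁ : Gra_d(p+1) ⊗ Gra_d(q+1) → Gra_d(p+q+1)`: the second graph is
inserted in place of the first vertex of the first graph, the half-edges at that vertex being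
reconnected in all possible ways; the edges of the first graph come before those of the
second. -/
def Gra.comp (d : ℕ) {p q M j k K : ℕ} (hM : p + q = M) (hK : j + k = K) :
    Gra 𝕂 d (p + 1) j →ₗ[𝕂] Gra 𝕂 d (q + 1) k →ₗ[𝕂] Gra 𝕂 d (M + 1) K :=
  Gra.lift d
    (fun g => Gra.lift d
      (fun g' => ∑ h ∈ reconnections hM g, Gra.mk d (joinEdges (by omega) hK h g'))
      (fun g' τ => by
        rw [Finset.smul_sum]
        refine Finset.sum_congr rfl fun h _ => ?_
        have := joinEdges_perm (q := q) (M := M) (by omega) hK h g' 1 τ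
        rw [show h ∘ ((1 : Equiv.Perm (Fin j)) : Fin j → Fin j) = h from rfl] at this
        rw [this, Gra.mk_perm, sign_sumPerm]
        simp)
      (fun g' e => by
        rw [Finset.smul_sum]
        refine Finset.sum_congr rfl fun h _ => ?_
        rw [joinEdges_flip_right, Gra.mk_flip]))
    (fun g σ => by
      refine Gra.hom_ext fun g' => ?_
      simp only [Gra.lift_mk, LinearMap.smul_apply]
      rw [sum_reconnections_perm, Finset.smul_sum]
      refine Finset.sum_congr rfl fun h _ => ?_
      have := joinEdges_perm (q := q) (M := M) (by omega) hK h g' σ 1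
      rw [show g' ∘ ((1 : Equiv.Perm (Fin k)) : Fin k → Fin k) = g' from rfl] at this
      rw [this, Gra.mk_perm, sign_sumPerm]
      simp)
    (fun g e => by
      refine Gra.hom_ext fun g' => ?_
      simp only [Gra.lift_mk, LinearMap.smul_apply]
      rw [sum_reconnections_flip, Finset.smul_sum]
      refine Finset.sum_congr rfl fun h _ => ?_
      rw [joinEdges_flip_left, Gra.mk_flip])

/-! ### The full graph complex -/

variable (𝕂) in
/-- Families of elements of `Gra_d(p+1)` with `k` edges, that is `∏_{N ≥ 1} Gra_d(N)`; the index
`p` is the number of vertices minus one. -/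
abbrev GraphSeries (d : ℕ) : Type _ := ∀ p k : ℕ, Gra 𝕂 d (p + 1) k

variable (𝕂) in
/-- The full graph complex `fGC_d`: invariants for the symmetric groups acting on the vertices,
twisted by the signature when `d` is odd. -/
def fGC (d : ℕ) : Submodule 𝕂 (GraphSeries 𝕂 d) where
  carrier := {γ | ∀ p k (σ : Equiv.Perm (Fin (p + 1))),
    (((Equiv.Perm.sign σ : ℤˣ) : ℤ) : 𝕂) ^ d • Gra.relabel d σ⁻¹ (γ p k) = γ p k}
  add_mem' := by
    intro a b ha hb p k σ
    simp only [Pi.add_apply, map_add, smul_add, ha p k σ, hb p k σ]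
  zero_mem' := by
    intro p k σ
    simp
  smul_mem' := by
    intro c a ha p k σ
    simp only [Pi.smul_apply, map_smul]
    rw [smul_comm, ha p k σ]

variable (𝕂) in
/-- The elements of `fGC_d` of degree `m`: a graph with `p + 1` vertices and `k` edges has degree
`d p + k (1 - d)`. -/
def fGCdeg (d : ℕ) (m : ℤ) : Submodule 𝕂 (GraphSeries 𝕂 d) where
  carrier := {γ | γ ∈ fGC 𝕂 d ∧
    ∀ p k : ℕ, (d : ℤ) * p + k * (1 - (d : ℤ)) ≠ m → γ p k = 0}
  add_mem' := by
    rintro a b ⟨ha, ha'⟩ ⟨hb, hb'⟩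
    refine ⟨add_mem ha hb, fun p k h => ?_⟩
    simp [ha' p k h, hb' p k h]
  zero_mem' := ⟨zero_mem _, fun _ _ _ => rfl⟩
  smul_mem' := by
    rintro c a ⟨ha, ha'⟩
    refine ⟨Submodule.smul_mem _ c ha, fun p k h => ?_⟩
    simp [ha' p k h]

/-- The permutations of `{0, …, M}` that are increasing on `{0, …, q}` and on `{q + 1, …, M}`,
i.e. the shuffles of type `(q + 1, M - q)`. -/
def shuffles (q M : ℕ) : Finset (Equiv.Perm (Fin (M + 1))) :=
  Finset.univ.filter fun τ =>
    ∀ a b : Fin (M + 1), a < b → ((b : ℕ) ≤ q ∨ q < (a : ℕ)) → τ a < τ b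

/-- The pre-Lie product `γ ∘ γ' = ∑_τ sgn(τ)^d (γ ∘₁ γ') · τ⁻¹`, the sum running over the shuffles
`τ` (so over the unshuffles `τ⁻¹`). -/
def preLie (d : ℕ) : GraphSeries 𝕂 d →ₗ[𝕂] GraphSeries 𝕂 d →ₗ[𝕂] GraphSeries 𝕂 d :=
  LinearMap.mk₂ 𝕂
    (fun γ γ' M K => ∑ p : Fin (M + 1), ∑ j : Fin (K + 1), ∑ τ ∈ shuffles (M - p) M,
      (((Equiv.Perm.sign τ : ℤˣ) : ℤ) : 𝕂) ^ d • Gra.relabel d τ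
        (Gra.comp d (show (p : ℕ) + (M - p) = M by omega) (show (j : ℕ) + (K - j) = K by omega)
          (γ p j) (γ' (M - p) (K - j))))
    (by
      intro a b c
      funext M K
      simp only [Pi.add_apply, map_add, LinearMap.add_apply, smul_add, Finset.sum_add_distrib])
    (by
      intro c a b
      funext M K
      simp only [Pi.smul_apply, map_smul, LinearMap.smul_apply, Finset.smul_sum]
      refine Finset.sum_congr rfl fun _ _ => Finset.sum_congr rfl fun _ _ =>
        Finset.sum_congr rfl fun _ _ => smul_comm _ _ _)
    (by
      intro a b c
      funext M K
      simp only [Pi.add_apply, map_add, smul_add, Finset.sum_add_distrib])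
    (by
      intro c a b
      funext M K
      simp only [Pi.smul_apply, map_smul, Finset.smul_sum]
      refine Finset.sum_congr rfl fun _ _ => Finset.sum_congr rfl fun _ _ =>
        Finset.sum_congr rfl fun _ _ => smul_comm _ _ _)

/-- The graph with two vertices and one edge from the first to the second: the Maurer–Cartan
element of `fGC_d` (of degree `1`) representing the bracket. -/
def bracketGraph (d : ℕ) : GraphSeries 𝕂 d
  | 1, 1 => Gra.mk d fun _ => (0, 1)
  | _, _ => 0

/-- The differential on elements of degree `m`: the graded commutator
`δ γ = [Γ, γ] = Γ ∘ γ - (-1)^m γ ∘ Γ` with the bracket graph `Γ`. -/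
def graphDiff (d : ℕ) (m : ℤ) : GraphSeries 𝕂 d →ₗ[𝕂] GraphSeries 𝕂 d :=
  preLie (𝕂 := 𝕂) d (bracketGraph d) - (-1 : 𝕂) ^ m • (preLie (𝕂 := 𝕂) d).flip (bracketGraph d)

variable (𝕂) in
/-- Cocycles of degree `m` of the full graph complex. -/
def cocycles (d : ℕ) (m : ℤ) : Submodule 𝕂 (GraphSeries 𝕂 d) :=
  fGCdeg 𝕂 d m ⊓ LinearMap.ker (graphDiff d m)

variable (𝕂) in
/-- Coboundaries of degree `m` of the full graph complex. -/
def coboundaries (d : ℕ) (m : ℤ) : Submodule 𝕂 (GraphSeries 𝕂 d) :=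
  (fGCdeg 𝕂 d (m - 1)).map (graphDiff d (m - 1))

variable (𝕂) in
/-- The cohomology `H^m(fGC_d)`. -/
abbrev graphCohomology (d : ℕ) (m : ℤ) : Type _ :=
  cocycles 𝕂 d m ⧸ (coboundaries 𝕂 d m).submoduleOf (cocycles 𝕂 d m)

end Gra

/-! ### Graded symplectic domains -/

/-- Smooth `𝕂`-valued functions on an open subset of `ℝ^ι`. -/
def SmoothFun (𝕂 : Type*) [RCLike 𝕂] {ι : Type} [Fintype ι]
    (U : TopologicalSpace.Opens (ι → ℝ)) : Subalgebra 𝕂 (U → 𝕂) where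
  carrier := {f | ContDiffOn ℝ ∞ (Function.extend Subtype.val f 0) U}
  mul_mem' := by
    intro a b ha hb
    refine (ContDiffOn.mul ha hb).congr fun x hx => ?_
    have h (f : U → 𝕂) : Function.extend Subtype.val f 0 x = f ⟨x, hx⟩ :=
      Subtype.val_injective.extend_apply f 0 ⟨x, hx⟩
    simp only [h, Pi.mul_apply]
  add_mem' := by
    intro a b ha hb
    refine (ContDiffOn.add ha hb).congr fun x hx => ?_
    have h (f : U → 𝕂) : Function.extend Subtype.val f 0 x = f ⟨x, hx⟩ :=
      Subtype.val_injective.extend_apply f 0 ⟨x, hx⟩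
    simp only [h, Pi.add_apply]
  algebraMap_mem' := by
    intro r
    refine (contDiffOn_const (c := r)).congr fun x hx => ?_
    exact Subtype.val_injective.extend_apply _ _ (⟨x, hx⟩ : U)

section Smooth

variable {𝕂 : Type*} [RCLike 𝕂] {ι : Type} [Fintype ι] {U : TopologicalSpace.Opens (ι → ℝ)}

/-- Extension by zero of a smooth function on `U`. -/
def ext0 (f : SmoothFun 𝕂 U) : (ι → ℝ) → 𝕂 :=
  Function.extend Subtype.val (f : U → 𝕂) 0

theorem ext0_apply (f : SmoothFun 𝕂 U) (x : U) : (ext0 f) x = (f : U → 𝕂) x :=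
  Subtype.val_injective.extend_apply _ _ x

theorem ext0_of_notMem (f : SmoothFun 𝕂 U) {x : ι → ℝ} (hx : x ∉ U) :
    (ext0 f) x = 0 :=
  Function.extend_apply' _ _ _ (by rintro ⟨y, rfl⟩; exact hx y.2)

theorem smoothFun_contDiffOn (f : SmoothFun 𝕂 U) : ContDiffOn ℝ ∞ (ext0 f) U := f.2

theorem smoothFun_contDiffAt (f : SmoothFun 𝕂 U) (x : U) : ContDiffAt ℝ ∞ (ext0 f) x :=
  (smoothFun_contDiffOn f).contDiffAt (U.isOpen.mem_nhds x.2)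

theorem ext0_add (f g : SmoothFun 𝕂 U) : ext0 (f + g) = (ext0 f) + (ext0 g) := by
  funext x
  by_cases hx : x ∈ U
  · simpa using (ext0_apply (f + g) ⟨x, hx⟩).trans
      (congrArg₂ (· + ·) (ext0_apply f ⟨x, hx⟩).symm
        (ext0_apply g ⟨x, hx⟩).symm)
  · simp [ext0_of_notMem _ hx]

theorem ext0_smul (c : 𝕂) (f : SmoothFun 𝕂 U) : ext0 (c • f) = c • (ext0 f) := by
  funext x
  by_cases hx : x ∈ U
  · simpa using (ext0_apply (c • f) ⟨x, hx⟩).trans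
      (congrArg (c • ·) (ext0_apply f ⟨x, hx⟩).symm)
  · simp [ext0_of_notMem _ hx]

variable (U) in
/-- The partial derivative in the `i`-th coordinate direction. -/
def pdSmooth [DecidableEq ι] (i : ι) : SmoothFun 𝕂 U →ₗ[𝕂] SmoothFun 𝕂 U where
  toFun f := ⟨fun x => fderiv ℝ (ext0 f) x (Pi.single i 1), by
    have h : ContDiffOn ℝ ∞ (fun y => fderiv ℝ (ext0 f) y (Pi.single i 1)) U :=
      ((smoothFun_contDiffOn f).fderiv_of_isOpen U.isOpen (by simp)).clm_apply contDiffOn_const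
    refine h.congr fun x hx => ?_
    exact Subtype.val_injective.extend_apply _ _ (⟨x, hx⟩ : U)⟩
  map_add' f g := by
    refine Subtype.ext (funext fun x => ?_)
    change fderiv ℝ (ext0 (f + g)) x (Pi.single i 1) = fderiv ℝ (ext0 f) x (Pi.single i 1) +
      fderiv ℝ (ext0 g) x (Pi.single i 1)
    rw [ext0_add, fderiv_add ((smoothFun_contDiffAt f x).differentiableAt (by simp))
      ((smoothFun_contDiffAt g x).differentiableAt (by simp))]
    rfl
  map_smul' c f := by
    refine Subtype.ext (funext fun x => ?_)
    change fderiv ℝ (ext0 (c • f)) x (Pi.single i 1) = c • fderiv ℝ (ext0 f) x (Pi.single i 1)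
    rw [ext0_smul, fderiv_const_smul ((smoothFun_contDiffAt f x).differentiableAt (by simp))]
    rfl

theorem pdSmooth_comm [DecidableEq ι] (i j : ι) (f : SmoothFun 𝕂 U) :
    pdSmooth U i (pdSmooth U j f) = pdSmooth U j (pdSmooth U i f) := by
  have key (i j : ι) (x : U) : (pdSmooth U i (pdSmooth U j f) : U → 𝕂) x =
      fderiv ℝ (fderiv ℝ (ext0 f)) x (Pi.single i 1) (Pi.single j 1) := by
    change fderiv ℝ (ext0 (pdSmooth U j f)) x (Pi.single i 1) = _
    have h : ext0 (pdSmooth U j f) =ᶠ[nhds (x : ι → ℝ)]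
        fun y => fderiv ℝ (ext0 f) y (Pi.single j 1) := by
      filter_upwards [U.isOpen.mem_nhds x.2] with y hy
      exact ext0_apply (pdSmooth U j f) ⟨y, hy⟩
    rw [h.fderiv_eq, fderiv_clm_apply]
    · simp
    · exact ((smoothFun_contDiffAt f x).fderiv_right (m := 1) (by norm_cast)).differentiableAt (by simp)
    · exact differentiableAt_const _
  refine Subtype.ext (funext fun x => ?_)
  rw [key i j, key j i]
  exact ((smoothFun_contDiffAt f x).isSymmSndFDerivAt (by
    rw [minSmoothness_of_isRCLikeNormedField]; norm_cast)) _ _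

end Smooth

section Slot

variable {𝕂 M : Type*} [CommRing 𝕂] [AddCommGroup M] [Module 𝕂 M]

/-- The operator `P ⊗ ⋯ ⊗ P ⊗ D ⊗ 1 ⊗ ⋯ ⊗ 1` with `D` on the factor `i`. -/
def slotOp {N : ℕ} (i : Fin N) (P D : Module.End 𝕂 M) : Module.End 𝕂 (⨂[𝕂] _ : Fin N, M) :=
  PiTensorProduct.map fun l => if l < i then P else if l = i then D else 1

theorem map_eq_smul {N : ℕ} {f g : Fin N → Module.End 𝕂 M} {c : 𝕂} (i : Fin N)
    (hi : f i = c • g i) (h : ∀ l, l ≠ i → f l = g l) :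
    PiTensorProduct.map f = c • PiTensorProduct.map g := by
  have : f = Function.update g i (c • g i) := by
    funext l
    by_cases hl : l = i
    · subst hl; simpa using hi
    · simp [hl, h l hl]
  rw [this, PiTensorProduct.map_update_smul, Function.update_eq_self]

theorem slotOp_mul {N : ℕ} (i j : Fin N) (P D P' D' : Module.End 𝕂 M) (c : 𝕂) (hc : c * c = 1)
    (hP : P * P' = P' * P) (h : D * P' = c • (P' * D)) (h' : D' * P = c • (P * D'))
    (hD : D * D' = c • (D' * D)) :
    slotOp i P D * slotOp j P' D' = c • (slotOp j P' D' * slotOp i P D) := by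
  have h'' : P * D' = c • (D' * P) := by rw [h', smul_smul, hc, one_smul]
  unfold slotOp
  rw [← PiTensorProduct.map_mul, ← PiTensorProduct.map_mul]
  rcases lt_trichotomy i j with hij | hij | hij
  · refine map_eq_smul i ?_ fun l hl => ?_
    · simp [hij, h]
    · by_cases h1 : l < i
      · simp [h1, h1.trans hij, hP]
      · simp [h1, hl]
  · subst hij
    refine map_eq_smul i ?_ fun l hl => ?_
    · simp [hD]
    · by_cases h1 : l < i
      · simp [h1, hP]
      · simp [h1, hl]
  · refine map_eq_smul j ?_ fun l hl => ?_
    · simp [hij, h'']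
    · by_cases h1 : l < j
      · simp [h1, h1.trans hij, hP]
      · simp [h1, hl]

theorem prod_ofFn_swap {R : Type*} [Semiring R] [Algebra 𝕂 R] (c : 𝕂) {k : ℕ}
    (x : Fin (k + 1) → R) (hx : ∀ i j, x i * x j = c • (x j * x i)) (i : Fin k) :
    (List.ofFn (x ∘ Equiv.swap i.castSucc i.succ)).prod = c • (List.ofFn x).prod := by
  induction k with
  | zero => exact i.elim0
  | succ k ih =>
    cases i using Fin.cases with
    | zero =>
      have h : (x ∘ Equiv.swap (0 : Fin (k + 2)) 1) =
          Fin.cons (x 1) (Fin.cons (x 0) fun l : Fin k => x l.succ.succ) := by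
        funext l
        cases l using Fin.cases with
        | zero => simp
        | succ l =>
          cases l using Fin.cases with
          | zero => simp
          | succ l =>
            have h0 : l.succ.succ ≠ (0 : Fin (k + 2)) := Fin.succ_ne_zero _
            have h1 : l.succ.succ ≠ (1 : Fin (k + 2)) := by
              rw [← Fin.succ_zero_eq_one, Ne, Fin.succ_inj]
              exact Fin.succ_ne_zero _
            simp [Equiv.swap_apply_of_ne_of_ne h0 h1]
      have h' : x = Fin.cons (x 0) (Fin.cons (x 1) fun l : Fin k => x l.succ.succ) := by
        funext l
        cases l using Fin.cases with
        | zero => simp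
        | succ l =>
          cases l using Fin.cases with
          | zero => simp
          | succ l => simp
      rw [Fin.castSucc_zero, Fin.succ_zero_eq_one, h]
      conv_rhs => rw [h']
      simp only [List.ofFn_cons, List.prod_cons]
      rw [← mul_assoc, hx 1 0, smul_mul_assoc, mul_assoc]
    | succ i =>
      have h : (x ∘ Equiv.swap i.succ.castSucc i.succ.succ) =
          Fin.cons (x 0) ((fun l : Fin (k + 1) => x l.succ) ∘ Equiv.swap i.castSucc i.succ) := by
        funext l
        cases l using Fin.cases with
        | zero =>
          simp only [Function.comp_apply, Fin.cons_zero]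
          rw [Equiv.swap_apply_of_ne_of_ne] <;> simp [Fin.ext_iff]
        | succ l =>
          simp only [Function.comp_apply, Fin.cons_succ]
          rw [← Fin.succ_castSucc, ← (Fin.succ_injective _).map_swap]
      rw [h]
      conv_rhs => rw [← Fin.cons_self_tail x]
      simp only [List.ofFn_cons, List.prod_cons]
      rw [ih (fun l => x l.succ) (fun _ _ => hx _ _) i, mul_smul_comm]
      rfl

/-- Reordering a product of elements that commute up to the sign `c`. -/
theorem prod_ofFn_perm {R : Type*} [Semiring R] [Algebra 𝕂 R] (c : 𝕂) {k : ℕ} (x : Fin k → R)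
    (hx : ∀ i j, x i * x j = c • (x j * x i)) (s : Equiv.Perm (Fin k) → 𝕂) (hs1 : s 1 = 1)
    (hs : ∀ σ τ, s (σ * τ) = s σ * s τ) (hswap : ∀ i j, i ≠ j → s (Equiv.swap i j) = c)
    (σ : Equiv.Perm (Fin k)) :
    (List.ofFn (x ∘ σ)).prod = s σ • (List.ofFn x).prod := by
  cases k with
  | zero => simp [Subsingleton.elim σ 1, hs1]
  | succ k =>
    have hσ : σ ∈ Submonoid.closure (Set.range fun i : Fin k => Equiv.swap i.castSucc i.succ) := by
      rw [Equiv.Perm.mclosure_swap_castSucc_succ]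
      trivial
    induction hσ using Submonoid.closure_induction generalizing x with
    | one => simp [hs1]
    | mem τ hτ =>
      obtain ⟨i, rfl⟩ := hτ
      rw [hswap _ _ (Fin.castSucc_lt_succ).ne]
      exact prod_ofFn_swap c x hx i
    | mul τ τ' _ _ ih ih' =>
      have := ih' (x ∘ τ) (fun i j => hx _ _)
      rw [Equiv.Perm.coe_mul, ← Function.comp_assoc, this, ih x hx, smul_smul, hs, mul_comm]

theorem sum_mul_sum_comm {α R : Type*} [Fintype α] [Semiring R] [Algebra 𝕂 R] (c : 𝕂)
    (x y : α → α → R) (h : ∀ A B A' B', x A B * y A' B' = c • (y A' B' * x A B)) :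
    (∑ A, ∑ B, x A B) * (∑ A, ∑ B, y A B) = c • ((∑ A, ∑ B, y A B) * ∑ A, ∑ B, x A B) := by
  simp only [← Fintype.sum_prod_type']
  rw [Finset.sum_mul_sum, Finset.sum_mul_sum, Finset.smul_sum, Finset.sum_comm]
  refine Finset.sum_congr rfl fun p _ => ?_
  rw [Finset.smul_sum]
  exact Finset.sum_congr rfl fun q _ => h _ _ _ _

theorem mul_mul_comm_sign {R : Type*} [Semiring R] [Algebra 𝕂 R] {a b a' b' : R}
    {c₁ c₂ c₃ c₄ : 𝕂} (h₁ : a * a' = c₁ • (a' * a)) (h₂ : a * b' = c₂ • (b' * a))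
    (h₃ : b * a' = c₃ • (a' * b)) (h₄ : b * b' = c₄ • (b' * b)) :
    a * b * (a' * b') = (c₁ * c₂ * (c₃ * c₄)) • (a' * b' * (a * b)) := by
  have e : a * b * (a' * b') = a * (b * a') * b' := by simp only [mul_assoc]
  rw [e, h₃, mul_smul_comm, smul_mul_assoc, ← mul_assoc, h₁, smul_mul_assoc, smul_mul_assoc,
    mul_assoc (a' * a), h₄, mul_smul_comm]
  have e' : a' * a * (b' * b) = a' * (a * b') * b := by simp only [mul_assoc]
  rw [e', h₂, mul_smul_comm, smul_mul_assoc]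
  simp only [smul_smul, mul_assoc]
  congr 1
  ring

theorem neg_one_pow_mul_self (n : ℕ) : (-1 : 𝕂) ^ (n * n) = (-1) ^ n := by
  rcases Nat.even_or_odd n with h | h
  · rw [(h.mul_left n).neg_one_pow, h.neg_one_pow]
  · rw [(h.mul h).neg_one_pow, h.neg_one_pow]

theorem bivector_symm {α R : Type*} [Fintype α] [Semiring R] [Algebra 𝕂 R] (n : ℕ) (deg : α → ℕ)
    (w : α → α → 𝕂) (hw : ∀ A B, w B A = -(-1) ^ (n + deg A * deg B) * w A B) (x y : α → R)
    (h : ∀ A B, y A * x B = (-1 : 𝕂) ^ (deg A * deg B) • (x B * y A)) :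
    ∑ A, ∑ B, w A B • (y A * x B) = (-1 : 𝕂) ^ (n + 1) • ∑ A, ∑ B, w A B • (x A * y B) := by
  rw [Finset.sum_comm, Finset.smul_sum]
  refine Finset.sum_congr rfl fun A _ => ?_
  rw [Finset.smul_sum]
  refine Finset.sum_congr rfl fun B _ => ?_
  rw [h, hw A B, smul_smul, smul_smul, mul_comm (deg B)]
  congr 1
  rw [pow_add, pow_succ]
  have : (-1 : 𝕂) ^ (deg A * deg B) * (-1 : 𝕂) ^ (deg A * deg B) = 1 := by
    rw [← pow_add, Even.neg_one_pow ⟨_, rfl⟩]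
  linear_combination (-(-1) ^ n * w A B) * this

theorem bivector_mul {α R : Type*} [Fintype α] [Semiring R] [Algebra 𝕂 R] (n : ℕ) (deg : α → ℕ)
    (w : α → α → 𝕂) (hw : ∀ A B, w A B ≠ 0 → deg A + deg B = n) (a b a' b' : α → R)
    (h₁ : ∀ A B, a A * a' B = (-1 : 𝕂) ^ (deg A * deg B) • (a' B * a A))
    (h₂ : ∀ A B, a A * b' B = (-1 : 𝕂) ^ (deg A * deg B) • (b' B * a A))
    (h₃ : ∀ A B, b A * a' B = (-1 : 𝕂) ^ (deg A * deg B) • (a' B * b A))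
    (h₄ : ∀ A B, b A * b' B = (-1 : 𝕂) ^ (deg A * deg B) • (b' B * b A)) :
    (∑ A, ∑ B, w A B • (a A * b B)) * (∑ A, ∑ B, w A B • (a' A * b' B)) =
      (-1 : 𝕂) ^ (n + 1 + 1) •
        ((∑ A, ∑ B, w A B • (a' A * b' B)) * ∑ A, ∑ B, w A B • (a A * b B)) := by
  refine sum_mul_sum_comm _ _ _ fun A B A' B' => ?_
  by_cases h : w A B = 0
  · simp [h]
  by_cases h' : w A' B' = 0
  · simp [h']
  have e := hw A B h
  have e' := hw A' B' h'
  have hs : (-1 : 𝕂) ^ (deg A * deg A') * (-1 : 𝕂) ^ (deg A * deg B') *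
      ((-1 : 𝕂) ^ (deg B * deg A') * (-1 : 𝕂) ^ (deg B * deg B')) = (-1 : 𝕂) ^ (n + 1 + 1) := by
    rw [← pow_add, ← pow_add, ← pow_add,
      show deg A * deg A' + deg A * deg B' + (deg B * deg A' + deg B * deg B')
        = (deg A + deg B) * (deg A' + deg B') by ring, e, e', neg_one_pow_mul_self]
    ring
  rw [← hs, smul_mul_smul_comm, smul_mul_smul_comm,
    mul_mul_comm_sign (h₁ A A') (h₂ A B') (h₃ B A') (h₄ B B'), smul_smul, smul_smul]
  congr 1
  ring

end Slot

/-- A Darboux chart of an NP-manifold of degree `n`: finitely many coordinates `z^A` of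
non-negative integer degrees, those of degree `0` ranging over an open subset of Euclidean space,
and a non-degenerate Poisson bracket of degree `-n`, inverse to a symplectic form of degree `n`,
with constant coefficients `poisson A B`. The degree condition says that the bivector
`poisson A B ∂_A ∂_B` has degree `-n`, the symmetry condition is that of a graded symplectic form of
degree `n`. -/
structure NPDomain (𝕂 : Type*) [RCLike 𝕂] (n : ℕ) where
  /-- number of coordinates -/
  size : ℕ
  /-- degrees of the coordinates -/
  deg : Fin size → ℕ
  /-- Poisson tensor -/
  poisson : Matrix (Fin size) (Fin size) 𝕂
  poisson_deg : ∀ A B, poisson A B ≠ 0 → deg A + deg B = n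
  poisson_symm : ∀ A B, poisson B A = -(-1) ^ (n + deg A * deg B) * poisson A B
  poisson_nondeg : IsUnit poisson.det
  /-- the base, where the coordinates of degree `0` take their values -/
  base : TopologicalSpace.Opens ({A : Fin size // deg A = 0} → ℝ)

namespace NPDomain

variable {𝕂 : Type*} [RCLike 𝕂] {n : ℕ} (V : NPDomain 𝕂 n)

/-- The coordinates of odd degree. -/
abbrev OddCoord : Type := {A : Fin V.size // Odd (V.deg A)}

/-- The coordinates of positive even degree. -/
abbrev EvenCoord : Type := {A : Fin V.size // V.deg A ≠ 0 ∧ Even (V.deg A)}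

/-- The free graded commutative algebra on the coordinates of positive degree (exterior in the odd
ones, polynomial in the even ones), with smooth functions on the base as coefficients. -/
abbrev PreFun : Type _ :=
  ExteriorAlgebra 𝕂 (V.OddCoord → 𝕂) ⊗[𝕂] (MvPolynomial V.EvenCoord 𝕂 ⊗[𝕂] SmoothFun 𝕂 V.base)

/-- The algebra of functions, a copy of the algebra `PreFun`. -/
def Fun : Type _ := V.PreFun

instance : Ring V.Fun := inferInstanceAs (Ring V.PreFun)

instance : Algebra 𝕂 V.Fun := inferInstanceAs (Algebra 𝕂 V.PreFun)

/-- The identification of `PreFun` with `Fun`. -/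
def ofPre : V.PreFun ≃ₐ[𝕂] V.Fun := @AlgEquiv.refl 𝕂 V.PreFun _ _ _

/-- The functions that are homogeneous of degree `k`: the span of the products of a monomial of degree
`k` in the coordinates of positive degree and a smooth function on the base. -/
def homog (k : ℕ) : Submodule 𝕂 V.Fun :=
  Submodule.span 𝕂 {x | ∃ (l : List V.OddCoord) (m : V.EvenCoord →₀ ℕ) (f : SmoothFun 𝕂 V.base),
    (l.map fun A => V.deg A).sum + (m.sum fun A e => e * V.deg A) = k ∧
    x = V.ofPre ((l.map fun A => ExteriorAlgebra.ι 𝕂 (Pi.single A (1 : 𝕂))).prod ⊗ₜ[𝕂]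
      (MvPolynomial.monomial m (1 : 𝕂) ⊗ₜ[𝕂] f))}

/-- The parity involution `f ↦ (-1)^{|f|} f` on `PreFun`. -/
def preParity : Module.End 𝕂 V.PreFun :=
  TensorProduct.map
    (CliffordAlgebra.involute (Q := (0 : QuadraticForm 𝕂 (V.OddCoord → 𝕂)))).toLinearMap
    LinearMap.id

/-- The (left) partial derivative with respect to the coordinate `A` on `PreFun`. -/
def prePd (A : Fin V.size) : Module.End 𝕂 V.PreFun :=
  if h0 : V.deg A = 0 then
    TensorProduct.map LinearMap.id
      (TensorProduct.map LinearMap.id (pdSmooth V.base ⟨A, h0⟩))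
  else if h1 : Odd (V.deg A) then
    TensorProduct.map
      (CliffordAlgebra.contractLeft (Q := (0 : QuadraticForm 𝕂 (V.OddCoord → 𝕂)))
        (LinearMap.proj (⟨A, h1⟩ : V.OddCoord)))
      LinearMap.id
  else
    TensorProduct.map LinearMap.id
      (TensorProduct.map
        (MvPolynomial.pderiv (⟨A, h0, Nat.not_odd_iff_even.mp h1⟩ : V.EvenCoord)).toLinearMap
        LinearMap.id)

theorem involute_contractLeft {M : Type*} [AddCommGroup M] [Module 𝕂 M] (φ : Module.Dual 𝕂 M)
    (x : ExteriorAlgebra 𝕂 M) :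
    CliffordAlgebra.contractLeft (Q := (0 : QuadraticForm 𝕂 M)) φ (CliffordAlgebra.involute x) =
      -CliffordAlgebra.involute (CliffordAlgebra.contractLeft φ x) := by
  induction x using CliffordAlgebra.left_induction with
  | algebraMap r => simp
  | add x y hx hy => rw [map_add, map_add, hx, hy, map_add, map_add, neg_add]
  | ι_mul x m hx =>
    rw [map_mul, CliffordAlgebra.involute_ι, neg_mul, map_neg, CliffordAlgebra.contractLeft_ι_mul,
      CliffordAlgebra.contractLeft_ι_mul, hx, map_sub, map_smul, map_mul,
      CliffordAlgebra.involute_ι]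
    simp

theorem prePd_mul_preParity (A : Fin V.size) :
    V.prePd A * V.preParity = (-1 : 𝕂) ^ V.deg A • (V.preParity * V.prePd A) := by
  unfold preParity prePd
  split_ifs with h0 h1
  · rw [h0, pow_zero, one_smul]
    simp only [Module.End.mul_eq_comp, ← TensorProduct.map_comp, LinearMap.id_comp,
      LinearMap.comp_id]
  · rw [h1.neg_one_pow]
    simp only [Module.End.mul_eq_comp, ← TensorProduct.map_comp, LinearMap.comp_id,
      ← TensorProduct.map_smul_left]
    congr 1
    refine LinearMap.ext fun x => ?_
    simpa using involute_contractLeft (LinearMap.proj (⟨A, h1⟩ : V.OddCoord)) x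
  · rw [(Nat.not_odd_iff_even.mp h1).neg_one_pow, one_smul]
    simp only [Module.End.mul_eq_comp, ← TensorProduct.map_comp, LinearMap.id_comp,
      LinearMap.comp_id]

theorem mul_pow_of_comm {R : Type*} [Semiring R] [Algebra 𝕂 R] {a b : R} {c : 𝕂}
    (h : a * b = c • (b * a)) (k : ℕ) : a * b ^ k = c ^ k • (b ^ k * a) := by
  induction k with
  | zero => simp
  | succ k ih =>
    rw [pow_succ, ← mul_assoc, ih, smul_mul_assoc, mul_assoc, h, mul_smul_comm, smul_smul,
      ← mul_assoc, pow_succ]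

theorem pderiv_comm {σ : Type*} (i j : σ) (f : MvPolynomial σ 𝕂) :
    MvPolynomial.pderiv i (MvPolynomial.pderiv j f) =
      MvPolynomial.pderiv j (MvPolynomial.pderiv i f) := by
  classical
  have h : ⁅MvPolynomial.pderiv (R := 𝕂) i, MvPolynomial.pderiv (R := 𝕂) j⁆ = 0 := by
    refine MvPolynomial.derivation_ext fun k => ?_
    rw [Derivation.commutator_apply]
    simp only [MvPolynomial.pderiv_X, Pi.single_apply]
    split_ifs <;> simp
  have := congrArg (fun D => D f) h
  simp only [Derivation.commutator_apply, Derivation.coe_zero, Pi.zero_apply] at this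
  exact sub_eq_zero.mp this

theorem prePd_mul_prePd (A B : Fin V.size) :
    V.prePd A * V.prePd B = (-1 : 𝕂) ^ (V.deg A * V.deg B) • (V.prePd B * V.prePd A) := by
  by_cases hA : Odd (V.deg A) ∧ Odd (V.deg B)
  · obtain ⟨hA, hB⟩ := hA
    rw [(hA.mul hB).neg_one_pow]
    have hA0 : V.deg A ≠ 0 := by rintro h; simp [h] at hA
    have hB0 : V.deg B ≠ 0 := by rintro h; simp [h] at hB
    simp only [prePd, hA0, hB0, hA, hB, dif_pos, dif_neg, not_false_eq_true, Module.End.mul_eq_comp,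
      ← TensorProduct.map_comp, ← TensorProduct.map_smul_left]
    congr 1
    refine LinearMap.ext fun x => ?_
    simpa using CliffordAlgebra.contractLeft_comm (Q := (0 : QuadraticForm 𝕂 (V.OddCoord → 𝕂)))
      (LinearMap.proj (⟨A, hA⟩ : V.OddCoord)) (LinearMap.proj (⟨B, hB⟩ : V.OddCoord)) x
  · have he : Even (V.deg A * V.deg B) := by
      rw [Nat.even_mul]
      by_contra h
      push Not at h
      exact hA ⟨Nat.not_even_iff_odd.mp h.1, Nat.not_even_iff_odd.mp h.2⟩
    rw [he.neg_one_pow, one_smul]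
    unfold prePd
    split_ifs with h1 h2 h3 h4 h5 h6 h7 h8
    all_goals
      simp only [Module.End.mul_eq_comp, ← TensorProduct.map_comp, LinearMap.id_comp,
        LinearMap.comp_id]
    · rw [LinearMap.ext (f := pdSmooth V.base ⟨A, h1⟩ ∘ₗ pdSmooth V.base ⟨B, h2⟩)
        (g := pdSmooth V.base ⟨B, h2⟩ ∘ₗ pdSmooth V.base ⟨A, h1⟩) fun f => pdSmooth_comm _ _ f]
    · exact absurd ⟨h4, h6⟩ hA
    · refine congrArg _ (congrArg (fun D => TensorProduct.map D LinearMap.id) ?_)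
      exact LinearMap.ext fun f => pderiv_comm _ _ f

theorem conj_mul_smul {M M' : Type*} [AddCommGroup M] [Module 𝕂 M] [AddCommGroup M'] [Module 𝕂 M']
    (e : M ≃ₗ[𝕂] M') {a b a' b' : Module.End 𝕂 M} {c : 𝕂} (h : a * b = c • (a' * b')) :
    e.conj a * e.conj b = c • (e.conj a' * e.conj b') := by
  simp only [Module.End.mul_eq_comp] at h ⊢
  rw [← LinearEquiv.conj_comp, h, map_smul, LinearEquiv.conj_comp]

/-- The parity involution on functions. -/
def parity : Module.End 𝕂 V.Fun := V.ofPre.toLinearEquiv.conj V.preParity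

/-- The (left) partial derivative with respect to the coordinate `A`. -/
def pd (A : Fin V.size) : Module.End 𝕂 V.Fun := V.ofPre.toLinearEquiv.conj (V.prePd A)

theorem pd_mul_parity (A : Fin V.size) :
    V.pd A * V.parity = (-1 : 𝕂) ^ V.deg A • (V.parity * V.pd A) := by
  exact conj_mul_smul V.ofPre.toLinearEquiv (V.prePd_mul_preParity A)

theorem pd_mul_pd (A B : Fin V.size) :
    V.pd A * V.pd B = (-1 : 𝕂) ^ (V.deg A * V.deg B) • (V.pd B * V.pd A) := by
  exact conj_mul_smul V.ofPre.toLinearEquiv (V.prePd_mul_prePd A B)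

theorem pd_mul_parity_pow (A : Fin V.size) (k : ℕ) :
    V.pd A * V.parity ^ k = (-1 : 𝕂) ^ (V.deg A * k) • (V.parity ^ k * V.pd A) := by
  rw [pow_mul]
  exact mul_pow_of_comm (V.pd_mul_parity A) k

/-- The Poisson bracket `{f, g} = ∑ ω^{AB} (-1)^{|f| |z^B|} ∂_A f · ∂_B g`. -/
def bracket : V.Fun →ₗ[𝕂] V.Fun →ₗ[𝕂] V.Fun :=
  ∑ A, ∑ B, V.poisson A B •
    (LinearMap.mul 𝕂 V.Fun).compl₁₂ (V.pd A * V.parity ^ V.deg B) (V.pd B)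

/-! ### The representation of graphs by multidifferential operators -/

/-- The derivative `∂_A` acting on the factor `i` of a tensor product, with the Koszul sign that
comes from moving it past the factors before. -/
def slotPd (N : ℕ) (i : Fin N) (A : Fin V.size) : Module.End 𝕂 (⨂[𝕂] _ : Fin N, V.Fun) :=
  slotOp i (V.parity ^ V.deg A) (V.pd A)

/-- The operator `Δ_{ij} = ∑ ω^{AB} ∂_A^{(i)} ∂_B^{(j)}` attached to an edge from `i` to `j`. -/
def edgeOp (N : ℕ) (i j : Fin N) : Module.End 𝕂 (⨂[𝕂] _ : Fin N, V.Fun) :=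
  ∑ A, ∑ B, V.poisson A B • (V.slotPd N i A * V.slotPd N j B)

theorem slotPd_mul (N : ℕ) (i j : Fin N) (A B : Fin V.size) :
    V.slotPd N i A * V.slotPd N j B =
      (-1 : 𝕂) ^ (V.deg A * V.deg B) • (V.slotPd N j B * V.slotPd N i A) := by
  refine slotOp_mul i j _ _ _ _ _ ?_ ?_ (V.pd_mul_parity_pow A _) ?_ (V.pd_mul_pd A B)
  · rw [← pow_add, Even.neg_one_pow ⟨_, rfl⟩]
  · rw [← pow_add, ← pow_add, add_comm]
  · rw [mul_comm]
    exact V.pd_mul_parity_pow B _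

theorem edgeOp_symm (N : ℕ) (i j : Fin N) :
    V.edgeOp N j i = (-1 : 𝕂) ^ (n + 1) • V.edgeOp N i j :=
  bivector_symm n V.deg V.poisson V.poisson_symm _ _ (V.slotPd_mul N j i)

theorem edgeOp_mul (N : ℕ) (i j k l : Fin N) :
    V.edgeOp N i j * V.edgeOp N k l =
      (-1 : 𝕂) ^ (n + 1 + 1) • (V.edgeOp N k l * V.edgeOp N i j) :=
  bivector_mul n V.deg V.poisson V.poisson_deg _ _ _ _ (V.slotPd_mul N i k) (V.slotPd_mul N i l)
    (V.slotPd_mul N j k) (V.slotPd_mul N j l)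

end NPDomain

section Cochain

/-! ### Cochains and the exponential

A cochain on the `d`-fold suspension of a graded vector space `M` is given by its components, which
are multilinear maps `M × ⋯ × M → M`, the `p`-th of them having `p + 1` arguments. The parity of the
grading enters through the involution `s`, which is `(-1)^i` on elements of degree `i`. -/

variable {𝕂 M : Type*} [Field 𝕂] [AddCommGroup M] [Module 𝕂 M]

variable (𝕂 M) in
/-- Families of multilinear maps with `1, 2, 3, …` arguments. -/
abbrev Cochain : Type _ := ∀ p : ℕ, MultilinearMap 𝕂 (fun _ : Fin (p + 1) => M) M

/-- The projection to the elements of even (`a = 0`) or odd (`a = 1`) degree. -/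
def parityPart (s : Module.End 𝕂 M) (a : Fin 2) : Module.End 𝕂 M :=
  (2⁻¹ : 𝕂) • (1 + (-1 : 𝕂) ^ (a : ℕ) • s)

/-- The Koszul sign of the permutation `x_0 ⊗ ⋯ ⊗ x_{N-1} ↦ x_{τ 0} ⊗ ⋯ ⊗ x_{τ (N-1)}` of elements,
where the parity of `x_{τ i}` is `a i`. -/
def koszulSign {N : ℕ} (τ : Equiv.Perm (Fin N)) (a : Fin N → Fin 2) : 𝕂 :=
  ∏ i, ∏ j, if i < j ∧ τ j < τ i then (-1) ^ ((a i : ℕ) * (a j : ℕ)) else 1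

/-- The multilinear map `(x_0, …, x_{N-1}) ↦ ± θ(x_{τ 0}, …, x_{τ (N-1)})` with the Koszul sign. -/
def permAct (s : Module.End 𝕂 M) {N : ℕ} (τ : Equiv.Perm (Fin N))
    (θ : MultilinearMap 𝕂 (fun _ : Fin N => M) M) : MultilinearMap 𝕂 (fun _ : Fin N => M) M :=
  ∑ a : Fin N → Fin 2, (koszulSign τ a : 𝕂) •
    (θ.compLinearMap fun i => parityPart s (a i)).domDomCongr τ

/-- The insertion `f(g(x_0, …, x_q), x_{q+1}, …, x_{p+q})`. -/
def insertFirst {p q r : ℕ} (h : p + q = r) (f : MultilinearMap 𝕂 (fun _ : Fin (p + 1) => M) M)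
    (g : MultilinearMap 𝕂 (fun _ : Fin (q + 1) => M) M) :
    MultilinearMap 𝕂 (fun _ : Fin (r + 1) => M) M :=
  (f.curryLeft.compMultilinearMap g).uncurrySum.domDomCongr
    (finSumFinEquiv.trans (finCongr (show q + 1 + p = r + 1 by omega)))

theorem insertFirst_apply {p q r : ℕ} (h : p + q = r)
    (f : MultilinearMap 𝕂 (fun _ : Fin (p + 1) => M) M)
    (g : MultilinearMap 𝕂 (fun _ : Fin (q + 1) => M) M) (x : Fin (r + 1) → M) :
    insertFirst h f g x =
      f (Fin.cons (g fun i => x ⟨i, by omega⟩) fun i : Fin p => x ⟨q + 1 + i, by omega⟩) :=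
  rfl

/-- The pre-Lie (Nijenhuis–Richardson) product of cochains on the `d`-fold suspension:
`(f ∘ g)(x) = ∑_τ ± f(g(x_{τ 0}, …, x_{τ q}), x_{τ (q+1)}, …)`, the sum running over shuffles `τ`,
with sign `sgn(τ)^d` times the Koszul sign. -/
def nrProd (d : ℕ) (s : Module.End 𝕂 M) (f g : Cochain 𝕂 M) : Cochain 𝕂 M := fun r =>
  ∑ p : Fin (r + 1), ∑ τ ∈ shuffles (r - p) r,
    (((Equiv.Perm.sign τ : ℤˣ) : ℤ) : 𝕂) ^ d •
      permAct s τ (insertFirst (show (p : ℕ) + (r - p) = r by omega) (f p) (g (r - p)))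

/-- The iterated products `((id ∘ D) ∘ D) ∘ ⋯ ∘ D`, i.e. the `j`-th power of the coderivation with
components `D`, followed by the projection to cogenerators. -/
def nrPow (d : ℕ) (s : Module.End 𝕂 M) (D : Cochain 𝕂 M) : ℕ → Cochain 𝕂 M
  | 0 => fun p =>
    match p with
    | 0 => MultilinearMap.ofSubsingleton 𝕂 M M (0 : Fin 1) LinearMap.id
    | _ + 1 => 0
  | j + 1 => nrProd d s (nrPow d s D j) D

/-- The components of the exponential `exp(D) = ∑_j D^j / j!` of a coderivation. If `D` has no
component with only one argument, only the terms with `j ≤ p` contribute. -/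
def cochainExp (d : ℕ) (s : Module.End 𝕂 M) (D : Cochain 𝕂 M) : Cochain 𝕂 M := fun p =>
  ∑ᶠ j : ℕ, ((j.factorial : 𝕂)⁻¹) • nrPow d s D j p

/-- Evaluation `Û(m) = ∑_{k ≥ 1} U_k(m, …, m) / k!` on a formal power series `m` without constant
term. -/
def evalSeries {R : Type*} [Ring R] [Algebra 𝕂 R] (U : Cochain 𝕂 R) (m : PowerSeries R) :
    PowerSeries R :=
  PowerSeries.mk fun N => ∑ p ∈ Finset.range N, (((p + 1).factorial : 𝕂)⁻¹) •
    ∑ a ∈ Finset.piAntidiag (Finset.univ : Finset (Fin (p + 1))) N,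
      U p fun i => PowerSeries.coeff (a i) m

/-- The extension of a bilinear operation to formal power series. -/
def seriesBracket {R : Type*} [Ring R] [Algebra 𝕂 R] (b : R →ₗ[𝕂] R →ₗ[𝕂] R)
    (F G : PowerSeries R) : PowerSeries R :=
  PowerSeries.mk fun N => ∑ a ∈ Finset.HasAntidiagonal.antidiagonal N,
    b (PowerSeries.coeff a.1 F) (PowerSeries.coeff a.2 G)

end Cochain

section RepDescent

variable {𝕂 R : Type*} [Field 𝕂] [Semiring R] [Algebra 𝕂 R]

theorem ofFn_prod_update (c : 𝕂) {k : ℕ} (x y : Fin k → R) (e : Fin k) (he : y e = c • x e)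
    (h : ∀ i, i ≠ e → y i = x i) : (List.ofFn y).prod = c • (List.ofFn x).prod := by
  induction k with
  | zero => exact e.elim0
  | succ k ih =>
    rw [List.ofFn_succ, List.ofFn_succ, List.prod_cons, List.prod_cons]
    cases e using Fin.cases with
    | zero =>
      rw [he, smul_mul_assoc]
      rw [show (fun i : Fin k => y i.succ) = fun i => x i.succ from
        funext fun i => h _ (Fin.succ_ne_zero i)]
    | succ e =>
      rw [h 0 (Fin.succ_ne_zero e).symm,
        ih (fun i => x i.succ) (fun i => y i.succ) e he fun i hi =>
          h _ fun hh => hi (Fin.succ_injective _ hh), mul_smul_comm]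

theorem ofFn_prod_perm_sign (d : ℕ) {k : ℕ} (x : Fin k → R)
    (hx : ∀ i j, x i * x j = (-1 : 𝕂) ^ d • (x j * x i)) (σ : Equiv.Perm (Fin k)) :
    (List.ofFn (x ∘ σ)).prod =
      (((Equiv.Perm.sign σ : ℤˣ) : ℤ) : 𝕂) ^ d • (List.ofFn x).prod := by
  refine prod_ofFn_perm _ x hx (fun σ => (((Equiv.Perm.sign σ : ℤˣ) : ℤ) : 𝕂) ^ d) ?_ ?_ ?_ σ
  · simp
  · intro σ τ
    simp [mul_pow]
  · intro i j h
    simp [Equiv.Perm.sign_swap h]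

/-- A map on `Gra_d(N)` obtained from operators `E i j` attached to the edges. -/
def Gra.liftEdges {M : Type*} [AddCommGroup M] [Module 𝕂 M] (d : ℕ) {N k : ℕ}
    (E : Fin N → Fin N → R) (L : R →ₗ[𝕂] M) (hE : ∀ i j, E j i = (-1 : 𝕂) ^ d • E i j)
    (hmul : ∀ i j k l, E i j * E k l = (-1 : 𝕂) ^ (d + 1) • (E k l * E i j)) :
    Gra 𝕂 d N k →ₗ[𝕂] M :=
  Gra.lift d (fun g => L (List.ofFn fun e => E (g e).1 (g e).2).prod)
    (fun g σ => by
      rw [← map_smul, ← ofFn_prod_perm_sign (d + 1) (fun e => E (g e).1 (g e).2)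
        (fun i j => hmul _ _ _ _) σ]
      rfl)
    (fun g e => by
      rw [← map_smul, ofFn_prod_update ((-1 : 𝕂) ^ d) (fun e => E (g e).1 (g e).2) _ e ?_ ?_]
      · simp only [flipEdge, Function.update_self]
        exact hE _ _
      · intro i hi
        simp only [flipEdge, Function.update_of_ne hi])

/-- Apply an operator to `x_0 ⊗ ⋯ ⊗ x_{N-1}` and multiply the factors. -/
def opToMultilinear {𝕂 R : Type*} [Field 𝕂] [Ring R] [Algebra 𝕂 R] (N : ℕ) :
    Module.End 𝕂 (⨂[𝕂] _ : Fin N, R) →ₗ[𝕂] MultilinearMap 𝕂 (fun _ : Fin N => R) R where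
  toFun T := (PiTensorProduct.lift (MultilinearMap.mkPiAlgebraFin 𝕂 N R) ∘ₗ T).compMultilinearMap
    (PiTensorProduct.tprod 𝕂)
  map_add' S T := by ext x; simp
  map_smul' c T := by ext x; simp

/-- The multidifferential operators attached to graphs: apply the product of the operators `E i j`
over the edges (in their order) to `x_0 ⊗ ⋯ ⊗ x_{N-1}`, then multiply the factors. -/
def graphOp {𝕂 R : Type*} [Field 𝕂] [Ring R] [Algebra 𝕂 R] (d : ℕ) {N k : ℕ}
    (E : Fin N → Fin N → Module.End 𝕂 (⨂[𝕂] _ : Fin N, R))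
    (hE : ∀ i j, E j i = (-1 : 𝕂) ^ d • E i j)
    (hmul : ∀ i j k l, E i j * E k l = (-1 : 𝕂) ^ (d + 1) • (E k l * E i j)) :
    Gra 𝕂 d N k →ₗ[𝕂] MultilinearMap 𝕂 (fun _ : Fin N => R) R :=
  Gra.liftEdges d E (opToMultilinear N) hE hmul

end RepDescent

namespace NPDomain

variable {𝕂 : Type*} [RCLike 𝕂] {n : ℕ} (V : NPDomain 𝕂 n)

/-- The representation `Gra_{n+1}(N) → Hom(C^∞(V)^{⊗N}, C^∞(V))`. It sends a multidigraph to the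
multidifferential operator which applies the product of the operators `Δ_{ij}` over the edges (in
their order) to `f_1 ⊗ ⋯ ⊗ f_N` and then multiplies the factors. -/
def rep {N k : ℕ} :
    Gra 𝕂 (n + 1) N k →ₗ[𝕂] MultilinearMap 𝕂 (fun _ : Fin N => V.Fun) V.Fun :=
  graphOp (n + 1) (V.edgeOp N) (V.edgeOp_symm N) (V.edgeOp_mul N)

/-- The cochain `Rep(γ)` attached to an element of the full graph complex. In a fixed degree
only finitely many numbers `k` of edges contribute to each component. -/
def repCochain (γ : GraphSeries 𝕂 (n + 1)) : Cochain 𝕂 V.Fun := fun p =>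
  ∑ᶠ k : ℕ, V.rep (γ p k)

/-- The components of the `L_∞`-morphism `U = exp(Rep(γ))`. -/
def expRep (γ : GraphSeries 𝕂 (n + 1)) : Cochain 𝕂 V.Fun :=
  cochainExp (n + 1) V.parity (V.repCochain γ)

/-! ### Hamiltonian functions and their deformations -/

/-- Hamiltonian functions: functions `H` of degree `n + 1` with `{H, H} = 0`. -/
def Ham : Set V.Fun := {H | H ∈ V.homog (n + 1) ∧ V.bracket H H = 0}

/-- Hamiltonian deformations of `H`: formal power series `ε H + O(ε²)` with coefficients of degree
`n + 1` whose bracket with themselves vanishes. -/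
def FHam (H : V.Fun) : Set (PowerSeries V.Fun) :=
  {F | PowerSeries.coeff 0 F = 0 ∧ (∀ k, PowerSeries.coeff k F ∈ V.homog (n + 1)) ∧
    seriesBracket V.bracket F F = 0 ∧ PowerSeries.coeff 1 F = H}

/-- Gauge equivalence of formal series: `G = exp({λ, ·}) F` for some `λ ∈ ε C^∞(V)_n[[ε]]`. (In the
coefficient of `ε^N` only the first terms of the exponential series contribute.) -/
def GaugeEquiv (F G : PowerSeries V.Fun) : Prop :=
  ∃ l : PowerSeries V.Fun, PowerSeries.coeff 0 l = 0 ∧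
    (∀ k, PowerSeries.coeff k l ∈ V.homog n) ∧
    G = PowerSeries.mk fun N => ∑ k ∈ Finset.range (N + 1),
      ((k.factorial : 𝕂)⁻¹) • PowerSeries.coeff N ((seriesBracket V.bracket l)^[k] F)

end NPDomain

/-- Hamiltonian deformation maps, given simultaneously for all graded symplectic domains of
degree `n` (of arbitrary dimension). -/
abbrev HamDefMap (𝕂 : Type*) [RCLike 𝕂] (n : ℕ) : Type _ :=
  ∀ (V : NPDomain 𝕂 n) (H : V.Ham), V.FHam (H : V.Fun)

/-- A Hamiltonian deformation map is universal if it is given by graphs: there are invariant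
elements `Γ_p` of `Gra_{n+1}(p+1)`, of total degree zero and not depending on the domain, such that
`H_* = ∑_p ε^{p+1} Rep(Γ_p)(H, …, H) / (p+1)!` for every Hamiltonian function on every domain. -/
def HamDefMap.IsUniversal {𝕂 : Type*} [RCLike 𝕂] {n : ℕ} (Φ : HamDefMap 𝕂 n) : Prop :=
  ∃ Γ ∈ fGCdeg 𝕂 (n + 1) 0, ∀ (V : NPDomain 𝕂 n) (H : V.Ham) (p : ℕ),
    PowerSeries.coeff (p + 1) (Φ V H : PowerSeries V.Fun) =
      (((p + 1).factorial : 𝕂)⁻¹) • V.repCochain Γ p fun _ => (H : V.Fun)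

end GraphHam

end

set_option linter.unusedSectionVars false

noncomputable section

namespace GraphHam

/-! ### Poisson superalgebras with constant bivector -/

/-! After suspension the functions of degree n + 1 are even, and a graph series γ of degree 0 acts
on them as a formal vector field M ↦ Σ_p γ_p(M,…,M)/(p+1)!. Insertion of graphs becomes insertion of
multidifferential operators (`rep_comp`, a consequence of the Leibniz rule), so the pre-Lie product
of graphs becomes differentiation of one vector field along another (`cochain_preLie`,
`hat_preLie`). A cocycle γ therefore gives a vector field commuting with M ↦ {M,M}/2
(`bracket_hat`). A coboundary δη gives, at solutions of {M,M} = 0, the field M ↦ {η(M), M}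
(`hat_graphDiff`).

The series attached to H is the time-one flow of the field of γ, started at εH. Writing M = εm, the
field becomes `hat γ`. A cocycle of degree 0 has no one-vertex component (`cocycle_zero`), so `hat
γ` is divisible by ε; flows then exist, are unique, and are polynomial in time in every order of ε
(`exists_solution`, `solution_unique`). Along the flow {m,m} satisfies a linear homogeneous equation
with zero initial value, hence stays zero (`flow_bracket`). The Taylor expansion at time one is a
sum over iterated pre-Lie powers of γ (`flow_eval_one`). This is the exponential of the
coderivation, and it also displays the graphs of the universal formula.

For γ' = γ + δη let m(t,s) be the flow in t of γ + sδη. Both ∂_s m and ε{l,m} solve the linearised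
flow equation with the same source when l solves the linearised flow with source η(m); hence ∂_s m =
ε{l,m} (`flow_variation`). At t = 1 this is a Hamiltonian path in s from one deformation to the
other. A Magnus-type equation, again contracting in ε, rewrites the path as exp(ε ad_L)
(`exists_magnus`, `exists_exponential`), which is the gauge equivalence.

Everything is done in abstract Poisson superalgebras, so that the same graphs act on functions, on
polynomials in a time variable, on power series in ε, and on the extension by an odd variable θ;
naturality (`Hom.map_rep`) compares these actions. The odd variable linearises the cocycle identity
in a direction l of the opposite parity using only its restriction to even arguments
(`cocycle_mixed`), so that Koszul signs of mixed arguments need not be tracked. -/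

/-- Degrees of the coordinates and a constant bivector `w A B ∂_A ∂_B` of degree `-n`. -/
structure Signature (𝕂 : Type*) [Field 𝕂] (n : ℕ) where
  size : ℕ
  deg : Fin size → ℕ
  w : Fin size → Fin size → 𝕂
  w_deg : ∀ A B, w A B ≠ 0 → deg A + deg B = n
  w_symm : ∀ A B, w B A = -(-1) ^ (n + deg A * deg B) * w A B

/-- A graded commutative algebra with commuting graded derivations `pd A` of degree `-deg A`. The
parity involution is `par`; graded commutativity is stated without reference to homogeneous
elements. -/
structure PoissonSuperalgebra {𝕂 : Type*} [Field 𝕂] {n : ℕ} (sg : Signature 𝕂 n) (R : Type*)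
    [Ring R] [Algebra 𝕂 R] where
  par : Module.End 𝕂 R
  pd : Fin sg.size → Module.End 𝕂 R
  homog : ℤ → Submodule 𝕂 R
  par_one : par 1 = 1
  par_mul : ∀ x y, par (x * y) = par x * par y
  par_par : ∀ x, par (par x) = x
  pd_par : ∀ A, pd A * par = (-1 : 𝕂) ^ sg.deg A • (par * pd A)
  pd_pd : ∀ A B, pd A * pd B = (-1 : 𝕂) ^ (sg.deg A * sg.deg B) • (pd B * pd A)
  pd_mul : ∀ A x y, pd A (x * y) = pd A x * y + (par ^ sg.deg A) x * pd A y
  -- If s and t are the parity signs of homogeneous x and y, then 1 + s + t - st equals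
  -- 2(-1)^{|x||y|}. This expresses graded commutativity linearly, also on inhomogeneous elements,
  -- at the cost of a factor 2.
  supercomm : ∀ x y, (2 : 𝕂) • (x * y) = y * x + y * par x + par y * x - par y * par x
  one_mem : 1 ∈ homog 0
  mul_mem : ∀ {k l x y}, x ∈ homog k → y ∈ homog l → x * y ∈ homog (k + l)
  par_of_mem : ∀ {k x}, x ∈ homog k → par x = (-1 : 𝕂) ^ k • x
  pd_mem : ∀ {A k x}, x ∈ homog k → pd A x ∈ homog (k - sg.deg A)

section SlotOp

variable {𝕂 M : Type*} [CommRing 𝕂] [AddCommGroup M] [Module 𝕂 M]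

/-- The tuple underlying `slotOp`. -/
def slotTuple {N : ℕ} (i : Fin N) (P D : Module.End 𝕂 M) (x : Fin N → M) : Fin N → M :=
  fun l => if l < i then P (x l) else if l = i then D (x l) else x l

theorem slotOp_tprod {N : ℕ} (i : Fin N) (P D : Module.End 𝕂 M) (x : Fin N → M) :
    slotOp i P D (PiTensorProduct.tprod 𝕂 x) = PiTensorProduct.tprod 𝕂 (slotTuple i P D x) := by
  rw [slotOp, PiTensorProduct.map_tprod]
  congr 1
  funext l
  unfold slotTuple
  split_ifs <;> rfl

end SlotOp

namespace PoissonSuperalgebra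

variable {𝕂 : Type*} [Field 𝕂] {n : ℕ} {sg : Signature 𝕂 n}
  {R : Type*} [Ring R] [Algebra 𝕂 R] (S : PoissonSuperalgebra sg R)
  {R' : Type*} [Ring R'] [Algebra 𝕂 R'] (S' : PoissonSuperalgebra sg R')

theorem par_sq : S.par * S.par = 1 := LinearMap.ext S.par_par

theorem par_pow_one (k : ℕ) : (S.par ^ k) 1 = 1 := by
  induction k with
  | zero => rfl
  | succ k ih => rw [pow_succ, Module.End.mul_apply, S.par_one, ih]

theorem par_pow_mul (k : ℕ) (x y : R) : (S.par ^ k) (x * y) = (S.par ^ k) x * (S.par ^ k) y := by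
  induction k generalizing x y with
  | zero => rfl
  | succ k ih => simp only [pow_succ, Module.End.mul_apply, S.par_mul, ih]

theorem pd_one (A : Fin sg.size) : S.pd A 1 = 0 := by
  have h := S.pd_mul A 1 1
  rw [mul_one, mul_one, S.par_pow_one, one_mul] at h
  simpa using h

theorem pd_mul_par_pow (A : Fin sg.size) (k : ℕ) :
    S.pd A * S.par ^ k = (-1 : 𝕂) ^ (sg.deg A * k) • (S.par ^ k * S.pd A) := by
  induction k with
  | zero => simp
  | succ k ih =>
    rw [pow_succ, ← mul_assoc, ih, smul_mul_assoc, mul_assoc, S.pd_par, mul_smul_comm, smul_smul,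
      ← mul_assoc, ← pow_add, Nat.mul_succ]

/-- The Poisson bracket. -/
def bracket : R →ₗ[𝕂] R →ₗ[𝕂] R :=
  ∑ A, ∑ B, sg.w A B • (LinearMap.mul 𝕂 R).compl₁₂ (S.pd A * S.par ^ sg.deg B) (S.pd B)

/-- The derivative `∂_A` on the factor `i`. -/
def slotPd (N : ℕ) (i : Fin N) (A : Fin sg.size) : Module.End 𝕂 (⨂[𝕂] _ : Fin N, R) :=
  slotOp i (S.par ^ sg.deg A) (S.pd A)

/-- The operator attached to an edge. -/
def edgeOp (N : ℕ) (i j : Fin N) : Module.End 𝕂 (⨂[𝕂] _ : Fin N, R) :=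
  ∑ A, ∑ B, sg.w A B • (S.slotPd N i A * S.slotPd N j B)

theorem slotPd_mul (N : ℕ) (i j : Fin N) (A B : Fin sg.size) :
    S.slotPd N i A * S.slotPd N j B =
      (-1 : 𝕂) ^ (sg.deg A * sg.deg B) • (S.slotPd N j B * S.slotPd N i A) := by
  refine slotOp_mul i j _ _ _ _ _ ?_ ?_ (S.pd_mul_par_pow A _) ?_ (S.pd_pd A B)
  · rw [← pow_add, Even.neg_one_pow ⟨_, rfl⟩]
  · rw [← pow_add, ← pow_add, add_comm]
  · rw [mul_comm]
    exact S.pd_mul_par_pow B _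

theorem edgeOp_symm (N : ℕ) (i j : Fin N) :
    S.edgeOp N j i = (-1 : 𝕂) ^ (n + 1) • S.edgeOp N i j :=
  bivector_symm n sg.deg sg.w sg.w_symm _ _ (S.slotPd_mul N j i)

theorem edgeOp_mul (N : ℕ) (i j k l : Fin N) :
    S.edgeOp N i j * S.edgeOp N k l =
      (-1 : 𝕂) ^ (n + 1 + 1) • (S.edgeOp N k l * S.edgeOp N i j) :=
  bivector_mul n sg.deg sg.w sg.w_deg _ _ _ _ (S.slotPd_mul N i k) (S.slotPd_mul N i l)
    (S.slotPd_mul N j k) (S.slotPd_mul N j l)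

/-- The action of graphs by multidifferential operators. -/
def rep {N k : ℕ} : Gra 𝕂 (n + 1) N k →ₗ[𝕂] MultilinearMap 𝕂 (fun _ : Fin N => R) R :=
  graphOp (n + 1) (S.edgeOp N) (S.edgeOp_symm N) (S.edgeOp_mul N)

/-- The product of the operators attached to the edges of a multidigraph. -/
def edgeProd {N k : ℕ} (g : MDigraph N k) : Module.End 𝕂 (⨂[𝕂] _ : Fin N, R) :=
  (List.ofFn fun e => S.edgeOp N (g e).1 (g e).2).prod

variable (𝕂 R) in
/-- Multiplication of the tensor factors. -/
def mulAll (N : ℕ) : (⨂[𝕂] _ : Fin N, R) →ₗ[𝕂] R :=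
  PiTensorProduct.lift (MultilinearMap.mkPiAlgebraFin 𝕂 N R)

theorem mulAll_tprod {N : ℕ} (x : Fin N → R) :
    mulAll 𝕂 R N (PiTensorProduct.tprod 𝕂 x) = (List.ofFn x).prod := by
  simp [mulAll]

theorem rep_mk {N k : ℕ} (g : MDigraph N k) (x : Fin N → R) :
    S.rep (Gra.mk (n + 1) g) x = mulAll 𝕂 R N (S.edgeProd g (PiTensorProduct.tprod 𝕂 x)) := by
  rw [rep, graphOp, Gra.liftEdges, Gra.lift_mk]
  rfl

/-- A nonzero coefficient `w A B` forces deg A + deg B = n, so the signs picked up by the two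
derivatives of an edge combine to (-1)^{en}, whatever the coordinates are. -/
theorem edgeOp_transport {N N' : ℕ} (f : Fin N → Fin N') (e : ℕ)
    (Z : (⨂[𝕂] _ : Fin N, R) →ₗ[𝕂] ⨂[𝕂] _ : Fin N', R')
    (hZ : ∀ i A x, Z (S.slotPd N i A x) = (-1 : 𝕂) ^ (e * sg.deg A) • S'.slotPd N' (f i) A (Z x))
    (i j : Fin N) (x) :
    Z (S.edgeOp N i j x) = (-1 : 𝕂) ^ (e * n) • S'.edgeOp N' (f i) (f j) (Z x) := by
  simp only [edgeOp, LinearMap.sum_apply, LinearMap.smul_apply, map_sum, map_smul,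
    Module.End.mul_apply, hZ, Finset.smul_sum]
  refine Finset.sum_congr rfl fun A _ => Finset.sum_congr rfl fun B _ => ?_
  by_cases h : sg.w A B = 0
  · simp [h]
  · rw [smul_smul, smul_smul, smul_smul, mul_assoc, ← pow_add, ← mul_add, sg.w_deg A B h, mul_comm]

/-- Reduces compatibilities of the graph action to single derivatives. In the applications Z is a
homomorphism applied to all slots, a constant or derivation acting on one slot, an exchange of
adjacent slots, or the inclusion of the first slots. -/
theorem edgeProd_transport {N N' : ℕ} (f : Fin N → Fin N') (e : ℕ)
    (Z : (⨂[𝕂] _ : Fin N, R) →ₗ[𝕂] ⨂[𝕂] _ : Fin N', R')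
    (hZ : ∀ i A x, Z (S.slotPd N i A x) = (-1 : 𝕂) ^ (e * sg.deg A) • S'.slotPd N' (f i) A (Z x))
    {k : ℕ} (g : MDigraph N k) (x) :
    Z (S.edgeProd g x) = (-1 : 𝕂) ^ (e * n * k) • S'.edgeProd (Prod.map f f ∘ g) (Z x) := by
  unfold edgeProd
  induction k with
  | zero => simp
  | succ k ih =>
    rw [List.ofFn_succ, List.ofFn_succ, List.prod_cons, List.prod_cons, Module.End.mul_apply,
      Module.End.mul_apply, S.edgeOp_transport S' f e Z hZ]
    have := ih (fun i => g i.succ)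
    rw [this, map_smul, smul_smul, ← pow_add, Nat.mul_succ, add_comm]
    rfl

/-! ### Naturality -/

/-- Homomorphisms of Poisson superalgebras. -/
structure Hom where
  toFun : R →ₗ[𝕂] R'
  map_one : toFun 1 = 1
  map_mul : ∀ x y, toFun (x * y) = toFun x * toFun y
  map_par : ∀ x, toFun (S.par x) = S'.par (toFun x)
  map_pd : ∀ A x, toFun (S.pd A x) = S'.pd A (toFun x)

variable {S S'} in
theorem Hom.map_par_pow (φ : Hom S S') (k : ℕ) (x : R) :
    φ.toFun ((S.par ^ k) x) = (S'.par ^ k) (φ.toFun x) := by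
  induction k generalizing x with
  | zero => rfl
  | succ k ih => rw [pow_succ, Module.End.mul_apply, ih, φ.map_par, pow_succ, Module.End.mul_apply]

variable {S S'} in
theorem Hom.map_prod (φ : Hom S S') (l : List R) : φ.toFun l.prod = (l.map φ.toFun).prod := by
  induction l with
  | nil => exact φ.map_one
  | cons a l ih => rw [List.prod_cons, φ.map_mul, ih, List.map_cons, List.prod_cons]

variable {S S'} in
theorem Hom.map_bracket (φ : Hom S S') (x y : R) :
    φ.toFun (S.bracket x y) = S'.bracket (φ.toFun x) (φ.toFun y) := by
  simp [bracket, φ.map_mul, φ.map_pd, φ.map_par_pow]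

variable {S S'} in
theorem Hom.map_rep (φ : Hom S S') {N k : ℕ} (g : Gra 𝕂 (n + 1) N k) (x : Fin N → R) :
    φ.toFun (S.rep g x) = S'.rep g (fun i => φ.toFun (x i)) := by
  let L : Gra 𝕂 (n + 1) N k →ₗ[𝕂] MultilinearMap 𝕂 (fun _ : Fin N => R) R' :=
    (LinearMap.compMultilinearMapₗ 𝕂 φ.toFun) ∘ₗ S.rep
  let L' : Gra 𝕂 (n + 1) N k →ₗ[𝕂] MultilinearMap 𝕂 (fun _ : Fin N => R) R' :=
    (MultilinearMap.compLinearMapₗ fun _ => φ.toFun) ∘ₗ S'.rep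
  suffices h : L = L' from congrArg (fun l => l g x) h
  refine Gra.hom_ext fun g => MultilinearMap.ext fun x => ?_
  change φ.toFun (S.rep _ x) = S'.rep _ fun i => φ.toFun (x i)
  rw [rep_mk, rep_mk]
  -- The map induced on tensor powers intertwines all slot derivatives without sign, so the
  -- transport applies with e = 0 and f = id; it also respects the final multiplication.
  let Z : (⨂[𝕂] _ : Fin N, R) →ₗ[𝕂] ⨂[𝕂] _ : Fin N, R' := PiTensorProduct.map fun _ => φ.toFun
  have hZ : ∀ i A y, Z (S.slotPd N i A y) =
      (-1 : 𝕂) ^ (0 * sg.deg A) • S'.slotPd N (id i) A (Z y) := by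
    intro i A y
    rw [zero_mul, pow_zero, one_smul]
    induction y using PiTensorProduct.induction_on with
    | smul_tprod r y =>
      simp only [map_smul, slotPd, slotOp_tprod, Z, PiTensorProduct.map_tprod]
      congr 2
      funext l
      unfold slotTuple
      simp only [id]
      split_ifs
      · exact φ.map_par_pow _ _
      · exact φ.map_pd _ _
      · rfl
    | add x y hx hy => simp only [map_add, hx, hy]
  have h1 := S.edgeProd_transport S' id 0 Z hZ g (PiTensorProduct.tprod 𝕂 x)
  have h2 : ∀ y, φ.toFun (mulAll 𝕂 R N y) = mulAll 𝕂 R' N (Z y) := by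
    intro y
    induction y using PiTensorProduct.induction_on with
    | smul_tprod r y =>
      simp only [map_smul, mulAll_tprod, Z, PiTensorProduct.map_tprod, φ.map_prod, List.map_ofFn]
      rfl
    | add x y hx hy => simp only [map_add, hx, hy]
  rw [h2, h1]
  simp [Z, PiTensorProduct.map_tprod]

end PoissonSuperalgebra

theorem Gra.induction_on {𝕂 : Type*} [Field 𝕂] {d N k : ℕ} {P : Gra 𝕂 d N k → Prop}
    (x : Gra 𝕂 d N k) (mk : ∀ g, P (Gra.mk d g)) (zero : P 0) (add : ∀ x y, P x → P y → P (x + y))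
    (smul : ∀ (c : 𝕂) x, P x → P (c • x)) : P x := by
  obtain ⟨y, rfl⟩ := Submodule.Quotient.mk_surjective _ x
  induction y using Finsupp.induction_linear with
  | zero => exact zero
  | add f g hf hg => exact add _ _ hf hg
  | single g c =>
    have := smul c _ (mk g)
    rw [Gra.mk, ← map_smul, Finsupp.smul_single, smul_eq_mul, mul_one] at this
    exact this

namespace PoissonSuperalgebra

variable {𝕂 : Type*} [Field 𝕂] {n : ℕ} {sg : Signature 𝕂 n}
  {R : Type*} [Ring R] [Algebra 𝕂 R] (S : PoissonSuperalgebra sg R)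

/-! ### Operators commuting with the structure -/

/-- `φ` behaves as multiplication by a constant of parity `e`. -/
structure SuperCommutes (e : ℕ) (φ : Module.End 𝕂 R) : Prop where
  par : φ * S.par = (-1 : 𝕂) ^ e • (S.par * φ)
  pd : ∀ A, φ * S.pd A = (-1 : 𝕂) ^ (e * sg.deg A) • (S.pd A * φ)

variable {S} in
theorem SuperCommutes.par_pow {e : ℕ} {φ : Module.End 𝕂 R} (h : S.SuperCommutes e φ) (a : ℕ) :
    φ * S.par ^ a = (-1 : 𝕂) ^ (e * a) • (S.par ^ a * φ) := by
  induction a with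
  | zero => simp
  | succ k ih =>
    rw [pow_succ, ← mul_assoc, ih, smul_mul_assoc, mul_assoc, h.par, mul_smul_comm, smul_smul,
      ← mul_assoc, ← pow_add, Nat.mul_succ]

-- `slotOp_mul` also covers the case in which φ and the derivative occupy the same slot. Hence an
-- operator of parity e crosses k edges, each of degree -n, at the cost (-1)^{enk}.
variable {S} in
theorem SuperCommutes.edgeProd {e : ℕ} {φ : Module.End 𝕂 R} (h : S.SuperCommutes e φ)
    {N k : ℕ} (i : Fin N) (g : MDigraph N k) (x) :
    slotOp i (S.par ^ e) φ (S.edgeProd g x) =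
      (-1 : 𝕂) ^ (e * n * k) • S.edgeProd g (slotOp i (S.par ^ e) φ x) := by
  refine (S.edgeProd_transport S id e (slotOp i (S.par ^ e) φ) (fun j A y => ?_) g x).trans ?_
  · have := slotOp_mul (𝕂 := 𝕂) i j (S.par ^ e) φ (S.par ^ sg.deg A) (S.pd A)
      ((-1 : 𝕂) ^ (e * sg.deg A)) (by rw [← pow_add, Even.neg_one_pow ⟨_, rfl⟩])
      (by rw [← pow_add, ← pow_add, add_comm]) (h.par_pow _)
      (by rw [mul_comm e]; exact S.pd_mul_par_pow A e) (h.pd A)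
    exact congrArg (fun T => T y) this
  · rfl

theorem slotTuple_one {N : ℕ} (i : Fin N) (φ : Module.End 𝕂 R) (x : Fin N → R) :
    slotTuple i 1 φ x = Function.update x i (φ (x i)) := by
  funext l
  unfold slotTuple
  by_cases h : l = i
  · subst h; simp
  · simp [h]

theorem slotTuple_zero {N : ℕ} (P φ : Module.End 𝕂 R) (x : Fin (N + 1) → R) :
    slotTuple 0 P φ x = Fin.cons (φ (x 0)) (Fin.tail x) := by
  funext l
  unfold slotTuple
  cases l using Fin.cases with
  | zero => simp
  | succ l => simp [Fin.tail]

theorem update_succ {α : Type*} {N : ℕ} (x : Fin (N + 1) → α) (i : Fin N) (a : α) :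
    (fun l : Fin N => Function.update x i.succ a l.succ) =
      Function.update (fun l : Fin N => x l.succ) i a :=
  Function.update_comp_eq_of_injective x (Fin.succ_injective N) i a

theorem prod_ofFn_update_of_bimodule {R : Type*} [Monoid R] (φ : R → R)
    (hl : ∀ x y, φ (x * y) = φ x * y) (hr : ∀ x y, φ (x * y) = x * φ y) {N : ℕ}
    (i : Fin N) (x : Fin N → R) :
    (List.ofFn (Function.update x i (φ (x i)))).prod = φ (List.ofFn x).prod := by
  induction N with
  | zero => exact i.elim0
  | succ N ih =>
    rw [List.ofFn_succ, List.ofFn_succ, List.prod_cons, List.prod_cons]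
    cases i using Fin.cases with
    | zero =>
      rw [hl]
      simp [Fin.succ_ne_zero]
    | succ i =>
      rw [hr, ← ih i (fun l => x l.succ), ← update_succ]
      simp [(Fin.succ_ne_zero i).symm]

/-- Constant scalars can be taken out of any argument. -/
theorem rep_update {φ : Module.End 𝕂 R} (h : S.SuperCommutes 0 φ)
    (hl : ∀ x y, φ (x * y) = φ x * y) (hr : ∀ x y, φ (x * y) = x * φ y) {N k : ℕ}
    (g : Gra 𝕂 (n + 1) N k) (x : Fin N → R) (i : Fin N) :
    S.rep g (Function.update x i (φ (x i))) = φ (S.rep g x) := by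
  induction g using Gra.induction_on with
  | mk g =>
    rw [rep_mk, rep_mk, ← slotTuple_one, ← slotOp_tprod]
    have := h.edgeProd i g (PiTensorProduct.tprod 𝕂 x)
    rw [pow_zero, zero_mul, zero_mul, pow_zero, one_smul] at this
    rw [← this]
    generalize S.edgeProd g (PiTensorProduct.tprod 𝕂 x) = y
    induction y using PiTensorProduct.induction_on with
    | smul_tprod r y =>
      rw [map_smul, map_smul, map_smul, map_smul, slotOp_tprod, slotTuple_one, mulAll_tprod,
        mulAll_tprod, prod_ofFn_update_of_bimodule φ hl hr]
    | add x y hx hy => rw [map_add, map_add, map_add, map_add, hx, hy]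
  | zero => simp
  | add g g' hg hg' => simp only [map_add, add_apply, hg, hg']
  | smul c g hg => simp only [map_smul, smul_apply, hg]

/-- Constants of parity `e` can be taken out of the first argument. -/
theorem rep_cons {e : ℕ} {φ : Module.End 𝕂 R} (h : S.SuperCommutes e φ)
    (hl : ∀ x y, φ (x * y) = φ x * y) {N k : ℕ}
    (g : Gra 𝕂 (n + 1) (N + 1) k) (y : R) (x : Fin N → R) :
    S.rep g (Fin.cons (φ y) x) = (-1 : 𝕂) ^ (e * n * k) • φ (S.rep g (Fin.cons y x)) := by
  induction g using Gra.induction_on with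
  | mk g =>
    rw [rep_mk, rep_mk]
    have h0 : Fin.cons (φ y) x = slotTuple 0 (S.par ^ e) φ (Fin.cons y x : Fin (N + 1) → R) := by
      rw [slotTuple_zero]; simp
    rw [h0, ← slotOp_tprod]
    have := h.edgeProd 0 g (PiTensorProduct.tprod 𝕂 (Fin.cons y x))
    have h2 : S.edgeProd g (slotOp 0 (S.par ^ e) φ (PiTensorProduct.tprod 𝕂 (Fin.cons y x))) =
        (-1 : 𝕂) ^ (e * n * k) • slotOp 0 (S.par ^ e) φ
          (S.edgeProd g (PiTensorProduct.tprod 𝕂 (Fin.cons y x))) := by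
      rw [this, smul_smul, ← pow_add, Even.neg_one_pow ⟨_, rfl⟩, one_smul]
    rw [h2, map_smul]
    congr 1
    generalize S.edgeProd g (PiTensorProduct.tprod 𝕂 (Fin.cons y x)) = z
    induction z using PiTensorProduct.induction_on with
    | smul_tprod r y =>
      rw [map_smul, map_smul, map_smul, map_smul, slotOp_tprod, slotTuple_zero, mulAll_tprod,
        mulAll_tprod, List.ofFn_succ, List.ofFn_succ, List.prod_cons, List.prod_cons, hl]
      rfl
    | add x y hx hy => rw [map_add, map_add, map_add, map_add, hx, hy]
  | zero => simp
  | add g g' hg hg' => simp only [map_add, add_apply, hg, hg', smul_add]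
  | smul c g hg => rw [map_smul, smul_apply, smul_apply, hg, map_smul,
      smul_comm]

theorem derivation_prod_ofFn (φ : Module.End 𝕂 R) (h1 : φ 1 = 0)
    (hφ : ∀ x y, φ (x * y) = φ x * y + x * φ y) {N : ℕ} (x : Fin N → R) :
    φ (List.ofFn x).prod = ∑ i, (List.ofFn (Function.update x i (φ (x i)))).prod := by
  induction N with
  | zero => simpa using h1
  | succ N ih =>
    rw [List.ofFn_succ, List.prod_cons, hφ, ih, Fin.sum_univ_succ]
    congr 1
    · rw [List.ofFn_succ, List.prod_cons]
      simp [Fin.succ_ne_zero]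
    · rw [Finset.mul_sum]
      refine Finset.sum_congr rfl fun i _ => ?_
      rw [List.ofFn_succ, List.prod_cons]
      rw [← update_succ]
      simp [(Fin.succ_ne_zero i).symm]

/-- Derivations with respect to a parameter act on the arguments one at a time. -/
theorem derivation_rep {φ : Module.End 𝕂 R} (h : S.SuperCommutes 0 φ)
    (hφ : ∀ x y, φ (x * y) = φ x * y + x * φ y) {N k : ℕ}
    (g : Gra 𝕂 (n + 1) N k) (x : Fin N → R) :
    φ (S.rep g x) = ∑ i, S.rep g (Function.update x i (φ (x i))) := by
  have h1 : φ 1 = 0 := by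
    have := hφ 1 1
    simpa using this
  induction g using Gra.induction_on with
  | mk g =>
    have key : ∀ i, S.rep (Gra.mk (n + 1) g) (Function.update x i (φ (x i))) =
        mulAll 𝕂 R N (slotOp i 1 φ (S.edgeProd g (PiTensorProduct.tprod 𝕂 x))) := by
      intro i
      rw [rep_mk, ← slotTuple_one, ← slotOp_tprod]
      have := h.edgeProd i g (PiTensorProduct.tprod 𝕂 x)
      rw [pow_zero, zero_mul, zero_mul, pow_zero, one_smul] at this
      rw [← this]
    simp only [key]
    rw [rep_mk]
    generalize S.edgeProd g (PiTensorProduct.tprod 𝕂 x) = y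
    induction y using PiTensorProduct.induction_on with
    | smul_tprod r y =>
      simp only [map_smul, slotOp_tprod, slotTuple_one, mulAll_tprod]
      rw [derivation_prod_ofFn φ h1 hφ, Finset.smul_sum]
    | add x y hx hy => simp only [map_add, hx, hy, Finset.sum_add_distrib]
  | zero => simp
  | add g g' hg hg' => simp only [map_add, add_apply, hg, hg', Finset.sum_add_distrib]
  | smul c g hg => simp only [map_smul, smul_apply, hg, Finset.smul_sum]

/-! ### Degrees -/

/-- Tensors of total degree `k`. -/
def tensorHomog (N : ℕ) (k : ℤ) : Submodule 𝕂 (⨂[𝕂] _ : Fin N, R) :=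
  Submodule.span 𝕂 {y | ∃ (c : Fin N → ℤ) (x : Fin N → R),
    (∀ i, x i ∈ S.homog (c i)) ∧ ∑ i, c i = k ∧ y = PiTensorProduct.tprod 𝕂 x}

theorem par_mem {k : ℤ} {x : R} (hx : x ∈ S.homog k) : S.par x ∈ S.homog k := by
  rw [S.par_of_mem hx]
  exact Submodule.smul_mem _ _ hx

theorem par_pow_mem {k : ℤ} {x : R} (hx : x ∈ S.homog k) (a : ℕ) : (S.par ^ a) x ∈ S.homog k := by
  induction a generalizing x with
  | zero => exact hx
  | succ a ih => rw [pow_succ]; exact ih (S.par_mem hx)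

theorem slotPd_mem {N : ℕ} {k l : ℤ} (i : Fin N) (A : Fin sg.size) (hl : l = k - sg.deg A) {y}
    (hy : y ∈ S.tensorHomog N k) : S.slotPd N i A y ∈ S.tensorHomog N l := by
  induction hy using Submodule.span_induction with
  | mem y hy =>
    obtain ⟨c, x, hx, hc, rfl⟩ := hy
    rw [slotPd, slotOp_tprod]
    refine Submodule.subset_span ⟨fun j => if j = i then c j - sg.deg A else c j, _, ?_, ?_, rfl⟩
    · intro j
      unfold slotTuple
      by_cases h : j = i
      · subst h
        simpa using S.pd_mem (hx j)
      · simp only [if_neg h]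
        split_ifs
        · exact S.par_pow_mem (hx j) _
        · exact hx j
    · rw [hl, ← hc]
      have : ∀ j, (if j = i then c j - sg.deg A else c j) =
          c j - if j = i then (sg.deg A : ℤ) else 0 := by
        intro j; split_ifs <;> simp
      simp [this, Finset.sum_sub_distrib]
  | zero => rw [map_zero]; exact zero_mem _
  | add x y _ _ hx hy => rw [map_add]; exact add_mem hx hy
  | smul c x _ hx => rw [map_smul]; exact Submodule.smul_mem _ _ hx

theorem edgeOp_mem {N : ℕ} {k : ℤ} (i j : Fin N) {y}
    (hy : y ∈ S.tensorHomog N k) : S.edgeOp N i j y ∈ S.tensorHomog N (k - n) := by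
  simp only [edgeOp, LinearMap.sum_apply, LinearMap.smul_apply, Module.End.mul_apply]
  refine sum_mem fun A _ => sum_mem fun B _ => ?_
  by_cases h : sg.w A B = 0
  · rw [h, zero_smul]; exact zero_mem _
  · refine Submodule.smul_mem _ _ (S.slotPd_mem i A ?_ (S.slotPd_mem j B rfl hy))
    have := sg.w_deg A B h
    omega

theorem edgeProd_mem {N K : ℕ} {k : ℤ} (g : MDigraph N K) {y}
    (hy : y ∈ S.tensorHomog N k) : S.edgeProd g y ∈ S.tensorHomog N (k - n * K) := by
  unfold edgeProd
  induction K with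
  | zero => simpa using hy
  | succ K ih =>
    rw [List.ofFn_succ, List.prod_cons, Module.End.mul_apply]
    have := S.edgeOp_mem (g 0).1 (g 0).2 (ih fun i => g i.succ)
    convert this using 2
    push_cast
    ring

theorem prod_ofFn_mem {N : ℕ} (c : Fin N → ℤ) (x : Fin N → R) (hx : ∀ i, x i ∈ S.homog (c i)) :
    (List.ofFn x).prod ∈ S.homog (∑ i, c i) := by
  induction N with
  | zero => simpa using S.one_mem
  | succ N ih =>
    rw [List.ofFn_succ, List.prod_cons, Fin.sum_univ_succ]
    exact S.mul_mem (hx 0) (ih _ _ fun i => hx i.succ)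

theorem mulAll_mem {N : ℕ} {k : ℤ} {y} (hy : y ∈ S.tensorHomog N k) :
    mulAll 𝕂 R N y ∈ S.homog k := by
  induction hy using Submodule.span_induction with
  | mem y hy =>
    obtain ⟨c, x, hx, rfl, rfl⟩ := hy
    rw [mulAll_tprod]
    exact S.prod_ofFn_mem c x hx
  | zero => rw [map_zero]; exact zero_mem _
  | add x y _ _ hx hy => rw [map_add]; exact add_mem hx hy
  | smul c x _ hx => rw [map_smul]; exact Submodule.smul_mem _ _ hx

/-- Each edge applies two derivatives of total degree -n, and the final multiplication preserves the
degree. -/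
theorem rep_mem {N K : ℕ} (g : Gra 𝕂 (n + 1) N K) (c : Fin N → ℤ) (x : Fin N → R)
    (hx : ∀ i, x i ∈ S.homog (c i)) : S.rep g x ∈ S.homog (∑ i, c i - n * K) := by
  induction g using Gra.induction_on with
  | mk g =>
    rw [rep_mk]
    exact S.mulAll_mem (S.edgeProd_mem g (Submodule.subset_span ⟨c, x, hx, rfl, rfl⟩))
  | zero => rw [map_zero]; exact zero_mem _
  | add g g' hg hg' => rw [map_add]; exact add_mem hg hg'
  | smul c g hg => rw [map_smul]; exact Submodule.smul_mem _ _ hg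

theorem bracket_mem {k l : ℤ} {x y : R} (hx : x ∈ S.homog k) (hy : y ∈ S.homog l) :
    S.bracket x y ∈ S.homog (k + l - n) := by
  simp only [bracket, LinearMap.sum_apply, LinearMap.smul_apply, LinearMap.compl₁₂_apply,
    LinearMap.mul_apply', Module.End.mul_apply]
  refine sum_mem fun A _ => sum_mem fun B _ => ?_
  by_cases h : sg.w A B = 0
  · rw [h, zero_smul]; exact zero_mem _
  · have := S.mul_mem (S.pd_mem (A := A) (S.par_pow_mem hx (sg.deg B))) (S.pd_mem (A := B) hy)
    have h2 := sg.w_deg A B h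
    have h3 : k + l - n = k - sg.deg A + (l - sg.deg B) := by omega
    rw [h3]
    exact Submodule.smul_mem _ _ this

end PoissonSuperalgebra

namespace PoissonSuperalgebra

variable {𝕂 : Type*} [Field 𝕂] {n : ℕ} {sg : Signature 𝕂 n}
  {R : Type*} [Ring R] [Algebra 𝕂 R] (S : PoissonSuperalgebra sg R)

/-! ### Equivariance -/

/-- The parity involution on the factor `i`. -/
def slotPar {N : ℕ} (i : Fin N) : Module.End 𝕂 (⨂[𝕂] _ : Fin N, R) :=
  PiTensorProduct.map (Pi.mulSingle i S.par)

theorem slotPar_mul_map {N : ℕ} (i : Fin N) (f : Fin N → Module.End 𝕂 R) (c : 𝕂)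
    (h : S.par * f i = c • (f i * S.par)) :
    S.slotPar i * PiTensorProduct.map f = c • (PiTensorProduct.map f * S.slotPar i) := by
  rw [slotPar, ← PiTensorProduct.map_mul, ← PiTensorProduct.map_mul]
  refine map_eq_smul i ?_ fun l hl => ?_
  · simpa using h
  · simp [hl]

theorem slotPar_sq {N : ℕ} (i : Fin N) : S.slotPar i * S.slotPar i = 1 := by
  rw [slotPar, ← PiTensorProduct.map_mul, ← PiTensorProduct.map_one]
  congr 1
  funext l
  by_cases h : l = i
  · subst h; simp [S.par_sq]
  · simp [h]

theorem slotPar_comm {N : ℕ} (i j : Fin N) :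
    S.slotPar i * S.slotPar j = S.slotPar j * S.slotPar i := by
  have := S.slotPar_mul_map i (Pi.mulSingle j S.par) 1 (by
    by_cases h : i = j
    · subst h; simp
    · simp [h])
  rwa [one_smul] at this

theorem slotPar_pow {N : ℕ} (i : Fin N) (a : ℕ) :
    S.slotPar i ^ a = PiTensorProduct.map (Pi.mulSingle i (S.par ^ a)) := by
  rw [slotPar, ← PiTensorProduct.map_pow]
  congr 1
  funext l
  by_cases h : l = i
  · subst h; simp
  · simp [h]

/-- Here s and t are the parity involutions of two tensor factors and 1 + s + t - st is twice the
Koszul sign of their exchange. An operator y changing the parity of the first factor by a replaces s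
by (-1)^a s; for odd a the combination becomes 1 - s + t + st, which is t times the original one
because t² = 1. -/
theorem koszul_comm {E : Type*} [Ring E] [Algebra 𝕂 E] {s t y : E} (a : ℕ)
    (ht : t * t = 1) (hst : s * t = t * s) (hsy : s * y = (-1 : 𝕂) ^ a • (y * s))
    (hty : t * y = y * t) :
    t ^ a * y * (1 + s + t - s * t) = (1 + s + t - s * t) * y := by
  rcases Nat.even_or_odd a with ha | ha
  · rw [ha.neg_one_pow, one_smul] at hsy
    obtain ⟨b, rfl⟩ := ha
    have : t ^ (b + b) = 1 := by rw [← two_mul, pow_mul, pow_two, ht, one_pow]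
    rw [this, one_mul]
    simp only [mul_add, mul_sub, add_mul, sub_mul, mul_one, one_mul, hsy, hty]
    rw [mul_assoc s, hty, ← mul_assoc s y, hsy, mul_assoc]
  · rw [ha.neg_one_pow, neg_one_smul] at hsy
    obtain ⟨b, rfl⟩ := ha
    have : t ^ (2 * b + 1) = t := by rw [pow_succ, pow_mul, pow_two, ht, one_pow, one_mul]
    rw [this]
    simp only [mul_add, mul_sub, add_mul, sub_mul, mul_one, one_mul, hsy, hty, mul_assoc]
    rw [← mul_assoc s, hsy, ht, mul_one, ← mul_assoc t s t, ← hst, mul_assoc, ht, mul_one,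
      neg_mul, mul_assoc, hst]
    abel

/-- The permutation of tensor factors by `e`. -/
def slotPerm {N : ℕ} (e : Equiv.Perm (Fin N)) :
    (⨂[𝕂] _ : Fin N, R) →ₗ[𝕂] ⨂[𝕂] _ : Fin N, R :=
  (PiTensorProduct.reindex 𝕂 (fun _ => R) e).toLinearMap

theorem slotPerm_tprod {N : ℕ} (e : Equiv.Perm (Fin N)) (x : Fin N → R) :
    slotPerm e (PiTensorProduct.tprod 𝕂 x) = PiTensorProduct.tprod 𝕂 (x ∘ e.symm) := by
  exact PiTensorProduct.reindex_tprod _ _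

theorem map_slotPerm {N : ℕ} (e : Equiv.Perm (Fin N)) (f : Fin N → Module.End 𝕂 R) (y) :
    PiTensorProduct.map f (slotPerm e y) = slotPerm e (PiTensorProduct.map (f ∘ e) y) := by
  induction y using PiTensorProduct.induction_on with
  | smul_tprod r y =>
    simp only [map_smul, slotPerm_tprod, PiTensorProduct.map_tprod]
    congr 2
    funext l
    simp
  | add x y hx hy => simp only [map_add, hx, hy]

/-- Twice the signed exchange of two adjacent tensor factors. -/
def slotSwap {k : ℕ} (i : Fin k) :
    (⨂[𝕂] _ : Fin (k + 1), R) →ₗ[𝕂] ⨂[𝕂] _ : Fin (k + 1), R :=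
  slotPerm (Equiv.swap i.castSucc i.succ) ∘ₗ
    (1 + S.slotPar i.castSucc + S.slotPar i.succ - S.slotPar i.castSucc * S.slotPar i.succ)

/-- Moving a derivative from one exchanged slot to the other creates or removes one parity operator
in `slotPd`, and by `koszul_comm` the Koszul sign inside `slotSwap` produces exactly the same
factor. -/
theorem slotSwap_slotPd {k : ℕ} (i : Fin k) (l : Fin (k + 1)) (A : Fin sg.size) (y) :
    S.slotSwap i (S.slotPd (k + 1) l A y) =
      S.slotPd (k + 1) (Equiv.swap i.castSucc i.succ l) A (S.slotSwap i y) := by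
  have hij : i.castSucc ≠ i.succ := (Fin.castSucc_lt_succ).ne
  have hpp : S.par * S.par ^ sg.deg A = (1 : 𝕂) • (S.par ^ sg.deg A * S.par) := by
    rw [one_smul, ← pow_succ, ← pow_succ']
  have hpd : S.par * S.pd A = (-1 : 𝕂) ^ sg.deg A • (S.pd A * S.par) := by
    rw [S.pd_par, smul_smul, ← pow_add, Even.neg_one_pow ⟨_, rfl⟩, one_smul]
  have h1 : S.par * 1 = (1 : 𝕂) • (1 * S.par) := by simp
  have hval : (i.succ : ℕ) = i.castSucc + 1 := by simp
  generalize hi : i.castSucc = a at *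
  generalize hj : i.succ = b at *
  have hK : ∀ (u v w : Module.End 𝕂 (⨂[𝕂] _ : Fin (k + 1), R)), u * v = v * w →
      ∀ y, v (w y) = u (v y) := fun u v w h y => (congrArg (fun T => T y) h).symm
  unfold slotSwap
  rw [hi, hj]
  simp only [LinearMap.comp_apply]
  unfold slotPd slotOp
  rw [map_slotPerm]
  congr 1
  set K := (1 + S.slotPar a + S.slotPar b - S.slotPar a * S.slotPar b) with hKdef
  refine hK _ _ _ ?_ y
  -- The derivative moves from the left slot to the right one, where it carries an additional parity
  -- operator on slot a; conjugation by the transposition places that operator on slot b.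
  by_cases hla : l = a
  · subst hla
    set F : Fin (k + 1) → Module.End 𝕂 R :=
      fun m => if m < l then S.par ^ sg.deg A else if m = l then S.pd A else 1 with hF
    have e1 : PiTensorProduct.map ((fun m => if m < Equiv.swap l b l then S.par ^ sg.deg A else
        if m = Equiv.swap l b l then S.pd A else 1) ∘ Equiv.swap l b) =
        S.slotPar b ^ sg.deg A * PiTensorProduct.map F := by
      rw [slotPar_pow, ← PiTensorProduct.map_mul]
      congr 1
      funext m
      simp only [Function.comp_apply, Equiv.swap_apply_left, hF]
      by_cases hm : m = l
      · subst hm; simp [hij]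
      by_cases hm' : m = b
      · subst hm'
        have h2 : l < m := by rw [Fin.lt_def]; omega
        simp [h2, h2.ne', h2.not_gt]
      · have h3 : m < b ↔ m < l := by
          rw [Fin.lt_def, Fin.lt_def]
          rw [Fin.ext_iff] at hm
          omega
        simp [Equiv.swap_apply_of_ne_of_ne hm hm', hm, hm', h3]
    rw [e1]
    refine koszul_comm (𝕂 := 𝕂) _ (S.slotPar_sq _) (S.slotPar_comm _ _) ?_ ?_
    · exact S.slotPar_mul_map _ _ _ (by simpa [hF] using hpd)
    · have := S.slotPar_mul_map b F 1 (by
        have h2 : l < b := by rw [Fin.lt_def]; omega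
        simp [hF, h2.ne', h2.not_gt])
      rwa [one_smul] at this
  -- Mirror case: the additional parity operator is present before the exchange. `koszul_comm` is
  -- used with the two slots in reversed roles, and the square of that operator cancels.
  by_cases hlb : l = b
  · subst hlb
    have h2 : a < l := by rw [Fin.lt_def]; omega
    set F : Fin (k + 1) → Module.End 𝕂 R := (fun m => if m < Equiv.swap a l l then S.par ^ sg.deg A else
        if m = Equiv.swap a l l then S.pd A else 1) ∘ Equiv.swap a l with hF
    have e1 : PiTensorProduct.map (fun m => if m < l then S.par ^ sg.deg A else if m = l then S.pd A else 1) =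
        S.slotPar a ^ sg.deg A * PiTensorProduct.map F := by
      rw [slotPar_pow, ← PiTensorProduct.map_mul]
      congr 1
      funext m
      simp only [Function.comp_apply, Equiv.swap_apply_right, hF]
      by_cases hm : m = a
      · subst hm; simp [h2, h2.ne', h2.not_gt]
      by_cases hm' : m = l
      · subst hm'
        simp [h2.ne']
      · have h3 : m < l ↔ m < a := by
          rw [Fin.lt_def, Fin.lt_def]
          rw [Fin.ext_iff] at hm
          omega
        simp [Equiv.swap_apply_of_ne_of_ne hm hm', hm, hm', h3]
    have key := koszul_comm (𝕂 := 𝕂) (s := S.slotPar l) (t := S.slotPar a)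
      (y := PiTensorProduct.map F) (sg.deg A) (S.slotPar_sq _) (S.slotPar_comm _ _)
      (S.slotPar_mul_map _ _ _ (by simpa [hF] using hpd))
      (by
        have := S.slotPar_mul_map a F 1 (by simp [hF, h2.ne', h2.not_gt])
        rwa [one_smul] at this)
    have hK' : K = 1 + S.slotPar l + S.slotPar a - S.slotPar l * S.slotPar a := by
      rw [hKdef, S.slotPar_comm a l]; abel
    have hsq : S.slotPar a ^ sg.deg A * S.slotPar a ^ sg.deg A = 1 := by
      rw [← pow_add, ← two_mul, pow_mul, pow_two, S.slotPar_sq, one_pow]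
    have hcomm : K * S.slotPar a ^ sg.deg A = S.slotPar a ^ sg.deg A * K := by
      have c0 : Commute (S.slotPar a) (S.slotPar a) := Commute.refl _
      have c1 : Commute (S.slotPar l) (S.slotPar a) := S.slotPar_comm l a
      have : Commute K (S.slotPar a) := by
        rw [hK']
        exact (((Commute.one_left _).add_left c1).add_left c0).sub_left (c1.mul_left c0)
      exact this.pow_right _
    rw [e1, ← mul_assoc, hcomm, mul_assoc, hK', ← key, ← mul_assoc, ← mul_assoc, hsq, one_mul]
  -- Both exchanged slots lie on the same side of l, so both or neither carry a parity operator, and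
  -- everything commutes.
  · set F : Fin (k + 1) → Module.End 𝕂 R :=
      fun m => if m < l then S.par ^ sg.deg A else if m = l then S.pd A else 1 with hF
    have hab : a < l ↔ b < l := by
      rw [Fin.lt_def, Fin.lt_def]
      rw [Fin.ext_iff] at hla hlb
      omega
    have e1 : ((fun m => if m < Equiv.swap a b l then S.par ^ sg.deg A else
        if m = Equiv.swap a b l then S.pd A else 1) ∘ Equiv.swap a b) = F := by
      funext m
      simp only [Function.comp_apply, Equiv.swap_apply_of_ne_of_ne hla hlb, hF]
      by_cases hm : m = a
      · subst hm
        rw [Equiv.swap_apply_left, if_neg (Ne.symm hlb), if_neg (Ne.symm hla)]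
        simp [hab]
      by_cases hm' : m = b
      · subst hm'
        rw [Equiv.swap_apply_right, if_neg (Ne.symm hlb), if_neg (Ne.symm hla)]
        simp [hab]
      · rw [Equiv.swap_apply_of_ne_of_ne hm hm']
    rw [e1]
    have hc : ∀ m, m ≠ l → S.slotPar m * PiTensorProduct.map F = PiTensorProduct.map F * S.slotPar m := by
      intro m hm
      have := S.slotPar_mul_map m F 1 (by
        simp only [hF, if_neg hm]
        split_ifs
        · exact hpp
        · exact h1)
      rwa [one_smul] at this
    have c1 : Commute (PiTensorProduct.map F) (S.slotPar a) := (hc a (Ne.symm hla)).symm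
    have c2 : Commute (PiTensorProduct.map F) (S.slotPar b) := (hc b (Ne.symm hlb)).symm
    exact (((Commute.one_right _).add_right c1).add_right c2).sub_right (c1.mul_right c2)

theorem exists_prod_ofFn_adjacent {R : Type*} [Monoid R] {k : ℕ} (i : Fin k) (x : Fin (k + 1) → R) :
    ∃ a b : R, ∀ y z, (List.ofFn (Function.update (Function.update x i.castSucc y) i.succ z)).prod =
      a * (y * z) * b := by
  induction k with
  | zero => exact i.elim0
  | succ k ih =>
    cases i using Fin.cases with
    | zero =>
      refine ⟨1, (List.ofFn fun l : Fin k => x l.succ.succ).prod, fun y z => ?_⟩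
      rw [List.ofFn_succ, List.ofFn_succ, List.prod_cons, List.prod_cons, one_mul, mul_assoc]
      simp [Function.update_of_ne]
      rfl
    | succ i =>
      obtain ⟨a, b, h⟩ := ih i fun l => x l.succ
      refine ⟨x 0 * a, b, fun y z => ?_⟩
      have h0 : Function.update (Function.update x i.succ.castSucc y) i.succ.succ z 0 = x 0 := by
        rw [Function.update_of_ne (Fin.succ_ne_zero _).symm, Function.update_of_ne]
        simp [Fin.ext_iff]
      rw [List.ofFn_succ, List.prod_cons, h0, update_succ, ← Fin.succ_castSucc, update_succ, h]
      simp only [mul_assoc]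

/-- This is the axiom `supercomm` for two neighbouring factors inside a longer product. -/
theorem mulAll_slotSwap {k : ℕ} (i : Fin k) (y) :
    mulAll 𝕂 R (k + 1) (S.slotSwap i y) = (2 : 𝕂) • mulAll 𝕂 R (k + 1) y := by
  have hij : i.castSucc ≠ i.succ := (Fin.castSucc_lt_succ).ne
  induction y using PiTensorProduct.induction_on with
  | smul_tprod r x =>
    rw [map_smul, map_smul, map_smul, smul_comm]
    congr 1
    obtain ⟨a, b, h⟩ := exists_prod_ofFn_adjacent i x
    obtain ⟨u, v, hx⟩ : ∃ u v, x = Function.update (Function.update x i.castSucc u) i.succ v :=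
      ⟨x i.castSucc, x i.succ, by simp⟩
    have hsw : ∀ u v, Function.update (Function.update x i.castSucc u) i.succ v ∘
        (Equiv.swap i.castSucc i.succ).symm =
        Function.update (Function.update x i.castSucc v) i.succ u := by
      intro u v
      funext l
      rw [Equiv.symm_swap, Function.comp_apply]
      by_cases hl : l = i.castSucc
      · subst hl; simp [hij]
      by_cases hl' : l = i.succ
      · subst hl'; simp [hij]
      · simp [Equiv.swap_apply_of_ne_of_ne hl hl', hl, hl']
    have p1 : ∀ u v, S.slotPar i.castSucc (PiTensorProduct.tprod 𝕂
        (Function.update (Function.update x i.castSucc u) i.succ v)) = PiTensorProduct.tprod 𝕂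
        (Function.update (Function.update x i.castSucc (S.par u)) i.succ v) := by
      intro u v
      rw [slotPar, PiTensorProduct.map_tprod]
      congr 1
      funext l
      by_cases hl : l = i.castSucc
      · subst hl; simp [hij]
      by_cases hl' : l = i.succ
      · subst hl'; simp [hl]
      · simp [hl, hl']
    have p2 : ∀ u v, S.slotPar i.succ (PiTensorProduct.tprod 𝕂
        (Function.update (Function.update x i.castSucc u) i.succ v)) = PiTensorProduct.tprod 𝕂
        (Function.update (Function.update x i.castSucc u) i.succ (S.par v)) := by
      intro u v
      rw [slotPar, PiTensorProduct.map_tprod]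
      congr 1
      funext l
      by_cases hl : l = i.castSucc
      · subst hl; simp [hij]
      by_cases hl' : l = i.succ
      · subst hl'; simp
      · simp [hl, hl']
    rw [hx, slotSwap, LinearMap.comp_apply]
    simp only [LinearMap.sub_apply, LinearMap.add_apply, Module.End.one_apply, Module.End.mul_apply,
      p1, p2, map_sub, map_add, slotPerm_tprod, hsw, mulAll_tprod, h]
    rw [← smul_mul_assoc, ← mul_smul_comm, S.supercomm]
    simp only [mul_add, mul_sub, add_mul, sub_mul]
  | add x y hx hy => simp only [map_add, smul_add, hx, hy]

/-- When all factors have parity d, the operator 1 + s + t - st acts as 1 + 2(-1)^d - 1 = 2(-1)^d.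
-/
theorem slotSwap_tprod {k : ℕ} {d : ℕ} (i : Fin k) (x : Fin (k + 1) → R)
    (hx : ∀ i, S.par (x i) = (-1 : 𝕂) ^ d • x i) :
    S.slotSwap i (PiTensorProduct.tprod 𝕂 (x ∘ Equiv.swap i.castSucc i.succ)) =
      (2 * (-1 : 𝕂) ^ d) • PiTensorProduct.tprod 𝕂 x := by
  have p : ∀ j (x : Fin (k + 1) → R), (∀ i, S.par (x i) = (-1 : 𝕂) ^ d • x i) →
      S.slotPar j (PiTensorProduct.tprod 𝕂 x) = (-1 : 𝕂) ^ d • PiTensorProduct.tprod 𝕂 x := by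
    intro j x hx
    have h := (PiTensorProduct.tprod 𝕂).map_update_smul x j ((-1 : 𝕂) ^ d) (x j)
    rw [Function.update_eq_self] at h
    rw [slotPar, PiTensorProduct.map_tprod, ← h]
    congr 1
    funext l
    by_cases hl : l = j
    · subst hl; simp [hx]
    · simp [hl]
  have hx' : ∀ l, S.par ((x ∘ Equiv.swap i.castSucc i.succ) l) =
      (-1 : 𝕂) ^ d • (x ∘ Equiv.swap i.castSucc i.succ) l := fun l => hx _
  rw [slotSwap, LinearMap.comp_apply]
  simp only [LinearMap.sub_apply, LinearMap.add_apply, Module.End.one_apply, Module.End.mul_apply,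
      p _ _ hx', map_smul, map_sub, map_add, slotPerm_tprod, smul_smul]
  rw [← pow_add, Even.neg_one_pow ⟨_, rfl⟩, one_smul]
  have : (x ∘ Equiv.swap i.castSucc i.succ) ∘ (Equiv.swap i.castSucc i.succ).symm = x := by
    funext l; simp
  rw [this, two_mul, add_smul]
  abel

theorem edgeProd_slotSwap {k K : ℕ} (i : Fin k) (g : MDigraph (k + 1) K) (y) :
    S.slotSwap i (S.edgeProd g y) = S.edgeProd (Prod.map (Equiv.swap i.castSucc i.succ)
      (Equiv.swap i.castSucc i.succ) ∘ g) (S.slotSwap i y) := by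
  have := S.edgeProd_transport S (Equiv.swap i.castSucc i.succ) 0 (S.slotSwap i)
    (fun j A y => by rw [zero_mul, pow_zero, one_smul, slotSwap_slotPd]) g y
  rw [zero_mul, zero_mul, pow_zero, one_smul] at this
  exact this

theorem _root_.GraphHam.Gra.relabel_mul (d : ℕ) {N k : ℕ} (σ τ : Equiv.Perm (Fin N)) (g : Gra 𝕂 d N k) :
    Gra.relabel d (σ * τ) g = Gra.relabel d σ (Gra.relabel d τ g) := by
  induction g using Gra.induction_on with
  | mk g => simp only [Gra.relabel, Gra.lift_mk]; rfl
  | zero => simp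
  | add g g' hg hg' => simp only [map_add, hg, hg']
  | smul c g hg => rw [map_smul, map_smul, map_smul, hg]

theorem _root_.GraphHam.Gra.relabel_one (d : ℕ) {N k : ℕ} (g : Gra 𝕂 d N k) :
    Gra.relabel d (1 : Equiv.Perm (Fin N)) g = g := by
  induction g using Gra.induction_on with
  | mk g => simp only [Gra.relabel, Gra.lift_mk]; rfl
  | zero => simp
  | add g g' hg hg' => simp only [map_add, hg, hg']
  | smul c g hg => rw [map_smul, hg]

variable [CharZero 𝕂]

/-- Passing `slotSwap` through the edge operators and multiplying out gives the claim times 2, which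
is invertible in characteristic zero. Adjacent transpositions generate, so this is the only case
needing work. -/
theorem rep_relabel_swap {k K : ℕ} {d : ℕ} (i : Fin k) (g : Gra 𝕂 (n + 1) (k + 1) K)
    (x : Fin (k + 1) → R) (hx : ∀ i, S.par (x i) = (-1 : 𝕂) ^ d • x i) :
    (-1 : 𝕂) ^ d • S.rep (Gra.relabel (n + 1) (Equiv.swap i.castSucc i.succ) g) x =
      S.rep g (x ∘ Equiv.swap i.castSucc i.succ) := by
  induction g using Gra.induction_on with
  | mk g =>
    rw [Gra.relabel, Gra.lift_mk, rep_mk, rep_mk]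
    have h := S.edgeProd_slotSwap i g (PiTensorProduct.tprod 𝕂 (x ∘ Equiv.swap i.castSucc i.succ))
    rw [S.slotSwap_tprod i x hx, map_smul] at h
    have h' := congrArg (mulAll 𝕂 R (k + 1)) h
    rw [mulAll_slotSwap, map_smul, mul_smul] at h'
    exact (smul_right_injective R (two_ne_zero (α := 𝕂)) h').symm
  | zero => simp
  | add g g' hg hg' => simp only [map_add, add_apply, smul_add, hg, hg']
  | smul c g hg => rw [map_smul, map_smul, map_smul, smul_apply, smul_apply, smul_comm, hg]

/-- On arguments of parity `d`, relabelling the vertices permutes the arguments. -/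
theorem rep_relabel {k K : ℕ} {d : ℕ} (τ : Equiv.Perm (Fin (k + 1))) (g : Gra 𝕂 (n + 1) (k + 1) K)
    (x : Fin (k + 1) → R) (hx : ∀ i, S.par (x i) = (-1 : 𝕂) ^ d • x i) :
    (((Equiv.Perm.sign τ : ℤˣ) : ℤ) : 𝕂) ^ d • S.rep (Gra.relabel (n + 1) τ g) x =
      S.rep g (x ∘ τ) := by
  have hτ : τ ∈ Submonoid.closure (Set.range fun i : Fin k => Equiv.swap i.castSucc i.succ) := by
    rw [Equiv.Perm.mclosure_swap_castSucc_succ]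
    trivial
  induction hτ using Submonoid.closure_induction generalizing x g with
  | one => simp [Gra.relabel_one]
  | mem τ hτ =>
    obtain ⟨i, rfl⟩ := hτ
    rw [Equiv.Perm.sign_swap (Fin.castSucc_lt_succ).ne]
    simpa using S.rep_relabel_swap i g x hx
  | mul τ τ' _ _ ih ih' =>
    rw [Gra.relabel_mul, Equiv.Perm.coe_mul, ← Function.comp_assoc, ← ih' g (x ∘ τ) (fun i => hx _),
      ← ih _ x hx, smul_smul]
    congr 1
    rw [map_mul]
    push_cast
    rw [mul_pow, mul_comm]

end PoissonSuperalgebra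

theorem mem_reconnections {p j q M : ℕ} (hM : p + q = M) (g : MDigraph (p + 1) j)
    (h : MDigraph (M + 1) j) :
    h ∈ reconnections hM g ↔ ∀ e, collapse hM (h e).1 = (g e).1 ∧ collapse hM (h e).2 = (g e).2 := by
  simp only [reconnections, Finset.mem_filter, Finset.mem_univ, true_and, funext_iff,
    Function.comp_apply, Prod.ext_iff, Prod.map_fst, Prod.map_snd]

namespace PoissonSuperalgebra

variable {𝕂 : Type*} [Field 𝕂] {n : ℕ} {sg : Signature 𝕂 n}
  {R : Type*} [Ring R] [Algebra 𝕂 R] (S : PoissonSuperalgebra sg R)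

/-! ### Compatibility with insertion -/

variable (𝕂 R) in
/-- Multiply the first `q + 1` tensor factors. -/
def blockMul {p q M : ℕ} (hM : p + q = M) :
    (⨂[𝕂] _ : Fin (M + 1), R) →ₗ[𝕂] ⨂[𝕂] _ : Fin (p + 1), R :=
  PiTensorProduct.lift
    (((PiTensorProduct.tprod 𝕂 (s := fun _ : Fin (p + 1) => R)).curryLeft.compMultilinearMap
      (MultilinearMap.mkPiAlgebraFin 𝕂 (q + 1) R)).uncurrySum.domDomCongr
      (finSumFinEquiv.trans (finCongr (show q + 1 + p = M + 1 by omega))))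

theorem blockMul_tprod {p q M : ℕ} (hM : p + q = M) (x : Fin (M + 1) → R) :
    blockMul 𝕂 R hM (PiTensorProduct.tprod 𝕂 x) = PiTensorProduct.tprod 𝕂
      (Fin.cons (List.ofFn fun i : Fin (q + 1) => x ⟨i, by omega⟩).prod
        fun i : Fin p => x ⟨q + 1 + i, by omega⟩) := by
  rw [blockMul, PiTensorProduct.lift.tprod]
  rfl

theorem pd_prod_ofFn (A : Fin sg.size) {N : ℕ} (x : Fin N → R) :
    S.pd A (List.ofFn x).prod =
      ∑ w, (List.ofFn (slotTuple w (S.par ^ sg.deg A) (S.pd A) x)).prod := by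
  induction N with
  | zero => simpa using S.pd_one A
  | succ N ih =>
    rw [List.ofFn_succ, List.prod_cons, S.pd_mul, ih, Fin.sum_univ_succ, Finset.mul_sum]
    congr 1
    · rw [slotTuple_zero, List.ofFn_succ, List.prod_cons]
      rfl
    · refine Finset.sum_congr rfl fun w _ => ?_
      rw [List.ofFn_succ, List.prod_cons]
      congr 1
      congr 2
      funext l
      simp [slotTuple]

theorem par_pow_prod_ofFn (a : ℕ) {N : ℕ} (x : Fin N → R) :
    (S.par ^ a) (List.ofFn x).prod = (List.ofFn fun i => (S.par ^ a) (x i)).prod := by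
  induction N with
  | zero => simpa using S.par_pow_one a
  | succ N ih =>
    rw [List.ofFn_succ, List.prod_cons, S.par_pow_mul, ih, List.ofFn_succ, List.prod_cons]

/-- The vertices lying over `v`. -/
def fiber {p q M : ℕ} (hM : p + q = M) (v : Fin (p + 1)) : Finset (Fin (M + 1)) :=
  Finset.univ.filter fun w => collapse hM w = v

/-- The graded Leibniz rule is the source of the sum over reconnections: a derivative of the merged
factor is the sum of the derivatives of its constituents, with parity operators on the earlier ones.
A later vertex has a single preimage, and multiplicativity of the parity spreads its parity operator
over the whole block. -/
theorem slotPd_blockMul {p q M : ℕ} (hM : p + q = M) (v : Fin (p + 1)) (A : Fin sg.size) (y) :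
    S.slotPd (p + 1) v A (blockMul 𝕂 R hM y) =
      ∑ w ∈ fiber hM v, blockMul 𝕂 R hM (S.slotPd (M + 1) w A y) := by
  induction y using PiTensorProduct.induction_on with
  | add x y hx hy => simp only [map_add, hx, hy, Finset.sum_add_distrib]
  | smul_tprod r x =>
    simp only [map_smul, ← Finset.smul_sum]
    congr 1
    simp only [slotPd, blockMul_tprod, slotOp_tprod]
    cases v using Fin.cases with
    | zero =>
      rw [slotTuple_zero, Fin.cons_zero, Fin.tail_cons, pd_prod_ofFn]
      have hlin : ∀ b : R, PiTensorProduct.tprod 𝕂 (Fin.cons b fun i : Fin p => x ⟨q + 1 + i, by omega⟩) =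
        (PiTensorProduct.tprod 𝕂 (s := fun _ : Fin (p + 1) => R)).curryLeft b
          fun i : Fin p => x ⟨q + 1 + i, by omega⟩ := fun b => rfl
      rw [hlin, map_sum, sum_apply]
      refine Finset.sum_bij (fun w _ => (⟨w, by omega⟩ : Fin (M + 1))) ?_ ?_ ?_ ?_
      · intro w _
        simp only [fiber, Finset.mem_filter, Finset.mem_univ, true_and, collapse, Fin.ext_iff,
          Fin.val_zero]
        omega
      · intro a _ b _ h
        simpa [Fin.ext_iff] using h
      · intro w hw
        simp only [fiber, Finset.mem_filter, Finset.mem_univ, true_and, collapse, Fin.ext_iff,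
          Fin.val_zero] at hw
        exact ⟨⟨w, by omega⟩, Finset.mem_univ _, rfl⟩
      · intro w _
        rw [← hlin]
        congr 2
        · refine congrArg List.prod (congrArg List.ofFn (funext fun i => ?_))
          simp [slotTuple, Fin.ext_iff]
        · funext i
          have h1 : ¬ (q + 1 + (i : ℕ) < w) := by omega
          have h2 : ¬ (q + 1 + (i : ℕ) = w) := by omega
          simp [slotTuple, Fin.ext_iff, h1, h2]
    | succ v =>
      have hf : fiber hM v.succ = {⟨q + 1 + v, by omega⟩} := by
        ext w
        simp only [fiber, Finset.mem_filter, Finset.mem_univ, true_and, collapse, Fin.ext_iff,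
          Finset.mem_singleton, Fin.val_succ]
        omega
      rw [hf, Finset.sum_singleton]
      congr 1
      funext l
      cases l using Fin.cases with
      | zero =>
        simp only [slotTuple, Fin.succ_pos, if_true, Fin.cons_zero, par_pow_prod_ofFn]
        congr 2
        funext i
        rw [if_pos]
        rw [Fin.lt_def]
        simp only
        omega
      | succ l =>
        simp only [slotTuple, Fin.cons_succ, Fin.lt_def, Fin.ext_iff, Fin.val_succ,
          Nat.add_lt_add_iff_left, Nat.add_lt_add_iff_right, Nat.add_right_cancel_iff,
          Nat.add_left_cancel_iff]

theorem edgeOp_blockMul {p q M : ℕ} (hM : p + q = M) (i j : Fin (p + 1)) (y) :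
    S.edgeOp (p + 1) i j (blockMul 𝕂 R hM y) =
      ∑ w ∈ fiber hM i, ∑ w' ∈ fiber hM j, blockMul 𝕂 R hM (S.edgeOp (M + 1) w w' y) := by
  simp only [edgeOp, LinearMap.sum_apply, LinearMap.smul_apply, Module.End.mul_apply, map_sum,
    map_smul, slotPd_blockMul, Finset.smul_sum]
  have h : ∀ f : Fin (M + 1) → Fin (M + 1) → Fin sg.size → Fin sg.size → ⨂[𝕂] _ : Fin (p + 1), R,
      ∑ w ∈ fiber hM i, ∑ w' ∈ fiber hM j, ∑ A, ∑ B, f w w' A B =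
      ∑ A, ∑ B, ∑ w' ∈ fiber hM j, ∑ w ∈ fiber hM i, f w w' A B := by
    intro f
    calc _ = ∑ w ∈ fiber hM i, ∑ A, ∑ w' ∈ fiber hM j, ∑ B, f w w' A B :=
          Finset.sum_congr rfl fun w _ => Finset.sum_comm
      _ = ∑ A, ∑ w ∈ fiber hM i, ∑ w' ∈ fiber hM j, ∑ B, f w w' A B := Finset.sum_comm
      _ = ∑ A, ∑ w ∈ fiber hM i, ∑ B, ∑ w' ∈ fiber hM j, f w w' A B :=
          Finset.sum_congr rfl fun A _ => Finset.sum_congr rfl fun w _ => Finset.sum_comm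
      _ = ∑ A, ∑ B, ∑ w ∈ fiber hM i, ∑ w' ∈ fiber hM j, f w w' A B :=
          Finset.sum_congr rfl fun A _ => Finset.sum_comm
      _ = _ := Finset.sum_congr rfl fun A _ => Finset.sum_congr rfl fun B _ => Finset.sum_comm
  rw [h]

theorem sum_reconnections_succ {α : Type*} [AddCommMonoid α] {p j q M : ℕ} (hM : p + q = M)
    (g : MDigraph (p + 1) (j + 1)) (F : MDigraph (M + 1) (j + 1) → α) :
    ∑ h ∈ reconnections hM g, F h = ∑ w ∈ fiber hM (g 0).1, ∑ w' ∈ fiber hM (g 0).2,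
      ∑ h ∈ reconnections hM (fun e => g e.succ : MDigraph (p + 1) j),
        F (Fin.cons (w, w') h : MDigraph (M + 1) (j + 1)) := by
  rw [← Finset.sum_product', ← Finset.sum_product']
  symm
  refine Finset.sum_bij' (fun a _ => (Fin.cons a.1 a.2 : MDigraph (M + 1) (j + 1)))
    (fun h _ => (h 0, fun e => h e.succ)) ?_ ?_ ?_ ?_ ?_
  · rintro ⟨⟨w, w'⟩, h⟩ ha
    simp only [Finset.mem_product, fiber, Finset.mem_filter, Finset.mem_univ, true_and,
      mem_reconnections] at ha ⊢
    intro e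
    cases e using Fin.cases with
    | zero => exact ha.1
    | succ e => exact ha.2 e
  · intro h hh
    simp only [Finset.mem_product, fiber, Finset.mem_filter, Finset.mem_univ, true_and,
      mem_reconnections] at hh ⊢
    exact ⟨hh 0, fun e => hh e.succ⟩
  · rintro ⟨w, h⟩ _
    simp
  · intro h _
    exact Fin.cons_self_tail h
  · rintro ⟨⟨w, w'⟩, h⟩ _
    rfl

theorem edgeProd_cons {N k : ℕ} (w : Fin N × Fin N) (g : MDigraph N k) (y) :
    S.edgeProd (Fin.cons w g : MDigraph N (k + 1)) y = S.edgeOp N w.1 w.2 (S.edgeProd g y) := by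
  rw [edgeProd, List.ofFn_succ, List.prod_cons]
  rfl

/-- Each half-edge at the vertex 0 is distributed over the block independently of the others, and a
reconnection is precisely one such choice for every half-edge. -/
theorem edgeProd_blockMul {p j q M : ℕ} (hM : p + q = M) (g : MDigraph (p + 1) j) (y) :
    S.edgeProd g (blockMul 𝕂 R hM y) =
      ∑ h ∈ reconnections hM g, blockMul 𝕂 R hM (S.edgeProd h y) := by
  induction j with
  | zero =>
    have : reconnections hM g = {fun e => e.elim0} := by
      ext h
      simp only [mem_reconnections, Finset.mem_singleton]
      exact ⟨fun _ => funext fun e => e.elim0, fun _ e => e.elim0⟩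
    rw [this]
    simp [edgeProd]
  | succ j ih =>
    rw [sum_reconnections_succ]
    have hg : g = (Fin.cons (g 0) (fun e => g e.succ) : MDigraph (p + 1) (j + 1)) :=
      (Fin.cons_self_tail g).symm
    conv_lhs => rw [hg]
    rw [edgeProd_cons, ih, map_sum]
    simp only [edgeProd_cons, edgeOp_blockMul]
    rw [Finset.sum_comm]
    exact Finset.sum_congr rfl fun w _ => Finset.sum_comm

theorem mulAll_blockMul {p q M : ℕ} (hM : p + q = M) (y) :
    mulAll 𝕂 R (p + 1) (blockMul 𝕂 R hM y) = mulAll 𝕂 R (M + 1) y := by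
  induction y using PiTensorProduct.induction_on with
  | add x y hx hy => simp only [map_add, hx, hy]
  | smul_tprod r x =>
    simp only [map_smul, blockMul_tprod, mulAll_tprod]
    congr 1
    rw [List.ofFn_succ, List.prod_cons, Fin.cons_zero]
    simp only [Fin.cons_succ]
    have h : q + 1 + p = M + 1 := by omega
    have hx : List.ofFn x = List.ofFn (fun i : Fin (q + 1) => x ⟨i, by omega⟩) ++
        List.ofFn (fun i : Fin p => x ⟨q + 1 + i, by omega⟩) := by
      exact (List.ofFn_congr h.symm x).trans List.ofFn_add
    rw [hx, List.prod_append]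

variable (𝕂 R) in
/-- Put together a tensor and further factors. -/
def appendLift {p q M : ℕ} (hM : p + q = M) :
    (⨂[𝕂] _ : Fin (q + 1), R) →ₗ[𝕂]
      MultilinearMap 𝕂 (fun _ : Fin p => R) (⨂[𝕂] _ : Fin (M + 1), R) :=
  PiTensorProduct.lift
    ((PiTensorProduct.tprod 𝕂 (s := fun _ : Fin (M + 1) => R)).domDomCongr
      (finSumFinEquiv.trans (finCongr (show q + 1 + p = M + 1 by omega))).symm).currySum

/-- Put together a tensor and the factors `z`. -/
def appendTensor {p q M : ℕ} (hM : p + q = M) (z : Fin p → R) :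
    (⨂[𝕂] _ : Fin (q + 1), R) →ₗ[𝕂] ⨂[𝕂] _ : Fin (M + 1), R where
  toFun y := appendLift 𝕂 R hM y z
  map_add' x y := by rw [map_add]; rfl
  map_smul' c x := by rw [map_smul]; rfl

theorem appendTensor_tprod {p q M : ℕ} (hM : p + q = M) (z : Fin p → R) (x : Fin (q + 1) → R) :
    appendTensor hM z (PiTensorProduct.tprod 𝕂 x) = PiTensorProduct.tprod 𝕂
      fun l : Fin (M + 1) => if h : (l : ℕ) < q + 1 then x ⟨l, h⟩ else z ⟨l - (q + 1), by omega⟩ := by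
  change appendLift 𝕂 R hM (PiTensorProduct.tprod 𝕂 x) z = _
  rw [appendLift, PiTensorProduct.lift.tprod]
  change PiTensorProduct.tprod 𝕂 _ = _
  congr 1
  subst hM
  funext l
  obtain ⟨e, rfl⟩ := (finSumFinEquiv.trans (finCongr (show q + 1 + p = p + q + 1 by omega))).surjective l
  rw [Equiv.symm_apply_apply]
  cases e with
  | inl e =>
    have h : ¬ q < (e : ℕ) := by omega
    simp [h]
  | inr e =>
    have h : ¬ (e : ℕ) + (q + 1) ≤ q := by omega
    simp [h]

/-- `slotPd` puts parity operators only on slots before the derivative, while the appended factors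
come after it; hence no sign. -/
theorem slotPd_appendTensor {p q M : ℕ} (hM : p + q = M) (z : Fin p → R) (v : Fin (q + 1))
    (A : Fin sg.size) (y) :
    appendTensor hM z (S.slotPd (q + 1) v A y) =
      S.slotPd (M + 1) (Fin.castLE (by omega) v) A (appendTensor hM z y) := by
  induction y using PiTensorProduct.induction_on with
  | add x y hx hy => simp only [map_add, hx, hy]
  | smul_tprod r x =>
    simp only [map_smul, slotPd, slotOp_tprod, appendTensor_tprod]
    congr 2
    funext l
    by_cases h : (l : ℕ) < q + 1
    · simp [slotTuple, h, Fin.lt_def, Fin.ext_iff]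
    · have h1 : ¬ (l : ℕ) < v := by omega
      have h2 : ¬ (l : ℕ) = v := by omega
      simp [slotTuple, h, Fin.lt_def, Fin.ext_iff, h1, h2]

theorem blockMul_appendTensor {p q M : ℕ} (hM : p + q = M) (z : Fin p → R) (y) :
    blockMul 𝕂 R hM (appendTensor hM z y) =
      PiTensorProduct.tprod 𝕂 (Fin.cons (mulAll 𝕂 R (q + 1) y) z) := by
  have hlin : ∀ b : R, PiTensorProduct.tprod 𝕂 (Fin.cons b z) =
    (PiTensorProduct.tprod 𝕂 (s := fun _ : Fin (p + 1) => R)).curryLeft b z := fun b => rfl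
  rw [hlin]
  induction y using PiTensorProduct.induction_on with
  | add x y hx hy => simp only [map_add, hx, hy, add_apply]
  | smul_tprod r x =>
    simp only [map_smul, smul_apply, appendTensor_tprod, blockMul_tprod, mulAll_tprod, ← hlin]
    congr 3
    · simp
    · funext i
      have h : ¬ (q + 1 + (i : ℕ) ≤ q) := by omega
      simp [h]

theorem edgeProd_joinEdges {j q k M K : ℕ} (hq : q ≤ M) (hK : j + k = K)
    (h : MDigraph (M + 1) j) (g' : MDigraph (q + 1) k) :
    S.edgeProd (joinEdges hq hK h g') = S.edgeProd h *
      S.edgeProd (Prod.map (Fin.castLE (by omega)) (Fin.castLE (by omega)) ∘ g' :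
        MDigraph (M + 1) k) := by
  subst hK
  unfold edgeProd
  rw [← List.prod_append, List.ofFn_add]
  refine congrArg List.prod (congrArg₂ (· ++ ·) (congrArg List.ofFn (funext fun e => ?_))
    (congrArg List.ofFn (funext fun e => ?_)))
  · change S.edgeOp (M + 1) (joinEdges hq rfl h g' (Fin.cast rfl (Fin.castAdd k e))).1
      (joinEdges hq rfl h g' (Fin.cast rfl (Fin.castAdd k e))).2 = _
    rw [joinEdges_left]
  · change S.edgeOp (M + 1) (joinEdges hq rfl h g' (Fin.cast rfl (Fin.natAdd j e))).1
      (joinEdges hq rfl h g' (Fin.cast rfl (Fin.natAdd j e))).2 = _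
    rw [joinEdges_right]
    rfl

/-- The representation turns insertion of graphs into insertion of operators. -/
theorem rep_comp {p q M j k K : ℕ} (hM : p + q = M) (hK : j + k = K)
    (g : Gra 𝕂 (n + 1) (p + 1) j) (g' : Gra 𝕂 (n + 1) (q + 1) k) :
    S.rep (Gra.comp (n + 1) hM hK g g') = insertFirst hM (S.rep g) (S.rep g') := by
  refine MultilinearMap.ext fun x => ?_
  rw [insertFirst_apply]
  set z : Fin p → R := fun i => x ⟨q + 1 + i, by omega⟩ with hz
  have hlin : ∀ (g : Gra 𝕂 (n + 1) (p + 1) j) (b : R), S.rep g (Fin.cons b z) =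
    (S.rep g).curryLeft b z := fun _ b => rfl
  induction g using Gra.induction_on with
  | zero => simp
  | add g₁ g₂ h₁ h₂ => simp only [map_add, LinearMap.add_apply, add_apply, h₁, h₂]
  | smul c g h => simp only [map_smul, LinearMap.smul_apply, smul_apply, h]
  | mk g =>
    induction g' using Gra.induction_on with
    | zero => rw [map_zero, map_zero, map_zero, hlin]; simp
    | add g₁ g₂ h₁ h₂ =>
      rw [map_add, map_add, add_apply, h₁, h₂, map_add, hlin, hlin, hlin, add_apply, map_add, add_apply]
    | smul c g h =>
      rw [map_smul, map_smul, smul_apply, h, map_smul, hlin, hlin, smul_apply, map_smul, smul_apply]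
    | mk g' =>
      rw [Gra.comp, Gra.lift_mk, Gra.lift_mk, map_sum, sum_apply]
      -- The inner graph acts on the first q + 1 slots, and the outer graph acts once these are
      -- merged. The edges of the outer graph come first in `joinEdges`, so their operators are
      -- applied last, in agreement with the composition and without a sign.
      have hx : PiTensorProduct.tprod 𝕂 x =
          appendTensor hM z (PiTensorProduct.tprod 𝕂 fun i : Fin (q + 1) => x ⟨i, by omega⟩) := by
        rw [appendTensor_tprod]
        congr 1
        funext l
        split_ifs with h
        · rfl
        · rw [hz]
          congr 1
          rw [Fin.ext_iff]
          simp only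
          omega
      have hJ := S.edgeProd_transport S (Fin.castLE (show q + 1 ≤ M + 1 by omega)) 0
        (appendTensor hM z) (fun i A y => by
          rw [zero_mul, pow_zero, one_smul, slotPd_appendTensor]) g'
        (PiTensorProduct.tprod 𝕂 fun i : Fin (q + 1) => x ⟨i, by omega⟩)
      rw [zero_mul, zero_mul, pow_zero, one_smul] at hJ
      rw [rep_mk, rep_mk, ← blockMul_appendTensor hM, edgeProd_blockMul, map_sum]
      refine Finset.sum_congr rfl fun h _ => ?_
      rw [rep_mk, edgeProd_joinEdges, Module.End.mul_apply, hx, ← hJ, mulAll_blockMul]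

end PoissonSuperalgebra

/-! ### Shuffles -/

theorem mem_shuffles {p q M : ℕ} (h : q + 1 + p = M + 1) (τ : Equiv.Perm (Fin (M + 1))) :
    τ ∈ shuffles q M ↔ StrictMono (fun e : Fin (q + 1) => τ (Fin.cast h (Fin.castAdd p e))) ∧
      StrictMono (fun e : Fin p => τ (Fin.cast h (Fin.natAdd (q + 1) e))) := by
  simp only [shuffles, Finset.mem_filter, Finset.mem_univ, true_and]
  constructor
  · intro hτ
    refine ⟨fun a b hab => hτ _ _ ?_ (Or.inl ?_), fun a b hab => hτ _ _ ?_ (Or.inr ?_)⟩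
    · rw [Fin.lt_def] at hab ⊢; simpa using hab
    · simp; omega
    · rw [Fin.lt_def] at hab ⊢; simpa using hab
    · simp; omega
  · rintro ⟨h1, h2⟩ a b hab hor
    rw [Fin.lt_def] at hab
    rcases hor with hb | ha
    · exact @h1 ⟨a, by omega⟩ ⟨b, by omega⟩ hab
    · have := @h2 ⟨a - (q + 1), by omega⟩ ⟨b - (q + 1), by omega⟩ (by rw [Fin.lt_def]; simp only; omega)
      have e1 : Fin.cast h (Fin.natAdd (q + 1) (⟨a - (q + 1), by omega⟩ : Fin p)) = a := by
        rw [Fin.ext_iff]; simp; omega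
      have e2 : Fin.cast h (Fin.natAdd (q + 1) (⟨b - (q + 1), by omega⟩ : Fin p)) = b := by
        rw [Fin.ext_iff]; simp; omega
      simp only [e1, e2] at this
      exact this

theorem sumPerm_mul {j k K : ℕ} (hK : j + k = K) (σ σ' : Equiv.Perm (Fin j))
    (τ τ' : Equiv.Perm (Fin k)) :
    sumPerm hK σ τ * sumPerm hK σ' τ' = sumPerm hK (σ * σ') (τ * τ') := by
  refine Equiv.coe_fn_injective (funext_edges hK (fun e => ?_) (fun e => ?_))
  · simp only [Equiv.Perm.mul_apply, sumPerm_left]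
  · simp only [Equiv.Perm.mul_apply, sumPerm_right]

theorem sumPerm_one {j k K : ℕ} (hK : j + k = K) : sumPerm hK (1 : Equiv.Perm (Fin j)) 1 = 1 := by
  refine Equiv.coe_fn_injective (funext_edges hK (fun e => ?_) (fun e => ?_))
  · simp only [Equiv.Perm.one_apply, sumPerm_left]
  · simp only [Equiv.Perm.one_apply, sumPerm_right]

theorem perm_eq_one_of_strictMono {N m : ℕ} {f : Fin N → Fin m}
    (hf : StrictMono f) (σ : Equiv.Perm (Fin N)) (hσ : StrictMono (f ∘ σ)) : σ = 1 := by
  have h : StrictMono σ := fun a b hab => hf.lt_iff_lt.mp (hσ hab)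
  refine Equiv.coe_fn_injective ((h.range_inj strictMono_id).mp ?_)
  simp

/-- Shuffles represent the left cosets of S_{q+1} × S_p. Sorting the values of a permutation on each
block gives the shuffle of its coset; it is unique because a strictly increasing map stays
increasing only under the trivial permutation of its arguments. -/
theorem shuffles_bijective {p q M : ℕ} (h : q + 1 + p = M + 1) :
    Function.Bijective (fun t : shuffles q M × Equiv.Perm (Fin (q + 1)) × Equiv.Perm (Fin p) =>
      (t.1 : Equiv.Perm (Fin (M + 1))) * sumPerm h t.2.1 t.2.2) := by
  constructor
  · rintro ⟨⟨τ, hτ⟩, α, β⟩ ⟨⟨τ', hτ'⟩, α', β'⟩ he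
    simp only at he
    have he' : τ = τ' * sumPerm h (α' * α⁻¹) (β' * β⁻¹) := by
      rw [← sumPerm_mul, ← mul_assoc, ← he, mul_assoc, sumPerm_mul, mul_inv_cancel, mul_inv_cancel,
        sumPerm_one, mul_one]
    rw [mem_shuffles h] at hτ hτ'
    have h1 : α' * α⁻¹ = 1 := by
      refine perm_eq_one_of_strictMono hτ'.1 _ ?_
      have := hτ.1
      rw [he'] at this
      simp only [Equiv.Perm.mul_apply, sumPerm_left] at this
      exact this
    have h2 : β' * β⁻¹ = 1 := by
      refine perm_eq_one_of_strictMono hτ'.2 _ ?_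
      have := hτ.2
      rw [he'] at this
      simp only [Equiv.Perm.mul_apply, sumPerm_right] at this
      exact this
    rw [h1, h2, sumPerm_one, mul_one] at he'
    rw [mul_inv_eq_one] at h1 h2
    subst he' h1 h2
    rfl
  · intro σ
    let f : Fin (q + 1) → Fin (M + 1) := fun e => σ (Fin.cast h (Fin.castAdd p e))
    let g : Fin p → Fin (M + 1) := fun e => σ (Fin.cast h (Fin.natAdd (q + 1) e))
    have hf : Function.Injective f := fun a b hab => by
      have := σ.injective hab
      simpa [Fin.ext_iff] using this
    have hg : Function.Injective g := fun a b hab => by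
      have := σ.injective hab
      simpa [Fin.ext_iff] using this
    refine ⟨⟨⟨σ * sumPerm h (Tuple.sort f) (Tuple.sort g), ?_⟩, (Tuple.sort f)⁻¹, (Tuple.sort g)⁻¹⟩, ?_⟩
    · rw [mem_shuffles h]
      simp only [Equiv.Perm.mul_apply, sumPerm_left, sumPerm_right]
      exact ⟨(Tuple.monotone_sort f).strictMono_of_injective (hf.comp (Tuple.sort f).injective),
        (Tuple.monotone_sort g).strictMono_of_injective (hg.comp (Tuple.sort g).injective)⟩
    · simp only
      rw [mul_assoc, sumPerm_mul, mul_inv_cancel, mul_inv_cancel, sumPerm_one, mul_one]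

theorem shuffles_card {p q M : ℕ} (h : q + 1 + p = M + 1) :
    (shuffles q M).card = (M + 1).choose (q + 1) := by
  have := Fintype.card_of_bijective (shuffles_bijective h)
  simp only [Fintype.card_prod, Fintype.card_coe, Fintype.card_perm, Fintype.card_fin] at this
  have h2 := Nat.choose_mul_factorial_mul_factorial (show q + 1 ≤ M + 1 by omega)
  rw [show M + 1 - (q + 1) = p by omega, ← this, mul_assoc] at h2
  exact (Nat.eq_of_mul_eq_mul_right (by positivity) h2).symm

/-- The set of shuffles is not stable under translation, the full symmetric group is. The
multiplicity is the order of the block subgroup. -/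
theorem shuffles_sum {A : Type*} [AddCommMonoid A] {p q M : ℕ} (h : q + 1 + p = M + 1)
    (Φ : Equiv.Perm (Fin (M + 1)) → A)
    (hΦ : ∀ ρ α β, Φ (ρ * sumPerm h α β) = Φ ρ) :
    ((q + 1).factorial * p.factorial) • ∑ τ ∈ shuffles q M, Φ τ = ∑ ρ, Φ ρ := by
  rw [← (shuffles_bijective h).sum_comp, Fintype.sum_prod_type]
  simp only [hΦ, Finset.sum_const, Finset.card_univ, Fintype.card_prod, Fintype.card_perm,
    Fintype.card_fin]
  rw [← Finset.smul_sum, Finset.sum_coe_sort (shuffles q M) Φ]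

/-! ### The pre-Lie product and its powers inside the graph complex -/

section Closure

variable {𝕂 : Type*} [Field 𝕂]

theorem Gra.relabel_mk (d : ℕ) {N k : ℕ} (τ : Equiv.Perm (Fin N)) (g : MDigraph N k) :
    Gra.relabel (𝕂 := 𝕂) d τ (Gra.mk d g) = Gra.mk d (Prod.map τ τ ∘ g) := by
  rw [Gra.relabel, Gra.lift_mk]

theorem Gra.comp_mk (d : ℕ) {p q M j k K : ℕ} (hM : p + q = M) (hK : j + k = K)
    (g : MDigraph (p + 1) j) (g' : MDigraph (q + 1) k) :
    Gra.comp (𝕂 := 𝕂) d hM hK (Gra.mk d g) (Gra.mk d g') =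
      ∑ h ∈ reconnections hM g, Gra.mk d (joinEdges (by omega) hK h g') := by
  rw [Gra.comp, Gra.lift_mk, Gra.lift_mk]

/-- The extension of a permutation by the fixed point `0`. -/
def extendPerm {p : ℕ} (β : Equiv.Perm (Fin p)) : Equiv.Perm (Fin (p + 1)) :=
  Equiv.Perm.decomposeFin.symm (0, β)

theorem extendPerm_zero {p : ℕ} (β : Equiv.Perm (Fin p)) : extendPerm β 0 = 0 := by
  simp [extendPerm]

theorem extendPerm_succ {p : ℕ} (β : Equiv.Perm (Fin p)) (i : Fin p) :
    extendPerm β i.succ = (β i).succ := by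
  simp [extendPerm]

theorem sign_extendPerm {p : ℕ} (β : Equiv.Perm (Fin p)) :
    Equiv.Perm.sign (extendPerm β) = Equiv.Perm.sign β := by
  simp [extendPerm]

theorem collapse_sumPerm {p q M : ℕ} (hM : p + q = M) (h : q + 1 + p = M + 1)
    (α : Equiv.Perm (Fin (q + 1))) (β : Equiv.Perm (Fin p)) (w : Fin (M + 1)) :
    collapse hM (sumPerm h α β w) = extendPerm β (collapse hM w) := by
  refine congrFun (funext_edges (f := fun w => collapse hM (sumPerm h α β w))
    (g := fun w => extendPerm β (collapse hM w)) h (fun e => ?_) (fun e => ?_)) w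
  · simp only [sumPerm_left]
    have h0 : ∀ e : Fin (q + 1), collapse hM (Fin.cast h (Fin.castAdd p e)) = 0 := by
      intro e
      rw [Fin.ext_iff]
      simp only [collapse, Fin.val_cast, Fin.val_castAdd, Fin.val_zero]
      omega
    rw [h0, h0, extendPerm_zero]
  · simp only [sumPerm_right]
    have h0 : ∀ e : Fin p, collapse hM (Fin.cast h (Fin.natAdd (q + 1) e)) = e.succ := by
      intro e
      rw [Fin.ext_iff]
      simp only [collapse, Fin.val_cast, Fin.val_natAdd, Fin.val_succ]
      omega
    rw [h0, h0, extendPerm_succ]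

theorem joinEdges_map {p q M j k K : ℕ} (hM : p + q = M) (hK : j + k = K) (h : q + 1 + p = M + 1)
    (α : Equiv.Perm (Fin (q + 1))) (β : Equiv.Perm (Fin p)) (r : MDigraph (M + 1) j)
    (g' : MDigraph (q + 1) k) :
    Prod.map (sumPerm h α β) (sumPerm h α β) ∘ joinEdges (q := q) (by omega) hK r g' =
      joinEdges (by omega) hK (Prod.map (sumPerm h α β) (sumPerm h α β) ∘ r)
        (Prod.map α α ∘ g') := by
  refine funext_edges hK (fun e => ?_) (fun e => ?_)
  · rw [Function.comp_apply, joinEdges_left, joinEdges_left, Function.comp_apply]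
  · rw [Function.comp_apply, joinEdges_right, joinEdges_right, Function.comp_apply]
    have h0 : ∀ e : Fin (q + 1), sumPerm h α β (Fin.castLE (by omega) e) =
      Fin.castLE (by omega) (α e) := fun e => sumPerm_left h α β e
    exact Prod.ext (h0 _) (h0 _)

/-- A block permutation permutes the inserted vertices among themselves and the remaining vertices
of the outer graph, whose vertex 0 stays fixed (`extendPerm`). It therefore carries the
reconnections of the outer graph bijectively to those of the relabelled one. -/
theorem Gra.relabel_comp (d : ℕ) {p q M j k K : ℕ} (hM : p + q = M) (hK : j + k = K)
    (h : q + 1 + p = M + 1) (α : Equiv.Perm (Fin (q + 1))) (β : Equiv.Perm (Fin p))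
    (g : Gra 𝕂 d (p + 1) j) (g' : Gra 𝕂 d (q + 1) k) :
    Gra.relabel d (sumPerm h α β) (Gra.comp d hM hK g g') =
      Gra.comp d hM hK (Gra.relabel d (extendPerm β) g) (Gra.relabel d α g') := by
  induction g using Gra.induction_on with
  | zero => simp
  | add g₁ g₂ h₁ h₂ => simp only [map_add, LinearMap.add_apply, h₁, h₂]
  | smul c g h => simp only [map_smul, LinearMap.smul_apply, h]
  | mk g =>
    induction g' using Gra.induction_on with
    | zero => simp
    | add g₁ g₂ h₁ h₂ => simp only [map_add, h₁, h₂]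
    | smul c g h => simp only [map_smul, h]
    | mk g' =>
      rw [relabel_mk, relabel_mk, comp_mk, comp_mk, map_sum]
      have hs : ∀ w, (sumPerm h α β) ((sumPerm h α β).symm w) = w := fun w => Equiv.apply_symm_apply _ _
      refine Finset.sum_bij' (fun r _ => Prod.map (sumPerm h α β) (sumPerm h α β) ∘ r)
        (fun r _ => Prod.map (sumPerm h α β).symm (sumPerm h α β).symm ∘ r) ?_ ?_ ?_ ?_ ?_
      · intro r hr
        rw [mem_reconnections] at hr ⊢
        intro e
        simp only [Function.comp_apply, Prod.map_fst, Prod.map_snd, collapse_sumPerm, hr e, and_self]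
      · intro r hr
        rw [mem_reconnections] at hr ⊢
        intro e
        have := hr e
        simp only [Function.comp_apply, Prod.map_fst, Prod.map_snd] at this ⊢
        rw [← hs (r e).1, ← hs (r e).2, collapse_sumPerm, collapse_sumPerm] at this
        exact ⟨(extendPerm β).injective this.1, (extendPerm β).injective this.2⟩
      · intro r _
        funext e
        exact Prod.ext (Equiv.symm_apply_apply _ _) (Equiv.symm_apply_apply _ _)
      · intro r _
        funext e
        exact Prod.ext (hs _) (hs _)
      · intro r _
        rw [relabel_mk, joinEdges_map hM]

theorem mem_fGC {d : ℕ} {γ : GraphSeries 𝕂 d} : γ ∈ fGC 𝕂 d ↔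
    ∀ p k (σ : Equiv.Perm (Fin (p + 1))),
      (((Equiv.Perm.sign σ : ℤˣ) : ℤ) : 𝕂) ^ d • Gra.relabel d σ (γ p k) = γ p k := by
  constructor
  · intro h p k σ
    have := h p k σ⁻¹
    rwa [inv_inv, Equiv.Perm.sign_inv] at this
  · intro h p k σ
    have := h p k σ⁻¹
    rwa [Equiv.Perm.sign_inv] at this

theorem preLie_apply (d : ℕ) (γ γ' : GraphSeries 𝕂 d) (M K : ℕ) :
    preLie d γ γ' M K = ∑ p : Fin (M + 1), ∑ j : Fin (K + 1), ∑ τ ∈ shuffles (M - p) M,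
      (((Equiv.Perm.sign τ : ℤˣ) : ℤ) : 𝕂) ^ d • Gra.relabel d τ
        (Gra.comp d (show (p : ℕ) + (M - p) = M by omega) (show (j : ℕ) + (K - j) = K by omega)
          (γ p j) (γ' (M - p) (K - j))) := rfl

/-- By invariance of γ and γ' a summand depends only on the coset of its shuffle. The shuffle sum is
therefore a sum over the full symmetric group divided by factorials, and that sum is invariant under
translation. The division uses characteristic zero. -/
theorem preLie_mem_fGC [CharZero 𝕂] {d : ℕ} {γ γ' : GraphSeries 𝕂 d} (hγ : γ ∈ fGC 𝕂 d)
    (hγ' : γ' ∈ fGC 𝕂 d) : preLie d γ γ' ∈ fGC 𝕂 d := by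
  rw [mem_fGC] at hγ hγ' ⊢
  intro M K σ
  rw [preLie_apply, map_sum, Finset.smul_sum]
  refine Finset.sum_congr rfl fun p _ => ?_
  rw [map_sum, Finset.smul_sum]
  refine Finset.sum_congr rfl fun j _ => ?_
  set A := Gra.comp d (show (p : ℕ) + (M - p) = M by omega) (show (j : ℕ) + (K - j) = K by omega)
    (γ p j) (γ' (M - p) (K - j)) with hA
  let Φ : Equiv.Perm (Fin (M + 1)) → Gra 𝕂 d (M + 1) K := fun τ =>
    (((Equiv.Perm.sign τ : ℤˣ) : ℤ) : 𝕂) ^ d • Gra.relabel d τ A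
  have h : M - p + 1 + (p : ℕ) = M + 1 := by omega
  have hmul : ∀ ρ τ, Φ (ρ * τ) = (((Equiv.Perm.sign ρ : ℤˣ) : ℤ) : 𝕂) ^ d • Gra.relabel d ρ (Φ τ) := by
    intro ρ τ
    simp only [Φ, Gra.relabel_mul, map_smul, smul_smul, ← mul_pow]
    congr 2
    rw [map_mul]
    push_cast
    rfl
  have h1 : ∀ α β, Φ (sumPerm h α β) = A := by
    intro α β
    simp only [Φ]
    rw [hA, Gra.relabel_comp, sign_sumPerm]
    have e1 := hγ p j (extendPerm β)
    have e2 := hγ' (M - p) (K - j) α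
    rw [sign_extendPerm] at e1
    conv_rhs => rw [← e1, ← e2]
    rw [map_smul, map_smul, LinearMap.smul_apply, smul_smul, ← mul_pow]
    push_cast
    rfl
  have hΦ : ∀ ρ α β, Φ (ρ * sumPerm h α β) = Φ ρ := by
    intro ρ α β
    rw [hmul, h1]
  have hΦ' : ∀ ρ α β, Φ (σ * (ρ * sumPerm h α β)) = Φ (σ * ρ) := by
    intro ρ α β
    rw [← mul_assoc, hΦ]
  have s1 := shuffles_sum h Φ hΦ
  have s2 := shuffles_sum h (fun ρ => Φ (σ * ρ)) hΦ'
  rw [(Group.mulLeft_bijective σ).sum_comp Φ, ← s1, ← Nat.cast_smul_eq_nsmul 𝕂,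
    ← Nat.cast_smul_eq_nsmul 𝕂] at s2
  have hne : (((M - p + 1).factorial * (p : ℕ).factorial : ℕ) : 𝕂) ≠ 0 := by
    rw [Nat.cast_ne_zero]; positivity
  have s3 := smul_right_injective (Gra 𝕂 d (M + 1) K) hne s2
  refine Eq.trans ?_ s3
  rw [map_sum, Finset.smul_sum]
  exact Finset.sum_congr rfl fun τ _ => (hmul σ τ).symm

theorem preLie_mem_fGCdeg [CharZero 𝕂] {d : ℕ} {a b c : ℤ} {γ γ' : GraphSeries 𝕂 d}
    (hγ : γ ∈ fGCdeg 𝕂 d a) (hγ' : γ' ∈ fGCdeg 𝕂 d b) (hc : a + b = c) :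
    preLie d γ γ' ∈ fGCdeg 𝕂 d c := by
  refine ⟨preLie_mem_fGC hγ.1 hγ'.1, fun M K hMK => ?_⟩
  rw [preLie_apply]
  refine Finset.sum_eq_zero fun p _ => Finset.sum_eq_zero fun j _ => Finset.sum_eq_zero fun τ _ => ?_
  by_cases h1 : (d : ℤ) * (p : ℕ) + (j : ℕ) * (1 - (d : ℤ)) = a
  · have h2 : (d : ℤ) * ((M - p : ℕ) : ℤ) + ((K - j : ℕ) : ℤ) * (1 - (d : ℤ)) ≠ b := by
      intro h2
      apply hMK
      rw [← hc, ← h1, ← h2, Nat.cast_sub (by omega), Nat.cast_sub (by omega)]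
      ring
    rw [hγ'.2 _ _ h2, map_zero, map_zero, smul_zero]
  · rw [hγ.2 _ _ h1, map_zero, LinearMap.zero_apply, map_zero, smul_zero]

/-- Only finitely many numbers of edges occur for each number of vertices. -/
def EdgeFinite {d : ℕ} (γ : GraphSeries 𝕂 d) : Prop := ∀ M, ∃ B, ∀ p ≤ M, ∀ k, B ≤ k → γ p k = 0

theorem EdgeFinite.preLie {d : ℕ} {γ γ' : GraphSeries 𝕂 d} (hγ : EdgeFinite γ)
    (hγ' : EdgeFinite γ') : EdgeFinite (preLie d γ γ') := by
  intro M
  obtain ⟨B, hB⟩ := hγ M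
  obtain ⟨B', hB'⟩ := hγ' M
  refine ⟨B + B', fun M' hM' K hK => ?_⟩
  rw [preLie_apply]
  refine Finset.sum_eq_zero fun p _ => Finset.sum_eq_zero fun j _ => Finset.sum_eq_zero fun τ _ => ?_
  by_cases h1 : B ≤ j
  · rw [hB p (by omega) _ h1, map_zero, LinearMap.zero_apply, map_zero, smul_zero]
  · rw [hB' (M' - p) (by omega) _ (by omega), map_zero, map_zero, smul_zero]

/-- The graph with one vertex and no edges. -/
def unitGraph (d : ℕ) : GraphSeries 𝕂 d
  | 0, 0 => Gra.mk d fun e => e.elim0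
  | _, _ => 0

/-- The iterated products `((1 ∘ γ) ∘ γ) ∘ ⋯ ∘ γ`. -/
def graphPow (d : ℕ) (γ : GraphSeries 𝕂 d) : ℕ → GraphSeries 𝕂 d
  | 0 => unitGraph d
  | j + 1 => preLie d (graphPow d γ j) γ

theorem unitGraph_mem (d : ℕ) : unitGraph d ∈ fGCdeg 𝕂 d 0 := by
  refine ⟨mem_fGC.mpr fun p k σ => ?_, fun p k h => ?_⟩
  · match p, k with
    | 0, 0 =>
      rw [show σ = 1 from Equiv.ext fun i => Subsingleton.elim (α := Fin 1) _ _, Gra.relabel_one]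
      simp
    | 0, k + 1 => simp [unitGraph]
    | p + 1, k => simp [unitGraph]
  · match p, k with
    | 0, 0 => simp at h
    | 0, k + 1 => rfl
    | p + 1, k => rfl

theorem unitGraph_edgeFinite (d : ℕ) : EdgeFinite (unitGraph d : GraphSeries 𝕂 d) := by
  refine fun M => ⟨1, fun p _ k hk => ?_⟩
  match p, k with
  | 0, k + 1 => rfl
  | p + 1, k => rfl

theorem bracketGraph_edgeFinite (d : ℕ) : EdgeFinite (bracketGraph d : GraphSeries 𝕂 d) := by
  refine fun M => ⟨2, fun p _ k hk => ?_⟩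
  match p, k with
  | 0, k => rfl
  | 1, k + 2 => rfl
  | p + 2, k => rfl

theorem graphPow_mem [CharZero 𝕂] {d : ℕ} {γ : GraphSeries 𝕂 d} (hγ : γ ∈ fGCdeg 𝕂 d 0) (j : ℕ) :
    graphPow d γ j ∈ fGCdeg 𝕂 d 0 := by
  induction j with
  | zero => exact unitGraph_mem d
  | succ j ih => exact preLie_mem_fGCdeg ih hγ (add_zero 0)

theorem graphPow_edgeFinite {d : ℕ} {γ : GraphSeries 𝕂 d} (hγ : EdgeFinite γ) (j : ℕ) :
    EdgeFinite (graphPow d γ j) := by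
  induction j with
  | zero => exact unitGraph_edgeFinite d
  | succ j ih => exact ih.preLie hγ

/-- Without a one-vertex component every further factor γ adds at least one vertex. -/
theorem graphPow_eq_zero {d : ℕ} {γ : GraphSeries 𝕂 d} (hγ : ∀ k, γ 0 k = 0) {j p : ℕ} (hjp : p < j)
    (k : ℕ) : graphPow d γ j p k = 0 := by
  induction j generalizing p k with
  | zero => omega
  | succ j ih =>
    rw [graphPow, preLie_apply]
    refine Finset.sum_eq_zero fun i _ => Finset.sum_eq_zero fun l _ => Finset.sum_eq_zero fun τ _ => ?_
    by_cases h1 : (i : ℕ) < j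
    · rw [ih h1, map_zero, LinearMap.zero_apply, map_zero, smul_zero]
    · have : p - i = 0 := by omega
      have h2 : γ (p - i) (k - l) = 0 := by rw [this]; exact hγ _
      rw [h2, map_zero, map_zero, smul_zero]

end Closure

/-! ### Finiteness of the number of edges in degrees at most zero -/

section EdgeFinite

variable {𝕂 : Type*} [Field 𝕂]

/-- A loop equals its own reversal, which costs (-1)^d = -1. -/
theorem Gra.mk_eq_zero_of_loop [CharZero 𝕂] {d N k : ℕ} (hd : Odd d) (g : MDigraph N k) (e : Fin k)
    (h : (g e).1 = (g e).2) : (Gra.mk d g : Gra 𝕂 d N k) = 0 := by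
  have hf : flipEdge e g = g := by
    unfold flipEdge
    rw [show (g e).swap = g e from Prod.ext h.symm h, Function.update_eq_self]
  have := Gra.mk_flip (𝕂 := 𝕂) d g e
  rw [hf, hd.neg_one_pow, neg_smul, one_smul, ← add_eq_zero_iff_eq_neg, ← two_smul 𝕂] at this
  exact (smul_eq_zero.mp this).resolve_left two_ne_zero

/-- For n ≥ 1 the equation (n+1)p - nk = m determines k from p. For n = 0 it does not restrict k but
forces p = m ≤ 0, so there is only one vertex; every edge is then a loop, and loops vanish because d
= 1 is odd. This is where the bound m ≤ 0 enters. -/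
theorem edgeFinite_of_mem [CharZero 𝕂] {n : ℕ} {m : ℤ} (hm : m ≤ 0) {γ : GraphSeries 𝕂 (n + 1)}
    (hγ : γ ∈ fGCdeg 𝕂 (n + 1) m) : EdgeFinite γ := by
  intro M
  rcases Nat.eq_zero_or_pos n with rfl | hn
  · refine ⟨1, fun p _ k hk => ?_⟩
    by_cases hp : (p : ℤ) = m
    · have hp0 : p = 0 := by omega
      subst hp0
      refine Gra.induction_on (P := fun x => x = 0) (γ 0 k) (fun g => ?_) rfl
        (fun x y hx hy => by rw [hx, hy, add_zero]) (fun c x hx => by rw [hx, smul_zero])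
      exact Gra.mk_eq_zero_of_loop (by decide) g ⟨0, hk⟩ (Subsingleton.elim (α := Fin 1) _ _)
    · refine hγ.2 _ _ fun h => hp ?_
      rw [← h]
      push_cast
      ring
  · refine ⟨((n + 1) * M + m.natAbs + 1), fun p hp k hk => hγ.2 _ _ fun h => ?_⟩
    push_cast at h
    have h1 : ((n : ℤ) + 1) * p ≤ (n + 1) * M := by
      have : (p : ℤ) ≤ M := by exact_mod_cast hp
      gcongr
    have h2 : (k : ℤ) ≤ n * k := by
      have : (1 : ℤ) ≤ n := by exact_mod_cast hn
      nlinarith [Int.natCast_nonneg k]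
    have h3 : ((n : ℤ) + 1) * M + m.natAbs + 1 ≤ k := by exact_mod_cast hk
    have h4 : (m.natAbs : ℤ) = -m := by omega
    nlinarith

theorem sum_antidiagonal_eq_product {A : Type*} [AddCommMonoid A] (B : ℕ) (F : ℕ → ℕ → A)
    (h1 : ∀ j k, B ≤ j → F j k = 0) (h2 : ∀ j k, B ≤ k → F j k = 0) :
    ∑ K ∈ Finset.range (2 * B), ∑ j : Fin (K + 1), F j (K - j) =
      ∑ j ∈ Finset.range B, ∑ k ∈ Finset.range B, F j k := by
  rw [← Finset.sum_product', ← Finset.sum_fiberwise_of_maps_to (g := fun a : ℕ × ℕ => a.1 + a.2)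
    (t := Finset.range (2 * B)) (fun a ha => by
      rw [Finset.mem_product, Finset.mem_range, Finset.mem_range] at ha
      rw [Finset.mem_range]
      omega)]
  refine Finset.sum_congr rfl fun K _ => ?_
  rw [Fin.sum_univ_eq_sum_range (fun j => F j (K - j)) (K + 1),
    ← Finset.Nat.sum_antidiagonal_eq_sum_range_succ F]
  symm
  refine Finset.sum_subset (fun a ha => ?_) fun a ha ha' => ?_
  · rw [Finset.mem_filter] at ha
    rw [Finset.HasAntidiagonal.mem_antidiagonal]
    exact ha.2
  · rw [Finset.HasAntidiagonal.mem_antidiagonal] at ha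
    rw [Finset.mem_filter, Finset.mem_product, Finset.mem_range, Finset.mem_range] at ha'
    by_cases hB : B ≤ a.1
    · exact h1 _ _ hB
    · exact h2 _ _ (by by_contra h; exact ha' ⟨⟨by omega, by omega⟩, ha⟩)

theorem MultilinearMap.cons_sum {R : Type*} [AddCommGroup R] [Module 𝕂 R] {p : ℕ} {ι : Type*}
    (f : MultilinearMap 𝕂 (fun _ : Fin (p + 1) => R) R) (s : Finset ι) (b : ι → R) (z : Fin p → R) :
    f (Fin.cons (∑ i ∈ s, b i) z) = ∑ i ∈ s, f (Fin.cons (b i) z) := by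
  change f.curryLeft (∑ i ∈ s, b i) z = _
  rw [map_sum, sum_apply]
  rfl

theorem insertFirst_sum {R : Type*} [AddCommGroup R] [Module 𝕂 R] {p q r : ℕ} (h : p + q = r)
    (s t : Finset ℕ)
    (f : ℕ → MultilinearMap 𝕂 (fun _ : Fin (p + 1) => R) R)
    (g : ℕ → MultilinearMap 𝕂 (fun _ : Fin (q + 1) => R) R) :
    insertFirst h (∑ j ∈ s, f j) (∑ k ∈ t, g k) = ∑ j ∈ s, ∑ k ∈ t, insertFirst h (f j) (g k) := by
  refine MultilinearMap.ext fun x => ?_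
  simp only [insertFirst_apply, sum_apply, MultilinearMap.cons_sum]

end EdgeFinite

namespace PoissonSuperalgebra

variable {𝕂 : Type*} [Field 𝕂] {n : ℕ} {sg : Signature 𝕂 n}
  {R : Type*} [Ring R] [Algebra 𝕂 R] (S : PoissonSuperalgebra sg R)

/-! ### The cochains attached to graph series -/

/-- The cochain attached to a graph series. -/
def cochain (γ : GraphSeries 𝕂 (n + 1)) : Cochain 𝕂 R := fun p => ∑ᶠ k : ℕ, S.rep (γ p k)

theorem cochain_eq_sum {γ : GraphSeries 𝕂 (n + 1)} {p B : ℕ} (hB : ∀ k, B ≤ k → γ p k = 0) :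
    S.cochain γ p = ∑ k ∈ Finset.range B, S.rep (γ p k) := by
  refine finsum_eq_sum_of_support_subset _ fun k hk => ?_
  rw [Function.mem_support] at hk
  rw [Finset.coe_range, Set.mem_Iio]
  by_contra h
  exact hk (by rw [hB k (by omega), map_zero])

theorem cochain_eq_zero {γ : GraphSeries 𝕂 (n + 1)} {p : ℕ} (hγ : ∀ k, γ p k = 0) :
    S.cochain γ p = 0 := by
  rw [S.cochain_eq_sum (B := 0) fun k _ => hγ k, Finset.sum_range_zero]

theorem cochain_add_smul {γ γ' : GraphSeries 𝕂 (n + 1)} (hγ : EdgeFinite γ) (hγ' : EdgeFinite γ')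
    (c : 𝕂) (p : ℕ) : S.cochain (γ + c • γ') p = S.cochain γ p + c • S.cochain γ' p := by
  obtain ⟨B, hB⟩ := hγ p
  obtain ⟨B', hB'⟩ := hγ' p
  have h1 : ∀ k, max B B' ≤ k → γ p k = 0 := fun k hk => hB p le_rfl k (by omega)
  have h2 : ∀ k, max B B' ≤ k → γ' p k = 0 := fun k hk => hB' p le_rfl k (by omega)
  rw [S.cochain_eq_sum h1, S.cochain_eq_sum h2, S.cochain_eq_sum (B := max B B')]
  · simp only [Pi.add_apply, Pi.smul_apply, map_add, map_smul, Finset.sum_add_distrib,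
      Finset.smul_sum]
  · intro k hk
    rw [Pi.add_apply, Pi.add_apply, Pi.smul_apply, Pi.smul_apply, h1 k hk, h2 k hk, smul_zero,
      add_zero]

variable {R' : Type*} [Ring R'] [Algebra 𝕂 R'] {S' : PoissonSuperalgebra sg R'}

variable {S} in
theorem Hom.map_cochain (φ : Hom S S') {γ : GraphSeries 𝕂 (n + 1)} (hγ : EdgeFinite γ) (p : ℕ)
    (x : Fin (p + 1) → R) :
    φ.toFun (S.cochain γ p x) = S'.cochain γ p fun i => φ.toFun (x i) := by
  obtain ⟨B, hB⟩ := hγ p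
  rw [S.cochain_eq_sum (hB p le_rfl), S'.cochain_eq_sum (hB p le_rfl), sum_apply, sum_apply, map_sum]
  exact Finset.sum_congr rfl fun k _ => φ.map_rep _ _

theorem cochain_update {φ : Module.End 𝕂 R} (h : S.SuperCommutes 0 φ)
    (hl : ∀ x y, φ (x * y) = φ x * y) (hr : ∀ x y, φ (x * y) = x * φ y)
    {γ : GraphSeries 𝕂 (n + 1)} (hγ : EdgeFinite γ) {p : ℕ} (x : Fin (p + 1) → R)
    (i : Fin (p + 1)) :
    S.cochain γ p (Function.update x i (φ (x i))) = φ (S.cochain γ p x) := by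
  obtain ⟨B, hB⟩ := hγ p
  rw [S.cochain_eq_sum (hB p le_rfl), sum_apply, sum_apply, map_sum]
  exact Finset.sum_congr rfl fun k _ => S.rep_update h hl hr _ _ _

theorem cochain_derivation {φ : Module.End 𝕂 R} (h : S.SuperCommutes 0 φ)
    (hφ : ∀ x y, φ (x * y) = φ x * y + x * φ y)
    {γ : GraphSeries 𝕂 (n + 1)} (hγ : EdgeFinite γ) {p : ℕ} (x : Fin (p + 1) → R) :
    φ (S.cochain γ p x) = ∑ i, S.cochain γ p (Function.update x i (φ (x i))) := by
  obtain ⟨B, hB⟩ := hγ p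
  simp only [S.cochain_eq_sum (hB p le_rfl), sum_apply, map_sum]
  rw [Finset.sum_comm]
  exact Finset.sum_congr rfl fun k _ => S.derivation_rep h hφ _ _

theorem cochain_mem {m : ℤ} {γ : GraphSeries 𝕂 (n + 1)} (hγ : γ ∈ fGCdeg 𝕂 (n + 1) m)
    (hγ' : EdgeFinite γ) {p : ℕ} {l : ℤ} (c : Fin (p + 1) → ℤ) (x : Fin (p + 1) → R)
    (hx : ∀ i, x i ∈ S.homog (c i)) (hl : ∑ i, c i - (n + 1) * p + m = l) :
    S.cochain γ p x ∈ S.homog l := by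
  obtain ⟨B, hB⟩ := hγ' p
  rw [S.cochain_eq_sum (hB p le_rfl), sum_apply]
  refine sum_mem fun k _ => ?_
  by_cases h : ((n + 1 : ℕ) : ℤ) * p + k * (1 - ((n + 1 : ℕ) : ℤ)) = m
  · have := S.rep_mem (γ p k) c x hx
    convert this using 2
    rw [← hl, ← h]
    push_cast
    ring
  · rw [hγ.2 p k h, map_zero]
    exact zero_mem _

/-- In degree 0 one has nk = (n+1)p, so nk is even for either parity of n, and the sign (-1)^{enk}
of `rep_cons` disappears. -/
theorem cochain_cons {e : ℕ} {φ : Module.End 𝕂 R} (h : S.SuperCommutes e φ)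
    (hl : ∀ x y, φ (x * y) = φ x * y) {γ : GraphSeries 𝕂 (n + 1)} (hγ : γ ∈ fGCdeg 𝕂 (n + 1) 0)
    (hγ' : EdgeFinite γ) {p : ℕ} (y : R) (x : Fin p → R) :
    S.cochain γ p (Fin.cons (φ y) x) = φ (S.cochain γ p (Fin.cons y x)) := by
  obtain ⟨B, hB⟩ := hγ' p
  rw [S.cochain_eq_sum (hB p le_rfl), sum_apply, sum_apply, map_sum]
  refine Finset.sum_congr rfl fun k _ => ?_
  rw [S.rep_cons h hl]
  by_cases hk : ((n + 1 : ℕ) : ℤ) * p + k * (1 - ((n + 1 : ℕ) : ℤ)) = 0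
  · have h1 : n * k = (n + 1) * p := by
      have : (n : ℤ) * k = (n + 1) * p := by push_cast at hk; linarith
      exact_mod_cast this
    have h2 : Even (n * k) := by
      rcases Nat.even_or_odd n with hn | hn
      · exact hn.mul_right k
      · rw [h1]
        exact hn.add_one.mul_right p
    rw [mul_assoc, (h2.mul_left e).neg_one_pow, one_smul]
  · rw [hγ.2 p k hk]
    simp

/-- The action of the bracket graph is the bracket. -/
theorem cochain_bracketGraph (x : Fin 2 → R) :
    S.cochain (bracketGraph (n + 1)) 1 x = S.bracket (x 0) (x 1) := by
  have h2 : ∀ k, 2 ≤ k → (bracketGraph (n + 1) : GraphSeries 𝕂 (n + 1)) 1 k = 0 := by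
    intro k hk
    match k with
    | k + 2 => rfl
  rw [S.cochain_eq_sum h2, Finset.sum_range_succ, Finset.sum_range_one]
  change (S.rep (0 : Gra 𝕂 (n + 1) 2 0) + S.rep (Gra.mk (n + 1) fun _ => (0, 1)) :
    MultilinearMap 𝕂 (fun _ : Fin 2 => R) R) x = _
  rw [map_zero, zero_add, rep_mk]
  simp only [edgeProd, List.ofFn_succ, List.ofFn_zero, List.prod_cons, List.prod_nil, mul_one,
    edgeOp, bracket, LinearMap.sum_apply, LinearMap.smul_apply, map_sum, map_smul,
    Module.End.mul_apply, slotPd, slotOp_tprod, mulAll_tprod, LinearMap.compl₁₂_apply,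
    LinearMap.mul_apply']
  rfl

theorem cochain_bracketGraph_of_ne {p : ℕ} (hp : p ≠ 1) :
    S.cochain (bracketGraph (n + 1)) p = 0 := by
  refine S.cochain_eq_zero fun k => ?_
  match p, k with
  | 0, k => rfl
  | p + 2, k => rfl
  | 1, k => exact absurd rfl hp

variable [CharZero 𝕂]

/-- Invariance of γ and `rep_relabel` contribute the same sign sgn(τ)^{n+1}, so on arguments of
parity n + 1 the components are symmetric functions. -/
theorem cochain_perm {γ : GraphSeries 𝕂 (n + 1)} (hγ : γ ∈ fGC 𝕂 (n + 1)) (hγ' : EdgeFinite γ)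
    {p : ℕ} (τ : Equiv.Perm (Fin (p + 1))) (x : Fin (p + 1) → R)
    (hx : ∀ i, S.par (x i) = (-1 : 𝕂) ^ (n + 1) • x i) :
    S.cochain γ p (x ∘ τ) = S.cochain γ p x := by
  obtain ⟨B, hB⟩ := hγ' p
  rw [S.cochain_eq_sum (hB p le_rfl), sum_apply, sum_apply]
  refine Finset.sum_congr rfl fun k _ => ?_
  rw [← S.rep_relabel τ _ x hx, ← smul_apply, ← map_smul, mem_fGC.mp hγ p k τ]

theorem cochain_update_const {γ : GraphSeries 𝕂 (n + 1)} (hγ : γ ∈ fGC 𝕂 (n + 1))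
    (hγ' : EdgeFinite γ) {p : ℕ} (i : Fin (p + 1)) {v m : R}
    (hv : S.par v = (-1 : 𝕂) ^ (n + 1) • v) (hm : S.par m = (-1 : 𝕂) ^ (n + 1) • m) :
    S.cochain γ p (Function.update (fun _ => m) i v) =
      S.cochain γ p (Fin.cons v fun _ => m) := by
  rw [← S.cochain_perm hγ hγ' (Equiv.swap 0 i) (Fin.cons v fun _ => m)]
  · congr 1
    funext l
    by_cases hl : l = i
    · subst hl; simp
    · rw [Function.update_of_ne hl, Function.comp_apply]
      by_cases hl0 : l = 0
      · subst hl0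
        rw [Equiv.swap_apply_left, ← Fin.succ_pred i (Ne.symm hl), Fin.cons_succ]
      · rw [Equiv.swap_apply_of_ne_of_ne hl0 hl, ← Fin.succ_pred l hl0, Fin.cons_succ]
  · intro l
    cases l using Fin.cases with
    | zero => exact hv
    | succ l => exact hm

/-- The chain rule. -/
theorem derivation_cochain_const {φ : Module.End 𝕂 R} (h : S.SuperCommutes 0 φ)
    (hφ : ∀ x y, φ (x * y) = φ x * y + x * φ y)
    {γ : GraphSeries 𝕂 (n + 1)} (hγ : γ ∈ fGC 𝕂 (n + 1)) (hγ' : EdgeFinite γ) (p : ℕ) {m : R}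
    (hm : S.par m = (-1 : 𝕂) ^ (n + 1) • m) :
    φ (S.cochain γ p fun _ => m) = ((p + 1 : ℕ) : 𝕂) • S.cochain γ p (Fin.cons (φ m) fun _ => m) := by
  have hv : S.par (φ m) = (-1 : 𝕂) ^ (n + 1) • φ m := by
    have := congrArg (fun T => T m) h.par
    simp only [Module.End.mul_apply, pow_zero, one_smul, hm, map_smul] at this
    exact this.symm
  rw [S.cochain_derivation h hφ hγ']
  simp only [S.cochain_update_const hγ hγ' _ hv hm]
  rw [Finset.sum_const, Finset.card_univ, Fintype.card_fin, Nat.cast_smul_eq_nsmul]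

/-- On even arguments the representation turns the pre-Lie product of graphs into that of
cochains. -/
theorem cochain_preLie {γ γ' : GraphSeries 𝕂 (n + 1)} (hγ : EdgeFinite γ) (hγ' : EdgeFinite γ')
    (M : ℕ) (x : Fin (M + 1) → R) (hx : ∀ i, S.par (x i) = (-1 : 𝕂) ^ (n + 1) • x i) :
    S.cochain (preLie (n + 1) γ γ') M x = ∑ p : Fin (M + 1), ∑ τ ∈ shuffles (M - p) M,
      insertFirst (show (p : ℕ) + (M - p) = M by omega) (S.cochain γ p) (S.cochain γ' (M - p))
        (x ∘ τ) := by
  obtain ⟨B₁, hB₁⟩ := hγ M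
  obtain ⟨B₂, hB₂⟩ := hγ' M
  -- A common bound for the numbers of edges of both series. The product then has fewer than 2B
  -- edges in the components concerned, and all sums over edge numbers are finite.
  set B := max B₁ B₂ with hB
  have h1 : ∀ p ≤ M, ∀ k, B ≤ k → γ p k = 0 := fun p hp k hk => hB₁ p hp k (by omega)
  have h2 : ∀ p ≤ M, ∀ k, B ≤ k → γ' p k = 0 := fun p hp k hk => hB₂ p hp k (by omega)
  have h3 : ∀ K, 2 * B ≤ K → preLie (n + 1) γ γ' M K = 0 := by
    intro K hK
    rw [preLie_apply]
    refine Finset.sum_eq_zero fun p _ => Finset.sum_eq_zero fun j _ => Finset.sum_eq_zero fun τ _ => ?_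
    by_cases hj : B ≤ j
    · rw [h1 p (by omega) _ hj, map_zero, LinearMap.zero_apply, map_zero, smul_zero]
    · rw [h2 (M - p) (by omega) _ (by omega), map_zero, map_zero, smul_zero]
  rw [S.cochain_eq_sum h3, sum_apply]
  have h4 : ∀ K, S.rep (preLie (n + 1) γ γ' M K) x = ∑ p : Fin (M + 1), ∑ τ ∈ shuffles (M - p) M,
      ∑ j : Fin (K + 1), insertFirst (show (p : ℕ) + (M - p) = M by omega) (S.rep (γ p j))
        (S.rep (γ' (M - p) (K - j))) (x ∘ τ) := by
    intro K
    rw [preLie_apply, map_sum, sum_apply]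
    refine Finset.sum_congr rfl fun p _ => ?_
    conv_rhs => rw [Finset.sum_comm]
    rw [map_sum, sum_apply]
    refine Finset.sum_congr rfl fun j _ => ?_
    rw [map_sum, sum_apply]
    refine Finset.sum_congr rfl fun τ _ => ?_
    rw [map_smul, smul_apply, S.rep_relabel τ _ x hx, S.rep_comp]
  simp only [h4]
  rw [Finset.sum_comm]
  refine Finset.sum_congr rfl fun p _ => ?_
  rw [Finset.sum_comm]
  refine Finset.sum_congr rfl fun τ _ => ?_
  rw [sum_antidiagonal_eq_product B (fun j k =>
    insertFirst (show (p : ℕ) + (M - p) = M by omega) (S.rep (γ p j))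
        (S.rep (γ' (M - p) k)) (x ∘ τ)), S.cochain_eq_sum (h1 p (by omega)),
    S.cochain_eq_sum (h2 (M - p) (by omega)), insertFirst_sum]
  · simp only [sum_apply]
  · intro j k hj
    rw [h1 p (by omega) j hj, map_zero, insertFirst_apply, zero_apply]
  · intro j k hk
    rw [h2 (M - p) (by omega) k hk, map_zero, insertFirst_apply, zero_apply]
    exact (S.rep (γ p j)).map_coord_zero 0 rfl

/-- On equal arguments all shuffles contribute the same value, and the binomial coefficient counts
them. -/
theorem cochain_preLie_const {γ γ' : GraphSeries 𝕂 (n + 1)} (hγ : EdgeFinite γ)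
    (hγ' : EdgeFinite γ') (M : ℕ) {m : R} (hm : S.par m = (-1 : 𝕂) ^ (n + 1) • m) :
    S.cochain (preLie (n + 1) γ γ') M (fun _ => m) = ∑ p ∈ Finset.range (M + 1),
      ((M + 1).choose (M - p + 1) : 𝕂) •
        S.cochain γ p (Fin.cons (S.cochain γ' (M - p) fun _ => m) fun _ => m) := by
  rw [S.cochain_preLie hγ hγ' M _ fun _ => hm, ← Fin.sum_univ_eq_sum_range
    (fun p => ((M + 1).choose (M - p + 1) : 𝕂) •
        S.cochain γ p (Fin.cons (S.cochain γ' (M - p) fun _ => m) fun _ => m))]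
  refine Finset.sum_congr rfl fun p _ => ?_
  rw [← shuffles_card (show M - p + 1 + (p : ℕ) = M + 1 by omega), Nat.cast_smul_eq_nsmul,
    ← Finset.sum_const]
  rfl

/-- The bracket graph has only a component with two arguments, so a single term survives in each of
the two products. The coefficients count the shuffles of types (p+1, 1) and (2, p). -/
theorem cochain_graphDiff_const {γ : GraphSeries 𝕂 (n + 1)} (hγ : EdgeFinite γ) (a : ℤ) (p : ℕ)
    {m : R} (hm : S.par m = (-1 : 𝕂) ^ (n + 1) • m) :
    S.cochain (graphDiff (n + 1) a γ) (p + 1) (fun _ => m) =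
      ((p + 2 : ℕ) : 𝕂) • S.bracket (S.cochain γ p fun _ => m) m - (-1 : 𝕂) ^ a •
        ((p + 2).choose 2 : 𝕂) • S.cochain γ p (Fin.cons (S.bracket m m) fun _ => m) := by
  have hb := bracketGraph_edgeFinite (𝕂 := 𝕂) (n + 1)
  have : graphDiff (n + 1) a γ = preLie (n + 1) (bracketGraph (n + 1)) γ +
      (-(-1 : 𝕂) ^ a) • preLie (n + 1) γ (bracketGraph (n + 1)) := by
    simp [graphDiff, sub_eq_add_neg]
  rw [this, S.cochain_add_smul (hb.preLie hγ) (hγ.preLie hb), add_apply, smul_apply,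
    S.cochain_preLie_const hb hγ _ hm, S.cochain_preLie_const hγ hb _ hm, neg_smul, ← sub_eq_add_neg]
  congr 1
  · rw [Finset.sum_eq_single 1]
    · rw [cochain_bracketGraph]
      simp
      congr 1
      ring
    · intro b _ hb
      rw [cochain_bracketGraph_of_ne _ hb, zero_apply, smul_zero]
    · simp
  · congr 1
    rw [Finset.sum_eq_single p]
    · rw [show p + 1 - p = 1 by omega, cochain_bracketGraph]
    · intro b hb hb'
      rw [Finset.mem_range] at hb
      rw [cochain_bracketGraph_of_ne _ (show p + 1 - b ≠ 1 by omega), zero_apply]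
      rw [(S.cochain γ b).map_coord_zero 0 rfl, smul_zero]
    · intro h
      rw [Finset.mem_range] at h
      omega

theorem cochain_graphDiff_zero {γ : GraphSeries 𝕂 (n + 1)} (hγ : EdgeFinite γ) (a : ℤ)
    {m : R} (hm : S.par m = (-1 : 𝕂) ^ (n + 1) • m) :
    S.cochain (graphDiff (n + 1) a γ) 0 (fun _ => m) = 0 := by
  have hb := bracketGraph_edgeFinite (𝕂 := 𝕂) (n + 1)
  have : graphDiff (n + 1) a γ = preLie (n + 1) (bracketGraph (n + 1)) γ +
      (-(-1 : 𝕂) ^ a) • preLie (n + 1) γ (bracketGraph (n + 1)) := by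
    simp [graphDiff, sub_eq_add_neg]
  rw [this, S.cochain_add_smul (hb.preLie hγ) (hγ.preLie hb), add_apply, smul_apply,
    S.cochain_preLie_const hb hγ _ hm, S.cochain_preLie_const hγ hb _ hm]
  rw [Finset.sum_range_one, Finset.sum_range_one, cochain_bracketGraph_of_ne _ (by decide),
    zero_apply, zero_apply, (S.cochain γ 0).map_coord_zero 0 rfl]
  simp

end PoissonSuperalgebra

/-! ### Functions on a graded symplectic domain -/

section Smooth

variable {𝕂 : Type*} [RCLike 𝕂] {ι : Type} [Fintype ι] {U : TopologicalSpace.Opens (ι → ℝ)}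

theorem ext0_mul (f g : SmoothFun 𝕂 U) : ext0 (f * g) = ext0 f * ext0 g := by
  funext x
  by_cases hx : x ∈ U
  · simpa using (ext0_apply (f * g) ⟨x, hx⟩).trans
      (congrArg₂ (· * ·) (ext0_apply f ⟨x, hx⟩).symm (ext0_apply g ⟨x, hx⟩).symm)
  · simp [ext0_of_notMem _ hx]

theorem pdSmooth_mul [DecidableEq ι] (i : ι) (f g : SmoothFun 𝕂 U) :
    pdSmooth U i (f * g) = pdSmooth U i f * g + f * pdSmooth U i g := by
  refine Subtype.ext (funext fun x => ?_)
  change fderiv ℝ (ext0 (f * g)) x (Pi.single i 1) = fderiv ℝ (ext0 f) x (Pi.single i 1) *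
    (g : U → 𝕂) x + (f : U → 𝕂) x * fderiv ℝ (ext0 g) x (Pi.single i 1)
  rw [ext0_mul, fderiv_mul ((smoothFun_contDiffAt f x).differentiableAt (by simp))
      ((smoothFun_contDiffAt g x).differentiableAt (by simp)), ext0_apply, ext0_apply]
  simp only [add_apply, smul_apply, smul_eq_mul]
  ring

end Smooth

section Tensor

variable {𝕂 A B : Type*} [Field 𝕂] [Ring A] [Algebra 𝕂 A] [Ring B] [Algebra 𝕂 B]

theorem map_right_leibniz (D : Module.End 𝕂 B) (hD : ∀ x y, D (x * y) = D x * y + x * D y)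
    (x y : A ⊗[𝕂] B) :
    TensorProduct.map LinearMap.id D (x * y) = TensorProduct.map LinearMap.id D x * y +
      x * TensorProduct.map LinearMap.id D y := by
  induction x with
  | zero => simp
  | add x x' hx hx' => simp only [add_mul, map_add, hx, hx']; abel
  | tmul a b =>
    induction y with
    | zero => simp
    | add y y' hy hy' => simp only [mul_add, map_add, hy, hy']; abel
    | tmul a' b' => simp [hD, TensorProduct.tmul_add]

theorem map_left_leibniz (D P : Module.End 𝕂 A) (hD : ∀ x y, D (x * y) = D x * y + P x * D y)
    (x y : A ⊗[𝕂] B) :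
    TensorProduct.map D LinearMap.id (x * y) = TensorProduct.map D LinearMap.id x * y +
      TensorProduct.map P LinearMap.id x * TensorProduct.map D LinearMap.id y := by
  induction x with
  | zero => simp
  | add x x' hx hx' => simp only [add_mul, map_add, hx, hx']; abel
  | tmul a b =>
    induction y with
    | zero => simp
    | add y y' hy hy' => simp only [mul_add, map_add, hy, hy']; abel
    | tmul a' b' => simp [hD, TensorProduct.add_tmul]

theorem map_left_involutive (P : Module.End 𝕂 A) (hP : ∀ x, P (P x) = x) (x : A ⊗[𝕂] B) :
    TensorProduct.map P LinearMap.id (TensorProduct.map P LinearMap.id x) = x := by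
  induction x with
  | zero => simp
  | add x y hx hy => rw [map_add, map_add, hx, hy]
  | tmul a b => simp [hP]

/-- The second tensor factor is commutative and carries no parity, so the identity of the first
factor is inherited. -/
theorem tensor_supercomm {B : Type*} [CommRing B] [Algebra 𝕂 B] (P : Module.End 𝕂 A)
    (hP : ∀ x y, (2 : 𝕂) • (x * y) = y * x + y * P x + P y * x - P y * P x) (x y : A ⊗[𝕂] B) :
    (2 : 𝕂) • (x * y) = y * x + y * TensorProduct.map P LinearMap.id x +
      TensorProduct.map P LinearMap.id y * x -
      TensorProduct.map P LinearMap.id y * TensorProduct.map P LinearMap.id x := by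
  induction x with
  | zero => simp
  | add x x' hx hx' =>
    simp only [mul_add, map_add, add_mul, smul_add, hx, hx']
    abel
  | tmul a b =>
    induction y with
    | zero => simp
    | add y y' hy hy' =>
      simp only [mul_add, map_add, add_mul, smul_add, hy, hy']
      abel
    | tmul a' b' =>
      simp only [TensorProduct.map_tmul, Algebra.TensorProduct.tmul_mul_tmul, LinearMap.id_apply]
      rw [TensorProduct.smul_tmul', hP, mul_comm b']
      simp only [TensorProduct.add_tmul, TensorProduct.sub_tmul]

theorem map_middle_leibniz {C : Type*} [CommRing C] [Algebra 𝕂 C] (D : Derivation 𝕂 C C)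
    (x y : A ⊗[𝕂] (C ⊗[𝕂] B)) :
    TensorProduct.map LinearMap.id (TensorProduct.map (D : C →ₗ[𝕂] C) LinearMap.id) (x * y) =
      TensorProduct.map LinearMap.id (TensorProduct.map (D : C →ₗ[𝕂] C) LinearMap.id) x * y +
      x * TensorProduct.map LinearMap.id (TensorProduct.map (D : C →ₗ[𝕂] C) LinearMap.id) y := by
  refine map_right_leibniz _ (fun x y => ?_) x y
  refine (map_left_leibniz (D : C →ₗ[𝕂] C) LinearMap.id (fun p q => ?_) x y).trans ?_
  · simp only [Derivation.coeFn_coe, Derivation.leibniz, smul_eq_mul, LinearMap.id_apply]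
    ring
  · rw [TensorProduct.map_id]
    rfl

theorem mul_mem_span {s t u : Set A} (h : ∀ x ∈ s, ∀ y ∈ t, x * y ∈ u) {x y : A}
    (hx : x ∈ Submodule.span 𝕂 s) (hy : y ∈ Submodule.span 𝕂 t) : x * y ∈ Submodule.span 𝕂 u := by
  have := Submodule.mul_mem_mul hx hy
  rw [Submodule.span_mul_span] at this
  refine Submodule.span_mono ?_ this
  rintro _ ⟨x, hx, y, hy, rfl⟩
  exact h x hx y hy

end Tensor

section Exterior

variable {𝕂 M : Type*} [Field 𝕂] [AddCommGroup M] [Module 𝕂 M]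

theorem contractLeft_mul (φ : Module.Dual 𝕂 M) (x y : ExteriorAlgebra 𝕂 M) :
    CliffordAlgebra.contractLeft (Q := (0 : QuadraticForm 𝕂 M)) φ (x * y) =
      CliffordAlgebra.contractLeft φ x * y +
        CliffordAlgebra.involute x * CliffordAlgebra.contractLeft φ y := by
  induction x using CliffordAlgebra.left_induction with
  | algebraMap r => simp [CliffordAlgebra.contractLeft_algebraMap_mul]
  | add x x' hx hx' => simp only [add_mul, map_add, hx, hx']; abel
  | ι_mul x m hx =>
    rw [mul_assoc, CliffordAlgebra.contractLeft_ι_mul, hx, CliffordAlgebra.contractLeft_ι_mul,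
      map_mul, CliffordAlgebra.involute_ι, sub_mul, smul_mul_assoc, mul_add]
    simp only [neg_mul, mul_assoc]
    abel

theorem ι_mul_eq_involute_mul (v : M) (x : ExteriorAlgebra 𝕂 M) :
    CliffordAlgebra.ι (0 : QuadraticForm 𝕂 M) v * x =
      CliffordAlgebra.involute x * CliffordAlgebra.ι (0 : QuadraticForm 𝕂 M) v := by
  induction x using CliffordAlgebra.left_induction with
  | algebraMap r =>
    rw [AlgHom.commutes]
    exact (Algebra.commutes r _).symm
  | add x x' hx hx' => simp only [mul_add, map_add, hx, hx', add_mul]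
  | ι_mul x m hx =>
    have h : CliffordAlgebra.ι (0 : QuadraticForm 𝕂 M) v * CliffordAlgebra.ι 0 m =
        -(CliffordAlgebra.ι (0 : QuadraticForm 𝕂 M) m * CliffordAlgebra.ι 0 v) := by
      have := CliffordAlgebra.ι_mul_ι_add_swap (Q := (0 : QuadraticForm 𝕂 M)) v m
      rw [eq_neg_iff_add_eq_zero, this]
      simp [QuadraticMap.polar]
    rw [← mul_assoc, h, neg_mul, mul_assoc, hx, map_mul, CliffordAlgebra.involute_ι, neg_mul, neg_mul,
      mul_assoc]

/-- Induction on the left factor: moving a generator across y replaces y by its involute, and this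
permutes the four terms of the right hand side among themselves. -/
theorem exterior_supercomm (x y : ExteriorAlgebra 𝕂 M) :
    (2 : 𝕂) • (x * y) = y * x + y * CliffordAlgebra.involute x +
      CliffordAlgebra.involute y * x - CliffordAlgebra.involute y * CliffordAlgebra.involute x := by
  induction x using CliffordAlgebra.left_induction with
  | algebraMap r =>
    rw [AlgHom.commutes, two_smul, Algebra.commutes]
    abel
  | add x x' hx hx' =>
    simp only [mul_add, map_add, add_mul, smul_add, hx, hx']
    abel
  | ι_mul x m hx =>
    rw [mul_assoc, ← mul_smul_comm, hx, map_mul, CliffordAlgebra.involute_ι]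
    have h := ι_mul_eq_involute_mul m y
    have h' := ι_mul_eq_involute_mul m (CliffordAlgebra.involute y)
    rw [CliffordAlgebra.involute_involute] at h'
    simp only [mul_add, mul_sub, ← mul_assoc, h, h', neg_mul, mul_neg]
    abel

/-- Contraction removes one factor belonging to A at a time, so a monomial goes to a combination of
monomials whose degree is lower by deg A. This is the homogeneity of odd derivatives. -/
theorem contractLeft_prod_mem {ι : Type*} [DecidableEq ι] (Q : QuadraticForm 𝕂 (ι → 𝕂))
    (deg : ι → ℕ) (A : ι) (l : List ι) :
    CliffordAlgebra.contractLeft (Q := Q) (LinearMap.proj A)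
        (l.map fun A => CliffordAlgebra.ι Q (Pi.single A (1 : 𝕂))).prod ∈
      Submodule.span 𝕂 {x : CliffordAlgebra Q | ∃ l' : List ι,
        (l'.map deg).sum + deg A = (l.map deg).sum ∧
        x = (l'.map fun A => CliffordAlgebra.ι Q (Pi.single A (1 : 𝕂))).prod} := by
  induction l with
  | nil => simp
  | cons B l ih =>
    rw [List.map_cons (f := fun A => CliffordAlgebra.ι Q (Pi.single A (1 : 𝕂))), List.prod_cons,
      CliffordAlgebra.contractLeft_ι_mul]
    refine sub_mem ?_ ?_
    · by_cases h : A = B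
      · subst h
        exact Submodule.smul_mem _ _ (Submodule.subset_span ⟨l, by simp [add_comm], rfl⟩)
      · have : (LinearMap.proj A : (ι → 𝕂) →ₗ[𝕂] 𝕂) (Pi.single B 1) = 0 := by
          simp [h]
        rw [this, zero_smul]
        exact zero_mem _
    · have key := Submodule.mem_map_of_mem
        (f := LinearMap.mulLeft 𝕂 (CliffordAlgebra.ι Q (Pi.single B (1 : 𝕂) : ι → 𝕂))) ih
      rw [Submodule.map_span] at key
      refine Submodule.span_mono ?_ key
      rintro _ ⟨_, ⟨l', hl', rfl⟩, rfl⟩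
      exact ⟨B :: l', by simp [add_assoc, hl'], by simp⟩

end Exterior

namespace NPDomain

variable {𝕂 : Type*} [RCLike 𝕂] {n : ℕ} (V : NPDomain 𝕂 n)

/-- The coordinate degrees and the Poisson tensor of a domain. -/
def signature : Signature 𝕂 n where
  size := V.size
  deg := V.deg
  w := V.poisson
  w_deg := V.poisson_deg
  w_symm := V.poisson_symm

theorem preParity_mul (x y : V.PreFun) :
    V.preParity (x * y) = V.preParity x * V.preParity y :=
  map_mul (Algebra.TensorProduct.map
    (CliffordAlgebra.involute (Q := (0 : QuadraticForm 𝕂 (V.OddCoord → 𝕂))))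
    (AlgHom.id 𝕂 (MvPolynomial V.EvenCoord 𝕂 ⊗[𝕂] SmoothFun 𝕂 V.base))) x y

theorem preParity_one : V.preParity 1 = 1 :=
  map_one (Algebra.TensorProduct.map
    (CliffordAlgebra.involute (Q := (0 : QuadraticForm 𝕂 (V.OddCoord → 𝕂))))
    (AlgHom.id 𝕂 (MvPolynomial V.EvenCoord 𝕂 ⊗[𝕂] SmoothFun 𝕂 V.base)))

theorem preParity_preParity (x : V.PreFun) : V.preParity (V.preParity x) = x :=
  map_left_involutive _ CliffordAlgebra.involute_involute x

theorem contractLeft_leibniz (φ : Module.Dual 𝕂 (V.OddCoord → 𝕂))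
    (x y : ExteriorAlgebra 𝕂 (V.OddCoord → 𝕂)) :
    CliffordAlgebra.contractLeft (Q := (0 : QuadraticForm 𝕂 (V.OddCoord → 𝕂))) φ (x * y) =
      CliffordAlgebra.contractLeft (Q := (0 : QuadraticForm 𝕂 (V.OddCoord → 𝕂))) φ x * y +
        CliffordAlgebra.involute (Q := (0 : QuadraticForm 𝕂 (V.OddCoord → 𝕂))) x *
          CliffordAlgebra.contractLeft (Q := (0 : QuadraticForm 𝕂 (V.OddCoord → 𝕂))) φ y :=
  contractLeft_mul φ x y

theorem map_exterior_leibniz (D P : Module.End 𝕂 (ExteriorAlgebra 𝕂 (V.OddCoord → 𝕂)))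
    (hD : ∀ x y, D (x * y) = D x * y + P x * D y) (x y : V.PreFun) :
    TensorProduct.map D LinearMap.id (x * y) = TensorProduct.map D LinearMap.id x * y +
      TensorProduct.map P LinearMap.id x * TensorProduct.map D LinearMap.id y :=
  map_left_leibniz D P hD x y

theorem preParity_pow_even {k : ℕ} (hk : Even k) : V.preParity ^ k = 1 := by
  have hsq : V.preParity * V.preParity = 1 := LinearMap.ext V.preParity_preParity
  obtain ⟨l, rfl⟩ := hk
  rw [← two_mul, pow_mul, pow_two, hsq, one_pow]

theorem preParity_pow_odd {k : ℕ} (hk : Odd k) : V.preParity ^ k = V.preParity := by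
  obtain ⟨l, rfl⟩ := hk
  rw [pow_succ, V.preParity_pow_even ⟨l, two_mul l⟩, one_mul]

set_option maxHeartbeats 1000000 in
theorem prePd_mul_odd {A : Fin V.size} (h0 : V.deg A ≠ 0) (h1 : Odd (V.deg A)) (x y : V.PreFun) :
    V.prePd A (x * y) = V.prePd A x * y + V.preParity x * V.prePd A y := by
  rw [prePd, dif_neg h0, dif_pos h1]
  exact V.map_exterior_leibniz _ _ (V.contractLeft_leibniz _) x y

theorem prePd_mul_zero {A : Fin V.size} (h0 : V.deg A = 0) (x y : V.PreFun) :
    V.prePd A (x * y) = V.prePd A x * y + x * V.prePd A y := by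
  rw [prePd, dif_pos h0]
  exact map_right_leibniz _ (map_right_leibniz _ (pdSmooth_mul _)) x y

theorem prePd_mul_even {A : Fin V.size} (h0 : V.deg A ≠ 0) (h1 : ¬ Odd (V.deg A)) (x y : V.PreFun) :
    V.prePd A (x * y) = V.prePd A x * y + x * V.prePd A y := by
  rw [prePd, dif_neg h0, dif_neg h1]
  exact map_middle_leibniz _ x y

theorem prePd_mul (A : Fin V.size) (x y : V.PreFun) :
    V.prePd A (x * y) = V.prePd A x * y + (V.preParity ^ V.deg A) x * V.prePd A y := by
  by_cases h1 : Odd (V.deg A)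
  · rw [V.preParity_pow_odd h1]
    exact V.prePd_mul_odd (by rintro h; simp [h] at h1) h1 x y
  · rw [V.preParity_pow_even (Nat.not_odd_iff_even.mp h1)]
    by_cases h0 : V.deg A = 0
    · exact V.prePd_mul_zero h0 x y
    · exact V.prePd_mul_even h0 h1 x y

theorem preFun_supercomm (x y : V.PreFun) :
    (2 : 𝕂) • (x * y) = y * x + y * V.preParity x + V.preParity y * x -
      V.preParity y * V.preParity x :=
  tensor_supercomm _ exterior_supercomm x y

/-- The monomials of the algebra of functions. -/
def monom (l : List V.OddCoord) (m : V.EvenCoord →₀ ℕ) (f : SmoothFun 𝕂 V.base) : V.PreFun :=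
  (l.map fun A => ExteriorAlgebra.ι 𝕂 (Pi.single A (1 : 𝕂))).prod ⊗ₜ[𝕂]
      (MvPolynomial.monomial m (1 : 𝕂) ⊗ₜ[𝕂] f)

/-- The degree of a monomial. -/
def monomDeg (l : List V.OddCoord) (m : V.EvenCoord →₀ ℕ) : ℕ :=
  (l.map fun A : V.OddCoord => V.deg A.1).sum + (m.sum fun A e => e * V.deg A)

/-- The homogeneous functions, graded by the integers. -/
def homogInt (k : ℤ) : Submodule 𝕂 V.Fun :=
  Submodule.span 𝕂 {x | ∃ l m f, (V.monomDeg l m : ℤ) = k ∧ x = V.ofPre (V.monom l m f)}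

theorem homogInt_natCast (k : ℕ) : V.homogInt k = V.homog k := by
  have h : ∀ l : List V.OddCoord, (l.map fun A => V.deg A).sum =
      (l.map fun A : V.OddCoord => V.deg A.1).sum := by
    intro l
    induction l with
    | nil => rfl
    | cons A l ih => simp
  unfold homog homogInt
  congr 1
  ext x
  simp only [h]
  constructor
  · rintro ⟨l, m, f, h, rfl⟩
    exact ⟨l, m, f, by exact_mod_cast h, rfl⟩
  · rintro ⟨l, m, f, h, rfl⟩
    exact ⟨l, m, f, by exact_mod_cast h, rfl⟩

theorem involute_monom (l : List V.OddCoord) :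
    (CliffordAlgebra.involute (Q := (0 : QuadraticForm 𝕂 (V.OddCoord → 𝕂))))
      (l.map fun A => ExteriorAlgebra.ι 𝕂 (Pi.single A (1 : 𝕂))).prod =
    (-1 : 𝕂) ^ (l.map fun A : V.OddCoord => V.deg A.1).sum •
      (l.map fun A => ExteriorAlgebra.ι 𝕂 (Pi.single A (1 : 𝕂))).prod := by
  induction l with
  | nil =>
    rw [List.map_nil, List.prod_nil, List.map_nil, List.sum_nil, pow_zero, one_smul]
    exact map_one _
  | cons A l ih =>
    have : (CliffordAlgebra.involute (Q := (0 : QuadraticForm 𝕂 (V.OddCoord → 𝕂))))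
        (ExteriorAlgebra.ι 𝕂 (Pi.single A (1 : 𝕂))) = -ExteriorAlgebra.ι 𝕂 (Pi.single A (1 : 𝕂)) :=
      CliffordAlgebra.involute_ι _
    rw [List.map_cons, List.prod_cons, List.map_cons, List.sum_cons]
    refine (map_mul _ _ _).trans ?_
    rw [ih, pow_add, A.2.neg_one_pow, this, mul_smul_comm, neg_mul, smul_neg, neg_one_mul,
      neg_smul]

theorem parity_of_mem {k : ℤ} {x : V.Fun} (hx : x ∈ V.homogInt k) :
    V.parity x = (-1 : 𝕂) ^ k • x := by
  induction hx using Submodule.span_induction with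
  | zero => simp
  | add x y _ _ hx hy => rw [map_add, hx, hy, smul_add]
  | smul c x _ hx => rw [map_smul, hx, smul_comm]
  | mem x hx =>
    obtain ⟨l, m, f, rfl, rfl⟩ := hx
    have h2 : Even (m.sum fun A e => e * V.deg A) :=
      Finset.even_sum _ fun A _ => (A.2.2).mul_left _
    have key : V.preParity (V.monom l m f) = (-1 : 𝕂) ^ V.monomDeg l m • V.monom l m f := by
      rw [monom, preParity, TensorProduct.map_tmul, LinearMap.id_apply, TensorProduct.smul_tmul',
        monomDeg, pow_add, h2.neg_one_pow, mul_one]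
      exact congrArg (· ⊗ₜ[𝕂] _) (V.involute_monom l)
    rw [zpow_natCast]
    exact key

theorem homogInt_mul_mem {k k' : ℤ} {x y : V.Fun} (hx : x ∈ V.homogInt k)
    (hy : y ∈ V.homogInt k') : x * y ∈ V.homogInt (k + k') := by
  refine mul_mem_span ?_ hx hy
  rintro _ ⟨l, m, f, rfl, rfl⟩ _ ⟨l', m', f', rfl, rfl⟩
  refine ⟨l ++ l', m + m', f * f', ?_, ?_⟩
  · unfold monomDeg
    rw [List.map_append, List.sum_append, Finsupp.sum_add_index']
    · push_cast; ring
    · simp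
    · intros; ring
  · have : V.monom l m f * V.monom l' m' f' = V.monom (l ++ l') (m + m') (f * f') := by
      unfold monom
      rw [Algebra.TensorProduct.tmul_mul_tmul, Algebra.TensorProduct.tmul_mul_tmul,
        MvPolynomial.monomial_mul, one_mul, List.map_append, List.prod_append]
    exact this

theorem prePd_monom_even {A : Fin V.size} (h0 : V.deg A ≠ 0) (h1 : ¬ Odd (V.deg A))
    (l : List V.OddCoord) (m : V.EvenCoord →₀ ℕ) (f : SmoothFun 𝕂 V.base) :
    V.prePd A (V.monom l m f) = ((m ⟨A, h0, Nat.not_odd_iff_even.mp h1⟩ : ℕ) : 𝕂) •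
      V.monom l (m - Finsupp.single ⟨A, h0, Nat.not_odd_iff_even.mp h1⟩ 1) f := by
  rw [prePd, dif_neg h0, dif_neg h1, monom, TensorProduct.map_tmul, TensorProduct.map_tmul,
    Derivation.coeFn_coe, MvPolynomial.pderiv_monomial, one_mul, monom, ← TensorProduct.tmul_smul,
    TensorProduct.smul_tmul', MvPolynomial.smul_monomial, smul_eq_mul, mul_one]
  rfl

theorem pd_monom_even {A : Fin V.size} (h0 : V.deg A ≠ 0) (h1 : ¬ Odd (V.deg A))
    (l : List V.OddCoord) (m : V.EvenCoord →₀ ℕ) (f : SmoothFun 𝕂 V.base) :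
    V.pd A (V.ofPre (V.monom l m f)) = ((m ⟨A, h0, Nat.not_odd_iff_even.mp h1⟩ : ℕ) : 𝕂) •
      V.ofPre (V.monom l (m - Finsupp.single ⟨A, h0, Nat.not_odd_iff_even.mp h1⟩ 1) f) :=
  (congrArg V.ofPre.toLinearMap (V.prePd_monom_even h0 h1 l m f)).trans
    (LinearMap.map_smul _ _ _)

theorem pd_mem {A : Fin V.size} {k : ℤ} {x : V.Fun} (hx : x ∈ V.homogInt k) :
    V.pd A x ∈ V.homogInt (k - V.deg A) := by
  induction hx using Submodule.span_induction with
  | zero => rw [map_zero]; exact zero_mem _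
  | add x x' _ _ hx hx' => rw [map_add]; exact add_mem hx hx'
  | smul c x _ hx => rw [map_smul]; exact Submodule.smul_mem _ _ hx
  | mem x hx =>
    obtain ⟨l, m, f, rfl, rfl⟩ := hx
    by_cases h0 : V.deg A = 0
    · rw [h0]
      refine Submodule.subset_span ⟨l, m, pdSmooth V.base ⟨A, h0⟩ f, ?_, ?_⟩
      · simp
      change V.ofPre (V.prePd A (V.monom l m f)) = _
      · rw [prePd, dif_pos h0]
        rfl
    · by_cases h1 : Odd (V.deg A)
      · have key := Submodule.mem_map_of_mem
          (f := V.ofPre.toLinearMap ∘ₗ (TensorProduct.mk 𝕂 (ExteriorAlgebra 𝕂 (V.OddCoord → 𝕂))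
            (MvPolynomial V.EvenCoord 𝕂 ⊗[𝕂] SmoothFun 𝕂 V.base)).flip
            (MvPolynomial.monomial m (1 : 𝕂) ⊗ₜ[𝕂] f)) (contractLeft_prod_mem
            (0 : QuadraticForm 𝕂 (V.OddCoord → 𝕂)) (fun A => V.deg A.1) ⟨A, h1⟩ l)
        rw [Submodule.map_span] at key
        change V.ofPre (V.prePd A (V.monom l m f)) ∈ _
        rw [prePd, dif_neg h0, dif_pos h1]
        refine Submodule.span_mono ?_ key
        rintro _ ⟨_, ⟨l', hl', rfl⟩, rfl⟩
        refine ⟨l', m, f, ?_, rfl⟩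
        simp only [monomDeg, ← hl']
        push_cast
        ring
      · have hA : V.deg A ≠ 0 ∧ Even (V.deg A) := ⟨h0, Nat.not_odd_iff_even.mp h1⟩
        rw [V.pd_monom_even h0 h1]
        by_cases hm : m ⟨A, hA⟩ = 0
        · rw [hm, Nat.cast_zero, zero_smul]
          exact zero_mem _
        · refine Submodule.smul_mem _ _ (Submodule.subset_span ⟨_, _, _, ?_, rfl⟩)
          have hs : m = (m - Finsupp.single ⟨A, hA⟩ 1) + Finsupp.single ⟨A, hA⟩ 1 := by
            refine (tsub_add_cancel_of_le ?_).symm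
            rw [Finsupp.single_le_iff]
            omega
          unfold monomDeg
          conv_rhs => rw [hs, Finsupp.sum_add_index' (by simp) (by intros; ring),
            Finsupp.sum_single_index (by simp)]
          push_cast
          ring

/-- The functions on a domain form a Poisson superalgebra. -/
def superalgebra : PoissonSuperalgebra V.signature V.Fun where
  par := V.parity
  pd := V.pd
  homog := V.homogInt
  par_one := V.preParity_one
  par_mul := V.preParity_mul
  par_par := V.preParity_preParity
  pd_par := V.pd_mul_parity
  pd_pd := V.pd_mul_pd
  pd_mul := by
    intro A x y
    have h : ∀ k, V.parity ^ k = V.ofPre.toLinearEquiv.conj (V.preParity ^ k) := by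
      intro k
      induction k with
      | zero => rfl
      | succ k ih => rw [pow_succ, ih, pow_succ]; rfl
    change V.pd A (x * y) = V.pd A x * y + (V.parity ^ V.deg A) x * V.pd A y
    rw [h]
    exact V.prePd_mul A x y
  supercomm := V.preFun_supercomm
  one_mem := by
    refine Submodule.subset_span ⟨[], 0, 1, ?_, ?_⟩
    · simp [monomDeg]
    · rfl
  mul_mem := V.homogInt_mul_mem
  par_of_mem := V.parity_of_mem
  pd_mem := V.pd_mem

theorem mem_superalgebra_homog {k : ℕ} {x : V.Fun} :
    x ∈ V.superalgebra.homog k ↔ x ∈ V.homog k := by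
  rw [← homogInt_natCast]
  rfl

theorem superalgebra_bracket : V.superalgebra.bracket = V.bracket := rfl

end NPDomain

/-! ### The exponential of a coderivation on Hamiltonian functions -/

section NR

variable {𝕂 M : Type*} [Field 𝕂] [CharZero 𝕂] [AddCommGroup M] [Module 𝕂 M]

theorem parityPart_apply {s : Module.End 𝕂 M} {d : ℕ} {x : M} (hx : s x = (-1 : 𝕂) ^ d • x)
    (a : Fin 2) : parityPart s a x = if (a : ℕ) = d % 2 then x else 0 := by
  have h : (-1 : 𝕂) ^ d = (-1) ^ (d % 2) := (neg_one_pow_eq_pow_mod_two d)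
  have h2 : (2⁻¹ : 𝕂) * 2 = 1 := inv_mul_cancel₀ two_ne_zero
  have h3 : (2⁻¹ : 𝕂) • (x + x) = x := by rw [← two_smul 𝕂, smul_smul, h2, one_smul]
  rw [parityPart, LinearMap.smul_apply, LinearMap.add_apply, LinearMap.smul_apply,
    Module.End.one_apply, hx, smul_smul, h]
  obtain hd | hd := Nat.mod_two_eq_zero_or_one d
  · rw [hd]
    fin_cases a <;> simp [h3]
  · rw [hd]
    fin_cases a <;> simp [h3]

/-- For constant parity the product runs over the inversions of τ, each of which contributes -1 when
the parity is odd and 1 when it is even. -/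
theorem koszulSign_const {N : ℕ} (τ : Equiv.Perm (Fin N)) (a : Fin 2) :
    (koszulSign τ (fun _ => a) : 𝕂) = (((Equiv.Perm.sign τ : ℤˣ) : ℤ) : 𝕂) ^ (a : ℕ) := by
  rw [Equiv.Perm.sign_eq_prod_prod_Ioi, koszulSign]
  push_cast
  rw [← Finset.prod_pow]
  refine Finset.prod_congr rfl fun i _ => ?_
  rw [← Finset.prod_pow]
  have : Finset.Ioi i = Finset.univ.filter fun j => i < j := by ext; simp
  rw [this, Finset.prod_filter]
  refine Finset.prod_congr rfl fun j _ => ?_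
  by_cases hij : i < j
  · have hne : τ i ≠ τ j := fun h => hij.ne (τ.injective h)
    by_cases h : τ j < τ i
    · have h' : ¬ τ i < τ j := not_lt.mpr h.le
      fin_cases a <;> simp [hij, h, h']
    · have h' : τ i < τ j := lt_of_le_of_ne (not_lt.mp h) hne
      simp [hij, h, h']
  · simp [hij]

/-- If all arguments have parity d, only the constant family of parity projections survives. Its
Koszul sign is sgn(τ)^d and cancels the prefactor, which leaves a plain permutation of the
arguments. -/
theorem permAct_apply {s : Module.End 𝕂 M} {d N : ℕ} (τ : Equiv.Perm (Fin (N + 1)))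
    (θ : MultilinearMap 𝕂 (fun _ : Fin (N + 1) => M) M) (x : Fin (N + 1) → M)
    (hx : ∀ i, s (x i) = (-1 : 𝕂) ^ d • x i) :
    (((Equiv.Perm.sign τ : ℤˣ) : ℤ) : 𝕂) ^ d • permAct s τ θ x = θ (x ∘ τ) := by
  have h1 : ∀ a : Fin (N + 1) → Fin 2,
      ((θ.compLinearMap fun i => parityPart s (a i)).domDomCongr τ) x =
        θ fun i => parityPart s (a i) (x (τ i)) := fun a => rfl
  set a₀ : Fin 2 := ⟨d % 2, Nat.mod_lt _ two_pos⟩ with ha₀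
  rw [permAct, sum_apply, Finset.sum_eq_single (fun _ => a₀)]
  · rw [smul_apply, h1, koszulSign_const, smul_smul, ← pow_add]
    have h2 : (((Equiv.Perm.sign τ : ℤˣ) : ℤ) : 𝕂) ^ (d + (a₀ : ℕ)) = 1 := by
      have : Even (d + (a₀ : ℕ)) := by
        rw [ha₀]
        rw [Nat.even_iff]
        simp only
        omega
      obtain h | h := Int.units_eq_one_or (Equiv.Perm.sign τ)
      · simp [h]
      · simp [h, this.neg_one_pow]
    rw [h2, one_smul]
    congr 1
    funext i
    rw [parityPart_apply (hx _), if_pos rfl]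
    rfl
  · intro a _ ha
    rw [smul_apply, h1]
    obtain ⟨i, hi⟩ : ∃ i, a i ≠ a₀ := by
      by_contra h
      push Not at h
      exact ha (funext h)
    rw [θ.map_coord_zero i, smul_zero]
    rw [parityPart_apply (hx _), if_neg]
    intro h
    exact hi (Fin.ext h)
  · simp

theorem insertFirst_zero_right {p q r : ℕ} (h : p + q = r)
    (f : MultilinearMap 𝕂 (fun _ : Fin (p + 1) => M) M) :
    insertFirst h f (0 : MultilinearMap 𝕂 (fun _ : Fin (q + 1) => M) M) = 0 := by
  ext x
  rw [insertFirst_apply, zero_apply, zero_apply]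
  exact f.map_coord_zero 0 rfl

theorem insertFirst_zero_left {p q r : ℕ} (h : p + q = r)
    (g : MultilinearMap 𝕂 (fun _ : Fin (q + 1) => M) M) :
    insertFirst h (0 : MultilinearMap 𝕂 (fun _ : Fin (p + 1) => M) M) g = 0 := by
  ext x
  rw [insertFirst_apply, zero_apply, zero_apply]

theorem permAct_zero (s : Module.End 𝕂 M) {N : ℕ} (τ : Equiv.Perm (Fin N)) :
    permAct s τ (0 : MultilinearMap 𝕂 (fun _ : Fin N => M) M) = 0 := by
  refine Finset.sum_eq_zero fun a _ => ?_
  ext x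
  exact smul_zero _

theorem nrPow_eq_zero (d : ℕ) (s : Module.End 𝕂 M) {D : Cochain 𝕂 M} (hD : D 0 = 0) {j p : ℕ}
    (hjp : p < j) : nrPow d s D j p = 0 := by
  induction j generalizing p with
  | zero => omega
  | succ j ih =>
    rw [nrPow, nrProd]
    refine Finset.sum_eq_zero fun i _ => Finset.sum_eq_zero fun τ _ => ?_
    by_cases h1 : (i : ℕ) < j
    · rw [ih h1, insertFirst_zero_left, permAct_zero, smul_zero]
    · have : p - i = 0 := by omega
      have h2 : D (p - i) = 0 := by rw [this]; exact hD
      rw [h2, insertFirst_zero_right, permAct_zero, smul_zero]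

theorem cochainExp_eq_sum (d : ℕ) (s : Module.End 𝕂 M) {D : Cochain 𝕂 M} (hD : D 0 = 0) (p : ℕ) :
    cochainExp d s D p = ∑ j ∈ Finset.range (p + 1), ((j.factorial : 𝕂)⁻¹) • nrPow d s D j p := by
  refine finsum_eq_sum_of_support_subset _ fun j hj => ?_
  by_contra h
  refine hj ?_
  dsimp only
  rw [nrPow_eq_zero d s hD (by simpa using h), smul_zero]

end NR

/-- Since H sits in order ε, only the exponents (1,…,1) contribute, and ε^{p+1} sees only the
component with p + 1 arguments. -/
theorem evalSeries_monomial {𝕂 R : Type*} [Field 𝕂] [Ring R] [Algebra 𝕂 R] (U : Cochain 𝕂 R)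
    (H : R) (p : ℕ) : PowerSeries.coeff (p + 1) (evalSeries U (PowerSeries.monomial 1 H)) =
      (((p + 1).factorial : 𝕂)⁻¹) • U p fun _ => H := by
  have hterm : ∀ (q : ℕ) (a : Fin (q + 1) → ℕ), a ≠ (fun _ => 1) →
      (U q fun i => PowerSeries.coeff (a i) (PowerSeries.monomial 1 H)) = 0 := by
    intro q a ha
    obtain ⟨i, hi⟩ : ∃ i, a i ≠ 1 := by
      by_contra h
      push Not at h
      exact ha (funext h)
    exact (U q).map_coord_zero i (by rw [PowerSeries.coeff_monomial, if_neg hi])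
  rw [evalSeries, PowerSeries.coeff_mk, Finset.sum_eq_single p]
  · rw [Finset.sum_eq_single fun _ => 1]
    · simp
    · exact fun a _ ha => hterm p a ha
    · intro h
      exact absurd (by simp) h
  · intro q _ hq
    rw [Finset.sum_eq_zero, smul_zero]
    intro a ha
    refine hterm q a ?_
    rintro rfl
    rw [Finset.mem_piAntidiag] at ha
    have := ha.1
    simp at this
    omega
  · simp

theorem evalSeries_monomial_zero {𝕂 R : Type*} [Field 𝕂] [Ring R] [Algebra 𝕂 R] (U : Cochain 𝕂 R)
    (H : R) : PowerSeries.coeff 0 (evalSeries U (PowerSeries.monomial 1 H)) = 0 := by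
  simp [evalSeries]

namespace PoissonSuperalgebra

variable {𝕂 : Type*} [Field 𝕂] [CharZero 𝕂] {n : ℕ} {sg : Signature 𝕂 n}
  {R : Type*} [Ring R] [Algebra 𝕂 R] (S : PoissonSuperalgebra sg R)

theorem cochain_unitGraph (m : Fin 1 → R) : S.cochain (unitGraph (n + 1)) 0 m = m 0 := by
  have h2 : ∀ k, 1 ≤ k → (unitGraph (n + 1) : GraphSeries 𝕂 (n + 1)) 0 k = 0 := by
    rintro (_ | k) hk
    · omega
    · rfl
  rw [S.cochain_eq_sum h2, Finset.sum_range_one, unitGraph, rep_mk]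
  simp [edgeProd, mulAll_tprod]

theorem cochain_unitGraph_succ (p : ℕ) : S.cochain (unitGraph (n + 1)) (p + 1) = 0 :=
  S.cochain_eq_zero fun _ => rfl

theorem par_of_mem_top {x : R} (hx : x ∈ S.homog (n + 1)) : S.par x = (-1 : 𝕂) ^ (n + 1) • x := by
  rw [S.par_of_mem hx]
  norm_cast

theorem cochain_mem_top {γ : GraphSeries 𝕂 (n + 1)} (hγ : γ ∈ fGCdeg 𝕂 (n + 1) 0) {p : ℕ}
    (x : Fin (p + 1) → R) (hx : ∀ i, x i ∈ S.homog (n + 1)) :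
    S.cochain γ p x ∈ S.homog (n + 1) :=
  S.cochain_mem hγ (edgeFinite_of_mem le_rfl hγ) (fun _ => n + 1) x hx (by simp; ring)

/-- On arguments of degree n + 1 both products are the same unsigned sum over shuffles. A series of
degree 0 maps such arguments to values of degree n + 1, which is what lets the induction hypothesis
apply to the outer factor. -/
theorem nrPow_cochain {γ : GraphSeries 𝕂 (n + 1)} (hγ : γ ∈ fGCdeg 𝕂 (n + 1) 0) (j p : ℕ)
    (x : Fin (p + 1) → R) (hx : ∀ i, x i ∈ S.homog (n + 1)) :
    nrPow (n + 1) S.par (S.cochain γ) j p x = S.cochain (graphPow (n + 1) γ j) p x := by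
  have hγf := edgeFinite_of_mem le_rfl hγ
  induction j generalizing p with
  | zero =>
    cases p with
    | zero =>
      rw [graphPow, cochain_unitGraph]
      rfl
    | succ p =>
      rw [graphPow, cochain_unitGraph_succ]
      rfl
  | succ j ih =>
    rw [graphPow, S.cochain_preLie (graphPow_edgeFinite hγf j) hγf p x
      fun i => S.par_of_mem_top (hx i), nrPow, nrProd, sum_apply]
    refine Finset.sum_congr rfl fun i _ => ?_
    rw [sum_apply]
    refine Finset.sum_congr rfl fun τ _ => ?_
    rw [smul_apply, permAct_apply τ _ x fun i => S.par_of_mem_top (hx i), insertFirst_apply,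
      insertFirst_apply, ih]
    intro l
    refine Fin.cases ?_ (fun l => ?_) l
    · exact S.cochain_mem_top hγ _ fun i => hx _
    · exact hx _

end PoissonSuperalgebra

/-! ### Cocycles of degree zero have no one-vertex component -/

section Cocycle

variable {𝕂 : Type*} [Field 𝕂]

/-- The graph with two vertices and one edge does not vanish. -/
theorem edge_ne_zero (d : ℕ) : (Gra.mk d (fun _ => (0, 1)) : Gra 𝕂 d 2 1) ≠ 0 := by
  -- A functional compatible with edge reversal that takes the value 1 on the edge; it descends to
  -- the quotient and detects the graph there.
  let F : MDigraph 2 1 → 𝕂 := fun g =>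
    if g 0 = (0, 1) then 1 else if g 0 = (1, 0) then (-1) ^ d else 0
  have hflip : ∀ g e, F (flipEdge e g) = (-1 : 𝕂) ^ d • F g := by
    intro g e
    obtain rfl : e = 0 := Subsingleton.elim _ _
    have hd : (-1 : 𝕂) ^ d * (-1) ^ d = 1 := by rw [← pow_add, Even.neg_one_pow ⟨_, rfl⟩]
    simp only [F, flipEdge, Function.update_self]
    generalize g 0 = e
    obtain ⟨a, b⟩ := e
    fin_cases a <;> fin_cases b <;> simp [Prod.ext_iff, hd]
  have hperm : ∀ g (σ : Equiv.Perm (Fin 1)),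
      F (g ∘ σ) = (((Equiv.Perm.sign σ : ℤˣ) : ℤ) : 𝕂) ^ (d + 1) • F g := by
    intro g σ
    obtain rfl : σ = 1 := Subsingleton.elim _ _
    simp
  intro h
  have := congrArg (Gra.lift d F hperm hflip) h
  rw [Gra.lift_mk, map_zero] at this
  simp [F] at this

theorem gra_one_zero (d : ℕ) (x : Gra 𝕂 d 1 0) :
    ∃ c : 𝕂, x = c • Gra.mk d (fun e => e.elim0) := by
  refine Gra.induction_on (P := fun x => ∃ c : 𝕂, x = c • Gra.mk d fun e => e.elim0) x
    (fun g => ⟨1, ?_⟩) ⟨0, (zero_smul _ _).symm⟩ ?_ ?_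
  · rw [one_smul]
    congr 1
    funext e
    exact e.elim0
  · rintro _ _ ⟨a, rfl⟩ ⟨b, rfl⟩
    exact ⟨a + b, (add_smul _ _ _).symm⟩
  · rintro c _ ⟨a, rfl⟩
    exact ⟨c * a, smul_smul _ _ _⟩

end Cocycle

section Cocycle

variable {𝕂 : Type*} [Field 𝕂]

theorem comp_edge_point (d : ℕ) :
    Gra.comp (𝕂 := 𝕂) d (show 1 + 0 = 1 from rfl) (show 1 + 0 = 1 from rfl)
      (Gra.mk d fun _ => (0, 1)) (Gra.mk d fun e => e.elim0) = Gra.mk d fun _ => (0, 1) := by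
  rw [Gra.comp_mk]
  have h : reconnections (show 1 + 0 = 1 from rfl) (fun _ => (0, 1) : MDigraph 2 1) =
      {fun _ => (0, 1)} := by decide
  rw [h, Finset.sum_singleton]
  congr 1
  funext e
  obtain rfl : e = 0 := Subsingleton.elim _ _
  rfl

theorem comp_point_edge (d : ℕ) :
    Gra.comp (𝕂 := 𝕂) d (show 0 + 1 = 1 from rfl) (show 0 + 1 = 1 from rfl)
      (Gra.mk d fun e => e.elim0) (Gra.mk d fun _ => (0, 1)) = Gra.mk d fun _ => (0, 1) := by
  rw [Gra.comp_mk]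
  have h : reconnections (show 0 + 1 = 1 from rfl) (fun e => e.elim0 : MDigraph 1 0) =
      {fun e => e.elim0} := by decide
  rw [h, Finset.sum_singleton]
  congr 1
  funext e
  obtain rfl : e = 0 := Subsingleton.elim _ _
  rfl

theorem bracketGraph_mem (d : ℕ) : (bracketGraph d : GraphSeries 𝕂 d) ∈ fGC 𝕂 d := by
  refine mem_fGC.mpr fun p k σ => ?_
  match p, k with
  | 1, 1 =>
    have hd : (-1 : 𝕂) ^ d * (-1) ^ d = 1 := by rw [← pow_add, Even.neg_one_pow ⟨_, rfl⟩]
    have h2 : σ = 1 ∨ σ = Equiv.swap 0 1 := by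
      revert σ
      decide
    rcases h2 with rfl | rfl
    · simp [Gra.relabel_one]
    · have hf : Gra.relabel (𝕂 := 𝕂) d (Equiv.swap 0 1) (Gra.mk d fun _ : Fin 1 => ((0 : Fin 2), 1)) =
          (-1 : 𝕂) ^ d • Gra.mk d fun _ => (0, 1) := by
        rw [Gra.relabel_mk, ← Gra.mk_flip d _ (0 : Fin 1)]
        congr 1
        funext e
        obtain rfl : e = 0 := Subsingleton.elim _ _
        simp [flipEdge]
      rw [bracketGraph, hf, Equiv.Perm.sign_swap (by decide), smul_smul]
      simp [hd]
  | 0, k => simp [bracketGraph]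
  | 1, 0 => simp [bracketGraph]
  | 1, k + 2 => simp [bracketGraph]
  | p + 2, k => simp [bracketGraph]

/-- The one-vertex part of a cocycle of degree zero vanishes. -/
theorem cocycle_zero [CharZero 𝕂] {n : ℕ} {γ : GraphSeries 𝕂 (n + 1)}
    (hγ : γ ∈ cocycles 𝕂 (n + 1) 0) (k : ℕ) : γ 0 k = 0 := by
  -- With one vertex and at least one edge, the degree -n(k+1) is nonzero for n ≥ 1, and for n = 0
  -- every edge is a loop.
  have hpos : ∀ k, γ 0 (k + 1) = 0 := by
    intro k
    by_cases hn : n = 0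
    · subst hn
      refine Gra.induction_on (P := fun x => x = 0) (γ 0 (k + 1)) (fun g => ?_) rfl
        (fun x y hx hy => by rw [hx, hy, add_zero]) (fun c x hx => by rw [hx, smul_zero])
      exact Gra.mk_eq_zero_of_loop (by decide) g 0 (Subsingleton.elim (α := Fin 1) _ _)
    · refine hγ.1.2 _ _ fun h => ?_
      push_cast at h
      have : ((k : ℤ) + 1) * n = 0 := by linarith
      rcases mul_eq_zero.mp this with h | h
      · omega
      · exact hn (by exact_mod_cast h)
  match k with
  | k + 1 => exact hpos k
  | 0 =>
    -- What remains is c times the point. With Γ the edge, its differential is 2cΓ - cΓ = cΓ: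
    -- inserting the point into Γ involves two shuffles, inserting Γ into the point only one. As Γ
    -- does not vanish, c = 0.
    obtain ⟨c, hc⟩ := gra_one_zero (n + 1) (γ 0 0)
    have h := congrFun (congrFun (LinearMap.mem_ker.mp hγ.2) 1) 1
    have hcomm : graphDiff (n + 1) 0 γ = preLie (n + 1) (bracketGraph (n + 1)) γ -
        preLie (n + 1) γ (bracketGraph (n + 1)) := by
      simp [graphDiff]
    have hsh : shuffles (1 - 1) 1 = Finset.univ := by decide
    have hsh' : shuffles (1 - 0) 1 = {1} := by decide
    rw [hcomm] at h
    change preLie (n + 1) (bracketGraph (n + 1)) γ 1 1 -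
      preLie (n + 1) γ (bracketGraph (n + 1)) 1 1 = 0 at h
    have h1 : preLie (n + 1) (bracketGraph (n + 1)) γ 1 1 =
        (2 * c) • Gra.mk (n + 1) fun _ => (0, 1) := by
      rw [preLie_apply]
      refine (Finset.sum_eq_single (1 : Fin 2) ?_ fun h => absurd (Finset.mem_univ _) h).trans ?_
      · intro p _ hp
        obtain rfl : p = 0 := by omega
        refine Finset.sum_eq_zero (ι := Fin 2) fun j _ => Finset.sum_eq_zero fun τ _ => ?_
        change _ • Gra.relabel (n + 1) τ (Gra.comp (n + 1) _ _ 0 _) = 0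
        rw [map_zero, LinearMap.zero_apply, map_zero, smul_zero]
      · refine (Finset.sum_eq_single (1 : Fin 2) ?_ fun h => absurd (Finset.mem_univ _) h).trans ?_
        · intro p _ hp
          obtain rfl : p = 0 := by omega
          refine Finset.sum_eq_zero fun τ _ => ?_
          change _ • Gra.relabel (n + 1) τ (Gra.comp (n + 1) _ _ 0 _) = 0
          rw [map_zero, LinearMap.zero_apply, map_zero, smul_zero]
        · change ∑ τ ∈ shuffles (1 - 1) 1, (((Equiv.Perm.sign τ : ℤˣ) : ℤ) : 𝕂) ^ (n + 1) •
            Gra.relabel (n + 1) τ (Gra.comp (n + 1) (show 1 + 0 = 1 from rfl)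
              (show 1 + 0 = 1 from rfl) (Gra.mk (n + 1) fun _ => (0, 1)) (γ 0 0)) = _
          have h2 : ∀ τ : Equiv.Perm (Fin 2), (((Equiv.Perm.sign τ : ℤˣ) : ℤ) : 𝕂) ^ (n + 1) •
              Gra.relabel (n + 1) τ (Gra.mk (n + 1) fun _ : Fin 1 => ((0 : Fin 2), 1)) =
                Gra.mk (n + 1) fun _ => (0, 1) :=
            mem_fGC.mp (bracketGraph_mem (𝕂 := 𝕂) (n + 1)) 1 1
          rw [hsh, hc, map_smul, comp_edge_point]
          simp only [map_smul, smul_comm _ c, h2]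
          rw [Finset.sum_const, Finset.card_univ, Fintype.card_perm, Fintype.card_fin,
            ← Nat.cast_smul_eq_nsmul 𝕂, smul_smul]
          norm_num [Nat.factorial]
    have h2 : preLie (n + 1) γ (bracketGraph (n + 1)) 1 1 =
        c • Gra.mk (n + 1) fun _ => (0, 1) := by
      refine (Finset.sum_eq_single (0 : Fin 2) ?_ fun h => absurd (Finset.mem_univ _) h).trans ?_
      · intro p _ hp
        obtain rfl : p = 1 := by omega
        refine Finset.sum_eq_zero fun j _ => Finset.sum_eq_zero fun τ _ => ?_
        change _ • Gra.relabel (n + 1) τ (Gra.comp (n + 1) _ _ _ 0) = 0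
        rw [map_zero, map_zero, smul_zero]
      · refine (Finset.sum_eq_single (0 : Fin 2) ?_ fun h => absurd (Finset.mem_univ _) h).trans ?_
        · intro p _ hp
          obtain rfl : p = 1 := by omega
          refine Finset.sum_eq_zero fun τ _ => ?_
          change _ • Gra.relabel (n + 1) τ (Gra.comp (n + 1) _ _ (γ 0 1) _) = 0
          rw [hpos, map_zero, LinearMap.zero_apply, map_zero, smul_zero]
        · change ∑ τ ∈ shuffles (1 - 0) 1, (((Equiv.Perm.sign τ : ℤˣ) : ℤ) : 𝕂) ^ (n + 1) •
            Gra.relabel (n + 1) τ (Gra.comp (n + 1) (show 0 + 1 = 1 from rfl)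
              (show 0 + 1 = 1 from rfl) (γ 0 0) (Gra.mk (n + 1) fun _ => (0, 1))) = _
          rw [hsh', Finset.sum_singleton, hc, map_smul, LinearMap.smul_apply, comp_point_edge]
          simp [Gra.relabel_one]
    rw [h1, h2, ← sub_smul] at h
    have h3 := (smul_eq_zero.mp h).resolve_right (edge_ne_zero _)
    have h4 : c = 0 := by linear_combination h3
    rw [hc, h4, zero_smul]

end Cocycle

/-! ### Polynomials and power series with coefficients in a Poisson superalgebra -/

/-- A ring of formal expressions `∑ t^N a_N` in a central variable `t`, described by its
coefficient maps. -/
structure CoeffExt (𝕂 R R' : Type*) [Field 𝕂] [Ring R] [Algebra 𝕂 R] [Ring R'] [Algebra 𝕂 R'] where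
  coeff : ℕ → R' →ₗ[𝕂] R
  ext : ∀ {x y}, (∀ N, coeff N x = coeff N y) → x = y
  coeff_one : ∀ N, coeff N 1 = if N = 0 then 1 else 0
  coeff_mul : ∀ N x y, coeff N (x * y) =
    ∑ a ∈ Finset.HasAntidiagonal.antidiagonal N, coeff a.1 x * coeff a.2 y
  map : Module.End 𝕂 R → Module.End 𝕂 R'
  coeff_map : ∀ φ N x, coeff N (map φ x) = φ (coeff N x)

namespace CoeffExt

variable {𝕂 R R' : Type*} [Field 𝕂] [Ring R] [Algebra 𝕂 R] [Ring R'] [Algebra 𝕂 R']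
  (E : CoeffExt 𝕂 R R') {n : ℕ} {sg : Signature 𝕂 n} (S : PoissonSuperalgebra sg R)

theorem map_mul (φ ψ : Module.End 𝕂 R) : E.map (φ * ψ) = E.map φ * E.map ψ :=
  LinearMap.ext fun x => E.ext fun N => by simp [E.coeff_map]

theorem map_smul (c : 𝕂) (φ : Module.End 𝕂 R) : E.map (c • φ) = c • E.map φ :=
  LinearMap.ext fun x => E.ext fun N => by simp [E.coeff_map]

theorem map_one : E.map 1 = 1 :=
  LinearMap.ext fun x => E.ext fun N => by simp [E.coeff_map]

theorem map_pow (φ : Module.End 𝕂 R) (k : ℕ) : E.map φ ^ k = E.map (φ ^ k) := by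
  induction k with
  | zero => rw [pow_zero, pow_zero, E.map_one]
  | succ k ih => rw [pow_succ, pow_succ, ih, E.map_mul]

/-- The structure of a Poisson superalgebra, coefficientwise. -/
def superalgebra : PoissonSuperalgebra sg R' where
  par := E.map S.par
  pd A := E.map (S.pd A)
  homog k := ⨅ N, (S.homog k).comap (E.coeff N)
  par_one := E.ext fun N => by
    rw [E.coeff_map, E.coeff_one]
    split_ifs
    · exact S.par_one
    · exact _root_.map_zero _
  par_mul x y := E.ext fun N => by simp only [E.coeff_map, E.coeff_mul, map_sum, S.par_mul]
  par_par x := E.ext fun N => by simp only [E.coeff_map, S.par_par]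
  pd_par A := by rw [← E.map_mul, S.pd_par, E.map_smul, E.map_mul]
  pd_pd A B := by rw [← E.map_mul, S.pd_pd, E.map_smul, E.map_mul]
  pd_mul A x y := E.ext fun N => by
    simp only [E.map_pow, map_add, E.coeff_map, E.coeff_mul, map_sum, S.pd_mul,
      Finset.sum_add_distrib]
  supercomm x y := E.ext fun N => by
    simp only [_root_.map_smul, map_add, map_sub, E.coeff_map, E.coeff_mul, Finset.smul_sum,
      S.supercomm, Finset.sum_add_distrib, Finset.sum_sub_distrib]
    -- The factors on the right of graded commutativity are exchanged, so each sum over the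
    -- antidiagonal is reindexed by the swap.
    congr 1
    · congr 1
      · congr 1
        · exact (Finset.Nat.sum_antidiagonal_swap (f := fun a : ℕ × ℕ => E.coeff a.1 y * E.coeff a.2 x))
        · exact (Finset.Nat.sum_antidiagonal_swap
            (f := fun a : ℕ × ℕ => E.coeff a.1 y * S.par (E.coeff a.2 x)))
      · exact (Finset.Nat.sum_antidiagonal_swap
          (f := fun a : ℕ × ℕ => S.par (E.coeff a.1 y) * E.coeff a.2 x))
    · exact (Finset.Nat.sum_antidiagonal_swap
        (f := fun a : ℕ × ℕ => S.par (E.coeff a.1 y) * S.par (E.coeff a.2 x)))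
  one_mem := by
    refine (Submodule.mem_iInf _).mpr fun N => ?_
    rw [Submodule.mem_comap, E.coeff_one]
    split_ifs
    · exact S.one_mem
    · exact zero_mem _
  mul_mem {k l x y} hx hy := by
    refine (Submodule.mem_iInf _).mpr fun N => ?_
    rw [Submodule.mem_comap, E.coeff_mul]
    exact sum_mem fun a _ => S.mul_mem ((Submodule.mem_iInf _).mp hx a.1)
      ((Submodule.mem_iInf _).mp hy a.2)
  par_of_mem {k x} hx := E.ext fun N => by
    rw [E.coeff_map, S.par_of_mem ((Submodule.mem_iInf _).mp hx N), _root_.map_smul]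
  pd_mem {A k x} hx := by
    refine (Submodule.mem_iInf _).mpr fun N => ?_
    rw [Submodule.mem_comap, E.coeff_map]
    exact S.pd_mem ((Submodule.mem_iInf _).mp hx N)

theorem mem_homog {k : ℤ} {x : R'} :
    x ∈ (E.superalgebra S).homog k ↔ ∀ N, E.coeff N x ∈ S.homog k :=
  Submodule.mem_iInf _

theorem coeff_bracket (N : ℕ) (x y : R') :
    E.coeff N ((E.superalgebra S).bracket x y) =
      ∑ a ∈ Finset.HasAntidiagonal.antidiagonal N, S.bracket (E.coeff a.1 x) (E.coeff a.2 y) := by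
  simp only [PoissonSuperalgebra.bracket, LinearMap.sum_apply, LinearMap.smul_apply, map_sum,
    _root_.map_smul, LinearMap.compl₁₂_apply, LinearMap.mul_apply', E.coeff_mul]
  symm
  rw [Finset.sum_comm]
  refine Finset.sum_congr rfl fun A _ => ?_
  rw [Finset.sum_comm]
  refine Finset.sum_congr rfl fun B _ => ?_
  rw [Finset.smul_sum]
  refine Finset.sum_congr rfl fun a _ => ?_
  have h : (E.superalgebra S).par ^ sg.deg B = E.map (S.par ^ sg.deg B) := E.map_pow _ _
  rw [Module.End.mul_apply, h]
  change _ = _ • (E.coeff a.1 (E.map _ (E.map _ x)) * E.coeff a.2 (E.map _ y))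
  simp only [E.coeff_map]

variable {S} in
theorem superCommutes {e : ℕ} {φ : Module.End 𝕂 R} (h : S.SuperCommutes e φ) :
    (E.superalgebra S).SuperCommutes e (E.map φ) where
  par := by
    change E.map φ * E.map S.par = _ • (E.map S.par * E.map φ)
    rw [← E.map_mul, h.par, E.map_smul, E.map_mul]
  pd A := by
    change E.map φ * E.map (S.pd A) = _ • (E.map (S.pd A) * E.map φ)
    rw [← E.map_mul, h.pd, E.map_smul, E.map_mul]

theorem map_left {φ : Module.End 𝕂 R} (h : ∀ x y, φ (x * y) = φ x * y) (x y : R') :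
    E.map φ (x * y) = E.map φ x * y :=
  E.ext fun N => by simp only [E.coeff_map, E.coeff_mul, map_sum, h]

theorem map_right {φ : Module.End 𝕂 R} (h : ∀ x y, φ (x * y) = x * φ y) (x y : R') :
    E.map φ (x * y) = x * E.map φ y :=
  E.ext fun N => by simp only [E.coeff_map, E.coeff_mul, map_sum, h]

theorem map_derivation {φ : Module.End 𝕂 R} (h : ∀ x y, φ (x * y) = φ x * y + x * φ y)
    (x y : R') : E.map φ (x * y) = E.map φ x * y + x * E.map φ y :=
  E.ext fun N => by
    simp only [map_add, E.coeff_map, E.coeff_mul, map_sum, h, Finset.sum_add_distrib]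

/-- Operators commuting with coefficientwise operators supercommute with the structure. -/
theorem superCommutes_of_comm {Φ : Module.End 𝕂 R'}
    (h : ∀ φ : Module.End 𝕂 R, Φ * E.map φ = E.map φ * Φ) :
    (E.superalgebra S).SuperCommutes 0 Φ where
  par := by rw [pow_zero, one_smul]; exact h _
  pd A := by rw [zero_mul, pow_zero, one_smul]; exact h _

/-- Homomorphisms extend coefficientwise. -/
def mapHom {R₁ R₁' : Type*} [Ring R₁] [Algebra 𝕂 R₁] [Ring R₁'] [Algebra 𝕂 R₁']
    (E₁ : CoeffExt 𝕂 R₁ R₁') {S : PoissonSuperalgebra sg R} {S₁ : PoissonSuperalgebra sg R₁}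
    (φ : PoissonSuperalgebra.Hom S S₁) (Φ : R' →ₗ[𝕂] R₁')
    (hΦ : ∀ N x, E₁.coeff N (Φ x) = φ.toFun (E.coeff N x)) :
    PoissonSuperalgebra.Hom (E.superalgebra S) (E₁.superalgebra S₁) where
  toFun := Φ
  map_one := E₁.ext fun N => by
    rw [hΦ, E.coeff_one, E₁.coeff_one]
    split_ifs
    · exact φ.map_one
    · exact _root_.map_zero _
  map_mul x y := E₁.ext fun N => by
    simp only [hΦ, E.coeff_mul, E₁.coeff_mul, map_sum, φ.map_mul]
  map_par x := E₁.ext fun N => by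
    change E₁.coeff N (Φ (E.map S.par x)) = E₁.coeff N (E₁.map S₁.par (Φ x))
    rw [hΦ, E.coeff_map, E₁.coeff_map, hΦ, φ.map_par]
  map_pd A x := E₁.ext fun N => by
    change E₁.coeff N (Φ (E.map (S.pd A) x)) = E₁.coeff N (E₁.map (S₁.pd A) (Φ x))
    rw [hΦ, E.coeff_map, E₁.coeff_map, hΦ, φ.map_pd]

/-- Elements of the coefficient ring as constants. -/
def constHom {S : PoissonSuperalgebra sg R} (C : R →ₗ[𝕂] R')
    (hC : ∀ N x, E.coeff N (C x) = if N = 0 then x else 0) :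
    PoissonSuperalgebra.Hom S (E.superalgebra S) where
  toFun := C
  map_one := E.ext fun N => by rw [hC, E.coeff_one]
  map_mul x y := E.ext fun N => by
    rw [hC, E.coeff_mul]
    cases N with
    | zero => simp [hC]
    | succ N =>
      rw [if_neg (Nat.succ_ne_zero N), Finset.sum_eq_zero]
      rintro ⟨a, b⟩ hab
      rw [Finset.HasAntidiagonal.mem_antidiagonal] at hab
      by_cases ha : a = 0
      · have : b ≠ 0 := by simp at hab; omega
        simp [hC, this]
      · simp [hC, ha]
  map_par x := E.ext fun N => by
    change _ = E.coeff N (E.map S.par (C x))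
    rw [E.coeff_map, hC, hC]
    split_ifs <;> simp
  map_pd A x := E.ext fun N => by
    change _ = E.coeff N (E.map (S.pd A) (C x))
    rw [E.coeff_map, hC, hC]
    split_ifs <;> simp

end CoeffExt

section Instances

variable {𝕂 R R₁ : Type*} [Field 𝕂] [Ring R] [Algebra 𝕂 R] [Ring R₁] [Algebra 𝕂 R₁]

/-- Apply a linear map to the coefficients of a power series. -/
def psMap (φ : R →ₗ[𝕂] R₁) : PowerSeries R →ₗ[𝕂] PowerSeries R₁ where
  toFun x := PowerSeries.mk fun N => φ (PowerSeries.coeff N x)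
  map_add' x y := PowerSeries.ext fun N => by simp
  map_smul' c x := PowerSeries.ext fun N => by
    rw [PowerSeries.coeff_mk]
    refine (φ.map_smul c (PowerSeries.coeff N x)).trans ?_
    change _ = c • PowerSeries.coeff N (PowerSeries.mk fun N => φ (PowerSeries.coeff N x))
    rw [PowerSeries.coeff_mk]

@[simp]
theorem coeff_psMap (φ : R →ₗ[𝕂] R₁) (N : ℕ) (x : PowerSeries R) :
    PowerSeries.coeff N (psMap φ x) = φ (PowerSeries.coeff N x) :=
  PowerSeries.coeff_mk N fun N => φ (PowerSeries.coeff N x)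

variable (𝕂 R) in
/-- Power series as a coefficient extension. -/
def psExt : CoeffExt 𝕂 R (PowerSeries R) where
  coeff N := { toFun := PowerSeries.coeff N, map_add' := by simp, map_smul' := fun c x => rfl }
  ext h := PowerSeries.ext h
  coeff_one N := PowerSeries.coeff_one N
  coeff_mul N x y := PowerSeries.coeff_mul N x y
  map φ := psMap φ
  coeff_map φ N x := coeff_psMap φ N x

theorem coeff_sum_monomial (φ : R →ₗ[𝕂] R₁) (N : ℕ) (x : Polynomial R) :
    (∑ i ∈ x.support, Polynomial.monomial i (φ (x.coeff i))).coeff N = φ (x.coeff N) := by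
  simp only [Polynomial.finsetSum_coeff, Polynomial.coeff_monomial, Finset.sum_ite_eq',
    Polynomial.mem_support_iff, ite_eq_left_iff, not_not]
  intro h
  rw [h, _root_.map_zero]

/-- Apply a linear map to the coefficients of a polynomial. -/
def polyMap (φ : R →ₗ[𝕂] R₁) : Polynomial R →ₗ[𝕂] Polynomial R₁ where
  toFun x := ∑ i ∈ x.support, Polynomial.monomial i (φ (x.coeff i))
  map_add' x y := Polynomial.ext fun N => by
    rw [Polynomial.coeff_add, coeff_sum_monomial, coeff_sum_monomial, coeff_sum_monomial,
      Polynomial.coeff_add, map_add]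
  map_smul' c x := Polynomial.ext fun N => by
    rw [coeff_sum_monomial, Polynomial.coeff_smul, _root_.map_smul, RingHom.id_apply,
      Polynomial.coeff_smul, coeff_sum_monomial]

@[simp]
theorem coeff_polyMap (φ : R →ₗ[𝕂] R₁) (N : ℕ) (x : Polynomial R) :
    (polyMap φ x).coeff N = φ (x.coeff N) :=
  coeff_sum_monomial φ N x

variable (𝕂 R) in
/-- Polynomials as a coefficient extension. -/
def polyExt : CoeffExt 𝕂 R (Polynomial R) where
  coeff N := { toFun := fun x => x.coeff N, map_add' := by simp, map_smul' := by simp }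
  ext h := Polynomial.ext h
  coeff_one N := Polynomial.coeff_one
  coeff_mul N x y := Polynomial.coeff_mul x y N
  map φ := polyMap φ
  coeff_map φ N x := coeff_polyMap φ N x

end Instances

namespace PoissonSuperalgebra

variable {𝕂 : Type*} [Field 𝕂] [CharZero 𝕂] {n : ℕ} {sg : Signature 𝕂 n}
  {R : Type*} [Ring R] [Algebra 𝕂 R] (S : PoissonSuperalgebra sg R)

/-! ### Graded symmetry and the Jacobi identity -/

theorem mul_comm_of_par {a b : ℕ} {x y : R} (hx : S.par x = (-1 : 𝕂) ^ a • x)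
    (hy : S.par y = (-1 : 𝕂) ^ b • y) : x * y = (-1 : 𝕂) ^ (a * b) • (y * x) := by
  have h := S.supercomm x y
  rw [hx, hy] at h
  have h2 : (2 : 𝕂) ≠ 0 := two_ne_zero
  refine smul_right_injective R h2 ?_
  dsimp only
  rw [h]
  simp only [mul_smul_comm, smul_mul_assoc, smul_smul]
  rcases Nat.even_or_odd a with ha | ha <;> rcases Nat.even_or_odd b with hb | hb
  · simp [ha.neg_one_pow, (ha.mul_right b).neg_one_pow, hb.neg_one_pow, two_smul]
  · simp [ha.neg_one_pow, (ha.mul_right b).neg_one_pow, hb.neg_one_pow, two_smul]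
  · simp [ha.neg_one_pow, (hb.mul_left a).neg_one_pow, hb.neg_one_pow, two_smul]
  · simp [ha.neg_one_pow, (ha.mul hb).neg_one_pow, hb.neg_one_pow, two_smul]
    abel

theorem par_pow_of_par {a : ℕ} {x : R} (hx : S.par x = (-1 : 𝕂) ^ a • x) (k : ℕ) :
    (S.par ^ k) x = (-1 : 𝕂) ^ (a * k) • x := by
  induction k with
  | zero => simp
  | succ k ih =>
    rw [pow_succ, Module.End.mul_apply, hx, map_smul, ih, smul_smul, ← pow_add, Nat.mul_succ,
      add_comm]

theorem par_pd {a : ℕ} {x : R} (hx : S.par x = (-1 : 𝕂) ^ a • x) (A : Fin sg.size) :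
    S.par (S.pd A x) = (-1 : 𝕂) ^ (a + sg.deg A) • S.pd A x := by
  have h := LinearMap.congr_fun (S.pd_par A) x
  rw [Module.End.mul_apply, LinearMap.smul_apply, Module.End.mul_apply, hx, map_smul] at h
  rw [pow_add, mul_comm, ← smul_smul, h, smul_smul, ← pow_add, Even.neg_one_pow ⟨_, rfl⟩, one_smul]

theorem bracket_apply (x y : R) : S.bracket x y =
    ∑ A, ∑ B, sg.w A B • (S.pd A ((S.par ^ sg.deg B) x) * S.pd B y) := by
  simp [bracket]

theorem bracket_apply_of_par {a : ℕ} {x : R} (hx : S.par x = (-1 : 𝕂) ^ a • x) (y : R) :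
    S.bracket x y =
      ∑ A, ∑ B, (sg.w A B * (-1) ^ (a * sg.deg B)) • (S.pd A x * S.pd B y) := by
  rw [bracket_apply]
  refine Finset.sum_congr rfl fun A _ => Finset.sum_congr rfl fun B _ => ?_
  rw [S.par_pow_of_par hx, map_smul, smul_mul_assoc, smul_smul]

/-- Graded symmetry of the bracket. -/
theorem bracket_symm {a b : ℕ} {x y : R} (hx : S.par x = (-1 : 𝕂) ^ a • x)
    (hy : S.par y = (-1 : 𝕂) ^ b • y) :
    S.bracket x y = -(-1 : 𝕂) ^ (n + a * b) • S.bracket y x := by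
  rw [S.bracket_apply_of_par hx, S.bracket_apply_of_par hy, Finset.sum_comm, Finset.smul_sum]
  refine Finset.sum_congr rfl fun B _ => ?_
  rw [Finset.smul_sum]
  refine Finset.sum_congr rfl fun A _ => ?_
  rw [S.mul_comm_of_par (S.par_pd hx A) (S.par_pd hy B), smul_smul, smul_smul, sg.w_symm B A]
  congr 1
  have h : ∀ k : ℕ, (-1 : 𝕂) ^ k * (-1) ^ k = 1 := fun k => by
    rw [← pow_add, Even.neg_one_pow ⟨_, rfl⟩]
  have e : (a + sg.deg A) * (b + sg.deg B) = a * b + a * sg.deg B + sg.deg A * b +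
    sg.deg A * sg.deg B := by ring
  rw [e]
  simp only [pow_add, mul_comm (sg.deg B) (sg.deg A), mul_comm b (sg.deg A)]
  linear_combination (-(-1 : 𝕂) ^ n * sg.w B A * (-1) ^ (a * b) * (-1) ^ (sg.deg A * b)) *
    ((-1) ^ (sg.deg A * sg.deg B) * (-1) ^ (sg.deg A * sg.deg B) * h (a * sg.deg B) +
      h (sg.deg A * sg.deg B))

/-- The exponent n + (n+1)² is odd, which makes the sign positive: on functions of parity n + 1 the
bracket is symmetric, and {m,m} = 0 is a genuine quadratic equation. -/
theorem bracket_symm_even {x y : R} (hx : S.par x = (-1 : 𝕂) ^ (n + 1) • x)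
    (hy : S.par y = (-1 : 𝕂) ^ (n + 1) • y) : S.bracket x y = S.bracket y x := by
  rw [S.bracket_symm hx hy]
  have : Odd (n + (n + 1) * (n + 1)) := by
    rw [show n + (n + 1) * (n + 1) = n * (n + 1) + 2 * n + 1 by ring, Nat.odd_add_one,
      Nat.not_odd_iff_even]
    exact (Nat.even_mul_succ_self n).add (even_two_mul n)
  rw [this.neg_one_pow, neg_neg, one_smul]

theorem bracket_symm_mixed {x y : R} (hx : S.par x = (-1 : 𝕂) ^ (n + 1) • x)
    (hy : S.par y = (-1 : 𝕂) ^ n • y) : S.bracket x y = -(-1 : 𝕂) ^ n • S.bracket y x := by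
  rw [S.bracket_symm hx hy, pow_add, (mul_comm (n + 1) n ▸ Nat.even_mul_succ_self n :
    Even ((n + 1) * n)).neg_one_pow, mul_one]

/-- Operators which supercommute with the structure and are derivations act as derivations of the
bracket. -/
theorem derivation_bracket {φ : Module.End 𝕂 R} (h : S.SuperCommutes 0 φ)
    (hφ : ∀ x y, φ (x * y) = φ x * y + x * φ y) (x y : R) :
    φ (S.bracket x y) = S.bracket (φ x) y + S.bracket x (φ y) := by
  have hpd : ∀ A x, φ (S.pd A x) = S.pd A (φ x) := fun A x => by
    simpa using LinearMap.congr_fun (h.pd A) x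
  have hpar : ∀ k x, φ ((S.par ^ k) x) = (S.par ^ k) (φ x) := fun k x => by
    simpa using LinearMap.congr_fun (h.par_pow k) x
  simp only [bracket_apply, map_sum, map_smul, hφ, hpd, hpar, smul_add, Finset.sum_add_distrib]

theorem bracket_const_left {φ : Module.End 𝕂 R} (h : S.SuperCommutes 0 φ)
    (hφ : ∀ x y, φ (x * y) = φ x * y) (x y : R) : S.bracket (φ x) y = φ (S.bracket x y) := by
  have hpd : ∀ A x, φ (S.pd A x) = S.pd A (φ x) := fun A x => by
    simpa using LinearMap.congr_fun (h.pd A) x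
  have hpar : ∀ k x, φ ((S.par ^ k) x) = (S.par ^ k) (φ x) := fun k x => by
    simpa using LinearMap.congr_fun (h.par_pow k) x
  simp only [bracket_apply, map_sum, map_smul, ← hpd, ← hpar, hφ]

theorem bracket_const_right {φ : Module.End 𝕂 R} (h : S.SuperCommutes 0 φ)
    (hφ : ∀ x y, φ (x * y) = x * φ y) (x y : R) : S.bracket x (φ y) = φ (S.bracket x y) := by
  have hpd : ∀ A x, φ (S.pd A x) = S.pd A (φ x) := fun A x => by
    simpa using LinearMap.congr_fun (h.pd A) x
  simp only [bracket_apply, map_sum, map_smul, hφ, hpd]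

/-- The components of the Hamiltonian vector field of a function. -/
def hamField (x : R) (B : Fin sg.size) : R := ∑ A, (sg.w A B * (-1) ^ (n * sg.deg B)) • S.pd A x

theorem bracket_eq_hamField {x : R} (hx : S.par x = (-1 : 𝕂) ^ n • x) (f : R) :
    S.bracket x f = ∑ B, S.hamField x B * S.pd B f := by
  rw [S.bracket_apply_of_par hx, Finset.sum_comm]
  refine Finset.sum_congr rfl fun B _ => ?_
  rw [hamField, Finset.sum_mul]
  exact Finset.sum_congr rfl fun A _ => (smul_mul_assoc _ _ _).symm

end PoissonSuperalgebra

/-- The comparison of signs in `hamField_bracket`, where A, B, D are degrees of coordinates and D +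
B = n comes from the degree condition on the bivector. -/
theorem even_sign_identity (n A B D : ℕ) (e : D + B = n) :
    Even (n * B) ↔ Even (n * D + (n + D * B) + ((n + B) * (n + A + D) + A * D)) := by
  subst e
  by_cases hA : Even A <;> by_cases hB : Even B <;> by_cases hD : Even D <;>
    simp [Nat.even_add, Nat.even_mul, hA, hB, hD]

namespace PoissonSuperalgebra

variable {𝕂 : Type*} [Field 𝕂] [CharZero 𝕂] {n : ℕ} {sg : Signature 𝕂 n}
  {R : Type*} [Ring R] [Algebra 𝕂 R] (S : PoissonSuperalgebra sg R)

theorem par_pow_even {k : ℕ} (hk : Even k) (x : R) : (S.par ^ k) x = x := by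
  obtain ⟨l, rfl⟩ := hk
  rw [← two_mul, pow_mul, pow_two, S.par_sq, one_pow, Module.End.one_apply]

theorem mul_par_pow {k : ℕ} {u : R} (hu : S.par u = (-1 : 𝕂) ^ k • u) (f : R) :
    u * (S.par ^ k) f = f * u := by
  have h2 : (2 : 𝕂) ≠ 0 := two_ne_zero
  refine smul_right_injective R h2 ?_
  dsimp only
  rw [S.supercomm, hu]
  rcases Nat.even_or_odd k with hk | hk
  · rw [S.par_pow_even hk, hk.neg_one_pow, two_smul]
    simp
  · obtain ⟨l, rfl⟩ := hk
    rw [pow_succ', Module.End.mul_apply, S.par_pow_even (even_two_mul l), S.par_par,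
      Odd.neg_one_pow ⟨l, rfl⟩, two_smul]
    simp

/-- From deg A + deg B = n one gets n + deg A ≡ deg B modulo 2. Thus the Hamiltonian vector field of
a function of parity n is even, and it acts as an ungraded derivation (`bracket_mul`). -/
theorem par_hamField {x : R} (hx : S.par x = (-1 : 𝕂) ^ n • x) (B : Fin sg.size) :
    S.par (S.hamField x B) = (-1 : 𝕂) ^ sg.deg B • S.hamField x B := by
  rw [hamField, map_sum, Finset.smul_sum]
  refine Finset.sum_congr rfl fun A _ => ?_
  rw [map_smul, S.par_pd hx, smul_comm]
  by_cases h : sg.w A B = 0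
  · simp [h]
  · have e : n + sg.deg A = sg.deg B + 2 * sg.deg A := by
      have := sg.w_deg A B h
      omega
    rw [e, pow_add, (even_two_mul _).neg_one_pow, mul_one]

theorem bracket_mul {x : R} (hx : S.par x = (-1 : 𝕂) ^ n • x) (f g : R) :
    S.bracket x (f * g) = S.bracket x f * g + f * S.bracket x g := by
  simp only [S.bracket_eq_hamField hx, S.pd_mul, mul_add, Finset.sum_add_distrib, Finset.sum_mul,
    Finset.mul_sum]
  congr 1
  · exact Finset.sum_congr rfl fun B _ => (mul_assoc _ _ _).symm
  · refine Finset.sum_congr rfl fun B _ => ?_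
    rw [← mul_assoc, S.mul_par_pow (S.par_hamField hx B), mul_assoc]

theorem pd_comm (A B : Fin sg.size) (f : R) :
    S.pd A (S.pd B f) = (-1 : 𝕂) ^ (sg.deg A * sg.deg B) • S.pd B (S.pd A f) := by
  simpa using LinearMap.congr_fun (S.pd_pd A B) f

/-- The components of the Hamiltonian vector field of a bracket. -/
theorem hamField_bracket {a b : R} (ha : S.par a = (-1 : 𝕂) ^ n • a)
    (hb : S.par b = (-1 : 𝕂) ^ n • b) (C : Fin sg.size) :
    S.hamField (S.bracket a b) C = S.bracket a (S.hamField b C) - S.bracket b (S.hamField a C) := by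
  -- Write X for `hamField`. Differentiating Σ_B X_a^B ∂_B b gives terms containing second
  -- derivatives of b, which assemble to {a, X_b^C}, and terms containing ∂_A X_a^B, which the
  -- graded symmetry of the bivector turns into -{b, X_a^C}.
  have h1 : S.hamField (S.bracket a b) C =
      ∑ B, ∑ A, (sg.w A C * (-1) ^ (n * sg.deg C)) • (S.pd A (S.hamField a B) * S.pd B b) +
      ∑ B, ∑ A, (sg.w A C * (-1) ^ (n * sg.deg C)) • (S.hamField a B * S.pd B (S.pd A b)) := by
    rw [hamField, S.bracket_eq_hamField ha, ← Finset.sum_add_distrib]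
    simp only [map_sum, Finset.smul_sum]
    rw [Finset.sum_comm]
    refine Finset.sum_congr rfl fun B _ => ?_
    rw [← Finset.sum_add_distrib]
    refine Finset.sum_congr rfl fun A _ => ?_
    rw [S.pd_mul, S.par_pow_of_par (S.par_hamField ha B), S.pd_comm A B, smul_add,
      smul_mul_smul_comm, ← pow_add, mul_comm (sg.deg A), Even.neg_one_pow ⟨_, rfl⟩, one_smul]
  have h2 : S.bracket a (S.hamField b C) =
      ∑ B, ∑ A, (sg.w A C * (-1) ^ (n * sg.deg C)) • (S.hamField a B * S.pd B (S.pd A b)) := by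
    rw [S.bracket_eq_hamField ha]
    refine Finset.sum_congr rfl fun B _ => ?_
    rw [show S.hamField b C = ∑ A, (sg.w A C * (-1) ^ (n * sg.deg C)) • S.pd A b from rfl, map_sum,
      Finset.mul_sum]
    exact Finset.sum_congr rfl fun A _ => by rw [map_smul, mul_smul_comm]
  rw [h1, ← h2, sub_eq_add_neg, add_comm]
  congr 1
  rw [S.bracket_eq_hamField hb, ← Finset.sum_neg_distrib]
  simp only [hamField, map_sum, map_smul, Finset.sum_mul, Finset.mul_sum, Finset.smul_sum,
    ← Finset.sum_neg_distrib, smul_mul_assoc, mul_smul_comm, smul_smul]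
  have h3 : ∀ F : Fin sg.size → Fin sg.size → Fin sg.size → R,
      ∑ B, ∑ A, ∑ D, F B A D = ∑ D, ∑ A, ∑ B, F B A D := by
    intro F
    rw [Finset.sum_comm]
    conv_rhs => rw [Finset.sum_comm]
    exact Finset.sum_congr rfl fun A _ => Finset.sum_comm
  rw [h3]
  refine Finset.sum_congr rfl fun D _ => Finset.sum_congr rfl fun A _ =>
    Finset.sum_congr rfl fun B _ => ?_
  by_cases h : sg.w D B = 0
  · have h' : sg.w B D = 0 := by rw [sg.w_symm D B, h, mul_zero]
    simp [h, h']
  have e := sg.w_deg D B h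
  have hp : S.pd B b * S.pd D (S.pd A a) = (-1 : 𝕂) ^ ((n + sg.deg B) * (n + sg.deg A + sg.deg D) +
      sg.deg A * sg.deg D) • (S.pd A (S.pd D a) * S.pd B b) := by
    rw [S.mul_comm_of_par (S.par_pd hb B) (S.par_pd (S.par_pd ha A) D), S.pd_comm D A,
      smul_mul_assoc, smul_smul, ← pow_add, mul_comm (sg.deg D)]
  rw [hp, smul_smul, ← neg_smul, sg.w_symm D B]
  congr 1
  have e2 : (-1 : 𝕂) ^ (n * sg.deg B) = (-1) ^ (n * sg.deg D + (n + sg.deg D * sg.deg B) +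
      ((n + sg.deg B) * (n + sg.deg A + sg.deg D) + sg.deg A * sg.deg D)) := by
    refine neg_one_pow_congr ?_
    exact even_sign_identity _ _ _ _ e
  rw [e2]
  simp only [pow_add]
  ring

/-- The Jacobi identity for functions of degree `n`. -/
theorem jacobi {a b : R} (ha : S.par a = (-1 : 𝕂) ^ n • a)
    (hb : S.par b = (-1 : 𝕂) ^ n • b) (f : R) :
    S.bracket a (S.bracket b f) = S.bracket (S.bracket a b) f + S.bracket b (S.bracket a f) := by
  have hab : S.par (S.bracket a b) = (-1 : 𝕂) ^ n • S.bracket a b := by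
    rw [S.bracket_eq_hamField ha, map_sum, Finset.smul_sum]
    refine Finset.sum_congr rfl fun B _ => ?_
    rw [S.par_mul, S.par_hamField ha, S.par_pd hb, smul_mul_smul_comm, ← pow_add,
      show sg.deg B + (n + sg.deg B) = n + 2 * sg.deg B by ring, pow_add,
      (even_two_mul _).neg_one_pow, mul_one]
  -- Brackets with a and b act as even vector fields. In their commutator the second-order terms
  -- cancel, and the first-order coefficients are those of `hamField_bracket`.
  have h1 : ∀ {a b : R}, S.par a = (-1 : 𝕂) ^ n • a → S.par b = (-1 : 𝕂) ^ n • b →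
      S.bracket a (S.bracket b f) = ∑ C, S.bracket a (S.hamField b C) * S.pd C f +
        ∑ C, ∑ B, S.hamField b C * (S.hamField a B * S.pd B (S.pd C f)) := by
    intro a b ha hb
    rw [S.bracket_eq_hamField hb, map_sum, ← Finset.sum_add_distrib]
    refine Finset.sum_congr rfl fun C _ => ?_
    rw [S.bracket_mul ha, S.bracket_eq_hamField ha (S.pd C f), Finset.mul_sum]
  rw [h1 ha hb, h1 hb ha, S.bracket_eq_hamField hab]
  simp only [S.hamField_bracket ha hb, sub_mul, Finset.sum_sub_distrib]
  have h2 : ∑ C, ∑ B, S.hamField b C * (S.hamField a B * S.pd B (S.pd C f)) =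
      ∑ C, ∑ B, S.hamField a C * (S.hamField b B * S.pd B (S.pd C f)) := by
    rw [Finset.sum_comm]
    refine Finset.sum_congr rfl fun B _ => Finset.sum_congr rfl fun C _ => ?_
    rw [← mul_assoc, S.mul_comm_of_par (S.par_hamField hb C) (S.par_hamField ha B), S.pd_comm B C,
      smul_mul_smul_comm, ← pow_add, mul_comm (sg.deg B), Even.neg_one_pow ⟨_, rfl⟩, one_smul,
      mul_assoc]
  rw [h2]
  abel

end PoissonSuperalgebra

/-! ### Adjoining an odd variable -/

/-- The ring `R[θ]` with an odd variable `θ`: the pair `(a, b)` stands for `a + θ b`. The grading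
involution enters the multiplication. -/
structure OddExt {𝕂 : Type*} [Field 𝕂] {n : ℕ} {sg : Signature 𝕂 n} {R : Type*} [Ring R]
    [Algebra 𝕂 R] (S : PoissonSuperalgebra sg R) where
  fst : R
  snd : R

namespace OddExt

variable {𝕂 : Type*} [Field 𝕂] {n : ℕ} {sg : Signature 𝕂 n}
  {R : Type*} [Ring R] [Algebra 𝕂 R] {S : PoissonSuperalgebra sg R}

@[ext]
theorem ext {x y : OddExt S} (h1 : x.fst = y.fst) (h2 : x.snd = y.snd) : x = y := by
  cases x; cases y; cases h1; cases h2; rfl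

/-- The underlying pair. -/
def equivProd : OddExt S ≃ R × R where
  toFun x := (x.fst, x.snd)
  invFun x := ⟨x.1, x.2⟩

instance : AddCommGroup (OddExt S) := equivProd.addCommGroup

instance : Module 𝕂 (OddExt S) := equivProd.module 𝕂

@[simp] theorem fst_add (x y : OddExt S) : (x + y).fst = x.fst + y.fst := rfl
@[simp] theorem snd_add (x y : OddExt S) : (x + y).snd = x.snd + y.snd := rfl
@[simp] theorem fst_neg (x : OddExt S) : (-x).fst = -x.fst := rfl
@[simp] theorem snd_neg (x : OddExt S) : (-x).snd = -x.snd := rfl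
@[simp] theorem fst_sub (x y : OddExt S) : (x - y).fst = x.fst - y.fst := rfl
@[simp] theorem snd_sub (x y : OddExt S) : (x - y).snd = x.snd - y.snd := rfl
@[simp] theorem fst_zero : (0 : OddExt S).fst = 0 := rfl
@[simp] theorem snd_zero : (0 : OddExt S).snd = 0 := rfl
@[simp] theorem fst_smul (c : 𝕂) (x : OddExt S) : (c • x).fst = c • x.fst := rfl
@[simp] theorem snd_smul (c : 𝕂) (x : OddExt S) : (c • x).snd = c • x.snd := rfl

/-- Dictated by a θ = θ par(a) and θ² = 0. -/
instance : Mul (OddExt S) := ⟨fun x y => ⟨x.fst * y.fst, x.snd * y.fst + S.par x.fst * y.snd⟩⟩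
instance : One (OddExt S) := ⟨⟨1, 0⟩⟩

@[simp] theorem fst_mul (x y : OddExt S) : (x * y).fst = x.fst * y.fst := rfl
@[simp] theorem snd_mul (x y : OddExt S) :
    (x * y).snd = x.snd * y.fst + S.par x.fst * y.snd := rfl
@[simp] theorem fst_one : (1 : OddExt S).fst = 1 := rfl
@[simp] theorem snd_one : (1 : OddExt S).snd = 0 := rfl

instance : Ring (OddExt S) where
  __ := (inferInstance : AddCommGroup (OddExt S))
  mul_assoc x y z := by ext <;> simp [mul_assoc, S.par_mul, mul_add, add_mul, add_assoc]
  one_mul x := by ext <;> simp [S.par_one]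
  mul_one x := by ext <;> simp
  zero_mul x := by ext <;> simp
  mul_zero x := by ext <;> simp
  left_distrib x y z := by ext <;> simp [mul_add]; abel
  right_distrib x y z := by ext <;> simp [add_mul]; abel

instance : Algebra 𝕂 (OddExt S) := Algebra.ofModule
  (fun c x y => by ext <;> simp) (fun c x y => by ext <;> simp)

/-- Build an operator from its two components. -/
def mapPair (φ ψ : Module.End 𝕂 R) : Module.End 𝕂 (OddExt S) where
  toFun x := ⟨φ x.fst, ψ x.snd⟩
  map_add' x y := by ext <;> simp
  map_smul' c x := by ext <;> simp

@[simp] theorem fst_mapPair (φ ψ : Module.End 𝕂 R) (x : OddExt S) :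
    (mapPair φ ψ x).fst = φ x.fst := rfl
@[simp] theorem snd_mapPair (φ ψ : Module.End 𝕂 R) (x : OddExt S) :
    (mapPair φ ψ x).snd = ψ x.snd := rfl

theorem mapPair_pow_par (k : ℕ) :
    (mapPair S.par (-S.par) : Module.End 𝕂 (OddExt S)) ^ k =
      mapPair (S.par ^ k) ((-1 : 𝕂) ^ k • S.par ^ k) := by
  induction k with
  | zero => exact LinearMap.ext fun x => by ext <;> simp
  | succ k ih =>
    rw [pow_succ, ih]
    exact LinearMap.ext fun x => by ext <;> simp [pow_succ, pow_succ]

variable (S) in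
/-- The Poisson superalgebra obtained by adjoining an odd variable of degree one. -/
def superalgebra : PoissonSuperalgebra sg (OddExt S) where
  -- As θ is odd, the parity changes sign on the second component, and ∂_A passes θ with the sign
  -- (-1)^{deg A}.
  par := mapPair S.par (-S.par)
  pd A := mapPair (S.pd A) ((-1 : 𝕂) ^ sg.deg A • S.pd A)
  homog k :=
    { carrier := {x | x.fst ∈ S.homog k ∧ x.snd ∈ S.homog (k - 1)}
      add_mem' := fun ha hb => ⟨add_mem ha.1 hb.1, add_mem ha.2 hb.2⟩
      zero_mem' := ⟨zero_mem _, zero_mem _⟩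
      smul_mem' := fun c x hx => ⟨Submodule.smul_mem _ c hx.1, Submodule.smul_mem _ c hx.2⟩ }
  par_one := by ext <;> simp [S.par_one]
  par_mul x y := by ext <;> simp [S.par_mul, S.par_par]; abel
  par_par x := by ext <;> simp [S.par_par]
  pd_par A := by
    have h : ∀ z, S.pd A (S.par z) = (-1 : 𝕂) ^ sg.deg A • S.par (S.pd A z) := fun z => by
      simpa using LinearMap.congr_fun (S.pd_par A) z
    exact LinearMap.ext fun x => by ext <;> simp [h]
  pd_pd A B := by
    have h : ∀ z, S.pd A (S.pd B z) = (-1 : 𝕂) ^ (sg.deg A * sg.deg B) • S.pd B (S.pd A z) :=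
      fun z => by simpa using LinearMap.congr_fun (S.pd_pd A B) z
    refine LinearMap.ext fun x => ?_
    ext
    · simp [h]
    · simp [h, smul_smul]
      congr 1
      ring
  pd_mul A x y := by
    have h : ∀ z, S.pd A (S.par z) = (-1 : 𝕂) ^ sg.deg A • S.par (S.pd A z) := fun z => by
      simpa using LinearMap.congr_fun (S.pd_par A) z
    have h2 : ∀ k z, S.par ((S.par ^ k) z) = (S.par ^ k) (S.par z) := fun k z => by
      rw [← Module.End.mul_apply, ← pow_succ', pow_succ, Module.End.mul_apply]
    have h3 : (-1 : 𝕂) ^ sg.deg A * (-1) ^ sg.deg A = 1 := by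
      rw [← pow_add, Even.neg_one_pow ⟨_, rfl⟩]
    rw [mapPair_pow_par]
    ext
    · simp [S.pd_mul]
    · simp [S.pd_mul, h, h2, smul_smul, h3, smul_add]
      abel
  supercomm x y := by
    have h := S.supercomm
    ext
    · simp [h]
    · have h1 := S.supercomm x.snd y.fst
      have h2 := S.supercomm (S.par x.fst) y.snd
      simp only [S.par_par] at h2
      simp only [snd_smul, snd_mul, snd_add, snd_sub, fst_mapPair, snd_mapPair,
        LinearMap.neg_apply, S.par_par, smul_add, h1, h2]
      simp only [mul_neg, neg_mul]
      abel
  one_mem := ⟨S.one_mem, zero_mem _⟩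
  mul_mem := by
    rintro k l x y ⟨hx, hx'⟩ ⟨hy, hy'⟩
    refine ⟨S.mul_mem hx hy, add_mem ?_ ?_⟩
    · have := S.mul_mem hx' hy
      rwa [show k - 1 + l = k + l - 1 by ring] at this
    · have := S.mul_mem (S.par_mem hx) hy'
      rwa [show k + (l - 1) = k + l - 1 by ring] at this
  par_of_mem := by
    rintro k x ⟨hx, hx'⟩
    ext
    · exact S.par_of_mem hx
    · have := S.par_of_mem hx'
      simp [this, zpow_sub_one₀]
  pd_mem := by
    rintro A k x ⟨hx, hx'⟩
    refine ⟨S.pd_mem hx, Submodule.smul_mem _ _ ?_⟩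
    have := S.pd_mem (A := A) hx'
    rwa [show k - 1 - (sg.deg A : ℤ) = k - sg.deg A - 1 by ring] at this

end OddExt

namespace OddExt

variable {𝕂 : Type*} [Field 𝕂] {n : ℕ} {sg : Signature 𝕂 n}
  {R : Type*} [Ring R] [Algebra 𝕂 R] {S : PoissonSuperalgebra sg R}

variable (S) in
/-- Setting the odd variable to zero. -/
def fstHom : PoissonSuperalgebra.Hom (superalgebra S) S where
  toFun := { toFun := fst, map_add' := fun _ _ => rfl, map_smul' := fun _ _ => rfl }
  map_one := rfl
  map_mul _ _ := rfl
  map_par _ := rfl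
  map_pd _ _ := rfl

variable (S) in
/-- Multiplication by the odd variable. -/
def theta : Module.End 𝕂 (OddExt S) where
  toFun x := ⟨0, x.fst⟩
  map_add' x y := by ext <;> simp
  map_smul' c x := by ext <;> simp

theorem theta_superCommutes : (superalgebra S).SuperCommutes 1 (theta S) where
  par := LinearMap.ext fun x => by ext <;> simp [theta, superalgebra]
  pd A := LinearMap.ext fun x => by
    ext
    · simp [theta, superalgebra]
    · simp only [theta, superalgebra, one_mul, Module.End.mul_apply, LinearMap.smul_apply,
        snd_smul, LinearMap.coe_mk, AddHom.coe_mk, snd_mapPair, fst_mapPair, smul_smul]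
      rw [← pow_add, Even.neg_one_pow ⟨_, rfl⟩, one_smul]

theorem theta_mul (x y : OddExt S) : theta S (x * y) = theta S x * y := by
  ext <;> simp [theta]

variable (S) in
/-- The Euler derivation for the odd variable. -/
def euler : Module.End 𝕂 (OddExt S) := mapPair 0 1

theorem euler_superCommutes : (superalgebra S).SuperCommutes 0 (euler S) where
  par := LinearMap.ext fun x => by ext <;> simp [euler, superalgebra]
  pd A := LinearMap.ext fun x => by ext <;> simp [euler, superalgebra]

theorem euler_mul (x y : OddExt S) : euler S (x * y) = euler S x * y + x * euler S y := by
  ext <;> simp [euler]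

theorem snd_sum {ι : Type*} (s : Finset ι) (f : ι → OddExt S) :
    (∑ i ∈ s, f i).snd = ∑ i ∈ s, (f i).snd :=
  map_sum ({ toFun := snd, map_zero' := rfl, map_add' := fun _ _ => rfl } : OddExt S →+ R) f s

/-- Pulling θ to the left past both derivatives costs (-1)^{deg A + deg B} = (-1)^n, and pulling it
out of the second argument also applies the parity to the first one. -/
theorem snd_bracket [CharZero 𝕂] (x y : OddExt S) : ((superalgebra S).bracket x y).snd =
    (-1 : 𝕂) ^ n • (S.bracket x.snd y.fst + S.bracket (S.par x.fst) y.snd) := by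
  simp only [PoissonSuperalgebra.bracket_apply, snd_sum, ← Finset.sum_add_distrib, Finset.smul_sum]
  refine Finset.sum_congr rfl fun A _ => Finset.sum_congr rfl fun B _ => ?_
  by_cases h : sg.w A B = 0
  · simp [h]
  have h2 : (-1 : 𝕂) ^ sg.deg A * (-1) ^ sg.deg B = (-1) ^ n := by
    rw [← pow_add, sg.w_deg A B h]
  have h3 : S.par (S.pd A ((S.par ^ sg.deg B) x.fst)) =
      (-1 : 𝕂) ^ sg.deg A • S.pd A ((S.par ^ sg.deg B) (S.par x.fst)) := by
    have h := LinearMap.congr_fun (S.pd_par A) ((S.par ^ sg.deg B) x.fst)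
    rw [Module.End.mul_apply, LinearMap.smul_apply, Module.End.mul_apply] at h
    rw [← Module.End.mul_apply (S.par ^ _), ← pow_succ, pow_succ', Module.End.mul_apply, h,
      smul_smul, ← pow_add, Even.neg_one_pow ⟨_, rfl⟩, one_smul]
  rw [snd_smul, snd_mul]
  change sg.w A B • ((mapPair (S.pd A) _ (((superalgebra S).par ^ sg.deg B) x)).snd *
    S.pd B y.fst + S.par ((mapPair (S.pd A) _ (((superalgebra S).par ^ sg.deg B) x)).fst) *
    ((-1 : 𝕂) ^ sg.deg B • S.pd B y.snd)) = _
  have h4 : (superalgebra S).par ^ sg.deg B =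
    mapPair (S.par ^ sg.deg B) ((-1 : 𝕂) ^ sg.deg B • S.par ^ sg.deg B) := mapPair_pow_par _
  rw [h4, snd_mapPair, fst_mapPair, snd_mapPair, fst_mapPair, h3]
  simp only [LinearMap.smul_apply, map_smul, smul_mul_assoc, mul_smul_comm, smul_smul, smul_add,
    ← h2]
  congr 2 <;> ring

end OddExt

/-! ### The cocycle identity on even elements and its linearisation -/

namespace PoissonSuperalgebra

variable {𝕂 : Type*} [Field 𝕂] [CharZero 𝕂] {n : ℕ} {sg : Signature 𝕂 n}
  {R : Type*} [Ring R] [Algebra 𝕂 R] (S : PoissonSuperalgebra sg R)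

theorem cochain_zero (p : ℕ) : S.cochain (0 : GraphSeries 𝕂 (n + 1)) p = 0 :=
  S.cochain_eq_zero fun _ => rfl

/-- The cocycle identity on even elements. -/
theorem cocycle_even {γ : GraphSeries 𝕂 (n + 1)} (hγ : γ ∈ cocycles 𝕂 (n + 1) 0) (p : ℕ) {m : R}
    (hm : S.par m = (-1 : 𝕂) ^ (n + 1) • m) :
    (2 : 𝕂) • S.bracket (S.cochain γ p fun _ => m) m =
      ((p + 1 : ℕ) : 𝕂) • S.cochain γ p (Fin.cons (S.bracket m m) fun _ => m) := by
  have h := S.cochain_graphDiff_const (edgeFinite_of_mem le_rfl hγ.1) 0 p hm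
  rw [LinearMap.mem_ker.mp hγ.2, cochain_zero, zero_apply, zpow_zero, one_smul] at h
  -- The two terms of the differential carry the coefficients p + 2 and (p+2)(p+1)/2; after
  -- doubling, the common factor p + 2 is cancelled.
  have h2 : ((p + 2).choose 2 : 𝕂) * 2 = ((p + 2 : ℕ) : 𝕂) * ((p + 1 : ℕ) : 𝕂) := by
    rw [Nat.cast_choose_two]
    push_cast
    ring
  have h3 : ((p + 2 : ℕ) : 𝕂) ≠ 0 := Nat.cast_ne_zero.mpr (by omega)
  refine smul_right_injective R h3 ?_
  dsimp only
  rw [smul_comm, (sub_eq_zero.mp h.symm), smul_smul, smul_smul, ← h2, mul_comm]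

/-- The cocycle identity, linearised in the direction of a function of degree `n`. -/
theorem cocycle_mixed {γ : GraphSeries 𝕂 (n + 1)} (hγ : γ ∈ cocycles 𝕂 (n + 1) 0) (p : ℕ)
    {m l : R} (hm : m ∈ S.homog (n + 1)) (hl : l ∈ S.homog n) (hmm : S.bracket m m = 0) :
    ((p + 1 : ℕ) : 𝕂) • S.bracket (S.cochain γ p (Fin.cons l fun _ => m)) m +
      S.bracket l (S.cochain γ p fun _ => m) =
      ((p + 1 : ℕ) : 𝕂) • S.cochain γ p (Fin.cons (S.bracket l m) fun _ => m) := by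
  set E := OddExt.superalgebra S with hE
  have hγf : EdgeFinite γ := edgeFinite_of_mem le_rfl hγ.1
  have hfst : ∀ y : Fin (p + 1) → OddExt S, (E.cochain γ p y).fst =
      S.cochain γ p fun i => (y i).fst := fun y => (OddExt.fstHom S).map_cochain hγf p y
  -- The element m + θ l is again of degree n + 1, so the identity for even elements applies to it;
  -- the wanted identity is its θ-coefficient, divided by 2(-1)^n.
  set m' : OddExt S := ⟨m, l⟩ with hm'
  have hm'h : m' ∈ E.homog (n + 1) := ⟨hm, by simpa using hl⟩
  have hm'p := E.par_of_mem_top hm'h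
  have hmp := S.par_of_mem_top hm
  have hlp : S.par l = (-1 : 𝕂) ^ n • l := by
    rw [S.par_of_mem hl]
    norm_cast
  have hcons : ∀ y : OddExt S, (E.cochain γ p (Fin.cons y fun _ => m')).fst =
      S.cochain γ p (Fin.cons y.fst fun _ => m) := by
    intro y
    rw [hfst]
    congr 1
    funext i
    refine Fin.cases rfl (fun i => rfl) i
  -- Since γ has degree 0, θ leaves the first argument without a sign; as θ² = 0, only the θ-free
  -- parts of the other arguments then matter.
  have htheta : ∀ y : R, E.cochain γ p (Fin.cons (⟨0, y⟩ : OddExt S) fun _ => m') =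
      ⟨0, S.cochain γ p (Fin.cons y fun _ => m)⟩ := by
    intro y
    have h := E.cochain_cons OddExt.theta_superCommutes OddExt.theta_mul hγ.1 hγf
      (⟨y, 0⟩ : OddExt S) (fun _ : Fin p => m')
    refine h.trans ?_
    change (⟨0, (E.cochain γ p (Fin.cons ⟨y, 0⟩ fun _ => m')).fst⟩ : OddExt S) = _
    rw [hcons]
  have hD1 : (E.cochain γ p fun _ => m').fst = S.cochain γ p fun _ => m := hfst _
  -- The Euler derivation θ ∂_θ isolates the θ-coefficient; by the chain rule this is the derivative
  -- in the direction l.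
  have hD2 : (E.cochain γ p fun _ => m').snd =
      ((p + 1 : ℕ) : 𝕂) • S.cochain γ p (Fin.cons l fun _ => m) := by
    have h := E.derivation_cochain_const OddExt.euler_superCommutes OddExt.euler_mul hγ.1.1 hγf p
      hm'p
    have h2 : OddExt.euler S m' = ⟨0, l⟩ := rfl
    rw [h2, htheta] at h
    exact congrArg OddExt.snd h
  -- The θ-free part is {m,m} = 0, and graded symmetry makes the two mixed brackets equal.
  have hsq : E.bracket m' m' = ⟨0, (2 * (-1 : 𝕂) ^ n) • S.bracket l m⟩ := by
    refine OddExt.ext ?_ ?_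
    · exact ((OddExt.fstHom S).map_bracket m' m').trans hmm
    · rw [OddExt.snd_bracket]
      change (-1 : 𝕂) ^ n • (S.bracket l m + S.bracket (S.par m) l) = _
      rw [hmp, map_smul, LinearMap.smul_apply, S.bracket_symm_mixed hmp hlp, smul_smul]
      have : (-1 : 𝕂) ^ n * (-1) ^ n = 1 := by rw [← pow_add, Even.neg_one_pow ⟨_, rfl⟩]
      rw [show (-1 : 𝕂) ^ (n + 1) * -(-1) ^ n = 1 by rw [pow_succ]; linear_combination this,
        one_smul, ← two_smul 𝕂, smul_smul, mul_comm]
  have key := congrArg OddExt.snd (E.cocycle_even hγ p hm'p)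
  rw [hsq, htheta, OddExt.snd_smul, OddExt.snd_smul, OddExt.snd_bracket, hD1, hD2,
    S.par_of_mem_top (S.cochain_mem_top hγ.1 _ fun _ => hm)] at key
  change (2 : 𝕂) • (-1 : 𝕂) ^ n • (S.bracket _ m + S.bracket _ l) = _ at key
  have hDp := S.par_of_mem_top (S.cochain_mem_top hγ.1 (p := p) _ fun _ => hm)
  have hcs : S.cochain γ p (Fin.cons ((2 * (-1 : 𝕂) ^ n) • S.bracket l m) fun _ => m) =
      (2 * (-1 : 𝕂) ^ n) • S.cochain γ p (Fin.cons (S.bracket l m) fun _ => m) :=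
    (S.cochain γ p).cons_smul _ _ _
  rw [hcs, map_smul, LinearMap.smul_apply, map_smul, LinearMap.smul_apply,
    S.bracket_symm_mixed hDp hlp, smul_smul, smul_smul, smul_comm _ (2 * (-1 : 𝕂) ^ n)] at key
  have h1 : (2 : 𝕂) * (-1) ^ n ≠ 0 := mul_ne_zero two_ne_zero (pow_ne_zero _ (by simp))
  have key' := smul_right_injective R h1 key
  have : (-1 : 𝕂) ^ n * (-1) ^ n = 1 := by rw [← pow_add, Even.neg_one_pow ⟨_, rfl⟩]
  rwa [show (-1 : 𝕂) ^ (n + 1) * -(-1) ^ n = 1 by rw [pow_succ]; linear_combination this,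
    one_smul] at key'

end PoissonSuperalgebra

/-! ### Formal power series -/

section Series

variable {𝕂 T : Type*} [Field 𝕂] [Ring T] [Algebra 𝕂 T]

variable (𝕂 T) in
/-- Multiplication by the formal parameter. -/
def eps : Module.End 𝕂 (PowerSeries T) := LinearMap.mulLeft 𝕂 PowerSeries.X

theorem coeff_zero_eps (x : PowerSeries T) : PowerSeries.coeff 0 (eps 𝕂 T x) = 0 := by
  simp [eps]

theorem coeff_succ_eps (N : ℕ) (x : PowerSeries T) :
    PowerSeries.coeff (N + 1) (eps 𝕂 T x) = PowerSeries.coeff N x := by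
  rw [eps, LinearMap.mulLeft_apply, PowerSeries.coeff_succ_X_mul]

theorem coeff_eps_pow (k N : ℕ) (x : PowerSeries T) :
    PowerSeries.coeff N ((eps 𝕂 T ^ k) x) =
      if k ≤ N then PowerSeries.coeff (N - k) x else 0 := by
  induction k generalizing N with
  | zero => simp
  | succ k ih =>
    rw [pow_succ', Module.End.mul_apply]
    cases N with
    | zero => simp [coeff_zero_eps]
    | succ N =>
      rw [coeff_succ_eps, ih]
      simp

theorem eps_mul_left (x y : PowerSeries T) : eps 𝕂 T (x * y) = eps 𝕂 T x * y := by
  simp [eps, mul_assoc]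

theorem eps_mul_right (x y : PowerSeries T) : eps 𝕂 T (x * y) = x * eps 𝕂 T y := by
  rw [eps, LinearMap.mulLeft_apply, LinearMap.mulLeft_apply, ← mul_assoc, ← mul_assoc,
    (PowerSeries.commute_X x).eq]

theorem eps_mul_psMap {T₁ : Type*} [Ring T₁] [Algebra 𝕂 T₁] (φ : T →ₗ[𝕂] T₁) (x : PowerSeries T) :
    psMap φ (eps 𝕂 T x) = eps 𝕂 T₁ (psMap φ x) := by
  refine PowerSeries.ext fun N => ?_
  cases N with
  | zero => simp [coeff_zero_eps]
  | succ N => rw [coeff_psMap, coeff_succ_eps, coeff_succ_eps, coeff_psMap]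

theorem eps_superCommutes {n : ℕ} {sg : Signature 𝕂 n} (S : PoissonSuperalgebra sg T) :
    ((psExt 𝕂 T).superalgebra S).SuperCommutes 0 (eps 𝕂 T) :=
  (psExt 𝕂 T).superCommutes_of_comm S fun φ => LinearMap.ext fun x => (eps_mul_psMap φ x).symm

/-- Congruence modulo `ε^N`. -/
def CongrMod (N : ℕ) (x y : PowerSeries T) : Prop :=
  ∀ i < N, PowerSeries.coeff i x = PowerSeries.coeff i y

theorem CongrMod.refl (N : ℕ) (x : PowerSeries T) : CongrMod N x x := fun _ _ => rfl

theorem CongrMod.symm {N : ℕ} {x y : PowerSeries T} (h : CongrMod N x y) : CongrMod N y x :=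
  fun i hi => (h i hi).symm

theorem CongrMod.trans {N : ℕ} {x y z : PowerSeries T} (h : CongrMod N x y) (h' : CongrMod N y z) :
    CongrMod N x z := fun i hi => (h i hi).trans (h' i hi)

theorem CongrMod.mono {N M : ℕ} {x y : PowerSeries T} (h : CongrMod N x y) (hM : M ≤ N) :
    CongrMod M x y := fun i hi => h i (by omega)

theorem CongrMod.add {N : ℕ} {x y x' y' : PowerSeries T} (h : CongrMod N x y)
    (h' : CongrMod N x' y') : CongrMod N (x + x') (y + y') := fun i hi => by
  rw [map_add, map_add, h i hi, h' i hi]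

theorem CongrMod.eps {N : ℕ} {x y : PowerSeries T} (h : CongrMod N x y) :
    CongrMod (N + 1) (eps 𝕂 T x) (eps 𝕂 T y) := by
  rintro (_ | i) hi
  · rw [coeff_zero_eps, coeff_zero_eps]
  · rw [coeff_succ_eps, coeff_succ_eps, h i (by omega)]

theorem eq_of_congrMod {x y : PowerSeries T} (h : ∀ N, CongrMod N x y) : x = y :=
  PowerSeries.ext fun N => h (N + 1) N (by omega)

variable (𝕂) in
theorem CongrMod.exists_eq {N : ℕ} {x y : PowerSeries T} (h : CongrMod N x y) :
    ∃ u, x = y + (GraphHam.eps 𝕂 T ^ N) u := by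
  refine ⟨PowerSeries.mk fun i => PowerSeries.coeff (i + N) (x - y), PowerSeries.ext fun i => ?_⟩
  rw [map_add, coeff_eps_pow]
  split_ifs with hi
  · rw [PowerSeries.coeff_mk, Nat.sub_add_cancel hi, map_sub]
    abel
  · rw [h i (by omega), add_zero]

theorem congrMod_eps_pow (N : ℕ) (x y : PowerSeries T) :
    CongrMod N (x + (GraphHam.eps 𝕂 T ^ N) y) x := fun i hi => by
  rw [map_add, coeff_eps_pow, if_neg (by omega), add_zero]

/-- Operators linear over the formal parameter. -/
def EpsLinear (φ : Module.End 𝕂 (PowerSeries T)) : Prop := ∀ x, φ (eps 𝕂 T x) = eps 𝕂 T (φ x)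

theorem EpsLinear.pow {φ : Module.End 𝕂 (PowerSeries T)} (h : EpsLinear φ) (N : ℕ)
    (x : PowerSeries T) : φ ((eps 𝕂 T ^ N) x) = (eps 𝕂 T ^ N) (φ x) := by
  induction N generalizing x with
  | zero => rfl
  | succ N ih => rw [pow_succ, Module.End.mul_apply, ih, h, Module.End.mul_apply]

theorem EpsLinear.congrMod {φ : Module.End 𝕂 (PowerSeries T)} (h : EpsLinear φ) {N : ℕ}
    {x y : PowerSeries T} (hxy : CongrMod N x y) : CongrMod N (φ x) (φ y) := by
  obtain ⟨u, rfl⟩ := hxy.exists_eq 𝕂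
  rw [map_add, h.pow]
  exact congrMod_eps_pow _ _ _

theorem epsLinear_psMap (φ : Module.End 𝕂 T) : EpsLinear (psMap φ) := eps_mul_psMap φ

theorem epsLinear_eps : EpsLinear (eps 𝕂 T) := fun _ => rfl

/-- The series `∑ ε^p y_p`. -/
def fsum (y : ℕ → PowerSeries T) : PowerSeries T :=
  PowerSeries.mk fun N => ∑ p ∈ Finset.range (N + 1), PowerSeries.coeff (N - p) (y p)

theorem coeff_fsum (y : ℕ → PowerSeries T) (N : ℕ) : PowerSeries.coeff N (fsum y) =
    ∑ p ∈ Finset.range (N + 1), PowerSeries.coeff (N - p) (y p) :=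
  PowerSeries.coeff_mk _ _

variable (𝕂) in
theorem fsum_congrMod (y : ℕ → PowerSeries T) (N : ℕ) :
    CongrMod N (fsum y) (∑ p ∈ Finset.range N, (eps 𝕂 T ^ p) (y p)) := by
  intro i hi
  rw [coeff_fsum, map_sum]
  simp only [coeff_eps_pow]
  rw [← Finset.sum_filter]
  refine Finset.sum_congr ?_ fun _ _ => rfl
  ext p
  simp
  omega

/-- Linearity over ε already implies continuity: modulo ε^N the infinite sum is finite. -/
theorem EpsLinear.fsum {φ : Module.End 𝕂 (PowerSeries T)} (h : EpsLinear φ)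
    (y : ℕ → PowerSeries T) : φ (fsum y) = GraphHam.fsum fun p => φ (y p) := by
  refine eq_of_congrMod fun N => (h.congrMod (fsum_congrMod 𝕂 y N)).trans ?_
  rw [map_sum]
  simp only [h.pow]
  exact (fsum_congrMod 𝕂 _ N).symm

theorem psMap_fsum {T₁ : Type*} [Ring T₁] [Algebra 𝕂 T₁] (φ : T →ₗ[𝕂] T₁)
    (y : ℕ → PowerSeries T) : psMap φ (fsum y) = fsum fun p => psMap φ (y p) :=
  PowerSeries.ext fun N => by simp [coeff_fsum]

theorem fsum_add (x y : ℕ → PowerSeries T) : fsum (fun p => x p + y p) = fsum x + fsum y :=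
  PowerSeries.ext fun N => by simp [coeff_fsum, Finset.sum_add_distrib]

theorem fsum_smul (c : 𝕂) (x : ℕ → PowerSeries T) : fsum (fun p => c • x p) = c • fsum x := by
  have h : ∀ (N : ℕ) (x : PowerSeries T),
    PowerSeries.coeff N (c • x) = c • PowerSeries.coeff N x := fun N x => rfl
  exact PowerSeries.ext fun N => by simp only [coeff_fsum, h, Finset.smul_sum]

variable (𝕂) in
theorem fsum_succ (y : ℕ → PowerSeries T) :
    fsum y = y 0 + eps 𝕂 T (fsum fun p => y (p + 1)) := by
  refine PowerSeries.ext fun N => ?_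
  rw [map_add, coeff_fsum, Finset.sum_range_succ']
  cases N with
  | zero => simp [coeff_zero_eps]
  | succ N =>
    rw [coeff_succ_eps, coeff_fsum, add_comm]
    simp

theorem fsum_fsum (F : ℕ → ℕ → PowerSeries T) :
    fsum (fun p => fsum fun q => F p q) =
      fsum fun k => ∑ a ∈ Finset.HasAntidiagonal.antidiagonal k, F a.1 a.2 := by
  refine PowerSeries.ext fun N => ?_
  simp only [coeff_fsum, map_sum]
  rw [Finset.sum_sigma', Finset.sum_sigma']
  refine Finset.sum_bij' (fun a _ => ⟨a.1 + a.2, (a.1, a.2)⟩) (fun b _ => ⟨b.2.1, b.2.2⟩) ?_ ?_ ?_ ?_ ?_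
  · rintro ⟨p, q⟩ h
    simp at h ⊢
    omega
  · rintro ⟨k, p, q⟩ h
    simp at h ⊢
    omega
  · rintro ⟨p, q⟩ h
    rfl
  · rintro ⟨k, p, q⟩ h
    simp at h
    obtain ⟨h1, rfl⟩ := h
    rfl
  · rintro ⟨p, q⟩ h
    simp [Nat.sub_sub]

theorem fsum_congrMod_congr {N : ℕ} {x y : ℕ → PowerSeries T} (h : ∀ p, CongrMod N (x p) (y p)) :
    CongrMod N (fsum x) (fsum y) := fun i hi => by
  rw [coeff_fsum, coeff_fsum]
  exact Finset.sum_congr rfl fun p _ => h p _ (by omega)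

/-- A contracting operator on power series has a fixed point. -/
theorem exists_fixedPoint (Ψ : PowerSeries T → PowerSeries T)
    (h : ∀ N x y, CongrMod N x y → CongrMod (N + 1) (Ψ x) (Ψ y)) (W : AddSubgroup T)
    (hW : ∀ x, (∀ N, PowerSeries.coeff N x ∈ W) → ∀ N, PowerSeries.coeff N (Ψ x) ∈ W) :
    ∃ x, Ψ x = x ∧ ∀ N, PowerSeries.coeff N x ∈ W := by
  have h1 : ∀ k, CongrMod k (Ψ^[k] 0) (Ψ^[k + 1] 0) := by
    intro k
    induction k with
    | zero => exact fun i hi => absurd hi (by omega)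
    | succ k ih =>
      rw [Function.iterate_succ_apply', Function.iterate_succ_apply' _ (k + 1)]
      exact h _ _ _ ih
  have h2 : ∀ k j, CongrMod k (Ψ^[k] 0) (Ψ^[k + j] 0) := by
    intro k j
    induction j with
    | zero => exact CongrMod.refl _ _
    | succ j ih => exact ih.trans ((h1 (k + j)).mono (by omega))
  have h3 : ∀ k N, PowerSeries.coeff N (Ψ^[k] 0) ∈ W := by
    intro k
    induction k with
    | zero => exact fun N => by simp
    | succ k ih =>
      rw [Function.iterate_succ_apply']
      exact hW _ ih
  -- Iterates k and k + 1 agree modulo ε^k, so the coefficient of ε^N is stable from the iterate N +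
  -- 1 on.
  let x : PowerSeries T := PowerSeries.mk fun N => PowerSeries.coeff N (Ψ^[N + 1] 0)
  have h4 : ∀ N, CongrMod N x (Ψ^[N] 0) := by
    intro N i hi
    rw [PowerSeries.coeff_mk]
    obtain ⟨j, rfl⟩ := Nat.exists_eq_add_of_le (show i + 1 ≤ N by omega)
    exact h2 (i + 1) j i (by omega)
  refine ⟨x, eq_of_congrMod fun N => ?_, fun N => ?_⟩
  · refine ((h N _ _ (h4 N)).mono (Nat.le_succ N)).trans ?_
    rw [← Function.iterate_succ_apply' Ψ]
    exact ((h4 (N + 1)).mono (Nat.le_succ N)).symm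
  · rw [PowerSeries.coeff_mk]
    exact h3 _ _

end Series

namespace PoissonSuperalgebra

variable {𝕂 : Type*} [Field 𝕂] [CharZero 𝕂] {n : ℕ} {sg : Signature 𝕂 n}
  {T : Type*} [Ring T] [Algebra 𝕂 T] (S : PoissonSuperalgebra sg T)

/-! ### Vector fields attached to graphs

A power series `m` stands for the formal deformation `ε m`. -/

/-- Power series with coefficients in a Poisson superalgebra. -/
abbrev series : PoissonSuperalgebra sg (PowerSeries T) := (psExt 𝕂 T).superalgebra S

theorem mem_series_homog {k : ℤ} {x : PowerSeries T} :
    x ∈ S.series.homog k ↔ ∀ N, PowerSeries.coeff N x ∈ S.homog k :=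
  (psExt 𝕂 T).mem_homog S

theorem fsum_mem {k : ℤ} {y : ℕ → PowerSeries T} (hy : ∀ p, y p ∈ S.series.homog k) :
    fsum y ∈ S.series.homog k := by
  rw [mem_series_homog]
  intro N
  rw [coeff_fsum]
  exact sum_mem fun p _ => S.mem_series_homog.mp (hy p) _

theorem eps_mem {k : ℤ} {x : PowerSeries T} (hx : x ∈ S.series.homog k) :
    eps 𝕂 T x ∈ S.series.homog k := by
  rw [mem_series_homog] at hx ⊢
  rintro (_ | N)
  · rw [coeff_zero_eps]
    exact zero_mem _
  · rw [coeff_succ_eps]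
    exact hx N

theorem epsLinear_bracket_left (y : PowerSeries T) : EpsLinear (S.series.bracket.flip y) :=
  fun x => S.series.bracket_const_left (eps_superCommutes S) eps_mul_left x y

theorem epsLinear_bracket (x : PowerSeries T) : EpsLinear (S.series.bracket x) :=
  fun y => S.series.bracket_const_right (eps_superCommutes S) eps_mul_right x y

theorem bracket_congrMod {N : ℕ} {x x' y y' : PowerSeries T} (h : CongrMod N x x')
    (h' : CongrMod N y y') : CongrMod N (S.series.bracket x y) (S.series.bracket x' y') :=
  ((S.epsLinear_bracket_left y).congrMod h).trans ((S.epsLinear_bracket x').congrMod h')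

theorem bracket_fsum (x y : ℕ → PowerSeries T) : S.series.bracket (fsum x) (fsum y) =
    fsum fun k => ∑ a ∈ Finset.HasAntidiagonal.antidiagonal k, S.series.bracket (x a.1) (y a.2) := by
  rw [← fsum_fsum fun p q => S.series.bracket (x p) (y q)]
  refine ((S.epsLinear_bracket_left (fsum y)).fsum x).trans ?_
  congr 1
  funext p
  exact (S.epsLinear_bracket (x p)).fsum y

/-- The vector field `m ↦ ∑_p ε^p γ_p(m, …, m) / (p + 1)!`. -/
def hat (γ : GraphSeries 𝕂 (n + 1)) (m : PowerSeries T) : PowerSeries T :=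
  fsum fun p => (((p + 1).factorial : 𝕂)⁻¹) • S.series.cochain γ p fun _ => m

/-- The derivative of the vector field `hat γ` at `m`. -/
def dhat (γ : GraphSeries 𝕂 (n + 1)) (m : PowerSeries T) : Module.End 𝕂 (PowerSeries T) where
  toFun v := fsum fun p => ((p.factorial : 𝕂)⁻¹) • S.series.cochain γ p (Fin.cons v fun _ => m)
  map_add' v w := by
    rw [← fsum_add]
    congr 1
    funext p
    rw [← smul_add]
    exact congrArg _ ((S.series.cochain γ p).cons_add _ _ _)
  map_smul' c v := by
    rw [RingHom.id_apply, ← fsum_smul]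
    congr 1
    funext p
    rw [smul_comm c]
    exact congrArg _ ((S.series.cochain γ p).cons_smul _ _ _)

theorem dhat_apply (γ : GraphSeries 𝕂 (n + 1)) (m v : PowerSeries T) : S.dhat γ m v =
    fsum fun p => ((p.factorial : 𝕂)⁻¹) • S.series.cochain γ p (Fin.cons v fun _ => m) := rfl

theorem hat_mem {a : ℤ} {γ : GraphSeries 𝕂 (n + 1)} (hγ : γ ∈ fGCdeg 𝕂 (n + 1) a)
    (hγ' : EdgeFinite γ) {m : PowerSeries T} (hm : m ∈ S.series.homog (n + 1)) :
    S.hat γ m ∈ S.series.homog (n + 1 + a) :=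
  S.fsum_mem fun p => Submodule.smul_mem _ _ <|
    S.series.cochain_mem hγ hγ' (fun _ => n + 1) _ (fun _ => hm) (by simp; ring)

theorem dhat_mem {γ : GraphSeries 𝕂 (n + 1)} (hγ : γ ∈ fGCdeg 𝕂 (n + 1) 0)
    (hγ' : EdgeFinite γ) {k : ℤ} {m v : PowerSeries T} (hm : m ∈ S.series.homog (n + 1))
    (hv : v ∈ S.series.homog k) : S.dhat γ m v ∈ S.series.homog k :=
  S.fsum_mem fun p => Submodule.smul_mem _ _ <|
    S.series.cochain_mem hγ hγ' (Fin.cons k fun _ => (n + 1 : ℤ)) _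
      (fun i => by refine Fin.cases hv (fun _ => hm) i) (by simp [Fin.sum_univ_succ]; ring)

theorem cochain_cons_const {φ : Module.End 𝕂 (PowerSeries T)} (h : S.series.SuperCommutes 0 φ)
    (hl : ∀ x y, φ (x * y) = φ x * y) (hr : ∀ x y, φ (x * y) = x * φ y)
    {γ : GraphSeries 𝕂 (n + 1)} (hγ : EdgeFinite γ) {p : ℕ} (v : PowerSeries T)
    (x : Fin p → PowerSeries T) :
    S.series.cochain γ p (Fin.cons (φ v) x) = φ (S.series.cochain γ p (Fin.cons v x)) := by
  have := S.series.cochain_update h hl hr hγ (Fin.cons v x : Fin (p + 1) → PowerSeries T) 0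
  rwa [Fin.cons_zero, Fin.update_cons_zero] at this

theorem dhat_const {φ : Module.End 𝕂 (PowerSeries T)} (h : S.series.SuperCommutes 0 φ)
    (hl : ∀ x y, φ (x * y) = φ x * y) (hr : ∀ x y, φ (x * y) = x * φ y) (hε : EpsLinear φ)
    {γ : GraphSeries 𝕂 (n + 1)} (hγ : EdgeFinite γ) (m v : PowerSeries T) :
    S.dhat γ m (φ v) = φ (S.dhat γ m v) := by
  rw [dhat_apply, dhat_apply, hε.fsum]
  congr 1
  funext p
  rw [S.cochain_cons_const h hl hr hγ, map_smul]

theorem epsLinear_dhat {γ : GraphSeries 𝕂 (n + 1)} (hγ : EdgeFinite γ) (m : PowerSeries T) :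
    EpsLinear (S.dhat γ m) :=
  fun v => S.dhat_const (eps_superCommutes S) eps_mul_left eps_mul_right epsLinear_eps hγ m v

theorem hat_add_smul {γ γ' : GraphSeries 𝕂 (n + 1)} (hγ : EdgeFinite γ) (hγ' : EdgeFinite γ')
    (c : 𝕂) (m : PowerSeries T) : S.hat (γ + c • γ') m = S.hat γ m + c • S.hat γ' m := by
  rw [hat, hat, hat, ← fsum_smul, ← fsum_add]
  congr 1
  funext p
  rw [S.series.cochain_add_smul hγ hγ', add_apply, smul_apply, smul_add, smul_comm c]

/-- The vector fields are natural. -/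
theorem map_hat {T₁ : Type*} [Ring T₁] [Algebra 𝕂 T₁] {S : PoissonSuperalgebra sg T}
    {S₁ : PoissonSuperalgebra sg T₁} (φ : Hom S S₁)
    {γ : GraphSeries 𝕂 (n + 1)} (hγ : EdgeFinite γ) (m : PowerSeries T) :
    psMap φ.toFun (S.hat γ m) = S₁.hat γ (psMap φ.toFun m) := by
  let Φ : Hom S.series S₁.series :=
    (psExt 𝕂 T).mapHom (psExt 𝕂 T₁) φ (psMap φ.toFun) fun N x => coeff_psMap _ _ _
  rw [hat, hat, psMap_fsum]
  congr 1
  funext p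
  rw [map_smul]
  exact congrArg _ (Φ.map_cochain hγ p _)

/-- The arguments are replaced one at a time; each difference is a multiple of ε^N, which comes out
of its argument by linearity over ε. -/
theorem cochain_congrMod {γ : GraphSeries 𝕂 (n + 1)} (hγ : EdgeFinite γ) {p N : ℕ}
    {x y : Fin (p + 1) → PowerSeries T} (h : ∀ i, CongrMod N (x i) (y i)) :
    CongrMod N (S.series.cochain γ p x) (S.series.cochain γ p y) := by
  have key : ∀ s : Finset (Fin (p + 1)),
      CongrMod N (S.series.cochain γ p (s.piecewise x y)) (S.series.cochain γ p y) := by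
    intro s
    induction s using Finset.induction with
    | empty =>
      rw [Finset.piecewise_empty]
      exact CongrMod.refl _ _
    | insert i s his ih =>
      refine CongrMod.trans ?_ ih
      rw [Finset.piecewise_insert]
      obtain ⟨u, hu⟩ := (h i).exists_eq 𝕂
      rw [hu, MultilinearMap.map_update_add]
      have h1 : Function.update (s.piecewise x y) i (y i) = s.piecewise x y := by
        conv_rhs => rw [← Function.update_eq_self i (s.piecewise x y)]
        rw [Finset.piecewise_eq_of_notMem _ _ _ his]
      have h2 : ∀ k, S.series.cochain γ p (Function.update (s.piecewise x y) i ((eps 𝕂 T ^ k) u)) =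
          (eps 𝕂 T ^ k) (S.series.cochain γ p (Function.update (s.piecewise x y) i u)) := by
        intro k
        induction k with
        | zero => rfl
        | succ k ih =>
          have := S.series.cochain_update (eps_superCommutes S) eps_mul_left eps_mul_right hγ
            (Function.update (s.piecewise x y) i ((eps 𝕂 T ^ k) u)) i
          rw [Function.update_self, Function.update_idem, ih] at this
          rw [pow_succ', Module.End.mul_apply, Module.End.mul_apply, this]
      rw [h1, h2]
      exact congrMod_eps_pow _ _ _
  have := key Finset.univ
  rwa [Finset.piecewise_univ] at this

/-- The term p = 0 is absent, so `hat γ` is divisible by ε and gains one order of precision. This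
contraction property gives existence and uniqueness of flows. -/
theorem hat_congrMod_succ {γ : GraphSeries 𝕂 (n + 1)} (hγ : EdgeFinite γ) (h0 : ∀ k, γ 0 k = 0)
    {N : ℕ} {x y : PowerSeries T} (h : CongrMod N x y) :
    CongrMod (N + 1) (S.hat γ x) (S.hat γ y) := by
  have h2 : ∀ x, S.hat γ x = eps 𝕂 T
      (fsum fun p => (((p + 2).factorial : 𝕂)⁻¹) • S.series.cochain γ (p + 1) fun _ => x) := by
    intro x
    rw [hat, fsum_succ 𝕂, S.series.cochain_eq_zero h0, zero_apply, smul_zero, zero_add]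
  rw [h2, h2]
  refine CongrMod.eps (fsum_congrMod_congr fun p i hi => ?_)
  exact congrArg ((((p + 2).factorial : 𝕂)⁻¹) • ·) (S.cochain_congrMod hγ (fun _ => h) i hi)

theorem dhat_congrMod_succ {γ : GraphSeries 𝕂 (n + 1)} (hγ : EdgeFinite γ) (h0 : ∀ k, γ 0 k = 0)
    {N : ℕ} {x y : PowerSeries T} (m : PowerSeries T) (h : CongrMod N x y) :
    CongrMod (N + 1) (S.dhat γ m x) (S.dhat γ m y) := by
  have h2 : ∀ v, S.dhat γ m v = eps 𝕂 T (fsum fun p => (((p + 1).factorial : 𝕂)⁻¹) •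
      S.series.cochain γ (p + 1) (Fin.cons v fun _ => m)) := by
    intro x
    rw [dhat_apply, fsum_succ 𝕂, S.series.cochain_eq_zero h0, zero_apply, smul_zero, zero_add]
  rw [h2, h2]
  refine CongrMod.eps (fsum_congrMod_congr fun p i hi => ?_)
  refine congrArg ((((p + 1).factorial : 𝕂)⁻¹) • ·) (S.cochain_congrMod hγ (fun j => ?_) i hi)
  exact Fin.cases h (fun _ => CongrMod.refl _ _) j


theorem factorial_inv_mul (p : ℕ) :
    (((p + 1).factorial : 𝕂)⁻¹) * ((p + 1 : ℕ) : 𝕂) = (p.factorial : 𝕂)⁻¹ := by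
  rw [Nat.factorial_succ]
  have h1 : ((p + 1 : ℕ) : 𝕂) ≠ 0 := Nat.cast_ne_zero.mpr (by omega)
  have h2 : (p.factorial : 𝕂) ≠ 0 := Nat.cast_ne_zero.mpr p.factorial_ne_zero
  push_cast at h1 ⊢
  field_simp

/-- The chain rule: by symmetry the p + 1 arguments contribute equally, which turns 1/(p+1)! into
1/p!. -/
theorem derivation_hat {φ : Module.End 𝕂 (PowerSeries T)} (h : S.series.SuperCommutes 0 φ)
    (hφ : ∀ x y, φ (x * y) = φ x * y + x * φ y) (hε : EpsLinear φ)
    {γ : GraphSeries 𝕂 (n + 1)} (hγ : γ ∈ fGC 𝕂 (n + 1)) (hγ' : EdgeFinite γ) {m : PowerSeries T}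
    (hm : S.series.par m = (-1 : 𝕂) ^ (n + 1) • m) :
    φ (S.hat γ m) = S.dhat γ m (φ m) := by
  rw [hat, hε.fsum, dhat_apply]
  congr 1
  funext p
  rw [map_smul, S.series.derivation_cochain_const h hφ hγ hγ' p hm, smul_smul, factorial_inv_mul]

/-- The number of shuffles, (M+1 choose q+1) with p + q = M, divided by (M+1)! is 1/(p! (q+1)!). So
the pre-Lie product of graphs is the derivative of one vector field along the other. -/
theorem hat_preLie {γ γ' : GraphSeries 𝕂 (n + 1)} (hγ : EdgeFinite γ) (hγ' : EdgeFinite γ')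
    {m : PowerSeries T} (hm : S.series.par m = (-1 : 𝕂) ^ (n + 1) • m) :
    S.hat (preLie (n + 1) γ γ') m = S.dhat γ m (S.hat γ' m) := by
  have h1 : ∀ p, S.series.cochain γ p (Fin.cons (S.hat γ' m) fun _ => m) =
      fsum fun q => (((q + 1).factorial : 𝕂)⁻¹) •
        S.series.cochain γ p (Fin.cons (S.series.cochain γ' q fun _ => m) fun _ => m) := by
    intro p
    let L : Module.End 𝕂 (PowerSeries T) :=
      { toFun := fun v => S.series.cochain γ p (Fin.cons v fun _ => m)
        map_add' := fun v w => (S.series.cochain γ p).cons_add _ _ _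
        map_smul' := fun c v => (S.series.cochain γ p).cons_smul _ _ _ }
    have hL : EpsLinear L := fun v =>
      S.cochain_cons_const (eps_superCommutes S) eps_mul_left eps_mul_right hγ v _
    have := hL.fsum fun q => (((q + 1).factorial : 𝕂)⁻¹) • S.series.cochain γ' q fun _ => m
    simp only [map_smul] at this
    exact this
  rw [dhat_apply]
  simp only [h1, ← fsum_smul]
  rw [fsum_fsum (fun p q => ((p.factorial : 𝕂)⁻¹) • (((q + 1).factorial : 𝕂)⁻¹) •
        S.series.cochain γ p (Fin.cons (S.series.cochain γ' q fun _ => m) fun _ => m)), hat]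
  congr 1
  funext M
  rw [S.series.cochain_preLie_const hγ hγ' M hm, Finset.Nat.sum_antidiagonal_eq_sum_range_succ_mk,
    Finset.smul_sum]
  refine Finset.sum_congr rfl fun p hp => ?_
  have hpM : p ≤ M := by simpa [Nat.lt_succ_iff] using hp
  rw [smul_smul, smul_smul]
  congr 1
  rw [Nat.cast_choose 𝕂 (show M - p + 1 ≤ M + 1 by omega),
    show M + 1 - (M - p + 1) = p by omega]
  have h2 : ((M + 1).factorial : 𝕂) ≠ 0 := Nat.cast_ne_zero.mpr (Nat.factorial_ne_zero _)
  field_simp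

/-- The field of γ commutes with the quadratic field m ↦ {m,m}/2, by summation of `cocycle_even`. -/
theorem bracket_hat {γ : GraphSeries 𝕂 (n + 1)} (hγ : γ ∈ cocycles 𝕂 (n + 1) 0)
    {m : PowerSeries T} (hm : S.series.par m = (-1 : 𝕂) ^ (n + 1) • m) :
    (2 : 𝕂) • S.series.bracket (S.hat γ m) m = S.dhat γ m (S.series.bracket m m) := by
  have h := (S.epsLinear_bracket_left m).fsum fun p => (((p + 1).factorial : 𝕂)⁻¹) •
    S.series.cochain γ p fun _ => m
  change S.series.bracket (S.hat γ m) m = fsum fun p => S.series.bracket _ m at h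
  rw [h, ← fsum_smul, dhat_apply]
  congr 1
  funext p
  rw [map_smul, LinearMap.smul_apply, smul_comm, S.series.cocycle_even hγ p hm, smul_smul,
    factorial_inv_mul]

/-- The derivative of the preceding identity in a direction l of the opposite parity, at a solution
of {m,m} = 0. It controls how ε{l,m} evolves under the linearised flow. -/
theorem bracket_hat_mixed {γ : GraphSeries 𝕂 (n + 1)} (hγ : γ ∈ cocycles 𝕂 (n + 1) 0)
    {m l : PowerSeries T} (hm : m ∈ S.series.homog (n + 1)) (hl : l ∈ S.series.homog n)
    (hmm : S.series.bracket m m = 0) :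
    S.series.bracket (S.dhat γ m l) m + S.series.bracket l (S.hat γ m) =
      S.dhat γ m (S.series.bracket l m) := by
  have h := (S.epsLinear_bracket_left m).fsum fun p => ((p.factorial : 𝕂)⁻¹) •
    S.series.cochain γ p (Fin.cons l fun _ => m)
  change S.series.bracket (S.dhat γ m l) m = fsum fun p => S.series.bracket _ m at h
  rw [h, hat, (S.epsLinear_bracket l).fsum, ← fsum_add, dhat_apply]
  congr 1
  funext p
  rw [map_smul, LinearMap.smul_apply, map_smul, ← factorial_inv_mul p, ← smul_smul, ← smul_add,
    S.series.cocycle_mixed hγ p hm hl hmm, smul_smul]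

/-- When {m,m} = 0 the part of the differential that inserts the bracket into η dies, and the
bracket of η(m) with m remains. It has one argument more than η, whence the factor ε. -/
theorem hat_graphDiff {η : GraphSeries 𝕂 (n + 1)} (hη : EdgeFinite η) (a : ℤ)
    {m : PowerSeries T} (hm : S.series.par m = (-1 : 𝕂) ^ (n + 1) • m)
    (hmm : S.series.bracket m m = 0) :
    S.hat (graphDiff (n + 1) a η) m = eps 𝕂 T (S.series.bracket (S.hat η m) m) := by
  have h := (S.epsLinear_bracket_left m).fsum fun p => (((p + 1).factorial : 𝕂)⁻¹) •
    S.series.cochain η p fun _ => m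
  change S.series.bracket (S.hat η m) m = fsum fun p => S.series.bracket _ m at h
  rw [h, hat, fsum_succ 𝕂, S.series.cochain_graphDiff_zero hη a hm, smul_zero, zero_add]
  congr 2
  funext p
  have h0 : S.series.cochain η p (Fin.cons (0 : PowerSeries T) fun _ => m) = 0 :=
    (S.series.cochain η p).map_coord_zero 0 rfl
  rw [S.series.cochain_graphDiff_const hη a p hm, hmm, h0, smul_zero, smul_zero, sub_zero,
    map_smul, LinearMap.smul_apply, smul_smul, factorial_inv_mul]

end PoissonSuperalgebra

/-! ### Polynomial dependence on a time parameter -/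

section Time

variable (𝕂 : Type*) {Q : Type*} [Field 𝕂] [Ring Q] [Algebra 𝕂 Q]

variable (Q) in
/-- The derivative with respect to time. -/
def timeDeriv : Module.End 𝕂 (Polynomial Q) := Polynomial.derivative.restrictScalars 𝕂

theorem coeff_timeDeriv (x : Polynomial Q) (N : ℕ) :
    (timeDeriv 𝕂 Q x).coeff N = ((N + 1 : ℕ) : 𝕂) • x.coeff (N + 1) := by
  change (Polynomial.derivative x).coeff N = _
  rw [Polynomial.coeff_derivative, Nat.cast_smul_eq_nsmul, nsmul_eq_mul, Nat.cast_comm]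
  push_cast
  rfl

theorem timeDeriv_mul (x y : Polynomial Q) :
    timeDeriv 𝕂 Q (x * y) = timeDeriv 𝕂 Q x * y + x * timeDeriv 𝕂 Q y :=
  Polynomial.derivative_mul

/-- The integral from time zero of the monomials of a polynomial. -/
def timeIntFun (x : Polynomial Q) : Polynomial Q :=
  ∑ i ∈ x.support, Polynomial.monomial (i + 1) ((((i + 1 : ℕ) : 𝕂)⁻¹) • x.coeff i)

theorem coeff_zero_timeIntFun (x : Polynomial Q) : (timeIntFun 𝕂 x).coeff 0 = 0 := by
  simp [timeIntFun, Polynomial.finsetSum_coeff, Polynomial.coeff_monomial]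

theorem coeff_succ_timeIntFun (x : Polynomial Q) (N : ℕ) :
    (timeIntFun 𝕂 x).coeff (N + 1) = (((N + 1 : ℕ) : 𝕂)⁻¹) • x.coeff N := by
  simp only [timeIntFun, Polynomial.finsetSum_coeff, Polynomial.coeff_monomial,
    Nat.add_right_cancel_iff, Finset.sum_ite_eq', Polynomial.mem_support_iff, ite_eq_left_iff,
    not_not]
  intro h
  rw [h, smul_zero]

variable (Q) in
/-- The integral from time zero. -/
def timeInt : Module.End 𝕂 (Polynomial Q) where
  toFun := timeIntFun 𝕂
  map_add' x y := Polynomial.ext fun N => by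
    cases N with
    | zero => simp [coeff_zero_timeIntFun]
    | succ N => simp [coeff_succ_timeIntFun]
  map_smul' c x := Polynomial.ext fun N => by
    cases N with
    | zero => simp [coeff_zero_timeIntFun]
    | succ N => simp only [coeff_succ_timeIntFun, Polynomial.coeff_smul, RingHom.id_apply,
        smul_comm c]

theorem timeDeriv_timeInt [CharZero 𝕂] (x : Polynomial Q) :
    timeDeriv 𝕂 Q (timeInt 𝕂 Q x) = x := Polynomial.ext fun N => by
  rw [coeff_timeDeriv]
  refine (congrArg _ (coeff_succ_timeIntFun 𝕂 x N)).trans ?_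
  rw [smul_smul, mul_inv_cancel₀ (Nat.cast_ne_zero.mpr (Nat.succ_ne_zero N)), one_smul]

theorem polyMap_timeDeriv {Q₁ : Type*} [Ring Q₁] [Algebra 𝕂 Q₁] (φ : Q →ₗ[𝕂] Q₁)
    (x : Polynomial Q) : polyMap φ (timeDeriv 𝕂 Q x) = timeDeriv 𝕂 Q₁ (polyMap φ x) :=
  Polynomial.ext fun N => by
    rw [coeff_polyMap, coeff_timeDeriv, coeff_timeDeriv, coeff_polyMap, map_smul]

variable (Q) in
/-- Multiplication by the time. -/
def timeMul : Module.End 𝕂 (Polynomial Q) := LinearMap.mulLeft 𝕂 Polynomial.X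

theorem timeDeriv_timeMul (x : Polynomial Q) :
    timeDeriv 𝕂 Q (timeMul 𝕂 Q x) = x + timeMul 𝕂 Q (timeDeriv 𝕂 Q x) := by
  rw [timeMul, LinearMap.mulLeft_apply, timeDeriv_mul, LinearMap.mulLeft_apply]
  congr 1
  change Polynomial.derivative Polynomial.X * _ = _
  rw [Polynomial.derivative_X, one_mul]

variable (Q) in
/-- Evaluation at the time `c`. -/
def timeEval (c : 𝕂) : Polynomial Q →ₗ[𝕂] Q where
  toFun x := x.sum fun i a => c ^ i • a
  map_add' x y := Polynomial.sum_add_index x y _ (fun i => smul_zero _) fun i a b => smul_add _ a b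
  map_smul' r x := by
    rw [RingHom.id_apply, Polynomial.sum_over_range' _ (fun i => smul_zero _) (x.natDegree + 1)
      (Nat.lt_succ_of_le (Polynomial.natDegree_smul_le r x)),
      Polynomial.sum_over_range _ (fun i => smul_zero _), Finset.smul_sum]
    refine Finset.sum_congr rfl fun i _ => ?_
    rw [Polynomial.coeff_smul, smul_comm]

theorem timeEval_monomial (c : 𝕂) (i : ℕ) (a : Q) :
    timeEval 𝕂 Q c (Polynomial.monomial i a) = c ^ i • a :=
  Polynomial.sum_monomial_index a _ (smul_zero _)

theorem timeEval_C (c : 𝕂) (a : Q) : timeEval 𝕂 Q c (Polynomial.C a) = a := by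
  rw [← Polynomial.monomial_zero_left, timeEval_monomial, pow_zero, one_smul]

theorem timeEval_zero (x : Polynomial Q) : timeEval 𝕂 Q 0 x = x.coeff 0 := by
  induction x using Polynomial.induction_on' with
  | add x y hx hy => rw [map_add, hx, hy, Polynomial.coeff_add]
  | monomial i a =>
    rw [timeEval_monomial, Polynomial.coeff_monomial]
    rcases Nat.eq_zero_or_pos i with rfl | hi
    · simp
    · rw [zero_pow hi.ne', zero_smul, if_neg hi.ne']

theorem timeEval_timeMul (c : 𝕂) (x : Polynomial Q) :
    timeEval 𝕂 Q c (timeMul 𝕂 Q x) = c • timeEval 𝕂 Q c x := by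
  induction x using Polynomial.induction_on' with
  | add x y hx hy => rw [map_add, map_add, hx, hy, map_add, smul_add]
  | monomial i a =>
    rw [timeMul, LinearMap.mulLeft_apply, Polynomial.X_mul_monomial, timeEval_monomial, timeEval_monomial, smul_smul, pow_succ']

theorem timeEval_mul (c : 𝕂) (x y : Polynomial Q) :
    timeEval 𝕂 Q c (x * y) = timeEval 𝕂 Q c x * timeEval 𝕂 Q c y := by
  induction x using Polynomial.induction_on' with
  | add x z hx hz => rw [add_mul, map_add, hx, hz, map_add, add_mul]
  | monomial i a =>
    induction y using Polynomial.induction_on' with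
    | add y z hy hz => rw [mul_add, map_add, hy, hz, map_add, mul_add]
    | monomial j b =>
      rw [Polynomial.monomial_mul_monomial, timeEval_monomial, timeEval_monomial,
        timeEval_monomial, smul_mul_smul_comm, pow_add]

theorem timeEval_polyMap {Q₁ : Type*} [Ring Q₁] [Algebra 𝕂 Q₁] (φ : Q →ₗ[𝕂] Q₁) (c : 𝕂)
    (x : Polynomial Q) : timeEval 𝕂 Q₁ c (polyMap φ x) = φ (timeEval 𝕂 Q c x) := by
  induction x using Polynomial.induction_on' with
  | add x z hx hz => rw [map_add, map_add, hx, hz, map_add, map_add]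
  | monomial i a =>
    have h : polyMap φ (Polynomial.monomial i a) = Polynomial.monomial i (φ a) :=
      Polynomial.ext fun N => by
        rw [coeff_polyMap, Polynomial.coeff_monomial, Polynomial.coeff_monomial]
        split_ifs <;> simp
    rw [h, timeEval_monomial, timeEval_monomial, map_smul]

theorem timeEval_timeInt (x : Polynomial Q) : timeEval 𝕂 Q 0 (timeInt 𝕂 Q x) = 0 := by
  rw [timeEval_zero]
  exact coeff_zero_timeIntFun 𝕂 x

/-- A polynomial is determined by its derivative and its value at time zero. -/
theorem eq_of_timeDeriv_eq [CharZero 𝕂] {x y : Polynomial Q}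
    (h : timeDeriv 𝕂 Q x = timeDeriv 𝕂 Q y)
    (h0 : timeEval 𝕂 Q 0 x = timeEval 𝕂 Q 0 y) : x = y := Polynomial.ext fun N => by
  cases N with
  | zero => rwa [timeEval_zero, timeEval_zero] at h0
  | succ N =>
    have := congrArg (fun z => Polynomial.coeff z N) h
    simp only [coeff_timeDeriv] at this
    exact smul_right_injective Q (Nat.cast_ne_zero.mpr (Nat.succ_ne_zero N) : ((N + 1 : ℕ) : 𝕂) ≠ 0)
      this

variable (Q) in
/-- Constants. -/
def timeConst : Q →ₗ[𝕂] Polynomial Q := Polynomial.CAlgHom.toLinearMap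

theorem timeConst_apply (a : Q) : timeConst 𝕂 Q a = Polynomial.C a := rfl

theorem timeDeriv_const (a : Q) : timeDeriv 𝕂 Q (timeConst 𝕂 Q a) = 0 := Polynomial.derivative_C

end Time

/-! ### Differential equations in time, solved order by order in ε -/

namespace PoissonSuperalgebra

variable {𝕂 : Type*} [Field 𝕂] {n : ℕ} {sg : Signature 𝕂 n}
  {Q : Type*} [Ring Q] [Algebra 𝕂 Q] (S : PoissonSuperalgebra sg Q)

/-- Polynomials with coefficients in a Poisson superalgebra. -/
abbrev poly : PoissonSuperalgebra sg (Polynomial Q) := (polyExt 𝕂 Q).superalgebra S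

theorem timeDeriv_superCommutes : S.poly.SuperCommutes 0 (timeDeriv 𝕂 Q) :=
  (polyExt 𝕂 Q).superCommutes_of_comm S fun φ =>
    LinearMap.ext fun x => (polyMap_timeDeriv 𝕂 φ x).symm

/-- Evaluation at a fixed time is a homomorphism. -/
def evalHom (c : 𝕂) : Hom S.poly S where
  toFun := timeEval 𝕂 Q c
  map_one := timeEval_C 𝕂 c 1
  map_mul := timeEval_mul 𝕂 c
  map_par := timeEval_polyMap 𝕂 S.par c
  map_pd A := timeEval_polyMap 𝕂 (S.pd A) c

theorem timeInt_mem {k : ℤ} {x : Polynomial Q} (hx : x ∈ S.poly.homog k) :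
    timeInt 𝕂 Q x ∈ S.poly.homog k := by
  rw [CoeffExt.mem_homog] at hx ⊢
  rintro (_ | N)
  · refine Eq.mpr (congrArg (· ∈ _) (coeff_zero_timeIntFun 𝕂 x)) (zero_mem _)
  · refine Eq.mpr (congrArg (· ∈ _) (coeff_succ_timeIntFun 𝕂 x N)) ?_
    exact Submodule.smul_mem _ _ (hx N)

theorem timeConst_mem {k : ℤ} {a : Q} (ha : a ∈ S.homog k) :
    timeConst 𝕂 Q a ∈ S.poly.homog k := by
  rw [CoeffExt.mem_homog]
  intro N
  refine Eq.mpr (congrArg (· ∈ _) (Polynomial.coeff_C : Polynomial.coeff _ N = _)) ?_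
  split_ifs
  · exact ha
  · exact zero_mem _

theorem timeEval_mem (c : 𝕂) {k : ℤ} {x : Polynomial Q} (hx : x ∈ S.poly.homog k) :
    timeEval 𝕂 Q c x ∈ S.homog k :=
  sum_mem fun i _ => Submodule.smul_mem _ _ (((polyExt 𝕂 Q).mem_homog S).mp hx i)

theorem psMap_mem {T T₁ : Type*} [Ring T] [Algebra 𝕂 T] [Ring T₁] [Algebra 𝕂 T₁]
    {S : PoissonSuperalgebra sg T} {S₁ : PoissonSuperalgebra sg T₁} {k l : ℤ} {φ : T →ₗ[𝕂] T₁}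
    (hφ : ∀ x ∈ S.homog k, φ x ∈ S₁.homog l) {x : PowerSeries T} (hx : x ∈ S.series.homog k) :
    psMap φ x ∈ S₁.series.homog l := by
  rw [CoeffExt.mem_homog] at hx ⊢
  intro N
  exact Eq.mpr (congrArg (· ∈ _) (coeff_psMap φ N x)) (hφ _ (hx N))

/-- Existence of solutions of differential equations whose right hand side is contracting. -/
theorem exists_solution [CharZero 𝕂] {k : ℤ}
    (Ψ : PowerSeries (Polynomial Q) → PowerSeries (Polynomial Q))
    (hΨ : ∀ N x y, CongrMod N x y → CongrMod (N + 1) (Ψ x) (Ψ y))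
    (hk : ∀ x ∈ S.poly.series.homog k, Ψ x ∈ S.poly.series.homog k) {x₀ : PowerSeries Q}
    (hx₀ : x₀ ∈ S.series.homog k) :
    ∃ x ∈ S.poly.series.homog k, psMap (timeDeriv 𝕂 Q) x = Ψ x ∧
      psMap (timeEval 𝕂 Q 0) x = x₀ := by
  -- Picard iteration for x = x₀ + ∫ Ψ(x); every coefficient in ε remains a polynomial in time.
  obtain ⟨x, hx, hxk⟩ := exists_fixedPoint
    (fun x => psMap (timeConst 𝕂 Q) x₀ + psMap (timeInt 𝕂 Q) (Ψ x))
    (fun N x y h => (CongrMod.refl _ _).add ((epsLinear_psMap _).congrMod (hΨ N x y h)))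
    (S.poly.homog k).toAddSubgroup (fun x hx => by
      refine S.poly.mem_series_homog.mp (add_mem (psMap_mem (fun _ h => S.timeConst_mem h) hx₀)
        (psMap_mem (fun _ h => S.timeInt_mem h) (hk x (S.poly.mem_series_homog.mpr hx))))
      )
  refine ⟨x, S.poly.mem_series_homog.mpr hxk, ?_, ?_⟩
  · conv_lhs => rw [← hx]
    refine PowerSeries.ext fun N => ?_
    simp only [map_add, coeff_psMap, timeDeriv_const, timeDeriv_timeInt, zero_add]
  · rw [← hx]
    refine PowerSeries.ext fun N => ?_
    simp only [map_add, coeff_psMap, timeEval_timeInt, timeConst_apply, timeEval_C, add_zero]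

/-- Uniqueness of solutions. -/
theorem solution_unique [CharZero 𝕂]
    (Ψ : PowerSeries (Polynomial Q) → PowerSeries (Polynomial Q))
    (hΨ : ∀ N x y, CongrMod N x y → CongrMod (N + 1) (Ψ x) (Ψ y))
    {x y : PowerSeries (Polynomial Q)} (hx : psMap (timeDeriv 𝕂 Q) x = Ψ x)
    (hy : psMap (timeDeriv 𝕂 Q) y = Ψ y)
    (h0 : psMap (timeEval 𝕂 Q 0) x = psMap (timeEval 𝕂 Q 0) y) : x = y := by
  refine eq_of_congrMod fun N => ?_
  induction N with
  | zero => exact fun i hi => absurd hi (by omega)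
  | succ N ih =>
    intro i hi
    -- The coefficient of ε^i on the right hand side depends only on coefficients of lower order,
    -- which agree by induction.
    refine eq_of_timeDeriv_eq 𝕂 ?_ ?_
    · rw [← coeff_psMap, ← coeff_psMap, hx, hy]
      exact hΨ N x y ih i hi
    · rw [← coeff_psMap, ← coeff_psMap, h0]

end PoissonSuperalgebra

namespace PoissonSuperalgebra

variable {𝕂 : Type*} [Field 𝕂] [CharZero 𝕂] {n : ℕ} {sg : Signature 𝕂 n}
  {R : Type*} [Ring R] [Algebra 𝕂 R] (S : PoissonSuperalgebra sg R)
  {R' : Type*} [Ring R'] [Algebra 𝕂 R']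

/-- Even operators with respect to which the whole structure is linear. -/
structure IsScalar (φ : Module.End 𝕂 R) : Prop where
  comm : S.SuperCommutes 0 φ
  left : ∀ x y, φ (x * y) = φ x * y
  right : ∀ x y, φ (x * y) = x * φ y

/-- Even derivations commuting with the structure. -/
structure IsTimeDerivation (φ : Module.End 𝕂 R) : Prop where
  comm : S.SuperCommutes 0 φ
  leibniz : ∀ x y, φ (x * y) = φ x * y + x * φ y

variable {S} in
theorem IsScalar.map {φ : Module.End 𝕂 R} (h : S.IsScalar φ) (E : CoeffExt 𝕂 R R') :
    (E.superalgebra S).IsScalar (E.map φ) :=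
  ⟨E.superCommutes h.comm, E.map_left h.left, E.map_right h.right⟩

variable {S} in
theorem IsTimeDerivation.map {φ : Module.End 𝕂 R} (h : S.IsTimeDerivation φ)
    (E : CoeffExt 𝕂 R R') : (E.superalgebra S).IsTimeDerivation (E.map φ) :=
  ⟨E.superCommutes h.comm, E.map_derivation h.leibniz⟩

theorem isScalar_zero : S.IsScalar 0 :=
  ⟨⟨by simp, by simp⟩, by simp, by simp⟩

theorem isScalar_timeMul : S.poly.IsScalar (timeMul 𝕂 R) where
  comm := (polyExt 𝕂 R).superCommutes_of_comm S fun φ => LinearMap.ext fun x =>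
    Polynomial.ext fun N => by
      change (Polynomial.X * polyMap φ x).coeff N = (polyMap φ (Polynomial.X * x)).coeff N
      rw [coeff_polyMap]
      cases N with
      | zero => simp
      | succ N => rw [Polynomial.coeff_X_mul, Polynomial.coeff_X_mul, coeff_polyMap]
  left x y := by simp [timeMul, mul_assoc]
  right x y := by
    simp only [timeMul, LinearMap.mulLeft_apply]
    rw [← mul_assoc, ← mul_assoc, (Polynomial.commute_X x).eq]

theorem isTimeDerivation_timeDeriv : S.poly.IsTimeDerivation (timeDeriv 𝕂 R) :=
  ⟨S.timeDeriv_superCommutes, timeDeriv_mul 𝕂⟩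

variable {S} in
/-- Homomorphisms act on power series. -/
def Hom.series {S' : PoissonSuperalgebra sg R'} (φ : Hom S S') : Hom S.series S'.series :=
  (psExt 𝕂 R).mapHom (psExt 𝕂 R') φ (psMap φ.toFun) fun _ _ => coeff_psMap _ _ _

variable {S} in
/-- Homomorphisms act on polynomials. -/
def Hom.poly {S' : PoissonSuperalgebra sg R'} (φ : Hom S S') : Hom S.poly S'.poly :=
  (polyExt 𝕂 R).mapHom (polyExt 𝕂 R') φ (polyMap φ.toFun) fun _ _ => coeff_polyMap _ _ _

theorem psMap_bracket {S' : PoissonSuperalgebra sg R'} (φ : Hom S S') (x y : PowerSeries R) :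
    psMap φ.toFun (S.series.bracket x y) =
      S'.series.bracket (psMap φ.toFun x) (psMap φ.toFun y) :=
  φ.series.map_bracket x y

/-! ### Flows of the vector fields -/

/-- The solutions of the flow equations preserve the Maurer–Cartan equation. -/
theorem flow_bracket {γ β : GraphSeries 𝕂 (n + 1)} (hγ : γ ∈ cocycles 𝕂 (n + 1) 0)
    (hβ : β ∈ cocycles 𝕂 (n + 1) 0) {ζ : Module.End 𝕂 R} (hζ : S.IsScalar ζ)
    {m : PowerSeries (Polynomial R)} (hm : m ∈ S.poly.series.homog (n + 1))
    (hflow : psMap (timeDeriv 𝕂 R) m =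
      S.poly.hat γ m + psMap (polyMap ζ) (S.poly.hat β m))
    (h0 : S.series.bracket (psMap (timeEval 𝕂 R 0) m) (psMap (timeEval 𝕂 R 0) m) = 0) :
    S.poly.series.bracket m m = 0 := by
  have hγf := edgeFinite_of_mem le_rfl hγ.1
  have hβf := edgeFinite_of_mem le_rfl hβ.1
  have hZ := (hζ.map (polyExt 𝕂 R)).map (psExt 𝕂 (Polynomial R))
  have hD := S.isTimeDerivation_timeDeriv.map (psExt 𝕂 (Polynomial R))
  have hmp := S.poly.series.par_of_mem_top hm
  have hDm : psMap (timeDeriv 𝕂 R) m ∈ S.poly.series.homog (n + 1) := by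
    refine psMap_mem (S := S.poly) (S₁ := S.poly) (fun x hx => ?_) hm
    rw [CoeffExt.mem_homog] at hx ⊢
    intro N
    exact Eq.mpr (congrArg (· ∈ _) (coeff_timeDeriv 𝕂 x N)) (Submodule.smul_mem _ _ (hx _))
  -- Both {m,m} and 0 solve the linear equation obtained by linearising the flow at m, and they
  -- agree at time zero.
  refine solution_unique (𝕂 := 𝕂) (fun v => S.poly.dhat γ m v + psMap (polyMap ζ) (S.poly.dhat β m v))
    (fun N x y h => (S.poly.dhat_congrMod_succ hγf (cocycle_zero hγ) m h).add
      ((epsLinear_psMap _).congrMod (S.poly.dhat_congrMod_succ hβf (cocycle_zero hβ) m h)))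
    ?_ (by simp) ?_
  · rw [show psMap (timeDeriv 𝕂 R) (S.poly.series.bracket m m) =
        S.poly.series.bracket (psMap (timeDeriv 𝕂 R) m) m +
        S.poly.series.bracket m (psMap (timeDeriv 𝕂 R) m) from
      S.poly.series.derivation_bracket hD.comm hD.leibniz m m,
      S.poly.series.bracket_symm_even hmp (S.poly.series.par_of_mem_top hDm), ← two_smul 𝕂, hflow,
      map_add, LinearMap.add_apply, smul_add, S.poly.bracket_hat hγ hmp]
    congr 1
    rw [← S.poly.bracket_hat hβ hmp, map_smul]
    exact congrArg _ (S.poly.series.bracket_const_left hZ.comm hZ.left _ _)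
  · have := S.poly.psMap_bracket (S.evalHom 0) m m
    refine this.trans (h0.trans ?_)
    rw [map_zero]

theorem timeDeriv_pow_coeff (j : ℕ) (x : Polynomial R) :
    ((timeDeriv 𝕂 R ^ j) x).coeff 0 = (j.factorial : 𝕂) • x.coeff j := by
  induction j generalizing x with
  | zero => simp
  | succ j ih =>
    rw [pow_succ, Module.End.mul_apply, ih, coeff_timeDeriv, smul_smul, Nat.factorial_succ,
      mul_comm (j + 1), Nat.cast_mul]

theorem timeEval_one_eq {M : ℕ} {x : Polynomial R} (h : ∀ j, M ≤ j → x.coeff j = 0) :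
    timeEval 𝕂 R 1 x = ∑ j ∈ Finset.range M, x.coeff j := by
  have h1 : timeEval 𝕂 R 1 x = ∑ j ∈ x.support, x.coeff j :=
    Finset.sum_congr rfl fun j _ => by simp
  rw [h1]
  refine Finset.sum_subset (fun j hj => ?_) fun j _ hj => by simpa using hj
  rw [Finset.mem_range]
  by_contra hj'
  exact Polynomial.mem_support_iff.mp hj (h j (by omega))

/-- Constants embed homomorphically into power series, so each term of the vector field is a
constant times a single power of ε. -/
theorem coeff_hat_const {γ : GraphSeries 𝕂 (n + 1)} (hγ : EdgeFinite γ) (H : R) (N : ℕ) :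
    PowerSeries.coeff N (S.hat γ (PowerSeries.C H)) =
      (((N + 1).factorial : 𝕂)⁻¹) • S.cochain γ N fun _ => H := by
  let φ : Hom S S.series := (psExt 𝕂 R).constHom (S := S)
    { toFun := PowerSeries.C, map_add' := by simp, map_smul' := fun c x => by
        refine PowerSeries.ext fun N => ?_
        change _ = c • PowerSeries.coeff N (PowerSeries.C x)
        rw [PowerSeries.coeff_C, PowerSeries.coeff_C]
        split_ifs <;> simp }
    fun N x => PowerSeries.coeff_C N x
  have h : ∀ p, S.series.cochain γ p (fun _ => PowerSeries.C H) =
      PowerSeries.C (S.cochain γ p fun _ => H) := fun p => (φ.map_cochain hγ p _).symm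
  have hs : ∀ (c : 𝕂) (i : ℕ) (x : PowerSeries R),
    PowerSeries.coeff i (c • x) = c • PowerSeries.coeff i x := fun _ _ _ => rfl
  rw [hat, coeff_fsum, Finset.sum_eq_single_of_mem N (by simp)]
  · rw [h, hs, Nat.sub_self, PowerSeries.coeff_C, if_pos rfl]
  · intro p hp hpN
    rw [h, hs, PowerSeries.coeff_C, if_neg, smul_zero]
    have := Finset.mem_range.mp hp
    omega

/-- The Taylor expansion of a flow at time one. -/
theorem flow_eval_one {γ : GraphSeries 𝕂 (n + 1)} (hγ : γ ∈ cocycles 𝕂 (n + 1) 0)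
    {m : PowerSeries (Polynomial R)} (hm : m ∈ S.poly.series.homog (n + 1))
    (hflow : psMap (timeDeriv 𝕂 R) m = S.poly.hat γ m) {H : R}
    (h0 : psMap (timeEval 𝕂 R 0) m = PowerSeries.C H) (N : ℕ) :
    PowerSeries.coeff N (psMap (timeEval 𝕂 R 1) m) =
      ∑ j ∈ Finset.range (N + 1), ((j.factorial : 𝕂)⁻¹) •
        (((N + 1).factorial : 𝕂)⁻¹) • S.cochain (graphPow (n + 1) γ j) N fun _ => H := by
  have hγf := edgeFinite_of_mem le_rfl hγ.1
  have hD := S.isTimeDerivation_timeDeriv.map (psExt 𝕂 (Polynomial R))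
  have hmp := S.poly.series.par_of_mem_top hm
  -- By the chain rule and `hat_preLie`, differentiating along the flow multiplies the graph series
  -- by γ from the right, so the j-th time derivative is the field of the j-th pre-Lie power.
  have h1 : ∀ j, (psMap (timeDeriv 𝕂 R) ^ j) m = S.poly.hat (graphPow (n + 1) γ j) m := by
    intro j
    induction j with
    | zero =>
      rw [pow_zero, Module.End.one_apply, graphPow, hat, fsum_succ 𝕂, S.poly.series.cochain_unitGraph]
      have : (fsum fun p => (((p + 1 + 1).factorial : 𝕂)⁻¹) •
          S.poly.series.cochain (unitGraph (n + 1)) (p + 1) fun _ => m) = 0 := by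
        refine PowerSeries.ext fun N => ?_
        rw [coeff_fsum]
        refine (Finset.sum_eq_zero fun p _ => ?_).trans (map_zero _).symm
        rw [S.poly.series.cochain_unitGraph_succ, zero_apply, smul_zero, map_zero]
      rw [this]
      simp
    | succ j ih =>
      have hj := graphPow_mem hγ.1 j
      have hjf := edgeFinite_of_mem le_rfl hj
      rw [pow_succ', Module.End.mul_apply, ih,
        show psMap (timeDeriv 𝕂 R) (S.poly.hat (graphPow (n + 1) γ j) m) = _ from
          S.poly.derivation_hat hD.comm hD.leibniz (epsLinear_psMap _) hj.1 hjf hmp]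
      change S.poly.dhat _ m (psMap (timeDeriv 𝕂 R) m) = _
      rw [hflow, graphPow, S.poly.hat_preLie hjf hγf hmp]
  -- Taylor coefficients at time zero: the j-th derivative evaluated at the constant series H,
  -- divided by j!.
  have h2 : ∀ j, (PowerSeries.coeff N m).coeff j = ((j.factorial : 𝕂)⁻¹) •
      (((N + 1).factorial : 𝕂)⁻¹) • S.cochain (graphPow (n + 1) γ j) N fun _ => H := by
    intro j
    have hjf := edgeFinite_of_mem le_rfl (graphPow_mem hγ.1 j)
    have h3 : ∀ (j : ℕ) (x : PowerSeries (Polynomial R)),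
        PowerSeries.coeff N ((psMap (timeDeriv 𝕂 R) ^ j) x) =
          (timeDeriv 𝕂 R ^ j) (PowerSeries.coeff N x) := by
      intro j
      induction j with
      | zero => intro x; rfl
      | succ j ih => intro x; rw [pow_succ, pow_succ, Module.End.mul_apply, ih, coeff_psMap]; rfl
    rw [← S.coeff_hat_const hjf, ← h0]
    have h4 : psMap (timeEval 𝕂 R 0) (S.poly.hat (graphPow (n + 1) γ j) m) = _ :=
      map_hat (S.evalHom 0) hjf m
    change _ = _ • PowerSeries.coeff N (S.hat _ (psMap (S.evalHom 0).toFun m))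
    rw [← h4, coeff_psMap, ← h1, h3, timeEval_zero, timeDeriv_pow_coeff, smul_smul,
      inv_mul_cancel₀ (Nat.cast_ne_zero.mpr (Nat.factorial_ne_zero j)), one_smul]
  -- The j-th power has no component with N + 1 arguments when j > N, so the coefficient of ε^N has
  -- degree at most N in time.
  rw [coeff_psMap, timeEval_one_eq (M := N + 1)]
  · exact Finset.sum_congr rfl fun j _ => h2 j
  · intro j hj
    rw [h2, S.cochain_eq_zero, zero_apply, smul_zero, smul_zero]
    exact fun k => graphPow_eq_zero (cocycle_zero hγ) (by omega) k

/-- Existence of flows. -/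
theorem exists_flow {γ β : GraphSeries 𝕂 (n + 1)} (hγ : γ ∈ cocycles 𝕂 (n + 1) 0)
    (hβ : β ∈ cocycles 𝕂 (n + 1) 0) {ζ : Module.End 𝕂 R}
    (hζ : ∀ x ∈ S.homog (n + 1), ζ x ∈ S.homog (n + 1)) {H : R} (hH : H ∈ S.homog (n + 1)) :
    ∃ m ∈ S.poly.series.homog (n + 1), psMap (timeDeriv 𝕂 R) m =
      S.poly.hat γ m + psMap (polyMap ζ) (S.poly.hat β m) ∧
      psMap (timeEval 𝕂 R 0) m = PowerSeries.C H := by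
  have hγf := edgeFinite_of_mem le_rfl hγ.1
  have hβf := edgeFinite_of_mem le_rfl hβ.1
  refine S.exists_solution (fun m => S.poly.hat γ m + psMap (polyMap ζ) (S.poly.hat β m))
    (fun N x y h => (S.poly.hat_congrMod_succ hγf (cocycle_zero hγ) h).add
      ((epsLinear_psMap _).congrMod (S.poly.hat_congrMod_succ hβf (cocycle_zero hβ) h)))
    (fun x hx => ?_) ?_
  · have h1 := S.poly.hat_mem hγ.1 hγf hx
    have h2 := S.poly.hat_mem hβ.1 hβf hx
    rw [add_zero] at h1 h2
    refine add_mem h1 (psMap_mem (S := S.poly) (S₁ := S.poly) (fun x hx => ?_) h2)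
    rw [CoeffExt.mem_homog] at hx ⊢
    intro N
    exact Eq.mpr (congrArg (· ∈ _) (coeff_polyMap ζ N x)) (hζ _ (hx _))
  · rw [mem_series_homog]
    intro N
    rw [PowerSeries.coeff_C]
    split_ifs
    · exact hH
    · exact zero_mem _

end PoissonSuperalgebra

/-! ### Variation of the flow along an exact cocycle -/

namespace PoissonSuperalgebra

variable {𝕂 : Type*} [Field 𝕂] [CharZero 𝕂] {n : ℕ} {sg : Signature 𝕂 n}
  {R : Type*} [Ring R] [Algebra 𝕂 R] (S : PoissonSuperalgebra sg R)

theorem timeMul_mem {k : ℤ} {x : Polynomial R} (hx : x ∈ S.poly.homog k) :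
    timeMul 𝕂 R x ∈ S.poly.homog k := by
  rw [CoeffExt.mem_homog] at hx ⊢
  rintro (_ | N)
  · exact Eq.mpr (congrArg (· ∈ _) (Polynomial.coeff_X_mul_zero x)) (zero_mem _)
  · exact Eq.mpr (congrArg (· ∈ _) (Polynomial.coeff_X_mul x N)) (hx N)

theorem bracket_mem_of_eq {k l a : ℤ} {x y : R} (hx : x ∈ S.homog k) (hy : y ∈ S.homog l)
    (ha : k + l - n = a) : S.bracket x y ∈ S.homog a := ha ▸ S.bracket_mem hx hy

theorem polyMap_commutator {φ ψ : Module.End 𝕂 R} (h : ∀ x, φ (ψ x) = x + ψ (φ x))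
    (x : Polynomial R) : polyMap φ (polyMap ψ x) = x + polyMap ψ (polyMap φ x) :=
  Polynomial.ext fun N => by
    rw [Polynomial.coeff_add, coeff_polyMap, coeff_polyMap, coeff_polyMap, coeff_polyMap, h]

theorem psMap_commutator {φ ψ : Module.End 𝕂 R} (h : ∀ x, φ (ψ x) = x + ψ (φ x))
    (x : PowerSeries R) : psMap φ (psMap ψ x) = x + psMap ψ (psMap φ x) :=
  PowerSeries.ext fun N => by
    rw [map_add, coeff_psMap, coeff_psMap, coeff_psMap, coeff_psMap, h]

/-- In the application D is the time derivative, D' the derivative in a parameter s, and Z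
multiplication by s. The source `hat β m` comes from D'Z = 1 + ZD'; the remaining terms linearise
the flow. -/
theorem deriv_flow_variation {γ β : GraphSeries 𝕂 (n + 1)} (hγ : γ ∈ cocycles 𝕂 (n + 1) 0)
    (hβ : β ∈ cocycles 𝕂 (n + 1) 0) {D D' Z : Module.End 𝕂 (PowerSeries R)}
    (hs : S.series.IsTimeDerivation D') (hsε : EpsLinear D') (hc : ∀ x, D (D' x) = D' (D x))
    (hZ : ∀ x, D' (Z x) = x + Z (D' x)) {m : PowerSeries R} (hm : m ∈ S.series.homog (n + 1))
    (hflow : D m = S.hat γ m + Z (S.hat β m)) :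
    D (D' m) = S.dhat γ m (D' m) + Z (S.dhat β m (D' m)) + S.hat β m := by
  have hmp := S.series.par_of_mem_top hm
  rw [hc, hflow, map_add, hZ,
    S.derivation_hat hs.comm hs.leibniz hsε hγ.1.1 (edgeFinite_of_mem le_rfl hγ.1) hmp,
    S.derivation_hat hs.comm hs.leibniz hsε hβ.1.1 (edgeFinite_of_mem le_rfl hβ.1) hmp]
  abel

/-- The Leibniz rule gives ε{Dl,m} + ε{l,Dm}. By `bracket_hat_mixed` the terms in γ and δη recombine
to the linearised flow applied to ε{l,m}, and the source of l leaves ε{η(m),m}, which is the field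
of δη by `hat_graphDiff`. So ε{l,m} obeys the same equation as the parameter derivative of m. -/
theorem deriv_hamiltonian_variation {γ η : GraphSeries 𝕂 (n + 1)} (hγ : γ ∈ cocycles 𝕂 (n + 1) 0)
    (hη : EdgeFinite η) (hβ : graphDiff (n + 1) (-1) η ∈ cocycles 𝕂 (n + 1) 0)
    {D Z : Module.End 𝕂 (PowerSeries R)} (hD : S.series.IsTimeDerivation D) (hDε : EpsLinear D)
    (hZ : S.series.IsScalar Z) (hZε : EpsLinear Z)
    {m l : PowerSeries R} (hm : m ∈ S.series.homog (n + 1)) (hl : l ∈ S.series.homog n)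
    (hmm : S.series.bracket m m = 0)
    (hflow : D m = S.hat γ m + Z (S.hat (graphDiff (n + 1) (-1) η) m))
    (hDl : D l = S.dhat γ m l + Z (S.dhat (graphDiff (n + 1) (-1) η) m l) + S.hat η m) :
    D (eps 𝕂 R (S.series.bracket l m)) = S.dhat γ m (eps 𝕂 R (S.series.bracket l m)) +
      Z (S.dhat (graphDiff (n + 1) (-1) η) m (eps 𝕂 R (S.series.bracket l m))) +
      S.hat (graphDiff (n + 1) (-1) η) m := by
  have hmp := S.series.par_of_mem_top hm
  rw [S.epsLinear_dhat (edgeFinite_of_mem le_rfl hγ.1) m,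
    S.epsLinear_dhat (edgeFinite_of_mem le_rfl hβ.1) m, hZε,
    ← S.bracket_hat_mixed hγ hm hl hmm, ← S.bracket_hat_mixed hβ hm hl hmm, hDε,
    S.series.derivation_bracket hD.comm hD.leibniz, hDl, hflow,
    S.hat_graphDiff hη (-1) hmp hmm]
  simp only [map_add, LinearMap.add_apply, S.series.bracket_const_left hZ.comm hZ.left,
    S.series.bracket_const_right hZ.comm hZ.right]
  abel

/-- Variations of a flow by a multiple of an exact cocycle are Hamiltonian. -/
theorem flow_variation {γ η : GraphSeries 𝕂 (n + 1)} (hγ : γ ∈ cocycles 𝕂 (n + 1) 0)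
    (hη : η ∈ fGCdeg 𝕂 (n + 1) (-1)) (hβ : graphDiff (n + 1) (-1) η ∈ cocycles 𝕂 (n + 1) 0)
    {m : PowerSeries (Polynomial (Polynomial R))} (hm : m ∈ S.poly.poly.series.homog (n + 1))
    (hflow : psMap (timeDeriv 𝕂 (Polynomial R)) m = S.poly.poly.hat γ m +
      psMap (polyMap (timeMul 𝕂 R))
        (S.poly.poly.hat (graphDiff (n + 1) (-1) η) m))
    {H : R} (hH : S.bracket H H = 0)
    (h0 : psMap (timeEval 𝕂 (Polynomial R) 0) m = PowerSeries.C (Polynomial.C H)) :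
    ∃ l ∈ S.poly.poly.series.homog n, psMap (polyMap (timeDeriv 𝕂 R)) m =
      eps 𝕂 (Polynomial (Polynomial R)) (S.poly.poly.series.bracket l m) := by
  set β := graphDiff (n + 1) (-1) η with hβdef
  have hγf := edgeFinite_of_mem le_rfl hγ.1
  have hβf := edgeFinite_of_mem le_rfl hβ.1
  have hηf := edgeFinite_of_mem (by norm_num) hη
  have hζ := S.isScalar_timeMul
  have hZ := (hζ.map (polyExt 𝕂 (Polynomial R))).map (psExt 𝕂 (Polynomial (Polynomial R)))
  have hD := S.poly.isTimeDerivation_timeDeriv.map (psExt 𝕂 (Polynomial (Polynomial R)))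
  have hs := (S.isTimeDerivation_timeDeriv.map (polyExt 𝕂 (Polynomial R))).map
    (psExt 𝕂 (Polynomial (Polynomial R)))
  have hmp := S.poly.poly.series.par_of_mem_top hm
  -- The outer polynomial variable is the time t and the inner one the parameter s: Z, D and ds are
  -- multiplication by s, ∂_t and ∂_s.
  set Z : Module.End 𝕂 (PowerSeries (Polynomial (Polynomial R))) :=
    psMap (polyMap (timeMul 𝕂 R)) with hZdef
  set D : Module.End 𝕂 (PowerSeries (Polynomial (Polynomial R))) :=
    psMap (timeDeriv 𝕂 (Polynomial R)) with hDdef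
  set ds : Module.End 𝕂 (PowerSeries (Polynomial (Polynomial R))) :=
    psMap (polyMap (timeDeriv 𝕂 R)) with hdsdef
  have hZε : EpsLinear Z := epsLinear_psMap _
  have hDε : EpsLinear D := epsLinear_psMap _
  have hdsε : EpsLinear ds := epsLinear_psMap _
  have hconst : S.series.bracket (PowerSeries.C H) (PowerSeries.C H) = 0 := by
    refine PowerSeries.ext fun N => ((psExt 𝕂 R).coeff_bracket S N _ _).trans ?_
    rw [map_zero]
    refine Finset.sum_eq_zero fun a _ => ?_
    change S.bracket (PowerSeries.coeff _ _) (PowerSeries.coeff _ _) = 0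
    rw [PowerSeries.coeff_C, PowerSeries.coeff_C]
    split_ifs <;> simp [hH]
  have hC : psMap (timeConst 𝕂 R) (PowerSeries.C H) = PowerSeries.C (Polynomial.C H) := by
    refine PowerSeries.ext fun N => ?_
    rw [coeff_psMap, PowerSeries.coeff_C, PowerSeries.coeff_C]
    split_ifs
    · rfl
    · exact map_zero _
  have hmm : S.poly.poly.series.bracket m m = 0 := by
    refine S.poly.flow_bracket hγ hβ hζ hm hflow ?_
    rw [h0, ← hC]
    let φ : Hom S S.poly := (polyExt 𝕂 R).constHom (timeConst 𝕂 R) fun N x => Polynomial.coeff_C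
    refine (S.psMap_bracket φ (PowerSeries.C H) (PowerSeries.C H)).symm.trans ?_
    rw [hconst, map_zero]
  have hdhat : ∀ {k : ℤ} {v}, v ∈ S.poly.poly.series.homog k →
      S.poly.poly.dhat γ m v + Z (S.poly.poly.dhat β m v) ∈ S.poly.poly.series.homog k := by
    intro k v hv
    refine add_mem (S.poly.poly.dhat_mem hγ.1 hγf hm hv)
      (psMap_mem (S := S.poly.poly) (S₁ := S.poly.poly) (fun x hx => ?_)
        (S.poly.poly.dhat_mem hβ.1 hβf hm hv))
    rw [CoeffExt.mem_homog] at hx ⊢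
    intro N
    exact Eq.mpr (congrArg (· ∈ _) (coeff_polyMap _ N x)) (S.timeMul_mem (hx _))
  have hcontr : ∀ c N x y, CongrMod N x y →
      CongrMod (N + 1) (S.poly.poly.dhat γ m x + Z (S.poly.poly.dhat β m x) + c)
        (S.poly.poly.dhat γ m y + Z (S.poly.poly.dhat β m y) + c) := fun c N x y h =>
    ((S.poly.poly.dhat_congrMod_succ hγf (cocycle_zero hγ) m h).add
      (hZε.congrMod (S.poly.poly.dhat_congrMod_succ hβf (cocycle_zero hβ) m h))).add
      (CongrMod.refl _ _)
  have hηm : S.poly.poly.hat η m ∈ S.poly.poly.series.homog n := by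
    have := S.poly.poly.hat_mem hη hηf hm
    rwa [add_neg_cancel_right] at this
  have hc : ∀ x, D (ds x) = ds (D x) := by
    intro x
    refine PowerSeries.ext fun N => ?_
    simp only [hDdef, hdsdef, coeff_psMap]
    exact (polyMap_timeDeriv 𝕂 _ _).symm
  -- The Hamiltonian l solves the linearised flow with source η(m) and vanishes at t = 0. Then ∂_s m
  -- and ε{l,m} satisfy the same equation, and both vanish at t = 0, since m starts at H for every
  -- s; uniqueness identifies them.
  obtain ⟨l, hl, hl1, hl2⟩ := S.poly.exists_solution
    (fun l => S.poly.poly.dhat γ m l + Z (S.poly.poly.dhat β m l) + S.poly.poly.hat η m)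
    (hcontr _) (fun x hx => add_mem (hdhat hx) hηm) (zero_mem (S.poly.series.homog n))
  refine ⟨l, hl, solution_unique (𝕂 := 𝕂)
    (fun v => S.poly.poly.dhat γ m v + Z (S.poly.poly.dhat β m v) + S.poly.poly.hat β m)
    (hcontr _) ?_ ?_ ?_⟩
  · exact S.poly.poly.deriv_flow_variation hγ hβ hs hdsε hc
      (psMap_commutator (polyMap_commutator (timeDeriv_timeMul 𝕂))) hm hflow
  · exact S.poly.poly.deriv_hamiltonian_variation hγ hηf hβ hD hDε hZ hZε hm hl hmm hflow hl1
  · have h1 : psMap (timeEval 𝕂 (Polynomial R) 0) (ds m) = 0 := by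
      have : psMap (timeEval 𝕂 (Polynomial R) 0) (ds m) =
          psMap (timeDeriv 𝕂 R) (psMap (timeEval 𝕂 (Polynomial R) 0) m) := by
        refine PowerSeries.ext fun N => ?_
        simp only [hdsdef, coeff_psMap]
        exact timeEval_polyMap 𝕂 _ 0 _
      rw [this, h0, ← hC]
      refine PowerSeries.ext fun N => ?_
      rw [coeff_psMap, coeff_psMap, timeDeriv_const, map_zero]
    rw [h1, eps_mul_psMap]
    have h2 : psMap (timeEval 𝕂 (Polynomial R) 0) (S.poly.poly.series.bracket l m) = _ :=
      S.poly.poly.psMap_bracket (S.poly.evalHom 0) l m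
    rw [h2]
    change _ = eps 𝕂 _ (S.poly.series.bracket (psMap (timeEval 𝕂 (Polynomial R) 0) l) _)
    rw [hl2, map_zero, LinearMap.zero_apply, map_zero]

/-- The flows of cohomologous cocycles are connected by a Hamiltonian path. -/
theorem exists_homotopy {γ η : GraphSeries 𝕂 (n + 1)} (hγ : γ ∈ cocycles 𝕂 (n + 1) 0)
    (hη : η ∈ fGCdeg 𝕂 (n + 1) (-1)) (hβ : graphDiff (n + 1) (-1) η ∈ cocycles 𝕂 (n + 1) 0)
    {H : R} (hH : H ∈ S.homog (n + 1)) (hHH : S.bracket H H = 0) :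
    ∃ x : PowerSeries (Polynomial R), ∃ l ∈ S.poly.series.homog n,
      psMap (timeDeriv 𝕂 R) x = eps 𝕂 (Polynomial R) (S.poly.series.bracket l x) ∧
      ∀ (c : 𝕂) (N : ℕ), PowerSeries.coeff N (psMap (timeEval 𝕂 R c) x) =
        ∑ j ∈ Finset.range (N + 1), ((j.factorial : 𝕂)⁻¹) • (((N + 1).factorial : 𝕂)⁻¹) •
          S.cochain (graphPow (n + 1) (γ + c • graphDiff (n + 1) (-1) η) j) N fun _ => H := by
  have hγf := edgeFinite_of_mem le_rfl hγ.1
  have hβf := edgeFinite_of_mem le_rfl hβ.1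
  -- The flow of γ + sδη with coefficients polynomial in s. Putting t = 1 yields a path in s, and
  -- putting s = c yields the flow of γ + cδη.
  obtain ⟨m, hm, hflow, h0⟩ := S.poly.exists_flow hγ hβ
    (ζ := timeMul 𝕂 R) (fun x hx => S.timeMul_mem hx) (S.timeConst_mem hH)
  obtain ⟨l, hl, hlm⟩ := S.flow_variation hγ hη hβ hm hflow hHH h0
  refine ⟨psMap (timeEval 𝕂 (Polynomial R) 1) m, psMap (timeEval 𝕂 (Polynomial R) 1) l,
    psMap_mem (S := S.poly.poly) (fun x hx => S.poly.timeEval_mem 1 hx) hl, ?_, fun c N => ?_⟩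
  · have h1 : psMap (timeDeriv 𝕂 R) (psMap (timeEval 𝕂 (Polynomial R) 1) m) =
        psMap (timeEval 𝕂 (Polynomial R) 1) (psMap (polyMap (timeDeriv 𝕂 R)) m) := by
      refine PowerSeries.ext fun N => ?_
      simp only [coeff_psMap]
      exact (timeEval_polyMap 𝕂 _ 1 _).symm
    rw [h1, hlm, eps_mul_psMap]
    exact congrArg _ (S.poly.poly.psMap_bracket (S.poly.evalHom 1) l m)
  · have h1 : psMap (timeEval 𝕂 R c) (psMap (timeEval 𝕂 (Polynomial R) 1) m) =
        psMap (timeEval 𝕂 R 1) (psMap (polyMap (timeEval 𝕂 R c)) m) := by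
      refine PowerSeries.ext fun N => ?_
      simp only [coeff_psMap]
      exact (timeEval_polyMap 𝕂 _ 1 _).symm
    rw [h1]
    refine S.flow_eval_one (add_mem hγ (Submodule.smul_mem _ c hβ))
      (psMap_mem (S := S.poly.poly) (fun x hx => ?_) hm) ?_ ?_ N
    · rw [CoeffExt.mem_homog] at hx ⊢
      intro N
      exact Eq.mpr (congrArg (· ∈ _) (coeff_polyMap _ N x)) (S.timeEval_mem c (hx _))
    · have h2 : ∀ {α : GraphSeries 𝕂 (n + 1)}, EdgeFinite α →
          psMap (polyMap (timeEval 𝕂 R c)) (S.poly.poly.hat α m) =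
            S.poly.hat α (psMap (polyMap (timeEval 𝕂 R c)) m) :=
        fun hα => map_hat (S.evalHom c).poly hα m
      have h3 : psMap (timeDeriv 𝕂 R) (psMap (polyMap (timeEval 𝕂 R c)) m) =
          psMap (polyMap (timeEval 𝕂 R c)) (psMap (timeDeriv 𝕂 (Polynomial R)) m) := by
        refine PowerSeries.ext fun N => ?_
        simp only [coeff_psMap]
        exact (polyMap_timeDeriv 𝕂 _ _).symm
      have h4 : ∀ y, psMap (polyMap (timeEval 𝕂 R c))
          (psMap (polyMap (timeMul 𝕂 R)) y) =
            c • psMap (polyMap (timeEval 𝕂 R c)) y := by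
        intro y
        rw [← map_smul]
        refine PowerSeries.ext fun N => Polynomial.ext fun i => ?_
        simp only [coeff_psMap, coeff_polyMap]
        refine (timeEval_timeMul 𝕂 c _).trans ?_
        rw [← map_smul]
        rfl
      rw [h3, hflow, map_add, h4, h2 hγf, h2 hβf, S.poly.hat_add_smul hγf hβf]
    · refine PowerSeries.ext fun N => ?_
      have h2 := congrArg (PowerSeries.coeff N) h0
      rw [coeff_psMap] at h2
      rw [coeff_psMap, coeff_psMap]
      refine (timeEval_polyMap 𝕂 _ 0 _).trans ?_
      rw [h2, PowerSeries.coeff_C, PowerSeries.coeff_C]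
      split_ifs
      · exact timeEval_C 𝕂 c H
      · exact map_zero _

end PoissonSuperalgebra

namespace PoissonSuperalgebra

variable {𝕂 : Type*} [Field 𝕂] [CharZero 𝕂] {n : ℕ} {sg : Signature 𝕂 n}
  {R : Type*} [Ring R] [Algebra 𝕂 R] (S : PoissonSuperalgebra sg R)

/-! ### The Magnus expansion -/

/-- The terms `ad_L^j(x) / j!` of the exponential series. -/
def expTerm (L x : R) (j : ℕ) : R := ((j.factorial : 𝕂)⁻¹) • (S.bracket L)^[j] x

theorem expTerm_zero (L x : R) : S.expTerm L x 0 = x := by simp [expTerm]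

theorem bracket_expTerm (L x : R) (j : ℕ) :
    S.bracket L (S.expTerm L x j) = ((j + 1 : ℕ) : 𝕂) • S.expTerm L x (j + 1) := by
  rw [expTerm, expTerm, map_smul, ← Function.iterate_succ_apply' (S.bracket L), smul_smul,
    ← factorial_inv_mul j, mul_comm]

/-- The terms `ad_L^j(x) / (j + 1)!` of the derivative of the exponential map. -/
def dexpTerm (L x : R) (j : ℕ) : R := (((j + 1).factorial : 𝕂)⁻¹) • (S.bracket L)^[j] x

theorem dexpTerm_zero (L x : R) : S.dexpTerm L x 0 = x := by simp [dexpTerm]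

theorem bracket_dexpTerm (L x : R) (j : ℕ) :
    S.bracket L (S.dexpTerm L x j) = ((j + 2 : ℕ) : 𝕂) • S.dexpTerm L x (j + 1) := by
  rw [dexpTerm, dexpTerm, map_smul, ← Function.iterate_succ_apply' (S.bracket L), smul_smul,
    ← factorial_inv_mul (j + 1), mul_comm]

theorem iterate_bracket_mem {k : ℤ} {L x : R} (hL : L ∈ S.homog n) (hx : x ∈ S.homog k) (j : ℕ) :
    (S.bracket L)^[j] x ∈ S.homog k := by
  induction j with
  | zero => exact hx
  | succ j ih =>
    rw [Function.iterate_succ_apply']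
    exact S.bracket_mem_of_eq hL ih (by ring)

theorem dexpTerm_mem {k : ℤ} {L x : R} (hL : L ∈ S.homog n) (hx : x ∈ S.homog k) (j : ℕ) :
    S.dexpTerm L x j ∈ S.homog k := Submodule.smul_mem _ _ (S.iterate_bracket_mem hL hx j)

theorem par_of_mem_nat {k : ℕ} {x : R} (hx : x ∈ S.homog k) : S.par x = (-1 : 𝕂) ^ k • x := by
  rw [S.par_of_mem hx, zpow_natCast]

/-- The derivative of the terms of the exponential series. -/
theorem derivation_expTerm {D : Module.End 𝕂 R} (hD : S.IsTimeDerivation D) {L x : R}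
    (hL : L ∈ S.homog n) (hDL : D L ∈ S.homog n) (hx : D x = 0) (k : ℕ) :
    D (S.expTerm L x (k + 1)) = ∑ a ∈ Finset.HasAntidiagonal.antidiagonal k,
      S.bracket (S.dexpTerm L (D L) a.1) (S.expTerm L x a.2) := by
  have hne : ∀ k : ℕ, ((k + 1 : ℕ) : 𝕂) ≠ 0 := fun k => Nat.cast_ne_zero.mpr (Nat.succ_ne_zero k)
  -- Multiplying by k + 1 undoes the factorial, so that term k + 1 is ad_L of term k and the Leibniz
  -- rule applies.
  have hrec : ∀ k, ((k + 1 : ℕ) : 𝕂) • D (S.expTerm L x (k + 1)) =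
      S.bracket (D L) (S.expTerm L x k) + S.bracket L (D (S.expTerm L x k)) := by
    intro k
    rw [← map_smul, ← S.bracket_expTerm, S.derivation_bracket hD.comm hD.leibniz]
  induction k with
  | zero =>
    have := hrec 0
    rw [S.expTerm_zero, hx, map_zero, add_zero] at this
    simpa [S.expTerm_zero, S.dexpTerm_zero] using this
  | succ k ih =>
    refine smul_right_injective R (hne (k + 1)) ?_
    change _ • D _ = _ • _
    rw [hrec, ih, map_sum]
    -- The Jacobi identity moves ad_L into either factor, raising the corresponding index by one.
    have hj : ∀ a : ℕ × ℕ, S.bracket L (S.bracket (S.dexpTerm L (D L) a.1) (S.expTerm L x a.2)) =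
        ((a.1 + 2 : ℕ) : 𝕂) • S.bracket (S.dexpTerm L (D L) (a.1 + 1)) (S.expTerm L x a.2) +
        ((a.2 + 1 : ℕ) : 𝕂) • S.bracket (S.dexpTerm L (D L) a.1) (S.expTerm L x (a.2 + 1)) := by
      intro a
      rw [S.jacobi (S.par_of_mem_nat hL) (S.par_of_mem_nat (S.dexpTerm_mem hL hDL _)),
        S.bracket_dexpTerm, S.bracket_expTerm, map_smul, map_smul, LinearMap.smul_apply]
    simp only [hj, Finset.sum_add_distrib]
    let f : ℕ × ℕ → R := fun a => S.bracket (S.dexpTerm L (D L) a.1) (S.expTerm L x a.2)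
    have h1 := Finset.Nat.sum_antidiagonal_succ (n := k)
      (f := fun a : ℕ × ℕ => ((a.1 + 1 : ℕ) : 𝕂) • f a)
    have h2 := Finset.Nat.sum_antidiagonal_succ' (n := k)
      (f := fun a : ℕ × ℕ => (a.2 : 𝕂) • f a)
    -- A bracket with indices a.1 + a.2 = k + 1 occurs with weight a.1 + 1 from raising the left
    -- index (or from the bracket with D L if a.1 = 0) and weight a.2 from raising the right one;
    -- together k + 2.
    have h3 : ((k + 1 + 1 : ℕ) : 𝕂) • ∑ a ∈ Finset.HasAntidiagonal.antidiagonal (k + 1), f a =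
        (∑ a ∈ Finset.HasAntidiagonal.antidiagonal (k + 1), ((a.1 + 1 : ℕ) : 𝕂) • f a) +
        ∑ a ∈ Finset.HasAntidiagonal.antidiagonal (k + 1), (a.2 : 𝕂) • f a := by
      rw [Finset.smul_sum, ← Finset.sum_add_distrib]
      refine Finset.sum_congr rfl fun a ha => ?_
      rw [← add_smul, ← Finset.HasAntidiagonal.mem_antidiagonal.mp ha]
      push_cast
      ring_nf
    refine Eq.trans ?_ h3.symm
    rw [h1, h2]
    simp only [f, S.dexpTerm_zero, zero_add, Nat.cast_zero, zero_smul, Nat.cast_one, one_smul,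
      add_assoc, Nat.reduceAdd]

theorem Hom.map_expTerm {R' : Type*} [Ring R'] [Algebra 𝕂 R'] {S : PoissonSuperalgebra sg R}
    {S' : PoissonSuperalgebra sg R'} (φ : Hom S S') (L x : R) (j : ℕ) :
    φ.toFun (S.expTerm L x j) = S'.expTerm (φ.toFun L) (φ.toFun x) j := by
  have h : φ.toFun ((S.bracket L)^[j] x) = (S'.bracket (φ.toFun L))^[j] (φ.toFun x) := by
    induction j with
    | zero => rfl
    | succ j ih =>
      rw [Function.iterate_succ_apply', Function.iterate_succ_apply', φ.map_bracket, ih]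
  rw [expTerm, expTerm, map_smul, h]

theorem expTerm_zero_left (x : R) (j : ℕ) : S.expTerm 0 x (j + 1) = 0 := by
  rw [expTerm, Function.iterate_succ_apply', map_zero, LinearMap.zero_apply, smul_zero]

theorem iterate_bracket_congrMod {N : ℕ} {L L' x x' : PowerSeries R} (h : CongrMod N L L')
    (h' : CongrMod N x x') (j : ℕ) :
    CongrMod N ((S.series.bracket L)^[j] x) ((S.series.bracket L')^[j] x') := by
  induction j with
  | zero => exact h'
  | succ j ih =>
    rw [Function.iterate_succ_apply', Function.iterate_succ_apply']
    exact S.bracket_congrMod h ih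

/-- The logarithmic derivative of the exponential map is invertible. -/
theorem exists_magnus {l : PowerSeries (Polynomial R)} (hl : l ∈ S.poly.series.homog n) :
    ∃ L ∈ S.poly.series.homog n, psMap (timeDeriv 𝕂 R) L ∈ S.poly.series.homog n ∧
      psMap (timeEval 𝕂 R 0) L = 0 ∧
      fsum (S.poly.series.dexpTerm L (psMap (timeDeriv 𝕂 R) L)) = l := by
  have hint : ∀ {x : PowerSeries (Polynomial R)}, x ∈ S.poly.series.homog n →
      psMap (timeInt 𝕂 R) x ∈ S.poly.series.homog n := fun hx =>
    psMap_mem (S := S.poly) (S₁ := S.poly) (fun _ h => S.timeInt_mem h) hx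
  -- The unknown is the derivative y of L, with L = ∫ y, and the equation is y + Σ_{j ≥ 1} ε^j
  -- ad_L^j(y)/(j+1)! = l. The powers of ε make it contracting.
  obtain ⟨y, hy, hyn⟩ := exists_fixedPoint
    (fun y => l + -eps 𝕂 (Polynomial R)
      (fsum fun j => S.poly.series.dexpTerm (psMap (timeInt 𝕂 R) y) y (j + 1)))
    (fun N x y h => by
      refine (CongrMod.refl _ _).add fun i hi => ?_
      rw [map_neg, map_neg]
      refine congrArg _ (CongrMod.eps (𝕂 := 𝕂) (N := N) (fsum_congrMod_congr fun j i hi => ?_) i hi)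
      exact congrArg ((((j + 1 + 1).factorial : 𝕂)⁻¹) • ·) (S.poly.iterate_bracket_congrMod ((epsLinear_psMap _).congrMod h) h
        (j + 1) i hi))
    (S.poly.homog n).toAddSubgroup (fun x hx => by
      have hx' := S.poly.mem_series_homog.mpr hx
      exact S.poly.mem_series_homog.mp (add_mem hl (neg_mem (S.poly.eps_mem (S.poly.fsum_mem
        fun j => S.poly.series.dexpTerm_mem (hint hx') hx' _)))))
  have hyn := S.poly.mem_series_homog.mpr hyn
  have hD : psMap (timeDeriv 𝕂 R) (psMap (timeInt 𝕂 R) y) = y :=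
    PowerSeries.ext fun N => by rw [coeff_psMap, coeff_psMap, timeDeriv_timeInt]
  refine ⟨psMap (timeInt 𝕂 R) y, hint hyn, ?_, ?_, ?_⟩
  · rwa [hD]
  · refine PowerSeries.ext fun N => ?_
    rw [coeff_psMap, coeff_psMap, timeEval_timeInt, map_zero]
  · rw [hD, fsum_succ 𝕂, dexpTerm_zero]
    nth_rewrite 1 [← hy]
    rw [neg_add_cancel_right]

/-- Hamiltonian paths are given by exponentials. -/
theorem exists_exponential {x l : PowerSeries (Polynomial R)} (hl : l ∈ S.poly.series.homog n)
    (hx : psMap (timeDeriv 𝕂 R) x = eps 𝕂 (Polynomial R) (S.poly.series.bracket l x)) :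
    ∃ L ∈ S.series.homog n, psMap (timeEval 𝕂 R 1) x =
      fsum (S.series.expTerm L (psMap (timeEval 𝕂 R 0) x)) := by
  obtain ⟨L, hL, hDL, hL0, hLl⟩ := S.exists_magnus hl
  have hD := S.isTimeDerivation_timeDeriv.map (psExt 𝕂 (Polynomial R))
  set x₀ := psMap (timeConst 𝕂 R) (psMap (timeEval 𝕂 R 0) x) with hx₀
  have hev : ∀ c, psMap (timeEval 𝕂 R c) x₀ = psMap (timeEval 𝕂 R 0) x := fun c =>
    PowerSeries.ext fun N => by
      rw [coeff_psMap, coeff_psMap, timeConst_apply, timeEval_C]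
  have hterm : ∀ c j, psMap (timeEval 𝕂 R c) (S.poly.series.expTerm L x₀ j) =
      S.series.expTerm (psMap (timeEval 𝕂 R c) L) (psMap (timeEval 𝕂 R 0) x) j := fun c j => by
    rw [← hev c]
    exact (S.evalHom c).series.map_expTerm L x₀ j
  -- With x₀ the constant path, Σ ε^j ad_L^j(x₀)/j! satisfies the same equation as x: by
  -- `derivation_expTerm` its derivative is ε times the bracket of Σ ε^j ad_L^j(L')/(j+1)! with it,
  -- and that sum is l by the choice of L.
  have hsol : x = fsum (S.poly.series.expTerm L x₀) := by
    refine solution_unique (𝕂 := 𝕂)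
      (fun v => eps 𝕂 (Polynomial R) (S.poly.series.bracket l v))
      (fun N x y h => CongrMod.eps (S.poly.bracket_congrMod (CongrMod.refl _ _) h)) hx ?_ ?_
    · have h0 : psMap (timeDeriv 𝕂 R) x₀ = 0 := PowerSeries.ext fun N => by
        rw [coeff_psMap, coeff_psMap, timeDeriv_const, map_zero]
      rw [psMap_fsum, fsum_succ 𝕂, expTerm_zero, h0, zero_add]
      nth_rewrite 1 [← hLl]
      rw [S.poly.bracket_fsum]
      congr 2
      funext k
      exact S.poly.series.derivation_expTerm hD hL hDL h0 k
    · rw [psMap_fsum, fsum_succ 𝕂, hterm, expTerm_zero]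
      simp only [hterm, hL0, expTerm_zero_left]
      have : (fsum fun _ : ℕ => (0 : PowerSeries R)) = 0 := PowerSeries.ext fun N => by
        simp [coeff_fsum]
      rw [this, map_zero, add_zero]
  refine ⟨psMap (timeEval 𝕂 R 1) L,
    psMap_mem (S := S.poly) (fun _ h => S.timeEval_mem 1 h) hL, ?_⟩
  conv_lhs => rw [hsol, psMap_fsum]
  congr 1
  funext j
  exact hterm 1 j

end PoissonSuperalgebra

/-! ### Deformations of Hamiltonian functions -/

namespace PoissonSuperalgebra

variable {𝕂 : Type*} [Field 𝕂] [CharZero 𝕂] {n : ℕ} {sg : Signature 𝕂 n}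
  {R : Type*} [Ring R] [Algebra 𝕂 R] (S : PoissonSuperalgebra sg R)

theorem seriesBracket_eq (x y : PowerSeries R) : seriesBracket S.bracket x y = S.series.bracket x y :=
  PowerSeries.ext fun N => (PowerSeries.coeff_mk N _).trans ((psExt 𝕂 R).coeff_bracket S N x y).symm

theorem cochain_zero_graph (p : ℕ) : S.cochain (0 : GraphSeries 𝕂 (n + 1)) p = 0 :=
  S.cochain_eq_zero fun _ => rfl

theorem cochain_sum_smul {ι : Type*} (s : Finset ι) (c : ι → 𝕂) (γ : ι → GraphSeries 𝕂 (n + 1))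
    (hγ : ∀ i, γ i ∈ fGCdeg 𝕂 (n + 1) 0) (p : ℕ) :
    S.cochain (∑ i ∈ s, c i • γ i) p = ∑ i ∈ s, c i • S.cochain (γ i) p := by
  classical
  induction s using Finset.induction_on with
  | empty => rw [Finset.sum_empty, Finset.sum_empty, cochain_zero_graph]
  | insert i s hi ih =>
    rw [Finset.sum_insert hi, Finset.sum_insert hi, add_comm (c i • γ i), add_comm (c i • S.cochain (γ i) p), ← ih]
    exact S.cochain_add_smul
      (edgeFinite_of_mem le_rfl (sum_mem fun i _ => Submodule.smul_mem _ _ (hγ i)))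
      (edgeFinite_of_mem le_rfl (hγ i)) (c i) p

/-- The deformation of `H` given by the flow of a cocycle at time one. -/
theorem coeff_evalSeries {γ : GraphSeries 𝕂 (n + 1)} (hγ : γ ∈ cocycles 𝕂 (n + 1) 0) {H : R}
    (hH : H ∈ S.homog (n + 1)) (p : ℕ) :
    PowerSeries.coeff (p + 1) (evalSeries (𝕂 := 𝕂) (cochainExp (n + 1) S.par (S.cochain γ))
      (PowerSeries.monomial 1 H)) =
      ∑ j ∈ Finset.range (p + 1), ((j.factorial : 𝕂)⁻¹) •
        (((p + 1).factorial : 𝕂)⁻¹) • S.cochain (graphPow (n + 1) γ j) p fun _ => H := by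
  rw [evalSeries_monomial, cochainExp_eq_sum _ _ (S.cochain_eq_zero (cocycle_zero hγ)), sum_apply,
    Finset.smul_sum]
  refine Finset.sum_congr rfl fun j _ => ?_
  rw [smul_apply, S.nrPow_cochain hγ.1 j p _ fun _ => hH, smul_comm]

theorem eq_eps_of_coeff {x y : PowerSeries R} (h0 : PowerSeries.coeff 0 x = 0)
    (h : ∀ N, PowerSeries.coeff (N + 1) x = PowerSeries.coeff N y) : x = eps 𝕂 R y :=
  PowerSeries.ext fun N => by
    cases N with
    | zero => rw [h0, coeff_zero_eps]
    | succ N => rw [h, coeff_succ_eps]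

/-- The deformation is again a solution of the Maurer–Cartan equation. -/
theorem evalSeries_spec {γ : GraphSeries 𝕂 (n + 1)} (hγ : γ ∈ cocycles 𝕂 (n + 1) 0) {H : R}
    (hH : H ∈ S.homog (n + 1)) (hHH : S.bracket H H = 0) :
    ∃ x ∈ S.series.homog (n + 1), S.series.bracket x x = 0 ∧
      evalSeries (𝕂 := 𝕂) (cochainExp (n + 1) S.par (S.cochain γ)) (PowerSeries.monomial 1 H) =
        eps 𝕂 R x := by
  have hzero : ∀ x : PowerSeries (Polynomial R),
      psMap (polyMap (0 : Module.End 𝕂 R)) x = 0 := fun x =>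
    PowerSeries.ext fun N => Polynomial.ext fun i => by
      rw [coeff_psMap, coeff_polyMap]
      simp
  -- The flow of γ alone is the case ζ = 0, in which the second cocycle plays no role.
  obtain ⟨m, hm, hflow, h0⟩ := S.exists_flow hγ hγ (ζ := 0)
    (fun x _ => by simp) hH
  have hmm := S.flow_bracket hγ hγ S.isScalar_zero hm hflow (by
    rw [h0]
    refine PowerSeries.ext fun N => ((psExt 𝕂 R).coeff_bracket S N _ _).trans ?_
    rw [map_zero]
    refine Finset.sum_eq_zero fun a _ => ?_
    change S.bracket (PowerSeries.coeff _ _) (PowerSeries.coeff _ _) = 0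
    rw [PowerSeries.coeff_C, PowerSeries.coeff_C]
    split_ifs <;> simp [hHH])
  rw [hzero, add_zero] at hflow
  refine ⟨psMap (timeEval 𝕂 R 1) m,
    psMap_mem (S := S.poly) (fun _ h => S.timeEval_mem 1 h) hm, ?_,
    eq_eps_of_coeff (evalSeries_monomial_zero _ _) fun N => ?_⟩
  · refine (S.poly.psMap_bracket (S.evalHom 1) m m).symm.trans ?_
    rw [hmm, map_zero]
  · rw [S.coeff_evalSeries hγ hH, S.flow_eval_one hγ hm hflow h0]

/-- Deformations given by cohomologous cocycles are related by the exponential of a Hamiltonian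
vector field. -/
theorem evalSeries_gauge {γ η : GraphSeries 𝕂 (n + 1)} (hγ : γ ∈ cocycles 𝕂 (n + 1) 0)
    (hη : η ∈ fGCdeg 𝕂 (n + 1) (-1)) (hβ : graphDiff (n + 1) (-1) η ∈ cocycles 𝕂 (n + 1) 0)
    {H : R} (hH : H ∈ S.homog (n + 1)) (hHH : S.bracket H H = 0) :
    ∃ L ∈ S.series.homog n, ∃ x,
      evalSeries (𝕂 := 𝕂) (cochainExp (n + 1) S.par (S.cochain γ)) (PowerSeries.monomial 1 H) =
        eps 𝕂 R x ∧
      evalSeries (𝕂 := 𝕂) (cochainExp (n + 1) S.par (S.cochain (γ + graphDiff (n + 1) (-1) η)))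
        (PowerSeries.monomial 1 H) = eps 𝕂 R (fsum (S.series.expTerm L x)) := by
  obtain ⟨y, l, hl, hy, hyc⟩ := S.exists_homotopy hγ hη hβ hH hHH
  obtain ⟨L, hL, hLy⟩ := S.exists_exponential hl hy
  -- The end points s = 0 and s = 1 of the path are the deformations given by γ and by γ + δη.
  refine ⟨L, hL, psMap (timeEval 𝕂 R 0) y,
    eq_eps_of_coeff (evalSeries_monomial_zero _ _) fun N => ?_,
    eq_eps_of_coeff (evalSeries_monomial_zero _ _) fun N => ?_⟩
  · rw [S.coeff_evalSeries hγ hH, hyc, zero_smul, add_zero]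
  · rw [← hLy, S.coeff_evalSeries (add_mem hγ hβ) hH, hyc, one_smul]

/-- Translates the normalised series x and L back to the actual ones, F = εx and λ = εL. -/
theorem iterate_bracket_eps (L x : PowerSeries R) (k : ℕ) :
    (seriesBracket S.bracket (eps 𝕂 R L))^[k] (eps 𝕂 R x) =
      (eps 𝕂 R ^ (k + 1)) ((S.series.bracket L)^[k] x) := by
  induction k with
  | zero => rfl
  | succ k ih =>
    rw [Function.iterate_succ_apply', ih, seriesBracket_eq,
      show S.series.bracket (eps 𝕂 R L) _ = _ from S.epsLinear_bracket_left _ L]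
    change eps 𝕂 R (S.series.bracket L _) = _
    rw [(S.epsLinear_bracket L).pow, Function.iterate_succ_apply', pow_succ' _ (k + 1),
      Module.End.mul_apply]

theorem coeff_exp_eps (L x : PowerSeries R) (N : ℕ) :
    PowerSeries.coeff N (eps 𝕂 R (fsum (S.series.expTerm L x))) =
      ∑ k ∈ Finset.range (N + 1), ((k.factorial : 𝕂)⁻¹) •
        PowerSeries.coeff N ((seriesBracket S.bracket (eps 𝕂 R L))^[k] (eps 𝕂 R x)) := by
  simp only [S.iterate_bracket_eps, coeff_eps_pow]
  -- The last term, k = N, is divisible by ε^{N+1} and does not reach the coefficient of ε^N.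
  rw [Finset.sum_range_succ, if_neg (by omega), smul_zero, add_zero]
  cases N with
  | zero => rw [coeff_zero_eps, Finset.sum_range_zero]
  | succ N =>
    rw [coeff_succ_eps, coeff_fsum]
    refine Finset.sum_congr rfl fun k hk => ?_
    rw [if_pos (by simpa using hk), Nat.add_sub_add_right]
    rfl

end PoissonSuperalgebra

/-! ### Universality and application to graded symplectic domains -/

/-- The graphs giving the universal formula for the deformation attached to `γ`. -/
def expGraph {𝕂 : Type*} [Field 𝕂] (d : ℕ) (γ : GraphSeries 𝕂 d) (M : ℕ) : GraphSeries 𝕂 d :=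
  ∑ j ∈ Finset.range (M + 1), ((j.factorial : 𝕂)⁻¹) • graphPow d γ j

theorem expGraph_mem {𝕂 : Type*} [Field 𝕂] [CharZero 𝕂] {d : ℕ} {γ : GraphSeries 𝕂 d}
    (hγ : γ ∈ fGCdeg 𝕂 d 0) (M : ℕ) : expGraph d γ M ∈ fGCdeg 𝕂 d 0 :=
  sum_mem fun j _ => Submodule.smul_mem _ _ (graphPow_mem hγ j)

namespace NPDomain

variable {𝕂 : Type*} [RCLike 𝕂] {n : ℕ} (V : NPDomain 𝕂 n)

theorem mem_superalgebra_homog_succ {x : V.Fun} :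
    x ∈ V.superalgebra.homog (n + 1) ↔ x ∈ V.homog (n + 1) := by
  rw [← V.mem_superalgebra_homog, Nat.cast_succ]

theorem evalSeries_mem_FHam {γ : GraphSeries 𝕂 (n + 1)} (hγ : γ ∈ cocycles 𝕂 (n + 1) 0) {H : V.Fun}
    (hH : H ∈ V.Ham) :
    evalSeries (𝕂 := 𝕂) (V.expRep γ) (PowerSeries.monomial 1 H) ∈ V.FHam H := by
  have hH1 := V.mem_superalgebra_homog_succ.mpr hH.1
  obtain ⟨x, hx, hxx, heq⟩ := V.superalgebra.evalSeries_spec hγ hH1 hH.2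
  have heq' : evalSeries (𝕂 := 𝕂) (V.expRep γ) (PowerSeries.monomial 1 H) = eps 𝕂 V.Fun x := heq
  refine ⟨evalSeries_monomial_zero _ _, fun k => ?_, ?_, ?_⟩
  · rw [heq', ← V.mem_superalgebra_homog_succ]
    exact V.superalgebra.mem_series_homog.mp (V.superalgebra.eps_mem hx) k
  · rw [heq', ← V.superalgebra_bracket, V.superalgebra.seriesBracket_eq,
      V.superalgebra.epsLinear_bracket,
      show V.superalgebra.series.bracket (eps 𝕂 V.Fun x) x = _ from
        V.superalgebra.epsLinear_bracket_left x x]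
    change eps 𝕂 V.Fun (eps 𝕂 V.Fun (V.superalgebra.series.bracket x x)) = 0
    rw [hxx, map_zero, map_zero]
  -- In order ε only the zeroth power, the identity, contributes.
  · have := V.superalgebra.coeff_evalSeries hγ hH1 0
    refine this.trans ?_
    rw [Finset.sum_range_one, graphPow, V.superalgebra.cochain_unitGraph]
    simp

theorem gaugeEquiv_of_exp {F G L x : PowerSeries V.Fun} (hL : L ∈ V.superalgebra.series.homog n)
    (hF : F = eps 𝕂 V.Fun x)
    (hG : G = eps 𝕂 V.Fun (fsum (V.superalgebra.series.expTerm L x))) : V.GaugeEquiv F G := by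
  refine ⟨eps 𝕂 V.Fun L, coeff_zero_eps L, fun k => ?_, PowerSeries.ext fun N => ?_⟩
  · rw [← V.mem_superalgebra_homog]
    exact V.superalgebra.mem_series_homog.mp (V.superalgebra.eps_mem hL) k
  · rw [hG, hF, PowerSeries.coeff_mk]
    exact V.superalgebra.coeff_exp_eps L x N

/-- With p + 1 vertices the powers j > p vanish, so the truncated sum `expGraph (n + 1) γ p` is
already the full exponential in that component. The diagonal family is therefore a single graph
series that serves all orders of ε. -/
theorem coeff_evalSeries_eq_repCochain {γ : GraphSeries 𝕂 (n + 1)} (hγ : γ ∈ cocycles 𝕂 (n + 1) 0)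
    {H : V.Fun} (hH : H ∈ V.Ham) (p : ℕ) :
    PowerSeries.coeff (p + 1)
      (evalSeries (𝕂 := 𝕂) (V.expRep γ) (PowerSeries.monomial 1 H)) =
      (((p + 1).factorial : 𝕂)⁻¹) • V.repCochain (fun p => expGraph (n + 1) γ p p) p fun _ => H := by
  refine (V.superalgebra.coeff_evalSeries hγ (V.mem_superalgebra_homog_succ.mpr hH.1) p).trans ?_
  change _ = _ • V.superalgebra.cochain (expGraph (n + 1) γ p) p fun _ => H
  rw [expGraph, V.superalgebra.cochain_sum_smul _ _ _ (graphPow_mem hγ.1), sum_apply,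
    Finset.smul_sum]
  exact Finset.sum_congr rfl fun j _ => smul_comm _ _ _

end NPDomain

theorem exists_graphDiff_of_mk_eq {𝕂 : Type*} [Field 𝕂] {d : ℕ} {γ γ' : cocycles 𝕂 d 0}
    (h : (Submodule.Quotient.mk γ : graphCohomology 𝕂 d 0) = Submodule.Quotient.mk γ') :
    ∃ η ∈ fGCdeg 𝕂 d (-1), graphDiff d (-1) η = (γ' : GraphSeries 𝕂 d) - γ :=
  ((Submodule.Quotient.eq ((coboundaries 𝕂 d 0).submoduleOf (cocycles 𝕂 d 0))).mp h.symm :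
    (γ' : GraphSeries 𝕂 d) - γ ∈ coboundaries 𝕂 d 0)

/-- The Hamiltonian deformation map attached to a cocycle. -/
def deformationMap {𝕂 : Type*} [RCLike 𝕂] {n : ℕ} (γ : cocycles 𝕂 (n + 1) 0) : HamDefMap 𝕂 n :=
  fun V H => ⟨evalSeries (𝕂 := 𝕂) (V.expRep (γ : GraphSeries 𝕂 (n + 1)))
    (PowerSeries.monomial 1 (H : V.Fun)), V.evalSeries_mem_FHam γ.2 H.2⟩

theorem deformationMap_apply {𝕂 : Type*} [RCLike 𝕂] {n : ℕ} (γ : cocycles 𝕂 (n + 1) 0)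
    (V : NPDomain 𝕂 n) (H : V.Ham) : (deformationMap γ V H : PowerSeries V.Fun) =
      evalSeries (𝕂 := 𝕂) (V.expRep (γ : GraphSeries 𝕂 (n + 1)))
        (PowerSeries.monomial 1 (H : V.Fun)) := rfl

end GraphHam

end

theorem mainTheorem8 {𝕂 : Type*} [RCLike 𝕂] (n : ℕ) :
    ∃ Φ : GraphHam.cocycles 𝕂 (n + 1) 0 → GraphHam.HamDefMap 𝕂 n,
      (∀ (γ : GraphHam.cocycles 𝕂 (n + 1) 0) (V : GraphHam.NPDomain 𝕂 n) (H : V.Ham),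
        (Φ γ V H : PowerSeries V.Fun) =
          GraphHam.evalSeries (𝕂 := 𝕂)
            (V.expRep (γ : GraphHam.GraphSeries 𝕂 (n + 1))) (PowerSeries.monomial 1 (H : V.Fun))) ∧
      (∀ γ : GraphHam.cocycles 𝕂 (n + 1) 0, (Φ γ).IsUniversal) ∧
      (∀ γ γ' : GraphHam.cocycles 𝕂 (n + 1) 0,
        (Submodule.Quotient.mk γ : GraphHam.graphCohomology 𝕂 (n + 1) 0) =
          Submodule.Quotient.mk γ' →
        ∀ (V : GraphHam.NPDomain 𝕂 n) (H : V.Ham), V.GaugeEquiv (Φ γ V H) (Φ γ' V H)) := by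
  refine ⟨GraphHam.deformationMap, fun γ V H => rfl, fun γ => ?_, fun γ γ' h V H => ?_⟩
  · have hmem := GraphHam.expGraph_mem γ.2.1
    -- Invariance and degree are conditions on each component separately, so they hold for this
    -- family although its components come from different truncations.
    refine ⟨fun p => GraphHam.expGraph (n + 1) γ p p,
      ⟨fun p k σ => (hmem p).1 p k σ, fun p k hpk => (hmem p).2 p k hpk⟩,
      fun V H p => ?_⟩
    rw [GraphHam.deformationMap_apply]
    exact V.coeff_evalSeries_eq_repCochain γ.2 H.2 p
  · obtain ⟨η, hη, hηγ⟩ := GraphHam.exists_graphDiff_of_mk_eq h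
    obtain ⟨L, hL, x, hx, hy⟩ := V.superalgebra.evalSeries_gauge γ.2 hη
      (hηγ ▸ sub_mem γ'.2 γ.2) (V.mem_superalgebra_homog_succ.mpr H.2.1) H.2.2
    rw [hηγ, add_sub_cancel] at hy
    exact V.gaugeEquiv_of_exp hL hx hy
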